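/- Let $1\le d\le 3$ and consider $$i\partial_t u+\Delta u+f(u)=0,\qquad u=u(t,x)\in\mathbb C,\ x\in\mathbb R^d. \tag{NLS}$$ Assumption (F): $f(z)=g(|z|^2)z$ with $g\in C([0,\infty),\mathbb R)\cap C^2((0,\infty),\mathbb R)$, $g(0)=0$, and $|sg'(s)|+|s^2g''(s)|\le C_0(s^{\alpha_1/2}+s^{\alpha_2/2})$ for all $s>0$, where $C_0>0$, $0<\alpha_1\le\alpha_2<\alpha_{\max}$, $\alpha_{\max}=\infty$ if $d=1,2$ and $\alpha_{\max}=4/(d-2)$ if $d\ge3$. Assumption (T)$_d$: there are constants $\omega_*>0$, $0<a<1$, $D>0$ and, for every $0<\omega<\omega_*$, a nontrivial weak solution $\varphi_\omega\in H^1(\mathbb R^d,\mathbb R)$ of $-\Delta\varphi+\omega\varphi=f(\varphi)$ with $|\varphi_\omega(x)|+\omega^{-1/2}|\nabla\varphi_\omega(x)|\le D\,\omega^{1/\alpha_1}e^{-a\omega^{1/2}|x|}$ for a.e. $x\in\mathbb R^d$. Suppose (F) and (T)$_d$ hold, and assume moreover either $d=1$ (with no further restriction on $0<\alpha_1\le\alpha_2<\infty$),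 or $d\in\{2,3\}$ and $2\left(\frac12-\frac1d\right)<\alpha_1<2$. Then for every $0<\rho<\infty$ there is $\lambda_0>0$, depending only on $d,f,C_0,\alpha_1,\alpha_2,\omega_*,a,D,\rho$, such that for every $\lambda_0\le\lambda<\infty$ there are $\omega_j\in(0,\omega_*)$, $v_j\in\mathbb R^d$, $\gamma_j\in\mathbb R$ $(j\in\mathbb N)$ with $$v_*:=\tfrac12\inf_{j<k}\min(1,\omega_j^{1/2},\omega_k^{1/2})\,|v_j-v_k|>0$$ and a function $\eta\in C([0,\infty),L^2(\mathbb R^d,\mathbb C))$ such that the sum of solitons $$T(t,x)=\sum_{j\in\mathbb N}e^{i(\omega_jt+\frac12v_j\cdot x-\frac14|v_j|^2t+\gamma_j)}\varphi_{\omega_j}(x-v_jt)$$ converges absolutely for every $t\ge0$ and a.e. $x$, the function $u=T+\eta$ is a solution of (NLS) in the sense of distributions on $(0,\infty)\times\mathbb R^d$ (with $u$ and $f(u)$ locally integrable there), and $$\sup_{t\ge0}e^{\lambda t}\left(\|\eta(t)\|_{L^2_x}+\|\eta(t)\|_{L^\infty_x}\right)\le\rho .$$ -/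

import Mathlib

open scoped ENNReal Topology

noncomputable section

namespace NLSTrain

/-- The space `ℝᵈ` with its Euclidean norm. -/
abbrev Space (d : ℕ) : Type := EuclideanSpace ℝ (Fin d)

/-- The nonlinearity `f(z) = g(|z|²) z`. -/
def nonlin (g : ℝ → ℝ) (z : ℂ) : ℂ := ((g (‖z‖ ^ 2) : ℝ) : ℂ) * z

/-- Assumption (F): `g ∈ C([0,∞),ℝ) ∩ C²((0,∞),ℝ)`, `g(0) = 0`,
`|s g'(s)| + |s² g''(s)| ≤ C₀ (s^{α₁/2} + s^{α₂/2})` for `s > 0`, and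
`0 < α₁ ≤ α₂ < α_max`, where `α_max = ∞` for `d = 1, 2` and `α_max = 4/(d-2)` for `d ≥ 3`.
Values of `g` on the negative half-line play no role. -/
structure AssumptionF (d : ℕ) (g : ℝ → ℝ) (C₀ α₁ α₂ : ℝ) : Prop where
  continuousOn : ContinuousOn g (Set.Ici 0)
  contDiffOn : ContDiffOn ℝ 2 g (Set.Ioi 0)
  map_zero : g 0 = 0
  C₀_pos : 0 < C₀
  bound : ∀ s : ℝ, 0 < s →
    |s * deriv g s| + |s ^ 2 * deriv (deriv g) s| ≤ C₀ * (s ^ (α₁ / 2) + s ^ (α₂ / 2))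
  α₁_pos : 0 < α₁
  α₁_le_α₂ : α₁ ≤ α₂
  α₂_lt : 3 ≤ d → α₂ < 4 / ((d : ℝ) - 2)

/-- `G` is the weak gradient of `φ : ℝᵈ → ℝ`, and both are square integrable
(that is, `φ ∈ H¹(ℝᵈ,ℝ)` and `∇φ = G`). -/
structure HasH1Gradient {d : ℕ} (φ : Space d → ℝ) (G : Space d → Space d) : Prop where
  memLp : MeasureTheory.MemLp φ 2
  memLp_grad : MeasureTheory.MemLp G 2
  weak : ∀ ψ : Space d → ℝ, ContDiff ℝ (⊤ : ℕ∞) ψ → HasCompactSupport ψ → ∀ e : Space d,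
    ∫ x, φ x * fderiv ℝ ψ x e = -∫ x, inner ℝ (G x) e * ψ x

/-- `φ` is a bound state of frequency `ω`, with weak gradient `G`: a nontrivial (not a.e. zero)
element of `H¹(ℝᵈ,ℝ)` with `-Δφ + ωφ = f(φ)` in the weak sense, i.e.
`∫ ∇φ·∇ψ + ω ∫ φψ = ∫ g(φ²) φ ψ` for all test functions `ψ`
(`fderiv ℝ ψ x (G x)` is `∇ψ(x)·G(x)`, and `f(φ) = g(φ²)φ` for real `φ`). -/
structure IsBoundState {d : ℕ} (g : ℝ → ℝ) (ω : ℝ) (φ : Space d → ℝ) (G : Space d → Space d) :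
    Prop where
  h1 : HasH1Gradient φ G
  nontrivial : ¬ (φ =ᵐ[MeasureTheory.volume] 0)
  equation : ∀ ψ : Space d → ℝ, ContDiff ℝ (⊤ : ℕ∞) ψ → HasCompactSupport ψ →
    (∫ x, fderiv ℝ ψ x (G x)) + ω * ∫ x, φ x * ψ x = ∫ x, g (φ x ^ 2) * φ x * ψ x

/-- `φ` is a family of small bound states as in Assumption (T)_d with constants `ωs`, `a`, `D`:
for `0 < ω < ωs`, `φ ω` is a bound state of frequency `ω` and
`|φ(x)| + ω^{-1/2}|∇φ(x)| ≤ D ω^{1/α₁} e^{-a ω^{1/2} |x|}` (for a.e. `x`, since `φ ω` and its weak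
gradient are classes modulo null sets). -/
def IsSmallSolitonFamily {d : ℕ} (g : ℝ → ℝ) (α₁ ωs a D : ℝ) (φ : ℝ → Space d → ℝ) : Prop :=
  ∀ ω : ℝ, 0 < ω → ω < ωs → ∃ G : Space d → Space d, IsBoundState g ω (φ ω) G ∧
    ∀ᵐ x : Space d, |φ ω x| + ω ^ (-(1 / 2) : ℝ) * ‖G x‖ ≤
      D * ω ^ (1 / α₁) * Real.exp (-(a * ω ^ (1 / 2 : ℝ) * ‖x‖))

/-- The soliton
`R_{φ,ω,v,x⁰,γ}(t,x) = e^{i(ωt + v·x/2 - |v|²t/4 + γ)} φ(x - x⁰ - vt)`. -/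
def soliton {d : ℕ} (φ : Space d → ℝ) (ω : ℝ) (v x₀ : Space d) (γ : ℝ) (t : ℝ) (x : Space d) : ℂ :=
  Complex.exp (Complex.I *
    ((ω * t + (1 / 2) * inner ℝ v x - (1 / 4) * ‖v‖ ^ 2 * t + γ : ℝ) : ℂ)) *
    ((φ (x - x₀ - t • v) : ℝ) : ℂ)

/-- The `j`-th constituent `R_j = R_{φ_{ω_j}, ω_j, v_j, 0, γ_j}` of the profile: a soliton of the
family `φ`, with initial position `0`. -/
def trainSoliton {d : ℕ} (φ : ℝ → Space d → ℝ) (ω : ℕ → ℝ) (v : ℕ → Space d) (γ : ℕ → ℝ)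
    (j : ℕ) (t : ℝ) (x : Space d) : ℂ :=
  soliton (φ (ω j)) (ω j) (v j) 0 (γ j) t x

/-- The profile `T = ∑_j R_j`. -/
def profile {d : ℕ} (φ : ℝ → Space d → ℝ) (ω : ℕ → ℝ) (v : ℕ → Space d) (γ : ℕ → ℝ)
    (t : ℝ) (x : Space d) : ℂ :=
  ∑' j, trainSoliton φ ω v γ j t x

/-- `(ω_j), (v_j), (γ_j)` are the parameters of an infinite soliton profile: frequencies in
`(0, ωs)`, positive minimal relative speed
`v_* = ½ inf_{j<k} min(1, ω_j^{1/2}, ω_k^{1/2}) |v_j - v_k| > 0` (so the velocities are pairwise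
distinct), and absolute convergence of `∑_j R_j(t,x)` for every `t ≥ 0` and a.e. `x`. -/
structure IsTrainProfile {d : ℕ} (ωs : ℝ) (φ : ℝ → Space d → ℝ) (ω : ℕ → ℝ) (v : ℕ → Space d)
    (γ : ℕ → ℝ) : Prop where
  freq : ∀ j, 0 < ω j ∧ ω j < ωs
  speed : ∃ c : ℝ, 0 < c ∧ ∀ j k, j < k →
    c ≤ (1 / 2) * (min 1 (min (ω j ^ (1 / 2 : ℝ)) (ω k ^ (1 / 2 : ℝ))) * ‖v j - v k‖)
  summable : ∀ t : ℝ, 0 ≤ t → ∀ᵐ x : Space d, Summable fun j => ‖trainSoliton φ ω v γ j t x‖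

/-- `u` solves `i∂ₜu + Δu + f(u) = 0` on `(0,∞) × ℝᵈ` in the sense of distributions: `u` and `f(u)`
are locally integrable there and `∫∫ u (-i∂ₜψ + Δψ) + f(u) ψ = 0` for all
`ψ ∈ C_c^∞((0,∞) × ℝᵈ, ℂ)`. -/
structure IsNLSSolution {d : ℕ} (g : ℝ → ℝ) (u : ℝ → Space d → ℂ) : Prop where
  locInt : MeasureTheory.LocallyIntegrableOn (fun p : ℝ × Space d => u p.1 p.2)
    (Set.Ioi 0 ×ˢ Set.univ)
  locInt_nonlin : MeasureTheory.LocallyIntegrableOn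
    (fun p : ℝ × Space d => nonlin g (u p.1 p.2)) (Set.Ioi 0 ×ˢ Set.univ)
  equation : ∀ ψ : ℝ × Space d → ℂ, ContDiff ℝ (⊤ : ℕ∞) ψ → HasCompactSupport ψ →
    tsupport ψ ⊆ Set.Ioi 0 ×ˢ Set.univ →
    ∫ p : ℝ × Space d,
      (u p.1 p.2 * (-Complex.I * deriv (fun s : ℝ => ψ (s, p.2)) p.1
          + Laplacian.laplacian (fun y : Space d => ψ (p.1, y)) p.2)
        + nonlin g (u p.1 p.2) * ψ p) = 0

/-- `η ∈ C([0,∞), L²(ℝᵈ,ℂ))`. -/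
def IsL2Continuous {d : ℕ} (η : ℝ → Space d → ℂ) : Prop :=
  (∀ t : ℝ, 0 ≤ t → MeasureTheory.MemLp (η t) 2) ∧
  ∀ t₀ : ℝ, 0 ≤ t₀ → Filter.Tendsto
    (fun t => MeasureTheory.eLpNorm (η t - η t₀) 2 MeasureTheory.volume)
    (𝓝[Set.Ici 0] t₀) (𝓝 0)

/-- The norm of `L² ∩ L^∞` (the sum of both norms, which dominates the maximum). -/
def normL2Linf {d : ℕ} (h : Space d → ℂ) : ℝ≥0∞ :=
  MeasureTheory.eLpNorm h 2 MeasureTheory.volume + MeasureTheory.eLpNorm h ∞ MeasureTheory.volume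

end NLSTrain

end

open scoped ENNReal Topology
noncomputable section
namespace NLSTrain

/-! ### The nonlinearity -/

variable {d : ℕ} {g : ℝ → ℝ} {C₀ α₁ α₂ : ℝ}

/-! Write `u = T + η` with `T = ∑ R_j` the sum of solitons. Each `R_j` solves the equation, so `η`
must satisfy `i∂ₜη + Δη + N(η) = 0` with `N(η) = f(T+η) - f(T) + H`, where `H = f(T) - ∑ f(R_j)` is
the interaction error. Imposing decay at infinity turns this into `η(t) = -i ∫₀^∞ e^{-iτΔ} N(η)(t+τ)
dτ`. The group is isometric on `L²` and `f` has a small Lipschitz constant near 0, so with `f`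
replaced by a globally Lipschitz extension this is a contraction in `L²` with an exponential weight
(`exists_duhamel_fixedPoint`). What remains is to show that `η` and `T` stay in the ball where the
extension equals `f`, that is, to bound `η` in `L^∞`.

The sup bound is not part of the contraction norm. It is a closed constraint that the Picard
iterates inherit, together with a Hölder modulus of order `s` for translations in `L²`
(`PerturbationBound`). It rests on a Campanato-type criterion: a function is bounded if its heat
regularisation at time 1 is bounded and the regularisations at time `σ` of its increments by `h` are
at most `A σ^{-q} |h|^s` with `q < s/2` (`ae_norm_le_of_heatEval_increments`). For a Duhamel
integral the regularised group is `e^{zΔ}` with `z = σ - iτ`. Splitting the source at a height and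
combining the `L² → L^∞` and `L¹ → L^∞` bounds of this complex Gaussian costs `σ^{-d(1-β)/4}
τ^{-dβ/2}` for data in `L^{2/(1+β)}` (`norm_heatEval_le_of_lintegral_rpow`). One needs `dβ/2 < 1`
for integrability in `τ` and `d(1-β)/4 < s/2` for the criterion; this yields `duhamel_ae_norm_le`.

The increments of the source are therefore needed in `L^{2/(1+b)}` for `b = 0` and `b = β`. A second
difference estimate for `f` near 0 (`AssumptionF.nonlin_second_diff`), which uses that `f'` is only
Hölder of order `min α₁ 1`, bounds them by products of powers of `η` and of a weight `Q` controlling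
the train. Hölder's inequality closes the estimate (`ProfileBounds.lnorm_increment_le`) when the
exponents satisfy the inequalities in `Exponents`; `exists_exponents` is where the restrictions on
`d` and `α₁` enter. Since `|η|^{min α₁ 1}` appears linearly, the `L²` decay rate is taken to be `λ /
min α₁ 1`.

The train has frequencies `θ^{j+1}` and velocities `K ω_j^{-1/2}` along one axis. In the scaled
distance `ω_j^{1/2}|x - t v_j|` all solitons but one are at least `K|t|/4` away from any given
point, so `H` decays at a rate proportional to `K`. Interpolation with its Hölder bound gives decay
of the increments too. Large `K` accommodates any `λ`, and then small `θ` makes everything small. -/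

theorem AssumptionF.hasDerivAt (hF : AssumptionF d g C₀ α₁ α₂) {s : ℝ} (hs : 0 < s) :
    HasDerivAt g (deriv g s) s :=
  ((hF.contDiffOn.contDiffAt (Ioi_mem_nhds hs)).differentiableAt (by norm_num)).hasDerivAt

theorem AssumptionF.hasDerivAt_deriv (hF : AssumptionF d g C₀ α₁ α₂) {s : ℝ} (hs : 0 < s) :
    HasDerivAt (deriv g) (deriv (deriv g) s) s := by
  have h1 : ContDiffOn ℝ 1 (deriv g) (Set.Ioi 0) :=
    hF.contDiffOn.deriv_of_isOpen isOpen_Ioi (by norm_num)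
  exact ((h1.contDiffAt (Ioi_mem_nhds hs)).differentiableAt (by norm_num)).hasDerivAt

theorem AssumptionF.bound_le_one (hF : AssumptionF d g C₀ α₁ α₂) {s : ℝ} (hs : 0 < s)
    (hs1 : s ≤ 1) :
    |s * deriv g s| ≤ 2 * C₀ * s ^ (α₁ / 2) ∧
      |s ^ 2 * deriv (deriv g) s| ≤ 2 * C₀ * s ^ (α₁ / 2) := by
  have hb := hF.bound s hs
  have h2 : s ^ (α₂ / 2) ≤ s ^ (α₁ / 2) :=
    Real.rpow_le_rpow_of_exponent_ge hs hs1 (by linarith [hF.α₁_le_α₂])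
  have h3 : C₀ * (s ^ (α₁ / 2) + s ^ (α₂ / 2)) ≤ 2 * C₀ * s ^ (α₁ / 2) := by
    nlinarith [hF.C₀_pos]
  constructor <;> linarith [abs_nonneg (s * deriv g s), abs_nonneg (s ^ 2 * deriv (deriv g) s)]

/-- The derivative bound is integrated from 0, where `g` vanishes. Since `g` need not be
differentiable at 0, the integration is phrased as monotonicity of `C s^{α₁/2} ± g`, which needs
derivatives only in the interior. -/
theorem AssumptionF.abs_apply_le (hF : AssumptionF d g C₀ α₁ α₂) {s : ℝ} (hs : 0 ≤ s) (hs1 : s ≤ 1) :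
    |g s| ≤ 4 * C₀ / α₁ * s ^ (α₁ / 2) := by
  have hα := hF.α₁_pos
  have hsub : Set.Icc (0 : ℝ) 1 ⊆ Set.Ici 0 := fun x hx => hx.1
  have hpc : ContinuousOn (fun s : ℝ => 4 * C₀ / α₁ * s ^ (α₁ / 2)) (Set.Icc 0 1) :=
    (continuous_const.mul (Real.continuous_rpow_const (by positivity))).continuousOn
  have hpd : ∀ x ∈ interior (Set.Icc (0 : ℝ) 1),
      HasDerivAt (fun s : ℝ => 4 * C₀ / α₁ * s ^ (α₁ / 2)) (2 * C₀ * x ^ (α₁ / 2 - 1)) x := by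
    intro x hx
    rw [interior_Icc] at hx
    have := (Real.hasDerivAt_rpow_const (p := α₁ / 2) (Or.inl hx.1.ne')).const_mul (4 * C₀ / α₁)
    have e : 4 * C₀ / α₁ * (α₁ / 2) = 2 * C₀ := by field_simp; ring
    rwa [← mul_assoc, e] at this
  have hgb : ∀ x ∈ interior (Set.Icc (0 : ℝ) 1), |deriv g x| ≤ 2 * C₀ * x ^ (α₁ / 2 - 1) := by
    intro x hx
    rw [interior_Icc] at hx
    have := (hF.bound_le_one hx.1 hx.2.le).1
    rw [abs_mul, abs_of_pos hx.1] at this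
    rw [Real.rpow_sub_one hx.1.ne', ← mul_div_assoc, le_div_iff₀ hx.1]
    linarith
  have hg : ∀ x ∈ interior (Set.Icc (0 : ℝ) 1), HasDerivAt g (deriv g x) x := by
    intro x hx
    rw [interior_Icc] at hx
    exact hF.hasDerivAt hx.1
  have h0 : (0 : ℝ) ^ (α₁ / 2) = 0 := Real.zero_rpow (by positivity)
  have m1 : MonotoneOn (fun s : ℝ => 4 * C₀ / α₁ * s ^ (α₁ / 2) - g s) (Set.Icc 0 1) := by
    refine monotoneOn_of_deriv_nonneg (convex_Icc 0 1) (hpc.sub (hF.continuousOn.mono hsub))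
      (fun x hx => ((hpd x hx).sub (hg x hx)).differentiableAt.differentiableWithinAt) ?_
    intro x hx
    have e := ((hpd x hx).sub (hg x hx)).deriv
    have : deriv (fun s : ℝ => 4 * C₀ / α₁ * s ^ (α₁ / 2) - g s) x = _ := e
    rw [this]
    linarith [le_abs_self (deriv g x), hgb x hx]
  have m2 : MonotoneOn (fun s : ℝ => 4 * C₀ / α₁ * s ^ (α₁ / 2) + g s) (Set.Icc 0 1) := by
    refine monotoneOn_of_deriv_nonneg (convex_Icc 0 1) (hpc.add (hF.continuousOn.mono hsub))
      (fun x hx => ((hpd x hx).add (hg x hx)).differentiableAt.differentiableWithinAt) ?_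
    intro x hx
    have e := ((hpd x hx).add (hg x hx)).deriv
    have : deriv (fun s : ℝ => 4 * C₀ / α₁ * s ^ (α₁ / 2) + g s) x = _ := e
    rw [this]
    linarith [neg_abs_le (deriv g x), hgb x hx]
  have a1 := m1 ⟨le_rfl, zero_le_one⟩ ⟨hs, hs1⟩ hs
  have a2 := m2 ⟨le_rfl, zero_le_one⟩ ⟨hs, hs1⟩ hs
  simp only [h0, hF.map_zero, mul_zero, sub_zero, add_zero] at a1 a2
  rw [abs_le]
  constructor <;> linarith

/-- The real derivative of `nonlin g` at `z` in direction `h`. -/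
def nonlinDeriv (g : ℝ → ℝ) (z h : ℂ) : ℂ :=
  ((g (‖z‖ ^ 2) : ℝ) : ℂ) * h +
    ((deriv g (‖z‖ ^ 2) * (2 * inner ℝ z h) : ℝ) : ℂ) * z

theorem nonlin_zero (g : ℝ → ℝ) : nonlin g 0 = 0 := by simp [nonlin]

theorem norm_sq_rpow_half (z : ℂ) (α : ℝ) : (‖z‖ ^ 2) ^ (α / 2) = ‖z‖ ^ α := by
  rw [← Real.rpow_natCast, ← Real.rpow_mul (norm_nonneg _)]
  congr 1
  push_cast
  ring

theorem AssumptionF.norm_nonlin_le (hF : AssumptionF d g C₀ α₁ α₂) {z : ℂ} (hz : ‖z‖ ≤ 1) :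
    ‖nonlin g z‖ ≤ 4 * C₀ / α₁ * ‖z‖ ^ α₁ * ‖z‖ := by
  rw [nonlin, norm_mul, Complex.norm_real, Real.norm_eq_abs]
  have := hF.abs_apply_le (s := ‖z‖ ^ 2) (by positivity) (by nlinarith [norm_nonneg z])
  rw [norm_sq_rpow_half] at this
  gcongr

theorem AssumptionF.deriv_bounds (hF : AssumptionF d g C₀ α₁ α₂) {z : ℂ} (hz : ‖z‖ ≤ 1)
    (h0 : z ≠ 0) :
    |deriv g (‖z‖ ^ 2)| * ‖z‖ ^ 2 ≤ 2 * C₀ * ‖z‖ ^ α₁ ∧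
      |deriv (deriv g) (‖z‖ ^ 2)| * ‖z‖ ^ 4 ≤ 2 * C₀ * ‖z‖ ^ α₁ := by
  have hp : 0 < ‖z‖ := norm_pos_iff.2 h0
  have := hF.bound_le_one (s := ‖z‖ ^ 2) (by positivity) (by nlinarith [norm_nonneg z])
  rw [norm_sq_rpow_half] at this
  rw [abs_mul, abs_mul, abs_of_pos (by positivity : (0:ℝ) < ‖z‖ ^ 2),
    abs_of_pos (by positivity : (0:ℝ) < (‖z‖ ^ 2) ^ 2)] at this
  constructor
  · linarith [this.1]
  · have e : (‖z‖ ^ 2) ^ 2 = ‖z‖ ^ 4 := by ring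
    rw [e] at this
    linarith [this.2]

theorem abs_inner_complex_le (z h : ℂ) : |(inner ℝ z h : ℝ)| ≤ ‖z‖ * ‖h‖ :=
  abs_real_inner_le_norm z h

theorem AssumptionF.norm_nonlinDeriv_le (hF : AssumptionF d g C₀ α₁ α₂) {z : ℂ} (hz : ‖z‖ ≤ 1)
    (h : ℂ) :
    ‖nonlinDeriv g z h‖ ≤ (4 * C₀ / α₁ + 4 * C₀) * ‖z‖ ^ α₁ * ‖h‖ := by
  have hα := hF.α₁_pos
  have hC := hF.C₀_pos
  have hg := hF.abs_apply_le (s := ‖z‖ ^ 2) (by positivity) (by nlinarith [norm_nonneg z])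
  rw [norm_sq_rpow_half] at hg
  by_cases h0 : z = 0
  · subst h0
    simp [nonlinDeriv, hF.map_zero]
    positivity
  have hd := (hF.deriv_bounds hz h0).1
  calc ‖nonlinDeriv g z h‖ ≤ |g (‖z‖ ^ 2)| * ‖h‖ +
        |deriv g (‖z‖ ^ 2) * (2 * inner ℝ z h)| * ‖z‖ := by
        refine (norm_add_le _ _).trans ?_
        rw [norm_mul, norm_mul, Complex.norm_real, Complex.norm_real, Real.norm_eq_abs,
          Real.norm_eq_abs]
    _ ≤ (4 * C₀ / α₁ * ‖z‖ ^ α₁) * ‖h‖ + (|deriv g (‖z‖ ^ 2)| * (2 * (‖z‖ * ‖h‖))) * ‖z‖ := by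
        rw [abs_mul, abs_mul, abs_two]
        gcongr
        exact abs_inner_complex_le z h
    _ = (4 * C₀ / α₁ * ‖z‖ ^ α₁) * ‖h‖ + 2 * (|deriv g (‖z‖ ^ 2)| * ‖z‖ ^ 2) * ‖h‖ := by ring
    _ ≤ (4 * C₀ / α₁ * ‖z‖ ^ α₁) * ‖h‖ + 2 * (2 * C₀ * ‖z‖ ^ α₁) * ‖h‖ := by gcongr
    _ = _ := by ring

theorem hasDerivAt_line (p q : ℂ) (τ : ℝ) : HasDerivAt (fun τ : ℝ => p + (τ : ℂ) * q) q τ := by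
  have := ((Complex.ofRealCLM.hasDerivAt (x := τ)).mul_const q).const_add p
  simpa using this

theorem hasDerivAt_line_norm_sq (p q : ℂ) (τ : ℝ) :
    HasDerivAt (fun τ : ℝ => ‖p + (τ : ℂ) * q‖ ^ 2) (2 * inner ℝ (p + (τ : ℂ) * q) q) τ :=
  (hasDerivAt_line p q τ).norm_sq

/-- Lines through the origin need care because `g'` may blow up there. Near 0 the nonlinearity is
`O(|z|^{1+α₁})`, hence differentiable with derivative 0, and the formula in `nonlinDeriv` gives 0 as
well whatever value `deriv g 0` takes. The mean value inequality is thus available on every segment.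
-/
theorem AssumptionF.hasDerivAt_nonlin_line (hF : AssumptionF d g C₀ α₁ α₂) (p q : ℂ) (τ : ℝ) :
    HasDerivAt (fun τ : ℝ => nonlin g (p + (τ : ℂ) * q))
      (nonlinDeriv g (p + (τ : ℂ) * q) q) τ := by
  by_cases h0 : p + (τ : ℂ) * q = 0
  · have hval : nonlinDeriv g (p + (τ : ℂ) * q) q = 0 := by
      rw [h0]; simp [nonlinDeriv, hF.map_zero]
    rw [hval, hasDerivAt_iff_isLittleO]
    simp only [h0, nonlin_zero, sub_zero, smul_zero]
    rw [Asymptotics.isLittleO_iff]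
    intro c hc
    have hcont : Continuous fun y : ℝ => 4 * C₀ / α₁ * ‖p + (y : ℂ) * q‖ ^ α₁ * ‖q‖ := by
      have : Continuous fun y : ℝ => ‖p + (y : ℂ) * q‖ := by fun_prop
      exact (continuous_const.mul
        ((Real.continuous_rpow_const hF.α₁_pos.le).comp this)).mul continuous_const
    have hlim : Filter.Tendsto (fun y : ℝ => 4 * C₀ / α₁ * ‖p + (y : ℂ) * q‖ ^ α₁ * ‖q‖)
        (𝓝 τ) (𝓝 0) := by
      have := hcont.tendsto τ
      simpa [h0, Real.zero_rpow hF.α₁_pos.ne'] using this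
    have hlim2 : Filter.Tendsto (fun y : ℝ => ‖p + (y : ℂ) * q‖) (𝓝 τ) (𝓝 0) := by
      have : Continuous fun y : ℝ => ‖p + (y : ℂ) * q‖ := by fun_prop
      simpa [h0] using this.tendsto τ
    filter_upwards [hlim.eventually (ge_mem_nhds hc), hlim2.eventually (ge_mem_nhds zero_lt_one)]
      with y hy hy1
    have e : p + (y : ℂ) * q = ((y - τ : ℝ) : ℂ) * q := by
      have : p = -((τ : ℂ) * q) := eq_neg_of_add_eq_zero_left h0
      rw [this]; push_cast; ring
    calc ‖nonlin g (p + (y : ℂ) * q)‖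
        ≤ 4 * C₀ / α₁ * ‖p + (y : ℂ) * q‖ ^ α₁ * ‖p + (y : ℂ) * q‖ := hF.norm_nonlin_le hy1
      _ = 4 * C₀ / α₁ * ‖p + (y : ℂ) * q‖ ^ α₁ * (‖y - τ‖ * ‖q‖) := by
          congr 1
          rw [e, norm_mul, Complex.norm_real]
      _ = (4 * C₀ / α₁ * ‖p + (y : ℂ) * q‖ ^ α₁ * ‖q‖) * ‖y - τ‖ := by ring
      _ ≤ c * ‖y - τ‖ := by gcongr
  · have hs : 0 < ‖p + (τ : ℂ) * q‖ ^ 2 := by positivity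
    have h1 := (HasDerivAt.scomp τ (hF.hasDerivAt hs) (hasDerivAt_line_norm_sq p q τ)).ofReal_comp
    have h2 := h1.mul (hasDerivAt_line p q τ)
    refine h2.congr_deriv ?_
    simp only [nonlinDeriv, smul_eq_mul, Function.comp]
    push_cast
    ring

/-- On a segment whose points all have modulus comparable to `r` the nonlinearity is twice
differentiable with second derivative of size `r^{α₁-1}`, and the mean value inequality applies. -/
theorem AssumptionF.norm_nonlinDeriv_sub_le_of_segment (hF : AssumptionF d g C₀ α₁ α₂)
    {z w h : ℂ} {r : ℝ} (hr : 0 < r) (hr1 : r ≤ 1)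
    (hseg : ∀ τ : ℝ, 0 ≤ τ → τ ≤ 1 → ‖w + (τ : ℂ) * (z - w)‖ ≤ r ∧
      r / 2 ≤ ‖w + (τ : ℂ) * (z - w)‖) :
    ‖nonlinDeriv g z h - nonlinDeriv g w h‖ ≤ 40 * C₀ * r ^ α₁ / r * ‖z - w‖ * ‖h‖ := by
  set δ := z - w with hδ
  have hC := hF.C₀_pos
  set F : ℝ → ℂ := fun τ => nonlinDeriv g (w + (τ : ℂ) * δ) h with hFdef
  have key : ∀ τ : ℝ, 0 ≤ τ → τ ≤ 1 → ∃ F', HasDerivAt F F' τ ∧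
      ‖F'‖ ≤ 40 * C₀ * r ^ α₁ / r * ‖δ‖ * ‖h‖ := by
    intro τ h0 h1
    obtain ⟨hle, hge⟩ := hseg τ h0 h1
    set ζ := w + (τ : ℂ) * δ with hζ
    have hpos : 0 < ‖ζ‖ := lt_of_lt_of_le (by linarith) hge
    have hs : 0 < ‖ζ‖ ^ 2 := by positivity
    have hne : ζ ≠ 0 := norm_pos_iff.1 hpos
    have hl := hasDerivAt_line w δ τ
    have hn := hasDerivAt_line_norm_sq w δ τ
    have hg1 := (HasDerivAt.scomp τ (hF.hasDerivAt hs) hn)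
    have hg2 := (HasDerivAt.scomp τ (hF.hasDerivAt_deriv hs) hn)
    have hin : HasDerivAt (fun τ : ℝ => (2 * inner ℝ (w + (τ : ℂ) * δ) h : ℝ))
        (2 * inner ℝ δ h) τ := by
      have := (hl.inner ℝ (hasDerivAt_const τ h)).const_mul 2
      simpa using this
    have hA := hg1.ofReal_comp.mul_const h
    have hB := ((hg2.mul hin).ofReal_comp).mul hl
    refine ⟨_, hA.add hB, ?_⟩
    have hd := hF.deriv_bounds (hle.trans hr1) hne
    have hr' : ‖ζ‖ ^ α₁ ≤ r ^ α₁ := Real.rpow_le_rpow hpos.le hle hF.α₁_pos.le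
    set a := |deriv g (‖ζ‖ ^ 2)| with ha
    set b := |deriv (deriv g) (‖ζ‖ ^ 2)| with hb
    have ha0 : 0 ≤ a := abs_nonneg _
    have hb0 : 0 ≤ b := abs_nonneg _
    have i1 := abs_inner_complex_le ζ δ
    have i2 := abs_inner_complex_le ζ h
    have i3 := abs_inner_complex_le δ h
    have step : ‖((2 * inner ℝ ζ δ * deriv g (‖ζ‖ ^ 2) : ℝ) : ℂ) * h +
        (((2 * inner ℝ ζ δ * deriv (deriv g) (‖ζ‖ ^ 2) * (2 * inner ℝ ζ h) +
          deriv g (‖ζ‖ ^ 2) * (2 * inner ℝ δ h) : ℝ) : ℂ) * ζ +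
        ((deriv g (‖ζ‖ ^ 2) * (2 * inner ℝ ζ h) : ℝ) : ℂ) * δ)‖ ≤
        (2 * (‖ζ‖ * ‖δ‖) * a) * ‖h‖ + ((2 * (‖ζ‖ * ‖δ‖) * b * (2 * (‖ζ‖ * ‖h‖)) +
          a * (2 * (‖δ‖ * ‖h‖))) * ‖ζ‖ + (a * (2 * (‖ζ‖ * ‖h‖))) * ‖δ‖) := by
      refine (norm_add_le _ _).trans (add_le_add ?_ ((norm_add_le _ _).trans (add_le_add ?_ ?_)))
      · rw [norm_mul, Complex.norm_real, Real.norm_eq_abs, abs_mul, abs_mul, abs_two]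
        gcongr
      · rw [norm_mul, Complex.norm_real, Real.norm_eq_abs]
        refine mul_le_mul_of_nonneg_right ((abs_add_le _ _).trans (add_le_add ?_ ?_))
          (norm_nonneg _)
        · rw [abs_mul, abs_mul, abs_mul, abs_mul, abs_two]
          gcongr
        · rw [abs_mul, abs_mul, abs_two]
          gcongr
      · rw [norm_mul, Complex.norm_real, Real.norm_eq_abs, abs_mul, abs_mul, abs_two]
        gcongr
    refine le_trans (le_of_eq ?_) (step.trans ?_)
    · congr 1
    · have e1 : (2 * (‖ζ‖ * ‖δ‖) * a) * ‖h‖ + ((2 * (‖ζ‖ * ‖δ‖) * b * (2 * (‖ζ‖ * ‖h‖)) +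
          a * (2 * (‖δ‖ * ‖h‖))) * ‖ζ‖ + (a * (2 * (‖ζ‖ * ‖h‖))) * ‖δ‖) =
          (6 * (a * ‖ζ‖ ^ 2) + 4 * (b * ‖ζ‖ ^ 4)) / ‖ζ‖ * ‖δ‖ * ‖h‖ := by
        field_simp
        ring
      rw [e1]
      -- Of the terms in `step`, those with `g'` add up to the factor 6 and the one with `g''` has
      -- factor 4; each quantity is at most `2 C₀ r^{α₁}`, giving 20. Dividing by `r / 2` instead of
      -- `r` doubles this to 40.
      have e2 : 6 * (a * ‖ζ‖ ^ 2) + 4 * (b * ‖ζ‖ ^ 4) ≤ 20 * C₀ * r ^ α₁ := by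
        have : 2 * C₀ * ‖ζ‖ ^ α₁ ≤ 2 * C₀ * r ^ α₁ := by gcongr
        linarith [hd.1, hd.2]
      have e3 : (6 * (a * ‖ζ‖ ^ 2) + 4 * (b * ‖ζ‖ ^ 4)) / ‖ζ‖ ≤ 20 * C₀ * r ^ α₁ / (r / 2) := by
        gcongr
      have e4 : 20 * C₀ * r ^ α₁ / (r / 2) = 40 * C₀ * r ^ α₁ / r := by
        field_simp; ring
      rw [e4] at e3
      gcongr
  choose! F' hF' hb using key
  have := norm_image_sub_le_of_norm_deriv_le_segment' (f := F) (f' := F') (a := 0) (b := 1)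
    (fun x hx => (hF' x hx.1 hx.2).hasDerivWithinAt) (fun x hx => hb x hx.1 hx.2.le) 1
    ⟨zero_le_one, le_rfl⟩
  simpa [hFdef, hδ] using this

/-- The derivative of the nonlinearity is Hölder of order `m = min α₁ 1`, by comparing `|z - w|`
with `r = max |z| |w|`. If `r ≤ 2|z - w|`, the size bound `r^{α₁} = r^m r^{α₁-m}` suffices.
Otherwise the segment stays outside the disc of radius `r / 2` and the second derivative bound
applies, with `|z - w| / r ≤ (|z - w| / r)^m`. -/
theorem AssumptionF.norm_nonlinDeriv_sub_le (hF : AssumptionF d g C₀ α₁ α₂) :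
    ∃ C : ℝ, 0 < C ∧ ∀ (M : ℝ) (z w h : ℂ), M ≤ 1 → ‖z‖ ≤ M → ‖w‖ ≤ M →
      ‖nonlinDeriv g z h - nonlinDeriv g w h‖ ≤
        C * ‖z - w‖ ^ (min α₁ 1) * M ^ (α₁ - min α₁ 1) * ‖h‖ := by
  have hα := hF.α₁_pos
  have hC := hF.C₀_pos
  set m := min α₁ 1 with hm
  have hm0 : 0 < m := lt_min hα one_pos
  have hm1 : m ≤ 1 := min_le_right _ _
  have hn0 : 0 ≤ α₁ - m := sub_nonneg.2 (min_le_left _ _)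
  set C1 := 4 * C₀ / α₁ + 4 * C₀ with hC1
  have hC1p : 0 < C1 := by positivity
  refine ⟨4 * C1 + 40 * C₀, by positivity, ?_⟩
  intro M z w h hM hz hw
  set r := max ‖z‖ ‖w‖ with hr
  have hrM : r ≤ M := max_le hz hw
  rcases eq_or_lt_of_le (le_max_of_le_left (norm_nonneg z) : 0 ≤ r) with h0 | hpos
  · have hz0 : z = 0 := norm_le_zero_iff.1 ((le_max_left _ _).trans h0.symm.le)
    have hw0 : w = 0 := norm_le_zero_iff.1 ((le_max_right _ _).trans h0.symm.le)
    have hM0 : 0 ≤ M := (norm_nonneg z).trans hz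
    subst hz0 hw0
    rw [sub_self, norm_zero]
    positivity
  have hM0 : 0 < M := hpos.trans_le hrM
  have hsplit : r ^ α₁ = r ^ m * r ^ (α₁ - m) := by
    rw [← Real.rpow_add hpos]; congr 1; ring
  have hrn : r ^ (α₁ - m) ≤ M ^ (α₁ - m) := Real.rpow_le_rpow hpos.le hrM hn0
  by_cases hcase : r ≤ 2 * ‖z - w‖
  · have b1 := hF.norm_nonlinDeriv_le (hz.trans hM) h
    have b2 := hF.norm_nonlinDeriv_le (hw.trans hM) h
    have c1 : ‖z‖ ^ α₁ ≤ r ^ α₁ := Real.rpow_le_rpow (norm_nonneg _) (le_max_left _ _) hα.le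
    have c2 : ‖w‖ ^ α₁ ≤ r ^ α₁ := Real.rpow_le_rpow (norm_nonneg _) (le_max_right _ _) hα.le
    have c3 : r ^ m ≤ 2 * ‖z - w‖ ^ m := by
      calc r ^ m ≤ (2 * ‖z - w‖) ^ m := Real.rpow_le_rpow hpos.le hcase hm0.le
        _ = 2 ^ m * ‖z - w‖ ^ m := Real.mul_rpow (by norm_num) (norm_nonneg _)
        _ ≤ 2 * ‖z - w‖ ^ m := by
          gcongr
          calc (2 : ℝ) ^ m ≤ 2 ^ (1 : ℝ) := Real.rpow_le_rpow_of_exponent_le (by norm_num) hm1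
            _ = 2 := by norm_num
    calc ‖nonlinDeriv g z h - nonlinDeriv g w h‖
        ≤ C1 * ‖z‖ ^ α₁ * ‖h‖ + C1 * ‖w‖ ^ α₁ * ‖h‖ := (norm_sub_le _ _).trans (add_le_add b1 b2)
      _ ≤ C1 * r ^ α₁ * ‖h‖ + C1 * r ^ α₁ * ‖h‖ := by gcongr
      _ = 2 * C1 * (r ^ m * r ^ (α₁ - m)) * ‖h‖ := by rw [hsplit]; ring
      _ ≤ 2 * C1 * ((2 * ‖z - w‖ ^ m) * M ^ (α₁ - m)) * ‖h‖ := by gcongr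
      _ = (4 * C1) * ‖z - w‖ ^ m * M ^ (α₁ - m) * ‖h‖ := by ring
      _ ≤ _ := by gcongr; linarith
  · push Not at hcase
    have hseg : ∀ τ : ℝ, 0 ≤ τ → τ ≤ 1 → ‖w + (τ : ℂ) * (z - w)‖ ≤ r ∧
      r / 2 ≤ ‖w + (τ : ℂ) * (z - w)‖ := by
      intro τ h0 h1
      constructor
      · have e : w + (τ : ℂ) * (z - w) = ((1 - τ : ℝ) : ℂ) * w + (τ : ℂ) * z := by push_cast; ring
        rw [e]
        refine (norm_add_le _ _).trans ?_
        rw [norm_mul, norm_mul, Complex.norm_real, Complex.norm_real, Real.norm_of_nonneg h0,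
          Real.norm_of_nonneg (by linarith : 0 ≤ 1 - τ)]
        nlinarith [le_max_left ‖z‖ ‖w‖, le_max_right ‖z‖ ‖w‖]
      · rcases le_total ‖w‖ ‖z‖ with hwz | hwz
        · have hrz : r = ‖z‖ := max_eq_left hwz
          have e : z = (w + (τ : ℂ) * (z - w)) + ((1 - τ : ℝ) : ℂ) * (z - w) := by push_cast; ring
          have := norm_add_le (w + (τ : ℂ) * (z - w)) (((1 - τ : ℝ) : ℂ) * (z - w))
          rw [← e, norm_mul, Complex.norm_real, Real.norm_of_nonneg (by linarith : 0 ≤ 1 - τ)]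
            at this
          nlinarith [norm_nonneg (z - w)]
        · have hrz : r = ‖w‖ := max_eq_right hwz
          have e : w = (w + (τ : ℂ) * (z - w)) - (τ : ℂ) * (z - w) := by ring
          have := norm_sub_le (w + (τ : ℂ) * (z - w)) ((τ : ℂ) * (z - w))
          rw [← e, norm_mul, Complex.norm_real, Real.norm_of_nonneg h0] at this
          nlinarith [norm_nonneg (z - w)]
    have hb := hF.norm_nonlinDeriv_sub_le_of_segment (h := h) hpos (hrM.trans hM) hseg
    have c1 : r ^ m / r * ‖z - w‖ ≤ ‖z - w‖ ^ m := by
      rcases eq_or_lt_of_le (norm_nonneg (z - w)) with h0 | hp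
      · rw [← h0, mul_zero]; exact Real.rpow_nonneg le_rfl _
      · have hle : ‖z - w‖ / r ≤ 1 := by rw [div_le_one hpos]; linarith
        have : (‖z - w‖ / r) ^ (1 : ℝ) ≤ (‖z - w‖ / r) ^ m :=
          Real.rpow_le_rpow_of_exponent_ge (by positivity) hle hm1
        rw [Real.rpow_one, Real.div_rpow hp.le hpos.le, div_le_div_iff₀ hpos (by positivity)] at this
        rw [div_mul_eq_mul_div, div_le_iff₀ hpos]
        linarith
    calc ‖nonlinDeriv g z h - nonlinDeriv g w h‖
        ≤ 40 * C₀ * r ^ α₁ / r * ‖z - w‖ * ‖h‖ := hb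
      _ = 40 * C₀ * (r ^ m / r * ‖z - w‖) * r ^ (α₁ - m) * ‖h‖ := by rw [hsplit]; ring
      _ ≤ 40 * C₀ * ‖z - w‖ ^ m * M ^ (α₁ - m) * ‖h‖ := by gcongr
      _ ≤ _ := by gcongr; linarith

theorem norm_line_le {p q : ℂ} {M τ : ℝ} (h0 : 0 ≤ τ) (h1 : τ ≤ 1) (hp : ‖p‖ ≤ M)
    (hq : ‖q‖ ≤ M) : ‖p + (τ : ℂ) * (q - p)‖ ≤ M := by
  have e : p + (τ : ℂ) * (q - p) = ((1 - τ : ℝ) : ℂ) * p + (τ : ℂ) * q := by push_cast; ring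
  rw [e]
  refine (norm_add_le _ _).trans ?_
  rw [norm_mul, norm_mul, Complex.norm_real, Complex.norm_real, Real.norm_of_nonneg h0,
    Real.norm_of_nonneg (by linarith : 0 ≤ 1 - τ)]
  nlinarith

/-- Second difference estimate for the nonlinearity near the origin. -/
theorem AssumptionF.nonlin_second_diff (hF : AssumptionF d g C₀ α₁ α₂) :
    ∃ C : ℝ, 0 < C ∧ ∀ (M : ℝ) (w₁ e₁ w₂ e₂ : ℂ), M ≤ 1 → ‖w₁‖ ≤ M → ‖w₂‖ ≤ M →
      ‖w₁ + e₁‖ ≤ M → ‖w₂ + e₂‖ ≤ M →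
      ‖(nonlin g (w₁ + e₁) - nonlin g w₁) - (nonlin g (w₂ + e₂) - nonlin g w₂)‖ ≤
        C * (M ^ α₁ * ‖e₁ - e₂‖ +
          (max ‖e₁‖ ‖e₂‖) ^ (min α₁ 1) * M ^ (α₁ - min α₁ 1) * ‖w₁ - w₂‖) := by
  have hα := hF.α₁_pos
  have hC := hF.C₀_pos
  obtain ⟨C2, hC2, hH⟩ := hF.norm_nonlinDeriv_sub_le
  set C1 := 4 * C₀ / α₁ + 4 * C₀ with hC1
  have hC1p : 0 < C1 := by positivity
  refine ⟨C1 + C2, by positivity, ?_⟩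
  intro M w₁ e₁ w₂ e₂ hM hw₁ hw₂ he₁ he₂
  have hM0 : 0 ≤ M := (norm_nonneg _).trans hw₁
  -- Both endpoints move simultaneously from the second configuration to the first, so that `F 1 - F
  -- 0` is the second difference. Since the velocities differ by `e₁ - e₂`, the derivative of `F` is
  -- `f'(z)(e₁ - e₂)` plus `(f'(z) - f'(w))(w₁ - w₂)`, with `z - w` between `e₂` and `e₁`.
  set F : ℝ → ℂ := fun τ => nonlin g ((w₂ + e₂) + (τ : ℂ) * ((w₁ + e₁) - (w₂ + e₂))) -
    nonlin g (w₂ + (τ : ℂ) * (w₁ - w₂)) with hFd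
  have hd : ∀ τ : ℝ, HasDerivAt F
      (nonlinDeriv g ((w₂ + e₂) + (τ : ℂ) * ((w₁ + e₁) - (w₂ + e₂))) ((w₁ + e₁) - (w₂ + e₂)) -
        nonlinDeriv g (w₂ + (τ : ℂ) * (w₁ - w₂)) (w₁ - w₂)) τ := fun τ =>
    (hF.hasDerivAt_nonlin_line _ _ τ).sub (hF.hasDerivAt_nonlin_line _ _ τ)
  have hlin : ∀ z a b : ℂ, nonlinDeriv g z (a + b) = nonlinDeriv g z a + nonlinDeriv g z b := by
    intro z a b
    simp only [nonlinDeriv, inner_add_right]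
    push_cast
    ring
  have hbd : ∀ τ ∈ Set.Ico (0 : ℝ) 1,
      ‖nonlinDeriv g ((w₂ + e₂) + (τ : ℂ) * ((w₁ + e₁) - (w₂ + e₂))) ((w₁ + e₁) - (w₂ + e₂)) -
        nonlinDeriv g (w₂ + (τ : ℂ) * (w₁ - w₂)) (w₁ - w₂)‖ ≤
      (C1 + C2) * (M ^ α₁ * ‖e₁ - e₂‖ +
          (max ‖e₁‖ ‖e₂‖) ^ (min α₁ 1) * M ^ (α₁ - min α₁ 1) * ‖w₁ - w₂‖) := by
    rintro τ ⟨h0, h1⟩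
    set z := (w₂ + e₂) + (τ : ℂ) * ((w₁ + e₁) - (w₂ + e₂)) with hz
    set w := w₂ + (τ : ℂ) * (w₁ - w₂) with hw
    have hzM : ‖z‖ ≤ M := norm_line_le h0 h1.le he₂ he₁
    have hwM : ‖w‖ ≤ M := norm_line_le h0 h1.le hw₂ hw₁
    have e : (w₁ + e₁) - (w₂ + e₂) = (e₁ - e₂) + (w₁ - w₂) := by ring
    have hzw : ‖z - w‖ ≤ max ‖e₁‖ ‖e₂‖ := by
      have : z - w = e₂ + (τ : ℂ) * (e₁ - e₂) := by rw [hz, hw]; ring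
      rw [this]
      exact norm_line_le h0 h1.le (le_max_right _ _) (le_max_left _ _)
    rw [e, hlin, add_sub_assoc]
    have b1 : ‖nonlinDeriv g z (e₁ - e₂)‖ ≤ C1 * M ^ α₁ * ‖e₁ - e₂‖ := by
      refine (hF.norm_nonlinDeriv_le (hzM.trans hM) _).trans ?_
      gcongr
    have b2 : ‖nonlinDeriv g z (w₁ - w₂) - nonlinDeriv g w (w₁ - w₂)‖ ≤
        C2 * (max ‖e₁‖ ‖e₂‖) ^ (min α₁ 1) * M ^ (α₁ - min α₁ 1) * ‖w₁ - w₂‖ := by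
      refine (hH M z w _ hM hzM hwM).trans ?_
      gcongr
    refine (norm_add_le _ _).trans ((add_le_add b1 b2).trans ?_)
    have p1 : 0 ≤ M ^ α₁ * ‖e₁ - e₂‖ := by positivity
    have p2 : 0 ≤ (max ‖e₁‖ ‖e₂‖) ^ (min α₁ 1) * M ^ (α₁ - min α₁ 1) * ‖w₁ - w₂‖ := by positivity
    nlinarith
  have := norm_image_sub_le_of_norm_deriv_le_segment' (f := F) (a := 0) (b := 1)
    (fun x _ => (hd x).hasDerivWithinAt) hbd 1 ⟨zero_le_one, le_rfl⟩
  simpa [hFd] using this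

/-- With a globally Lipschitz nonlinearity the fixed point argument runs in `L²` without a prior sup
bound. The Lipschitz constant is small with `R`, up to the dimensional factor of the extension
theorem. -/
theorem exists_lipschitz_extension_nonlin {C R : ℝ} (hC0 : 0 ≤ C) (hR0 : 0 ≤ R)
    (h : ∀ z w : ℂ, ‖z‖ ≤ R → ‖w‖ ≤ R →
      ‖nonlin g z - nonlin g w‖ ≤ C * R ^ α₁ * ‖z - w‖) :
    ∃ F : ℂ → ℂ, (∀ z w, ‖F z - F w‖ ≤
      (lipschitzExtensionConstant ℂ : ℝ) * (C * R ^ α₁) * ‖z - w‖) ∧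
      ∀ z, ‖z‖ ≤ R → F z = nonlin g z := by
  have hl : LipschitzOnWith (Real.toNNReal (C * R ^ α₁)) (nonlin g) (Metric.closedBall 0 R) := by
    refine LipschitzOnWith.of_dist_le_mul fun z hz w hw => ?_
    rw [dist_eq_norm, dist_eq_norm, Real.coe_toNNReal _ (by positivity)]
    exact h z w (by simpa using hz) (by simpa using hw)
  obtain ⟨F, hF, he⟩ := hl.extend_finite_dimension
  refine ⟨F, fun z w => ?_, fun z hz => (he (by simpa using hz)).symm⟩
  have := hF.dist_le_mul z w
  rwa [dist_eq_norm, dist_eq_norm, NNReal.coe_mul, Real.coe_toNNReal _ (by positivity)] at this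

end NLSTrain
end

open scoped ENNReal Topology
noncomputable section
namespace NLSTrain
open MeasureTheory FourierTransform

/-! ### The Schrödinger group on `L²` -/

/-- The space `L²(ℝᵈ,ℂ)`. -/
abbrev L2 (d : ℕ) : Type := Lp (α := Space d) ℂ 2 volume

variable {d : ℕ}

theorem memLp_phase_mul {θ : Space d → ℝ} (hθ : Continuous θ) {f : Space d → ℂ} (hf : MemLp f 2) :
    MemLp (fun ξ => Complex.exp (Complex.I * θ ξ) * f ξ) 2 := by
  refine hf.of_le ?_ (Filter.Eventually.of_forall fun ξ => ?_)
  · have : Continuous fun ξ => Complex.exp (Complex.I * θ ξ) := by fun_prop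
    exact this.aestronglyMeasurable.mul hf.1
  · rw [norm_mul, mul_comm Complex.I, Complex.norm_exp_ofReal_mul_I, one_mul]

/-- Multiplication by the unimodular function `e^{iθ}`. -/
def mulPhase (θ : Space d → ℝ) (hθ : Continuous θ) : L2 d →ₗᵢ[ℂ] L2 d where
  toFun f := (memLp_phase_mul hθ (Lp.memLp f)).toLp _
  map_add' f g := by
    rw [← MemLp.toLp_add, MemLp.toLp_eq_toLp_iff]
    filter_upwards [Lp.coeFn_add f g] with x hx
    simp only [hx, Pi.add_apply]; ring
  map_smul' c f := by
    rw [RingHom.id_apply, ← MemLp.toLp_const_smul, MemLp.toLp_eq_toLp_iff]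
    filter_upwards [Lp.coeFn_smul c f] with x hx
    simp only [hx, Pi.smul_apply, smul_eq_mul]; ring
  norm_map' f := by
    simp only [LinearMap.coe_mk, AddHom.coe_mk]
    rw [Lp.norm_toLp, Lp.norm_def]
    congr 1
    refine eLpNorm_congr_norm_ae (Filter.Eventually.of_forall fun ξ => ?_)
    rw [norm_mul, mul_comm Complex.I, Complex.norm_exp_ofReal_mul_I, one_mul]

theorem mulPhase_coe (θ : Space d → ℝ) (hθ : Continuous θ) (f : L2 d) :
    mulPhase θ hθ f =ᵐ[volume] fun ξ => Complex.exp (Complex.I * θ ξ) * f ξ :=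
  MemLp.coeFn_toLp (memLp_phase_mul hθ (Lp.memLp f))

theorem mulPhase_mulPhase {θ η : Space d → ℝ} (hθ : Continuous θ) (hη : Continuous η)
    (f : L2 d) : mulPhase θ hθ (mulPhase η hη f) = mulPhase (fun ξ => θ ξ + η ξ) (hθ.add hη) f := by
  ext1
  filter_upwards [mulPhase_coe θ hθ (mulPhase η hη f), mulPhase_coe η hη f,
    mulPhase_coe (fun ξ => θ ξ + η ξ) (hθ.add hη) f] with x h1 h2 h3
  rw [h1, h2, h3, ← mul_assoc, ← Complex.exp_add]
  push_cast
  ring_nf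

/-- The Fourier multiplier with symbol `e^{iθ}`. -/
def fourierPhase (θ : Space d → ℝ) (hθ : Continuous θ) : L2 d →ₗᵢ[ℂ] L2 d :=
  ((Lp.fourierTransformₗᵢ (Space d) ℂ).symm.toLinearIsometry.comp (mulPhase θ hθ)).comp
    (Lp.fourierTransformₗᵢ (Space d) ℂ).toLinearIsometry

theorem fourierPhase_apply (θ : Space d → ℝ) (hθ : Continuous θ) (f : L2 d) :
    fourierPhase θ hθ f = 𝓕⁻ (mulPhase θ hθ (𝓕 f)) := rfl

theorem fourier_fourierPhase (θ : Space d → ℝ) (hθ : Continuous θ) (f : L2 d) :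
    𝓕 (fourierPhase θ hθ f) = mulPhase θ hθ (𝓕 f) := by
  rw [fourierPhase_apply, FourierTransform.fourier_fourierInv_eq]

theorem fourierPhase_fourierPhase {θ η : Space d → ℝ} (hθ : Continuous θ) (hη : Continuous η)
    (f : L2 d) :
    fourierPhase θ hθ (fourierPhase η hη f) =
      fourierPhase (fun ξ => θ ξ + η ξ) (hθ.add hη) f := by
  rw [fourierPhase_apply, fourier_fourierPhase, mulPhase_mulPhase, ← fourierPhase_apply]

theorem fourierPhase_comm {θ η : Space d → ℝ} (hθ : Continuous θ) (hη : Continuous η)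
    (f : L2 d) :
    fourierPhase θ hθ (fourierPhase η hη f) = fourierPhase η hη (fourierPhase θ hθ f) := by
  rw [fourierPhase_fourierPhase, fourierPhase_fourierPhase]
  congr 2
  funext ξ
  rw [add_comm]

theorem mulPhase_zero (h : Continuous fun _ : Space d => (0 : ℝ)) (f : L2 d) :
    mulPhase (fun _ => 0) h f = f := by
  ext1
  filter_upwards [mulPhase_coe _ h f] with x hx
  rw [hx]; simp

theorem fourierPhase_zero (h : Continuous fun _ : Space d => (0 : ℝ)) (f : L2 d) :
    fourierPhase (fun _ => 0) h f = f := by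
  rw [fourierPhase_apply, mulPhase_zero, FourierTransform.fourierInv_fourier_eq]

/-- The symbol phase of the free Schrödinger group. -/
def schPhase (t : ℝ) (ξ : Space d) : ℝ := -(4 * Real.pi ^ 2 * t * ‖ξ‖ ^ 2)

theorem continuous_schPhase (t : ℝ) : Continuous (schPhase (d := d) t) := by
  unfold schPhase; fun_prop

/-- The free Schrödinger group `e^{itΔ}`. -/
def sch (t : ℝ) : L2 d →ₗᵢ[ℂ] L2 d := fourierPhase (schPhase t) (continuous_schPhase t)

theorem sch_add (s t : ℝ) (f : L2 d) : sch (s + t) f = sch s (sch t f) := by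
  rw [sch, sch, sch, fourierPhase_fourierPhase]
  congr 2
  funext ξ
  simp only [schPhase]; ring

theorem sch_zero (f : L2 d) : sch 0 f = f := by
  have : schPhase (d := d) 0 = fun _ => 0 := by funext ξ; simp [schPhase]
  unfold sch
  simp only [this, fourierPhase_zero]

theorem norm_mulPhase_sub_sq (θ : Space d → ℝ) (hθ : Continuous θ) (f : L2 d) :
    ENNReal.ofReal (‖mulPhase θ hθ f - f‖ ^ 2) =
      ∫⁻ ξ, ‖(Complex.exp (Complex.I * θ ξ) - 1) * f ξ‖ₑ ^ 2 := by
  have h : eLpNorm (mulPhase θ hθ f - f : L2 d) 2 volume =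
      eLpNorm (fun ξ => (Complex.exp (Complex.I * θ ξ) - 1) * f ξ) 2 volume := by
    refine eLpNorm_congr_ae ?_
    filter_upwards [mulPhase_coe θ hθ f, Lp.coeFn_sub (mulPhase θ hθ f) f] with x h1 h2
    rw [h2, Pi.sub_apply, h1]; ring
  rw [ENNReal.ofReal_pow (norm_nonneg _), ofReal_norm, Lp.enorm_def, h,
    eLpNorm_eq_lintegral_rpow_enorm_toReal (by norm_num) (by norm_num)]
  rw [← ENNReal.rpow_natCast, ← ENNReal.rpow_mul]
  norm_num

/-- By Plancherel this is dominated convergence for `(e^{iθ_t} - 1) 𝓕f`, with dominating function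
`2|𝓕f|`. -/
theorem tendsto_sch_zero (f : L2 d) : Filter.Tendsto (fun t => sch t f) (𝓝 0) (𝓝 f) := by
  rw [tendsto_iff_norm_sub_tendsto_zero]
  have h1 : ∀ t : ℝ, ‖sch t f - f‖ =
      ‖mulPhase (schPhase t) (continuous_schPhase t) (𝓕 f) - 𝓕 f‖ := by
    intro t
    rw [← Lp.norm_fourier_eq (sch t f - f)]
    congr 1
    have : (𝓕 (sch t f - f) : L2 d) = 𝓕 (sch t f) - 𝓕 f :=
      (Lp.fourierTransformₗᵢ (Space d) ℂ).map_sub _ _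
    rw [this, sch, fourier_fourierPhase]
  simp only [h1]
  set F : L2 d := 𝓕 f
  have h2 : Filter.Tendsto (fun t : ℝ => ∫⁻ ξ, ‖(Complex.exp (Complex.I * schPhase t ξ) - 1) * F ξ‖ₑ ^ 2)
      (𝓝 0) (𝓝 (∫⁻ ξ : Space d, 0)) := by
    have hb : ∫⁻ ξ, (2 * ‖F ξ‖ₑ) ^ 2 ≠ ∞ := by
      have := (Lp.memLp F).const_mul (2 : ℂ)
      have h := this.eLpNorm_lt_top
      rw [eLpNorm_lt_top_iff_lintegral_rpow_enorm_lt_top (by norm_num) (by norm_num)] at h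
      convert h.ne using 3 with ξ
      rw [enorm_mul]
      have h2 : ‖(2 : ℂ)‖ₑ = 2 := by rw [← ofReal_norm]; norm_num
      rw [h2]
      norm_num
    refine tendsto_lintegral_filter_of_dominated_convergence (fun ξ => (2 * ‖F ξ‖ₑ) ^ 2)
      (Filter.Eventually.of_forall fun t => ?_)
      (Filter.Eventually.of_forall fun t => Filter.Eventually.of_forall fun ξ => ?_) hb
      (Filter.Eventually.of_forall fun ξ => ?_)
    · have : Continuous fun ξ : Space d => Complex.exp (Complex.I * schPhase t ξ) - 1 := by
        have := continuous_schPhase (d := d) t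
        fun_prop
      exact ((this.measurable.mul (Lp.stronglyMeasurable F).measurable).enorm.pow_const 2)
    · rw [enorm_mul]
      gcongr
      rw [← ofReal_norm, ← ENNReal.ofReal_ofNat 2]
      refine ENNReal.ofReal_le_ofReal ((norm_sub_le _ _).trans ?_)
      rw [mul_comm Complex.I, Complex.norm_exp_ofReal_mul_I, norm_one]; norm_num
    · have : Continuous fun t : ℝ => ‖(Complex.exp (Complex.I * schPhase t ξ) - 1) * F ξ‖ₑ ^ 2 := by
        unfold schPhase
        fun_prop
      have := this.tendsto 0
      simpa [schPhase] using this
  simp only [← norm_mulPhase_sub_sq _ (continuous_schPhase _), lintegral_zero] at h2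
  have h3 := (ENNReal.tendsto_toReal ENNReal.zero_ne_top).comp h2
  have h4 : Filter.Tendsto (fun t : ℝ =>
      ‖mulPhase (schPhase t) (continuous_schPhase t) F - F‖ ^ 2) (𝓝 0) (𝓝 0) := by
    refine Filter.Tendsto.congr (fun t => ?_) h3
    simp
  have h5 := h4.sqrt
  simpa using h5

theorem continuous_sch_uncurry : Continuous fun p : ℝ × L2 d => sch p.1 p.2 := by
  rw [continuous_iff_continuousAt]
  rintro ⟨t, f⟩
  rw [ContinuousAt, tendsto_iff_norm_sub_tendsto_zero]
  have hle : ∀ p : ℝ × L2 d, ‖sch p.1 p.2 - sch t f‖ ≤ ‖p.2 - f‖ + ‖sch (p.1 - t) f - f‖ := by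
    intro p
    have e1 : sch p.1 p.2 - sch t f = sch p.1 (p.2 - f) + sch t (sch (p.1 - t) f - f) := by
      rw [map_sub, map_sub, ← sch_add]
      have : t + (p.1 - t) = p.1 := by ring
      rw [this]; abel
    rw [e1]
    refine (norm_add_le _ _).trans ?_
    rw [LinearIsometry.norm_map, LinearIsometry.norm_map]
  refine squeeze_zero (fun _ => norm_nonneg _) hle ?_
  have l1 : Filter.Tendsto (fun p : ℝ × L2 d => ‖p.2 - f‖) (𝓝 (t, f)) (𝓝 0) := by
    have : Continuous fun p : ℝ × L2 d => ‖p.2 - f‖ := by fun_prop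
    simpa using this.tendsto (t, f)
  have l2 : Filter.Tendsto (fun p : ℝ × L2 d => ‖sch (p.1 - t) f - f‖) (𝓝 (t, f)) (𝓝 0) := by
    have h1 : Filter.Tendsto (fun p : ℝ × L2 d => p.1 - t) (𝓝 (t, f)) (𝓝 0) := by
      have : Continuous fun p : ℝ × L2 d => p.1 - t := by fun_prop
      simpa using this.tendsto (t, f)
    have := ((tendsto_sch_zero f).comp h1).sub_const f
    simpa using this.norm
  simpa using l1.add l2

/-! ### Translations -/

/-- The translate `x ↦ f (x + h)`. -/
def trans (h : Space d) : L2 d →ₗᵢ[ℂ] L2 d :=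
  Lp.compMeasurePreservingₗᵢ ℂ (fun x => x + h) (measurePreserving_add_right volume h)

theorem trans_coe (h : Space d) (f : L2 d) : trans h f =ᵐ[volume] fun x => f (x + h) :=
  Lp.coeFn_compMeasurePreserving f (measurePreserving_add_right volume h)

/-- Both sides are isometries, so the identity need only be checked on Schwartz functions. Its
purpose is that translations, being Fourier multipliers, commute with the Schrödinger group. -/
theorem trans_eq_fourierPhase (h : Space d) (f : L2 d) :
    trans h f = fourierPhase (fun ξ => 2 * Real.pi * inner ℝ h ξ) (by fun_prop) f := by
  have hc : Continuous fun ξ : Space d => 2 * Real.pi * inner ℝ h ξ := by fun_prop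
  refine DenseRange.induction_on (p := fun f => trans h f = fourierPhase _ hc f)
    (SchwartzMap.denseRange_toLpCLM (p := 2) ENNReal.ofNat_ne_top) f ?_ ?_
  · exact isClosed_eq (trans h).continuous (fourierPhase _ hc).continuous
  · intro ψ
    rw [SchwartzMap.toLpCLM_apply]
    have key : (𝓕 (trans h (ψ.toLp 2)) : L2 d) = mulPhase _ hc (𝓕 (ψ.toLp 2)) := by
      have e1 : trans h (ψ.toLp 2) =
          (SchwartzMap.compSubConstCLM ℂ (-h) ψ).toLp 2 := by
        ext1
        have hq := (measurePreserving_add_right (volume : Measure (Space d)) h).quasiMeasurePreserving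
        filter_upwards [trans_coe h (ψ.toLp 2), hq.ae (ψ.coeFn_toLp 2 volume),
          (SchwartzMap.compSubConstCLM ℂ (-h) ψ).coeFn_toLp 2 volume] with x h1 h2 h3
        rw [h1, h2, h3]
        simp
      rw [e1, SchwartzMap.toLp_fourier_eq, SchwartzMap.toLp_fourier_eq]
      ext1
      filter_upwards [(𝓕 (SchwartzMap.compSubConstCLM ℂ (-h) ψ)).coeFn_toLp 2 volume,
        mulPhase_coe _ hc ((𝓕 ψ).toLp 2), (𝓕 ψ).coeFn_toLp 2 volume] with ξ h1 h2 h3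
      rw [h1, h2, h3, SchwartzMap.fourier_coe, SchwartzMap.fourier_coe]
      have := congrFun (VectorFourier.fourierIntegral_comp_add_right Real.fourierChar
        (volume : Measure (Space d)) (innerₗ (Space d)) (ψ : Space d → ℂ) h) ξ
      have e2 : (SchwartzMap.compSubConstCLM ℂ (-h) ψ : Space d → ℂ) =
          (ψ : Space d → ℂ) ∘ fun v => v + h := by
        funext v; simp
      rw [e2]
      refine Eq.trans this ?_
      rw [Circle.smul_def, Real.fourierChar_apply, smul_eq_mul, mul_comm Complex.I]
      rfl
    have := congrArg (fun u : L2 d => (𝓕⁻ u : L2 d)) key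
    simp only [FourierTransform.fourierInv_fourier_eq] at this
    rw [this, fourierPhase_apply]

theorem trans_sch (h : Space d) (t : ℝ) (f : L2 d) : trans h (sch t f) = sch t (trans h f) := by
  rw [trans_eq_fourierPhase, trans_eq_fourierPhase, sch, fourierPhase_comm]

theorem fourier_trans (h : Space d) (f : L2 d) :
    (𝓕 (trans h f) : L2 d) =ᵐ[volume]
      fun ξ => Complex.exp (Complex.I * (2 * Real.pi * inner ℝ h ξ : ℝ)) * (𝓕 f : L2 d) ξ := by
  rw [trans_eq_fourierPhase, fourier_fourierPhase]
  exact mulPhase_coe _ _ _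

end NLSTrain
end

open scoped ENNReal Topology
noncomputable section
namespace NLSTrain
open MeasureTheory FourierTransform

variable {d : ℕ}

/-! ### Regularised point evaluations -/

/-- For integrable and square integrable `w`, the `L²` inverse Fourier transform is given by the
Fourier integral. -/
theorem fourierInv_toLp_ae_eq {w : Space d → ℂ} (h1 : Integrable w) (h2 : MemLp w 2) :
    (𝓕⁻ (h2.toLp w) : L2 d) =ᵐ[volume] 𝓕⁻ w := by
  have hcont : Continuous (𝓕⁻ w) := by
    have : Continuous (𝓕 w) := VectorFourier.fourierIntegral_continuous Real.continuous_fourierChar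
      (by exact continuous_inner) h1
    have e : 𝓕⁻ w = fun y => 𝓕 w (-y) := by
      funext y; exact Real.fourierInv_eq_fourier_neg w y
    rw [e]; exact this.comp continuous_neg
  refine ae_eq_of_integral_contDiff_smul_eq
    ((Lp.memLp (𝓕⁻ (h2.toLp w) : L2 d)).locallyIntegrable (by norm_num))
    hcont.locallyIntegrable ?_
  intro ψ hψ hψc
  set Ψ : Space d → ℂ := fun x => (ψ x : ℂ) with hΨ
  have hΨs : ContDiff ℝ (⊤ : ℕ∞) Ψ := Complex.ofRealCLM.contDiff.comp hψ
  have hΨc : HasCompactSupport Ψ := hψc.comp_left (g := fun r : ℝ => (r : ℂ)) Complex.ofReal_zero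
  set S := hΨc.toSchwartzMap hΨs with hS
  have hScoe : ∀ x, S x = (ψ x : ℂ) := fun x => rfl
  have e1 : inner ℂ (S.toLp 2) (𝓕⁻ (h2.toLp w) : L2 d) =
      ∫ x, ψ x • (𝓕⁻ (h2.toLp w) : L2 d) x := by
    rw [L2.inner_def]
    refine integral_congr_ae ?_
    filter_upwards [S.coeFn_toLp 2 volume] with x hx
    rw [hx, hScoe]
    simp [mul_comm]
  have e2 : inner ℂ (S.toLp 2) (𝓕⁻ (h2.toLp w) : L2 d) =
      inner ℂ ((𝓕 S).toLp 2) (h2.toLp w) := by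
    rw [← Lp.inner_fourier_eq, FourierTransform.fourier_fourierInv_eq, SchwartzMap.toLp_fourier_eq]
  have e3 : inner ℂ ((𝓕 S).toLp 2) (h2.toLp w) = ∫ ξ, 𝓕⁻ Ψ ξ * w ξ := by
    rw [L2.inner_def]
    refine integral_congr_ae ?_
    filter_upwards [(𝓕 S).coeFn_toLp 2 volume, h2.coeFn_toLp] with ξ hx hw
    rw [hx, hw, SchwartzMap.fourier_coe, RCLike.inner_apply]
    rw [mul_comm]
    congr 1
    rw [Real.fourier_eq', Real.fourierInv_eq', ← integral_conj]
    congr 1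
    funext v
    rw [smul_eq_mul, smul_eq_mul, map_mul, ← Complex.exp_conj, hScoe]
    simp [hΨ, map_ofNat]
  -- The multiplication formula, for the bilinear form with reversed sign, which turns the Fourier
  -- integral into its inverse.
  have e4 : ∫ ξ, 𝓕⁻ Ψ ξ * w ξ = ∫ x, Ψ x * 𝓕⁻ w x := by
    have hΨi : Integrable Ψ := hΨs.continuous.integrable_of_hasCompactSupport hΨc
    have := VectorFourier.integral_fourierIntegral_smul_eq_flip (L := -(innerₗ (Space d)))
      (e := Real.fourierChar) (μ := volume) (ν := volume) Real.continuous_fourierChar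
      (by simp only [LinearMap.neg_apply]; exact continuous_inner.neg) hΨi h1
    simp only [smul_eq_mul] at this
    refine Eq.trans ?_ (this.trans ?_)
    · rfl
    · congr 1
      funext x
      congr 1
      rw [Real.fourierInv_eq, VectorFourier.fourierIntegral]
      congr 1
      funext v
      simp [real_inner_comm]
  rw [← e1, e2, e3, e4]
  congr 1

/-- The symbol of the regularised evaluation. -/
def evalSymbol (z : ℂ) (x ξ : Space d) : ℂ :=
  Complex.exp (-(4 * Real.pi ^ 2 * z) * ‖ξ‖ ^ 2 + 2 * Real.pi * Complex.I * (inner ℝ x ξ : ℝ))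

theorem continuous_evalSymbol (z : ℂ) (x : Space d) : Continuous (evalSymbol z x) := by
  unfold evalSymbol; fun_prop

theorem norm_evalSymbol (z : ℂ) (x ξ : Space d) :
    ‖evalSymbol z x ξ‖ = Real.exp (-(4 * Real.pi ^ 2 * z.re) * ‖ξ‖ ^ 2) := by
  rw [evalSymbol, Complex.norm_exp]
  congr 1
  have e : (-(4 * Real.pi ^ 2 * z) * ‖ξ‖ ^ 2 : ℂ) =
      ((-(4 * Real.pi ^ 2 * ‖ξ‖ ^ 2) : ℝ) : ℂ) * z := by push_cast; ring
  have e2 : (2 * Real.pi * Complex.I * (inner ℝ x ξ : ℝ) : ℂ) =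
      ((2 * Real.pi * inner ℝ x ξ : ℝ) : ℂ) * Complex.I := by push_cast; ring
  rw [Complex.add_re, e, e2, Complex.re_ofReal_mul, Complex.re_ofReal_mul, Complex.I_re]
  ring

theorem integrable_gauss {c : ℝ} (hc : 0 < c) :
    Integrable fun ξ : Space d => Real.exp (-c * ‖ξ‖ ^ 2) := by
  have := GaussianFourier.integrable_cexp_neg_mul_sq_norm_add (V := Space d) (b := (c : ℂ))
    (by simpa using hc) 0 0
  have h2 := this.norm
  refine h2.congr (Filter.Eventually.of_forall fun ξ => ?_)
  simp only [zero_mul, add_zero]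
  rw [Complex.norm_exp]
  congr 1
  have : (-(c : ℂ) * (‖ξ‖ : ℂ) ^ 2) = ((-c * ‖ξ‖ ^ 2 : ℝ) : ℂ) := by push_cast; ring
  rw [this, Complex.ofReal_re]

theorem integrable_evalSymbol {z : ℂ} (hz : 0 < z.re) (x : Space d) :
    Integrable (evalSymbol z x) := by
  have := integrable_gauss (d := d) (c := 4 * Real.pi ^ 2 * z.re) (by positivity)
  refine this.mono' (continuous_evalSymbol z x).aestronglyMeasurable
    (Filter.Eventually.of_forall fun ξ => ?_)
  rw [norm_evalSymbol]

theorem memLp_evalSymbol {z : ℂ} (hz : 0 < z.re) (x : Space d) : MemLp (evalSymbol z x) 2 := by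
  rw [memLp_two_iff_integrable_sq_norm (continuous_evalSymbol z x).aestronglyMeasurable]
  have := integrable_gauss (d := d) (c := 8 * Real.pi ^ 2 * z.re) (by positivity)
  refine this.congr (Filter.Eventually.of_forall fun ξ => ?_)
  simp only
  rw [norm_evalSymbol, ← Real.exp_nat_mul]
  congr 1
  push_cast
  ring

/-- The value at `x` of `e^{zΔ} f`. -/
def heatEval (z : ℂ) (x : Space d) (f : L2 d) : ℂ := ∫ ξ, evalSymbol z x ξ * (𝓕 f : L2 d) ξ

/-- The kernel representing `heatEval z x`. -/
def heatKernel (z : ℂ) (hz : 0 < z.re) (x : Space d) : L2 d :=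
  𝓕⁻ ((memLp_evalSymbol hz x).star.toLp _)

theorem heatEval_eq_inner {z : ℂ} (hz : 0 < z.re) (x : Space d) (f : L2 d) :
    heatEval z x f = inner ℂ (heatKernel z hz x) f := by
  rw [heatKernel, ← Lp.inner_fourier_eq, FourierTransform.fourier_fourierInv_eq, L2.inner_def,
    heatEval]
  refine integral_congr_ae ?_
  filter_upwards [(memLp_evalSymbol hz x).star.coeFn_toLp] with ξ hξ
  rw [hξ, RCLike.inner_apply, Pi.star_apply, RCLike.star_def, RCLike.conj_conj, mul_comm]

theorem integrable_heatEval {z : ℂ} (hz : 0 < z.re) (x : Space d) (f : L2 d) :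
    Integrable fun ξ => evalSymbol z x ξ * (𝓕 f : L2 d) ξ := by
  have := (memLp_evalSymbol hz x).integrable_mul (Lp.memLp (𝓕 f : L2 d))
  exact this

/-- Plancherel reduces the norm to a real Gaussian integral, equal to `(8π Re z)^{-d/2}`; the factor
`(8π)⁻¹ ≤ 1` is dropped. -/
theorem norm_heatKernel_le {z : ℂ} (hz : 0 < z.re) (x : Space d) :
    ‖heatKernel z hz x‖ ≤ z.re ^ (-(d : ℝ) / 4) := by
  have e1 : ‖heatKernel z hz x‖ = ‖((memLp_evalSymbol hz x).star.toLp _ : L2 d)‖ :=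
    (Lp.fourierTransformₗᵢ (Space d) ℂ).symm.norm_map _
  have e2 : ‖((memLp_evalSymbol hz x).star.toLp _ : L2 d)‖ ^ 2 =
      (Real.pi / (8 * Real.pi ^ 2 * z.re)) ^ ((d : ℝ) / 2) := by
    have hG := GaussianFourier.integral_rexp_neg_mul_sq_norm (V := Space d)
      (b := 8 * Real.pi ^ 2 * z.re) (by positivity)
    rw [finrank_euclideanSpace_fin] at hG
    rw [← hG, ← @RCLike.ofReal_inj ℂ, RCLike.ofReal_pow, ← inner_self_eq_norm_sq_to_K (𝕜 := ℂ),
      L2.inner_def]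
    rw [show (RCLike.ofReal (∫ v : Space d, Real.exp (-(8 * Real.pi ^ 2 * z.re) * ‖v‖ ^ 2)) : ℂ) =
      ∫ v : Space d, ((Real.exp (-(8 * Real.pi ^ 2 * z.re) * ‖v‖ ^ 2) : ℝ) : ℂ) from
      integral_ofReal.symm]
    refine integral_congr_ae ?_
    filter_upwards [(memLp_evalSymbol hz x).star.coeFn_toLp] with ξ hξ
    rw [hξ, inner_self_eq_norm_sq_to_K, Pi.star_apply, norm_star, norm_evalSymbol,
      ← RCLike.ofReal_pow, ← Real.exp_nat_mul]
    congr 2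
    push_cast
    ring
  rw [e1]
  have h0 : (0:ℝ) ≤ z.re ^ (-(d : ℝ) / 4) := by positivity
  refine le_of_sq_le_sq ?_ h0 |>.trans le_rfl
  rw [e2, ← Real.rpow_natCast (z.re ^ (-(d : ℝ) / 4)) 2, ← Real.rpow_mul hz.le]
  have e3 : Real.pi / (8 * Real.pi ^ 2 * z.re) = (8 * Real.pi)⁻¹ * z.re⁻¹ := by
    field_simp
  have e4 : (-(d : ℝ) / 4 * ((2 : ℕ) : ℝ)) = -((d : ℝ) / 2) := by push_cast; ring
  rw [e3, e4, Real.rpow_neg hz.le, ← Real.inv_rpow hz.le]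
  refine Real.rpow_le_rpow (by positivity) ?_ (by positivity)
  have : (8 * Real.pi)⁻¹ ≤ 1 := inv_le_one_of_one_le₀ (by linarith [Real.pi_gt_three])
  have hzi : 0 < z.re⁻¹ := by positivity
  nlinarith

theorem norm_heatEval_le {z : ℂ} (hz : 0 < z.re) (x : Space d) (f : L2 d) :
    ‖heatEval z x f‖ ≤ z.re ^ (-(d : ℝ) / 4) * ‖f‖ := by
  rw [heatEval_eq_inner hz]
  refine (norm_inner_le_norm _ _).trans ?_
  gcongr
  exact norm_heatKernel_le hz x

/-- The kernel is an explicit complex Gaussian. Its prefactor depends on `|z|` and its exponential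
has modulus at most 1, so the bound survives as `Re z → 0`: this is the dispersive estimate. -/
theorem norm_heatKernel_apply_le {z : ℂ} (hz : 0 < z.re) (x : Space d) :
    ∀ᵐ y, ‖heatKernel z hz x y‖ ≤ ‖z‖ ^ (-(d : ℝ) / 2) := by
  have hint : Integrable (star (evalSymbol z x)) := by
    refine (integrable_evalSymbol hz x).norm.mono'
      (continuous_evalSymbol z x).star.aestronglyMeasurable
      (Filter.Eventually.of_forall fun ξ => ?_)
    simp
  filter_upwards [fourierInv_toLp_ae_eq hint (memLp_evalSymbol hz x).star] with y hy
  rw [heatKernel, hy, Real.fourierInv_eq_fourier_neg]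
  set b : ℂ := 4 * Real.pi ^ 2 * (starRingEnd ℂ z) with hb
  have hbr : b = ((4 * Real.pi ^ 2 : ℝ) : ℂ) * (starRingEnd ℂ z) := by rw [hb]; push_cast; ring
  have hbre : b.re = 4 * Real.pi ^ 2 * z.re := by
    rw [hbr, Complex.re_ofReal_mul, Complex.conj_re]
  have hb0 : 0 < b.re := by rw [hbre]; positivity
  have e1 : star (evalSymbol z x) =
      fun v => Complex.exp (-b * ‖v‖ ^ 2 + 2 * Real.pi * Complex.I * (inner ℝ (-x) v : ℝ)) := by
    funext v
    rw [Pi.star_apply, evalSymbol, RCLike.star_def, ← Complex.exp_conj]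
    congr 1
    simp only [map_add, map_mul, map_neg, map_pow, Complex.conj_ofReal, Complex.conj_I,
      inner_neg_left, hb]
    simp [map_ofNat]
  rw [e1, fourier_gaussian_innerProductSpace' hb0, norm_mul, finrank_euclideanSpace_fin]
  have hznorm : 0 < ‖z‖ := norm_pos_iff.2 (fun h => by simp [h] at hz)
  have hbn : ‖b‖ = 4 * Real.pi ^ 2 * ‖z‖ := by
    rw [hbr, norm_mul, Complex.norm_real, Real.norm_of_nonneg (by positivity), RCLike.norm_conj]
  have n1 : ‖((Real.pi : ℂ) / b) ^ ((d : ℂ) / 2)‖ ≤ ‖z‖ ^ (-(d : ℝ) / 2) := by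
    have : ((d : ℂ) / 2) = (((d : ℝ) / 2 : ℝ) : ℂ) := by push_cast; ring
    rw [this, Complex.norm_cpow_real, norm_div, Complex.norm_real,
      Real.norm_of_nonneg Real.pi_pos.le, hbn]
    have e3 : Real.pi / (4 * Real.pi ^ 2 * ‖z‖) = (4 * Real.pi)⁻¹ * ‖z‖⁻¹ := by field_simp
    have e4 : -(d : ℝ) / 2 = -((d : ℝ) / 2) := by ring
    rw [e3, e4, Real.rpow_neg hznorm.le, ← Real.inv_rpow hznorm.le]
    refine Real.rpow_le_rpow (by positivity) ?_ (by positivity)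
    have : (4 * Real.pi)⁻¹ ≤ 1 := inv_le_one_of_one_le₀ (by linarith [Real.pi_gt_three])
    have hzi : 0 < ‖z‖⁻¹ := by positivity
    nlinarith
  have n2 : ‖Complex.exp (-(Real.pi : ℂ) ^ 2 * (‖-x - -y‖ : ℂ) ^ 2 / b)‖ ≤ 1 := by
    rw [Complex.norm_exp, Real.exp_le_one_iff]
    have : (-(Real.pi : ℂ) ^ 2 * (‖-x - -y‖ : ℂ) ^ 2 / b) =
        ((-(Real.pi ^ 2 * ‖-x - -y‖ ^ 2) : ℝ) : ℂ) * b⁻¹ := by push_cast; ring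
    rw [this, Complex.re_ofReal_mul, Complex.inv_re]
    have : 0 ≤ b.re / Complex.normSq b := div_nonneg hb0.le (Complex.normSq_nonneg _)
    nlinarith [sq_nonneg (Real.pi * ‖-x - -y‖)]
  calc _ ≤ ‖z‖ ^ (-(d : ℝ) / 2) * 1 := mul_le_mul n1 n2 (norm_nonneg _) (by positivity)
    _ = _ := mul_one _

theorem norm_heatEval_le_lintegral {z : ℂ} (hz : 0 < z.re) (x : Space d) (f : L2 d) {B : ℝ}
    (hB : 0 ≤ B) (hf : ∫⁻ y, ‖f y‖ₑ ≤ ENNReal.ofReal B) :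
    ‖heatEval z x f‖ ≤ ‖z‖ ^ (-(d : ℝ) / 2) * B := by
  rw [heatEval_eq_inner hz, L2.inner_def]
  have h0 : (0:ℝ) ≤ ‖z‖ ^ (-(d : ℝ) / 2) := by positivity
  rw [← ENNReal.ofReal_le_ofReal_iff (by positivity), ofReal_norm]
  refine (enorm_integral_le_lintegral_enorm _).trans ?_
  calc ∫⁻ y, ‖inner ℂ (heatKernel z hz x y) (f y)‖ₑ
      ≤ ∫⁻ y, ENNReal.ofReal (‖z‖ ^ (-(d : ℝ) / 2)) * ‖f y‖ₑ := by
        refine lintegral_mono_ae ?_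
        filter_upwards [norm_heatKernel_apply_le hz x] with y hy
        rw [← ofReal_norm, ← ofReal_norm, ← ENNReal.ofReal_mul h0]
        refine ENNReal.ofReal_le_ofReal ((norm_inner_le_norm _ _).trans ?_)
        gcongr
    _ = ENNReal.ofReal (‖z‖ ^ (-(d : ℝ) / 2)) * ∫⁻ y, ‖f y‖ₑ :=
        lintegral_const_mul _ (Lp.stronglyMeasurable f).enorm
    _ ≤ _ := by rw [ENNReal.ofReal_mul h0]; gcongr

theorem heatEval_add {z : ℂ} (hz : 0 < z.re) (x : Space d) (f g : L2 d) :
    heatEval z x (f + g) = heatEval z x f + heatEval z x g := by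
  simp only [heatEval_eq_inner hz, inner_add_right]

theorem heatEval_sub {z : ℂ} (hz : 0 < z.re) (x : Space d) (f g : L2 d) :
    heatEval z x (f - g) = heatEval z x f - heatEval z x g := by
  simp only [heatEval_eq_inner hz, inner_sub_right]

theorem heatEval_trans (z : ℂ) (x h : Space d) (f : L2 d) :
    heatEval z x (trans h f) = heatEval z (x + h) f := by
  refine integral_congr_ae ?_
  filter_upwards [fourier_trans h f] with ξ hξ
  rw [hξ, ← mul_assoc, evalSymbol, evalSymbol, ← Complex.exp_add, inner_add_left]
  congr 2
  push_cast
  ring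

/-- The unitary group is absorbed into the imaginary part of the complex time, so the Gaussian
bounds apply with `|z + it|` in place of `|z|`. -/
theorem heatEval_sch (z : ℂ) (x : Space d) (t : ℝ) (f : L2 d) :
    heatEval z x (sch t f) = heatEval (z + Complex.I * t) x f := by
  refine integral_congr_ae ?_
  have := mulPhase_coe _ (continuous_schPhase t) (𝓕 f : L2 d)
  rw [← fourier_fourierPhase] at this
  filter_upwards [this] with ξ hξ
  rw [sch, hξ, ← mul_assoc, evalSymbol, evalSymbol, ← Complex.exp_add]
  congr 2
  simp only [schPhase]
  push_cast
  ring

/-- Splitting at a height: the dispersive estimate with data in `L^r`, `1/r = (1+β)/2`, combined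
with the smoothing of the heat flow. -/
theorem norm_heatEval_le_of_lintegral_rpow {β : ℝ} (hβ0 : 0 ≤ β) (hβ1 : β ≤ 1) {z : ℂ}
    (hz : 0 < z.re) {τ : ℝ} (hτ : 0 < τ) (hτz : τ ≤ ‖z‖) (x : Space d) (f : L2 d) {B : ℝ}
    (hB : 0 < B)
    (hf : ∫⁻ y, ‖f y‖ₑ ^ (2 / (1 + β)) ≤ ENNReal.ofReal (B ^ (2 / (1 + β)))) :
    ‖heatEval z x f‖ ≤
      2 * B * z.re ^ (-((d : ℝ) * (1 - β) / 4)) * τ ^ (-((d : ℝ) * β / 2)) := by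
  set σ := z.re with hσ
  set r := 2 / (1 + β) with hr
  have hr1 : 1 ≤ r := by rw [hr, le_div_iff₀ (by linarith)]; linarith
  have hr2 : r ≤ 2 := by rw [hr, div_le_iff₀ (by linarith)]; linarith
  have hrβ : r * (1 + β) = 2 := by rw [hr]; field_simp
  -- The cutting height `M = Bμ` is the one for which the `L¹` and the `L²` contributions coincide;
  -- `c1` and `c2` verify that they equal the same expression.
  set μ : ℝ := τ ^ (-(d : ℝ) / r) * σ ^ ((d : ℝ) / (2 * r)) with hμ
  have hμ0 : 0 < μ := by positivity
  set M := B * μ with hM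
  have hM0 : 0 < M := by positivity
  have hfm : Measurable fun y => ‖f y‖ := (Lp.stronglyMeasurable f).measurable.norm
  set S : Set (Space d) := {y | M < ‖f y‖} with hS
  have hSm : MeasurableSet S := measurableSet_lt measurable_const hfm
  have hf1 : MemLp (S.indicator f) 2 := (Lp.memLp f).indicator hSm
  have hf2 : MemLp (Sᶜ.indicator f) 2 := (Lp.memLp f).indicator hSm.compl
  have hsum : f = hf1.toLp _ + hf2.toLp _ := by
    rw [← MemLp.toLp_add]
    ext1
    filter_upwards [(hf1.add hf2).coeFn_toLp] with y hy
    rw [hy, Set.indicator_self_add_compl]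
  -- Above the height, `|f| ≤ M^{1-r} |f|^r` because `r ≥ 1`, so this part is integrable; below it,
  -- `|f|² ≤ M^{2-r} |f|^r` because `r ≤ 2`.
  have b1 : ∫⁻ y, ‖(hf1.toLp _ : L2 d) y‖ₑ ≤ ENNReal.ofReal (M ^ (1 - r) * B ^ r) := by
    rw [ENNReal.ofReal_mul (by positivity)]
    calc ∫⁻ y, ‖(hf1.toLp _ : L2 d) y‖ₑ ≤ ∫⁻ y, ENNReal.ofReal (M ^ (1 - r)) * ‖f y‖ₑ ^ r := by
          refine lintegral_mono_ae ?_
          filter_upwards [hf1.coeFn_toLp] with y hy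
          rw [hy]
          by_cases hyS : y ∈ S
          · rw [Set.indicator_of_mem hyS]
            have hlt : M < ‖f y‖ := hyS
            have hp : 0 < ‖f y‖ := hM0.trans hlt
            rw [← ofReal_norm, ENNReal.ofReal_rpow_of_pos hp, ← ENNReal.ofReal_mul (by positivity)]
            refine ENNReal.ofReal_le_ofReal ?_
            have h1 : ‖f y‖ ^ (1 - r) ≤ M ^ (1 - r) :=
              Real.rpow_le_rpow_of_nonpos hM0 hlt.le (by linarith)
            calc ‖f y‖ = ‖f y‖ ^ (1 - r) * ‖f y‖ ^ r := by
                  rw [← Real.rpow_add hp]; simp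
              _ ≤ _ := by gcongr
          · rw [Set.indicator_of_notMem hyS]; simp
      _ = ENNReal.ofReal (M ^ (1 - r)) * ∫⁻ y, ‖f y‖ₑ ^ r :=
          lintegral_const_mul _ ((Lp.stronglyMeasurable f).enorm.pow_const r)
      _ ≤ _ := by gcongr
  have b2 : ‖(hf2.toLp _ : L2 d)‖ ≤ Real.sqrt (M ^ (2 - r) * B ^ r) := by
    rw [Lp.norm_toLp]
    refine ENNReal.toReal_le_of_le_ofReal (Real.sqrt_nonneg _) ?_
    rw [eLpNorm_eq_lintegral_rpow_enorm_toReal (by norm_num) (by norm_num)]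
    have hle : ∫⁻ y, ‖Sᶜ.indicator f y‖ₑ ^ (2 : ℝ) ≤ ENNReal.ofReal (M ^ (2 - r) * B ^ r) := by
      rw [ENNReal.ofReal_mul (by positivity)]
      calc ∫⁻ y, ‖Sᶜ.indicator f y‖ₑ ^ (2 : ℝ)
          ≤ ∫⁻ y, ENNReal.ofReal (M ^ (2 - r)) * ‖f y‖ₑ ^ r := by
            refine lintegral_mono fun y => ?_
            by_cases hyS : y ∈ Sᶜ
            · rw [Set.indicator_of_mem hyS]
              have hle : ‖f y‖ ≤ M := not_lt.1 hyS
              rw [← ofReal_norm, ENNReal.ofReal_rpow_of_nonneg (norm_nonneg _) (by norm_num),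
                ENNReal.ofReal_rpow_of_nonneg (norm_nonneg _) (by linarith),
                ← ENNReal.ofReal_mul (by positivity)]
              refine ENNReal.ofReal_le_ofReal ?_
              calc ‖f y‖ ^ (2 : ℝ) = ‖f y‖ ^ (2 - r) * ‖f y‖ ^ r := by
                    rw [← Real.rpow_add_of_nonneg (norm_nonneg _) (by linarith) (by linarith)]
                    simp
                _ ≤ _ := by
                    gcongr
            · rw [Set.indicator_of_notMem hyS]; simp
        _ = ENNReal.ofReal (M ^ (2 - r)) * ∫⁻ y, ‖f y‖ₑ ^ r :=
            lintegral_const_mul _ ((Lp.stronglyMeasurable f).enorm.pow_const r)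
        _ ≤ _ := by gcongr
    calc (∫⁻ y, ‖Sᶜ.indicator f y‖ₑ ^ (ENNReal.toReal 2)) ^ (1 / ENNReal.toReal 2)
        ≤ (ENNReal.ofReal (M ^ (2 - r) * B ^ r)) ^ (1 / ENNReal.toReal 2) := by
          gcongr
          simpa using hle
      _ = ENNReal.ofReal (Real.sqrt (M ^ (2 - r) * B ^ r)) := by
          rw [ENNReal.ofReal_rpow_of_nonneg (by positivity) (by norm_num), Real.sqrt_eq_rpow]
          norm_num
  have c1 : τ ^ (-(d : ℝ) / 2) * (M ^ (1 - r) * B ^ r) =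
      B * σ ^ (-((d : ℝ) * (1 - β) / 4)) * τ ^ (-((d : ℝ) * β / 2)) := by
    have hBB : B ^ (1 - r) * B ^ r = B := by rw [← Real.rpow_add hB]; simp
    rw [hM, Real.mul_rpow hB.le hμ0.le, hμ, Real.mul_rpow (by positivity) (by positivity),
      ← Real.rpow_mul hτ.le, ← Real.rpow_mul hz.le]
    calc _ = (B ^ (1 - r) * B ^ r) * σ ^ ((d : ℝ) / (2 * r) * (1 - r)) *
          (τ ^ (-(d : ℝ) / 2) * τ ^ (-(d : ℝ) / r * (1 - r))) := by ring
      _ = _ := by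
        rw [hBB, ← Real.rpow_add hτ]
        congr 2
        · congr 1
          rw [hr]; field_simp; ring
        · rw [hr]; field_simp; ring
  have c2 : σ ^ (-(d : ℝ) / 4) * Real.sqrt (M ^ (2 - r) * B ^ r) =
      B * σ ^ (-((d : ℝ) * (1 - β) / 4)) * τ ^ (-((d : ℝ) * β / 2)) := by
    have hBB : M ^ (2 - r) * B ^ r = (B * μ ^ (1 - r / 2)) ^ 2 := by
      rw [hM, Real.mul_rpow hB.le hμ0.le, mul_pow, ← Real.rpow_natCast (μ ^ (1 - r / 2)),
        ← Real.rpow_mul hμ0.le, mul_right_comm, ← Real.rpow_add hB]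
      congr 1
      · simp
      · congr 1; push_cast; ring
    rw [hBB, Real.sqrt_sq (by positivity), hμ, Real.mul_rpow (by positivity) (by positivity),
      ← Real.rpow_mul hτ.le, ← Real.rpow_mul hz.le]
    calc _ = B * (σ ^ (-(d : ℝ) / 4) * σ ^ ((d : ℝ) / (2 * r) * (1 - r / 2))) *
          τ ^ (-(d : ℝ) / r * (1 - r / 2)) := by ring
      _ = _ := by
        rw [← Real.rpow_add hz]
        congr 2
        · congr 1
          rw [hr]; field_simp; ring
        · rw [hr]; field_simp; ring
  calc ‖heatEval z x f‖ ≤ ‖heatEval z x (hf1.toLp _)‖ + ‖heatEval z x (hf2.toLp _)‖ := by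
        conv_lhs => rw [hsum]
        rw [heatEval_add hz]
        exact norm_add_le _ _
    _ ≤ ‖z‖ ^ (-(d : ℝ) / 2) * (M ^ (1 - r) * B ^ r) +
        σ ^ (-(d : ℝ) / 4) * Real.sqrt (M ^ (2 - r) * B ^ r) := by
        refine add_le_add (norm_heatEval_le_lintegral hz x _ (by positivity) b1)
          ((norm_heatEval_le hz x _).trans ?_)
        gcongr
    _ ≤ τ ^ (-(d : ℝ) / 2) * (M ^ (1 - r) * B ^ r) +
        σ ^ (-(d : ℝ) / 4) * Real.sqrt (M ^ (2 - r) * B ^ r) := by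
        have h0 : (0 : ℝ) ≤ (d : ℝ) := Nat.cast_nonneg d
        have : ‖z‖ ^ (-(d : ℝ) / 2) ≤ τ ^ (-(d : ℝ) / 2) :=
          Real.rpow_le_rpow_of_nonpos hτ hτz (by linarith)
        gcongr
    _ = _ := by rw [c1, c2]; ring

end NLSTrain
end

open scoped ENNReal Topology
noncomputable section
namespace NLSTrain
open MeasureTheory FourierTransform

variable {d : ℕ}

/-! ### Boundedness of `L²` functions through their heat regularisations -/

theorem memLp_two_iff_lintegral {α : Type*} [MeasurableSpace α] {μ : Measure α} {f : α → ℂ} :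
    MemLp f 2 μ ↔ AEStronglyMeasurable f μ ∧ ∫⁻ x, ‖f x‖ₑ ^ (2 : ℝ) ∂μ < ∞ := by
  rw [MemLp, eLpNorm_lt_top_iff_lintegral_rpow_enorm_lt_top (by norm_num) (by norm_num)]
  simp

theorem eLpNorm_two_eq {α : Type*} [MeasurableSpace α] {μ : Measure α} (f : α → ℂ) :
    eLpNorm f 2 μ = (∫⁻ x, ‖f x‖ₑ ^ (2 : ℝ) ∂μ) ^ (1 / 2 : ℝ) := by
  rw [eLpNorm_eq_lintegral_rpow_enorm_toReal (by norm_num) (by norm_num)]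
  simp

theorem tendsto_toLp_of_dominated {ι : Type*} {l : Filter ι} [l.IsCountablyGenerated]
    {F : ι → Space d → ℂ} {G : Space d → ℂ} (hF : ∀ i, MemLp (F i) 2) (hG : MemLp G 2)
    {b : Space d → ℝ} (hb : ∫⁻ x, ENNReal.ofReal (b x) ^ (2 : ℝ) ≠ ∞)
    (hle : ∀ᶠ i in l, ∀ᵐ x, ‖F i x - G x‖ ≤ b x)
    (hlim : ∀ᵐ x, Filter.Tendsto (fun i => F i x) l (𝓝 (G x))) :
    Filter.Tendsto (fun i => ((hF i).toLp (F i) : L2 d)) l (𝓝 (hG.toLp G)) := by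
  rw [Lp.tendsto_Lp_iff_tendsto_eLpNorm'']
  simp only [eLpNorm_two_eq]
  have h0 : Filter.Tendsto (fun i => ∫⁻ x, ‖(F i - G) x‖ₑ ^ (2 : ℝ)) l
      (𝓝 (∫⁻ _ : Space d, 0)) := by
    refine tendsto_lintegral_filter_of_dominated_convergence'
      (fun x => ENNReal.ofReal (b x) ^ (2 : ℝ))
      (Filter.Eventually.of_forall fun i => (((hF i).1.sub hG.1).enorm).pow_const 2) ?_ hb ?_
    · filter_upwards [hle] with i hi
      filter_upwards [hi] with x hx
      rw [← ofReal_norm]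
      gcongr
      exact hx
    · filter_upwards [hlim] with x hx
      have h1 : Filter.Tendsto (fun i => ‖F i x - G x‖ₑ) l (𝓝 0) := by
        have := (hx.sub_const (G x)).enorm
        simpa using this
      have := h1.ennrpow_const 2
      simpa using this
  have h1 := h0.ennrpow_const (1 / 2 : ℝ)
  simpa using h1

/-- A subsequence converges almost everywhere. Pointwise bounds are thus closed conditions in `L²`,
which is what lets them pass to the limit of the Picard iteration. -/
theorem ae_norm_le_of_tendsto {f : ℕ → L2 d} {g : L2 d} {B : ℝ}
    (hf : Filter.Tendsto f Filter.atTop (𝓝 g)) (hB : ∀ n, ∀ᵐ x, ‖f n x‖ ≤ B) :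
    ∀ᵐ x, ‖g x‖ ≤ B := by
  obtain ⟨ns, -, hns⟩ := (tendstoInMeasure_of_tendsto_Lp hf).exists_seq_tendsto_ae
  filter_upwards [hns, ae_all_iff.2 hB] with x hx hBx
  exact le_of_tendsto hx.norm (Filter.Eventually.of_forall fun n => hBx _)

/-- The average of `heatEval σ` against the heat kernel at time `σ`. -/
theorem heatEval_two_mul {σ : ℝ} (hσ : 0 < σ) (x : Space d) (f : L2 d) :
    Integrable (fun h : Space d => Real.exp (-(4 * σ)⁻¹ * ‖h‖ ^ 2)) ∧
    heatEval ((2 * σ : ℝ) : ℂ) x f =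
      ((4 * Real.pi * σ) ^ (-((d : ℝ) / 2)) : ℝ) *
        ∫ h, ((Real.exp (-(4 * σ)⁻¹ * ‖h‖ ^ 2) : ℝ) : ℂ) * heatEval (σ : ℂ) (x + h) f := by
  have hG : Integrable (fun h : Space d => Real.exp (-(4 * σ)⁻¹ * ‖h‖ ^ 2)) :=
    integrable_gauss (by positivity)
  refine ⟨hG, ?_⟩
  have hσ' : 0 < (σ : ℂ).re := by simpa using hσ
  set F : L2 d := 𝓕 f with hF
  have hfour : ∀ ξ : Space d, ∫ h, ((Real.exp (-(4 * σ)⁻¹ * ‖h‖ ^ 2) : ℝ) : ℂ) *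
      Complex.exp (2 * Real.pi * Complex.I * (inner ℝ h ξ : ℝ)) =
      ((4 * Real.pi * σ) ^ ((d : ℝ) / 2) : ℝ) *
        Complex.exp (-(4 * Real.pi ^ 2 * σ) * ‖ξ‖ ^ 2) := by
    intro ξ
    have hb : 0 < ((4 * σ)⁻¹ : ℂ).re := by
      have : ((4 * σ)⁻¹ : ℂ) = (((4 * σ)⁻¹ : ℝ) : ℂ) := by push_cast; ring
      rw [this, Complex.ofReal_re]; positivity
    have := fourier_gaussian_innerProductSpace (V := Space d) hb (-ξ)
    rw [Real.fourier_eq', finrank_euclideanSpace_fin] at this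
    have hσc : (σ : ℂ) ≠ 0 := by exact_mod_cast hσ.ne'
    convert this using 1
    · congr 1
      funext h
      rw [smul_eq_mul, mul_comm]
      push_cast
      congr 2
      rw [inner_neg_right]
      push_cast
      ring
    · congr 1
      · rw [Complex.ofReal_cpow (by positivity)]
        push_cast
        congr 1
        field_simp
      · congr 1
        rw [norm_neg]
        field_simp
  have hint : Integrable (Function.uncurry fun (h : Space d) (ξ : Space d) =>
      ((Real.exp (-(4 * σ)⁻¹ * ‖h‖ ^ 2) : ℝ) : ℂ) * (evalSymbol (σ : ℂ) (x + h) ξ * F ξ))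
      (volume.prod volume) := by
    have h1 : Integrable (fun p : Space d × Space d =>
        ((Real.exp (-(4 * σ)⁻¹ * ‖p.1‖ ^ 2) : ℝ) : ℂ) * (evalSymbol (σ : ℂ) x p.2 * F p.2))
        (volume.prod volume) := hG.ofReal.mul_prod (integrable_heatEval hσ' x f)
    refine h1.norm.mono' ?_ (Filter.Eventually.of_forall fun p => ?_)
    · refine AEStronglyMeasurable.mul ?_ (AEStronglyMeasurable.mul ?_ ?_)
      · have : Continuous fun p : Space d × Space d =>
          ((Real.exp (-(4 * σ)⁻¹ * ‖p.1‖ ^ 2) : ℝ) : ℂ) := by fun_prop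
        exact this.aestronglyMeasurable
      · have : Continuous fun p : Space d × Space d => evalSymbol (σ : ℂ) (x + p.1) p.2 := by
          unfold evalSymbol; fun_prop
        exact this.aestronglyMeasurable
      · exact ((Lp.stronglyMeasurable F).comp_measurable measurable_snd).aestronglyMeasurable
    · simp only [Function.uncurry, norm_mul, norm_evalSymbol]
      exact le_rfl
  have hswap : ∫ h, ((Real.exp (-(4 * σ)⁻¹ * ‖h‖ ^ 2) : ℝ) : ℂ) * heatEval (σ : ℂ) (x + h) f =
      ∫ ξ, (∫ h, ((Real.exp (-(4 * σ)⁻¹ * ‖h‖ ^ 2) : ℝ) : ℂ) *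
        (evalSymbol (σ : ℂ) (x + h) ξ * F ξ)) := by
    rw [← integral_integral_swap hint]
    congr 1
    funext h
    rw [heatEval, ← integral_const_mul]
  rw [hswap, heatEval, ← integral_const_mul]
  congr 1
  funext ξ
  have e1 : ∀ h : Space d, ((Real.exp (-(4 * σ)⁻¹ * ‖h‖ ^ 2) : ℝ) : ℂ) *
        (evalSymbol (σ : ℂ) (x + h) ξ * F ξ) =
      (((Real.exp (-(4 * σ)⁻¹ * ‖h‖ ^ 2) : ℝ) : ℂ) *
        Complex.exp (2 * Real.pi * Complex.I * (inner ℝ h ξ : ℝ))) *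
        (evalSymbol (σ : ℂ) x ξ * F ξ) := by
    intro h
    have : evalSymbol (σ : ℂ) (x + h) ξ =
        Complex.exp (2 * Real.pi * Complex.I * (inner ℝ h ξ : ℝ)) * evalSymbol (σ : ℂ) x ξ := by
      rw [evalSymbol, evalSymbol, ← Complex.exp_add, inner_add_left]
      congr 1
      push_cast
      ring
    rw [this]; ring
  simp only [e1]
  rw [integral_mul_const, hfour]
  have e2 : evalSymbol ((2 * σ : ℝ) : ℂ) x ξ =
      Complex.exp (-(4 * Real.pi ^ 2 * σ) * ‖ξ‖ ^ 2) * evalSymbol (σ : ℂ) x ξ := by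
    rw [evalSymbol, evalSymbol, ← Complex.exp_add]
    congr 1
    push_cast
    ring
  rw [e2]
  have e3 : (((4 * Real.pi * σ) ^ (-((d : ℝ) / 2)) : ℝ) : ℂ) *
      (((4 * Real.pi * σ) ^ ((d : ℝ) / 2) : ℝ) : ℂ) = 1 := by
    rw [← Complex.ofReal_mul, ← Real.rpow_add (by positivity)]
    simp
  linear_combination (-(Complex.exp (-(4 * Real.pi ^ 2 * σ) * ‖ξ‖ ^ 2) *
    evalSymbol (σ : ℂ) x ξ * F ξ)) * e3

theorem rpow_le_gauss {σ s r : ℝ} (hσ : 0 < σ) (hs0 : 0 ≤ s) (hs2 : s ≤ 2) (hr : 0 ≤ r) :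
    r ^ s ≤ 8 * σ ^ (s / 2) * Real.exp ((8 * σ)⁻¹ * r ^ 2) := by
  set y := r ^ 2 / σ with hy
  have hy0 : 0 ≤ y := by positivity
  have e1 : r ^ s = σ ^ (s / 2) * y ^ (s / 2) := by
    rw [← Real.mul_rpow hσ.le hy0, hy, mul_div_cancel₀ _ hσ.ne', ← Real.rpow_natCast,
      ← Real.rpow_mul hr]
    congr 1; push_cast; ring
  have e2 : y ^ (s / 2) ≤ 1 + y := by
    calc y ^ (s / 2) ≤ (1 + y) ^ (s / 2) := Real.rpow_le_rpow hy0 (by linarith) (by linarith)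
      _ ≤ (1 + y) ^ (1 : ℝ) := Real.rpow_le_rpow_of_exponent_le (by linarith) (by linarith)
      _ = 1 + y := Real.rpow_one _
  have e3 : 1 + y ≤ 8 * Real.exp (y / 8) := by
    have := Real.add_one_le_exp (y / 8)
    linarith
  have e4 : (8 * σ)⁻¹ * r ^ 2 = y / 8 := by rw [hy]; field_simp
  rw [e1, e4]
  have : (0 : ℝ) < σ ^ (s / 2) := by positivity
  nlinarith

/-- By the semigroup property `e^{2σΔ}f - e^{σΔ}f` at `x` is the average of `e^{σΔ}(f(·+h) - f)(x)`
over the heat kernel in `h`. Half of the Gaussian exponent absorbs `|h|^s` at the price of `8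
σ^{s/2}`, and the remaining wider Gaussian has mass `2^{d/2}`. -/
theorem norm_heatEval_two_mul_sub_le {σ s A : ℝ} (hσ : 0 < σ) (hs0 : 0 ≤ s) (hs2 : s ≤ 2)
    (hA : 0 ≤ A) (x : Space d) (f : L2 d)
    (h : ∀ h, ‖heatEval (σ : ℂ) x (trans h f - f)‖ ≤ A * ‖h‖ ^ s) :
    ‖heatEval ((2 * σ : ℝ) : ℂ) x f - heatEval (σ : ℂ) x f‖ ≤
      A * (8 * 2 ^ ((d : ℝ) / 2)) * σ ^ (s / 2) := by
  have hσ' : 0 < (σ : ℂ).re := by simpa using hσ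
  obtain ⟨hG, h2⟩ := heatEval_two_mul hσ x f
  set c : ℝ := (4 * Real.pi * σ) ^ (-((d : ℝ) / 2)) with hc
  have hc0 : 0 < c := by positivity
  have hmass : c * ∫ h : Space d, Real.exp (-(4 * σ)⁻¹ * ‖h‖ ^ 2) = 1 := by
    rw [GaussianFourier.integral_rexp_neg_mul_sq_norm (by positivity), finrank_euclideanSpace_fin,
      hc]
    have : Real.pi / (4 * σ)⁻¹ = 4 * Real.pi * σ := by field_simp
    rw [this, ← Real.rpow_add (by positivity)]
    simp
  have hshift : ∀ h, heatEval (σ : ℂ) (x + h) f - heatEval (σ : ℂ) x f =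
      heatEval (σ : ℂ) x (trans h f - f) := by
    intro h
    rw [heatEval_sub hσ', heatEval_trans]
  have hbd : ∀ y, ‖heatEval (σ : ℂ) y f‖ ≤ σ ^ (-(d : ℝ) / 4) * ‖f‖ := fun y => by
    simpa using norm_heatEval_le hσ' y f
  have hcont : Continuous fun h => heatEval (σ : ℂ) (x + h) f := by
    have hc1 : ∀ h, heatEval (σ : ℂ) (x + h) f =
        ∫ ξ, evalSymbol (σ : ℂ) (x + h) ξ * (𝓕 f : L2 d) ξ := fun h => rfl
    simp only [hc1]
    refine continuous_of_dominated (F := fun h ξ => evalSymbol (σ : ℂ) (x + h) ξ * (𝓕 f : L2 d) ξ)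
      (bound := fun ξ => ‖evalSymbol (σ : ℂ) x ξ * (𝓕 f : L2 d) ξ‖)
      (fun h => (integrable_heatEval hσ' (x + h) f).1)
      (fun h => Filter.Eventually.of_forall fun ξ => ?_)
      (integrable_heatEval hσ' x f).norm (Filter.Eventually.of_forall fun ξ => ?_)
    · rw [norm_mul, norm_mul, norm_evalSymbol, norm_evalSymbol]
    · unfold evalSymbol
      fun_prop
  have hi1 : Integrable fun h : Space d => ((Real.exp (-(4 * σ)⁻¹ * ‖h‖ ^ 2) : ℝ) : ℂ) *
      heatEval (σ : ℂ) (x + h) f := by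
    refine Integrable.mul_bdd (c := σ ^ (-(d : ℝ) / 4) * ‖f‖) hG.ofReal
      hcont.aestronglyMeasurable ?_
    exact Filter.Eventually.of_forall fun h => hbd _
  have e1 : heatEval ((2 * σ : ℝ) : ℂ) x f - heatEval (σ : ℂ) x f =
      (c : ℂ) * ∫ h, ((Real.exp (-(4 * σ)⁻¹ * ‖h‖ ^ 2) : ℝ) : ℂ) *
        heatEval (σ : ℂ) x (trans h f - f) := by
    simp only [← hshift, mul_sub]
    have hi2 : Integrable fun h : Space d => ((Real.exp (-(4 * σ)⁻¹ * ‖h‖ ^ 2) : ℝ) : ℂ) *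
        heatEval (σ : ℂ) x f := hG.ofReal.mul_const _
    rw [integral_sub hi1 hi2, integral_mul_const, mul_sub, ← mul_assoc, ← h2]
    have : (c : ℂ) * ∫ h : Space d, ((Real.exp (-(4 * σ)⁻¹ * ‖h‖ ^ 2) : ℝ) : ℂ) = 1 := by
      rw [integral_complex_ofReal]
      exact_mod_cast hmass
    rw [this, one_mul]
  have hG2 : Integrable fun h : Space d => Real.exp (-(8 * σ)⁻¹ * ‖h‖ ^ 2) :=
    integrable_gauss (by positivity)
  have hmass2 : c * ∫ h : Space d, Real.exp (-(8 * σ)⁻¹ * ‖h‖ ^ 2) = 2 ^ ((d : ℝ) / 2) := by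
    rw [GaussianFourier.integral_rexp_neg_mul_sq_norm (by positivity), finrank_euclideanSpace_fin,
      hc]
    have : Real.pi / (8 * σ)⁻¹ = 2 * (4 * Real.pi * σ) := by field_simp; ring
    rw [this, Real.mul_rpow (x := 2) (y := 4 * Real.pi * σ) (by norm_num) (by positivity),
      mul_left_comm,
      ← Real.rpow_add (by positivity)]
    simp
  rw [e1, norm_mul, Complex.norm_real, Real.norm_of_nonneg hc0.le]
  calc c * ‖∫ h, ((Real.exp (-(4 * σ)⁻¹ * ‖h‖ ^ 2) : ℝ) : ℂ) *
        heatEval (σ : ℂ) x (trans h f - f)‖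
      ≤ c * ∫ h : Space d, A * (8 * σ ^ (s / 2)) * Real.exp (-(8 * σ)⁻¹ * ‖h‖ ^ 2) := by
        gcongr
        refine norm_integral_le_of_norm_le (hG2.const_mul _)
          (Filter.Eventually.of_forall fun k => ?_)
        rw [norm_mul, Complex.norm_real, Real.norm_of_nonneg (Real.exp_pos _).le]
        calc Real.exp (-(4 * σ)⁻¹ * ‖k‖ ^ 2) * ‖heatEval (σ : ℂ) x (trans k f - f)‖
            ≤ Real.exp (-(4 * σ)⁻¹ * ‖k‖ ^ 2) *
              (A * (8 * σ ^ (s / 2) * Real.exp ((8 * σ)⁻¹ * ‖k‖ ^ 2))) := by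
              gcongr
              refine (h k).trans ?_
              gcongr
              exact rpow_le_gauss hσ hs0 hs2 (norm_nonneg _)
          _ = A * (8 * σ ^ (s / 2)) * (Real.exp (-(4 * σ)⁻¹ * ‖k‖ ^ 2) *
              Real.exp ((8 * σ)⁻¹ * ‖k‖ ^ 2)) := by ring
          _ = _ := by
              rw [← Real.exp_add]
              congr 2
              field_simp
              ring
    _ = A * (8 * σ ^ (s / 2)) * (c * ∫ h : Space d, Real.exp (-(8 * σ)⁻¹ * ‖h‖ ^ 2)) := by
        rw [integral_const_mul]; ring
    _ = _ := by rw [hmass2]; ring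

/-- At the times `2^{-n}` the regularisations converge to `f` in `L²`, by dominated convergence on
the Fourier side, and a common sup bound passes to the limit. -/
theorem ae_norm_le_of_heatEval_le {f : L2 d} {B : ℝ}
    (h : ∀ (n : ℕ) (x : Space d), ‖heatEval (((1 / 2 : ℝ) ^ n : ℝ) : ℂ) x f‖ ≤ B) :
    ∀ᵐ y, ‖f y‖ ≤ B := by
  set F : L2 d := 𝓕 f with hF
  have hre : ∀ n : ℕ, 0 < ((((1 / 2 : ℝ) ^ n : ℝ)) : ℂ).re := fun n => by
    rw [Complex.ofReal_re]; positivity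
  have hi : ∀ n : ℕ, Integrable fun ξ => evalSymbol (((1 / 2 : ℝ) ^ n : ℝ) : ℂ) 0 ξ * F ξ :=
    fun n => integrable_heatEval (hre n) 0 f
  have hle : ∀ (n : ℕ) (ξ : Space d), ‖evalSymbol (((1 / 2 : ℝ) ^ n : ℝ) : ℂ) 0 ξ‖ ≤ 1 := by
    intro n ξ
    rw [norm_evalSymbol, Real.exp_le_one_iff]
    have := hre n
    have h1 : 0 ≤ 4 * Real.pi ^ 2 * ((((1 / 2 : ℝ) ^ n : ℝ)) : ℂ).re := by positivity
    nlinarith [sq_nonneg ‖ξ‖]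
  have hm : ∀ n : ℕ, MemLp (fun ξ => evalSymbol (((1 / 2 : ℝ) ^ n : ℝ) : ℂ) 0 ξ * F ξ) 2 := by
    intro n
    refine (Lp.memLp F).of_le (hi n).1 (Filter.Eventually.of_forall fun ξ => ?_)
    rw [norm_mul]
    exact mul_le_of_le_one_left (norm_nonneg _) (hle n ξ)
  have hconv : Filter.Tendsto (fun n => ((hm n).toLp _ : L2 d)) Filter.atTop
      (𝓝 ((Lp.memLp F).toLp F)) := by
    refine tendsto_toLp_of_dominated hm (Lp.memLp F) (b := fun ξ => 2 * ‖F ξ‖) ?_ ?_ ?_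
    · have h2 := (memLp_two_iff_lintegral.1 ((Lp.memLp F).const_mul (2 : ℂ))).2
      refine ne_of_eq_of_ne ?_ h2.ne
      refine lintegral_congr fun ξ => ?_
      rw [← ofReal_norm, norm_mul]
      norm_num
    · refine Filter.Eventually.of_forall fun n => Filter.Eventually.of_forall fun ξ => ?_
      refine (norm_sub_le _ _).trans ?_
      rw [norm_mul]
      nlinarith [hle n ξ, norm_nonneg (F ξ)]
    · refine Filter.Eventually.of_forall fun ξ => ?_
      have h1 : Filter.Tendsto (fun n : ℕ => ((1 / 2 : ℝ) ^ n)) Filter.atTop (𝓝 0) :=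
        tendsto_pow_atTop_nhds_zero_of_lt_one (by norm_num) (by norm_num)
      have h2 : Continuous fun σ : ℝ => evalSymbol (σ : ℂ) 0 ξ * F ξ := by
        unfold evalSymbol; fun_prop
      have h3 := (h2.tendsto 0).comp h1
      have h4 : evalSymbol ((0 : ℝ) : ℂ) 0 ξ = 1 := by simp [evalSymbol]
      rw [h4, one_mul] at h3
      exact h3
  rw [Lp.toLp_coeFn] at hconv
  have hinv : Filter.Tendsto (fun n => (𝓕⁻ ((hm n).toLp _ : L2 d) : L2 d)) Filter.atTop
      (𝓝 f) := by
    have hc := ((Lp.fourierTransformₗᵢ (Space d) ℂ).symm.continuous.tendsto F).comp hconv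
    have : (Lp.fourierTransformₗᵢ (Space d) ℂ).symm F = f :=
      (Lp.fourierTransformₗᵢ (Space d) ℂ).symm_apply_apply f
    rw [this] at hc
    exact hc
  refine ae_norm_le_of_tendsto hinv fun n => ?_
  filter_upwards [fourierInv_toLp_ae_eq (hi n) (hm n)] with y hy
  rw [hy]
  refine le_of_eq_of_le ?_ (h n y)
  congr 1
  rw [Real.fourierInv_eq', heatEval]
  congr 1
  funext ξ
  rw [smul_eq_mul, ← mul_assoc, evalSymbol, evalSymbol, ← Complex.exp_add]
  congr 2
  rw [inner_zero_left, real_inner_comm]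
  push_cast
  ring

/-- A Campanato–Morrey type criterion for boundedness in terms of the heat flow. -/
theorem ae_norm_le_of_heatEval_increments {f : L2 d} {s q A B : ℝ} (hs0 : 0 ≤ s) (hs2 : s ≤ 2)
    (hq : q < s / 2) (hA : 0 ≤ A) (h1 : ∀ x, ‖heatEval (1 : ℂ) x f‖ ≤ B)
    (h2 : ∀ (σ : ℝ) (x h : Space d), 0 < σ → σ ≤ 1 →
      ‖heatEval (σ : ℂ) x (trans h f - f)‖ ≤ A * σ ^ (-q) * ‖h‖ ^ s) :
    ∀ᵐ y, ‖f y‖ ≤ B + A * (8 * 2 ^ ((d : ℝ) / 2) / (1 - (1 / 2) ^ (s / 2 - q))) := by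
  set κ : ℝ := (1 / 2 : ℝ) ^ (s / 2 - q) with hκ
  have hκ0 : 0 < κ := by positivity
  have hκ1 : κ < 1 := Real.rpow_lt_one (by norm_num) (by norm_num) (by linarith)
  set c : ℝ := A * (8 * 2 ^ ((d : ℝ) / 2)) with hc
  have hc0 : 0 ≤ c := by positivity
  -- Telescope over dyadic times from 1 down to `2^{-n}`. The step ending at time `σ` costs a
  -- multiple of `σ^{s/2-q}`, so the increments are dominated by a geometric series with ratio `κ`.
  refine ae_norm_le_of_heatEval_le fun n x => ?_
  have key : ‖heatEval (((1 / 2 : ℝ) ^ n : ℝ) : ℂ) x f‖ ≤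
      B + c * ∑ k ∈ Finset.range n, κ ^ k := by
    induction n with
    | zero => simpa using h1 x
    | succ n ih =>
      set σ : ℝ := (1 / 2) ^ (n + 1) with hσ
      have hσ0 : 0 < σ := by positivity
      have hσ1 : σ ≤ 1 := pow_le_one₀ (by norm_num) (by norm_num)
      have e : (1 / 2 : ℝ) ^ n = 2 * σ := by rw [hσ, pow_succ]; ring
      rw [e] at ih
      have inc := norm_heatEval_two_mul_sub_le hσ0 hs0 hs2 (A := A * σ ^ (-q)) (by positivity) x f
        (fun h => h2 σ x h hσ0 hσ1)
      have e2 : A * σ ^ (-q) * (8 * 2 ^ ((d : ℝ) / 2)) * σ ^ (s / 2) = c * κ ^ (n + 1) := by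
        have : σ ^ (-q) * σ ^ (s / 2) = κ ^ (n + 1) := by
          rw [← Real.rpow_add hσ0, hσ, hκ, ← Real.rpow_natCast, ← Real.rpow_natCast,
            ← Real.rpow_mul (by norm_num), ← Real.rpow_mul (by norm_num)]
          congr 1; ring
        rw [← this, hc]; ring
      rw [e2] at inc
      have h3 : κ ^ (n + 1) ≤ κ ^ n := pow_le_pow_of_le_one hκ0.le hκ1.le (Nat.le_succ n)
      have h4 := norm_sub_norm_le (heatEval (σ : ℂ) x f) (heatEval ((2 * σ : ℝ) : ℂ) x f)
      rw [norm_sub_rev] at h4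
      rw [Finset.sum_range_succ, mul_add]
      have h5 : c * κ ^ (n + 1) ≤ c * κ ^ n := by gcongr
      linarith
  refine key.trans ?_
  have hgeo : ∑ k ∈ Finset.range n, κ ^ k ≤ (1 - κ)⁻¹ := by
    rw [← tsum_geometric_of_lt_one hκ0.le hκ1]
    exact (summable_geometric_of_lt_one hκ0.le hκ1).sum_le_tsum _ (fun _ _ => by positivity)
  have : c * ∑ k ∈ Finset.range n, κ ^ k ≤ c * (1 - κ)⁻¹ := by gcongr
  have e : A * (8 * 2 ^ ((d : ℝ) / 2) / (1 - κ)) = c * (1 - κ)⁻¹ := by rw [hc]; ring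
  rw [e]
  linarith

end NLSTrain
end

open scoped ENNReal Topology BoundedContinuousFunction
noncomputable section
namespace NLSTrain
open MeasureTheory

/-! ### Duhamel integrals from infinity for an isometric group -/

section Duhamel

variable {E : Type*} [NormedAddCommGroup E] [NormedSpace ℂ E]

/-- The Duhamel integral from infinity for the group `S` and the source `F`. -/
def duhamel (S : ℝ → E →ₗᵢ[ℂ] E) (F : ℝ → E) (t : ℝ) : E :=
  (-Complex.I) • ∫ τ in Set.Ioi (0 : ℝ), S (-τ) (F (t + τ))

variable {S : ℝ → E →ₗᵢ[ℂ] E}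

theorem continuous_duhamel_integrand (hS : Continuous fun p : ℝ × E => S p.1 p.2) {F : ℝ → E}
    (hF : Continuous F) : Continuous fun p : ℝ × ℝ => S (-p.2) (F (p.1 + p.2)) := by
  have h : Continuous fun p : ℝ × ℝ => ((-p.2, F (p.1 + p.2)) : ℝ × E) := by fun_prop
  exact hS.comp h

theorem integrableOn_exp_neg_const_mul (A : ℝ) :
    IntegrableOn (fun τ : ℝ => A * Real.exp (-τ)) (Set.Ioi 0) :=
  (integrableOn_exp_neg_Ioi 0).const_mul A

theorem norm_duhamel_integrand_le {F : ℝ → E} {A μ t τ : ℝ} (hμ : 1 ≤ μ) (hA : 0 ≤ A)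
    (hτ : 0 < τ) (hb : ‖F (t + τ)‖ ≤ A * Real.exp (-(μ * (t + τ)))) :
    ‖S (-τ) (F (t + τ))‖ ≤ A * Real.exp (-(μ * t)) * Real.exp (-τ) := by
  rw [LinearIsometry.norm_map]
  refine hb.trans ?_
  rw [mul_assoc, ← Real.exp_add]
  gcongr
  nlinarith

theorem integrableOn_duhamel (hS : Continuous fun p : ℝ × E => S p.1 p.2) {F : ℝ → E}
    (hF : Continuous F) {A μ t : ℝ} (hμ : 1 ≤ μ) (hA : 0 ≤ A)
    (hb : ∀ τ, 0 < τ → ‖F (t + τ)‖ ≤ A * Real.exp (-(μ * (t + τ)))) :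
    IntegrableOn (fun τ => S (-τ) (F (t + τ))) (Set.Ioi 0) := by
  have hc : Continuous fun τ : ℝ => S (-τ) (F (t + τ)) :=
    (continuous_duhamel_integrand hS hF).comp (by fun_prop : Continuous fun τ : ℝ => (t, τ))
  refine Integrable.mono' (integrableOn_exp_neg_const_mul (A * Real.exp (-(μ * t))))
    hc.aestronglyMeasurable ?_
  refine (ae_restrict_iff' measurableSet_Ioi).2 (Filter.Eventually.of_forall fun τ hτ => ?_)
  exact norm_duhamel_integrand_le hμ hA hτ (hb τ hτ)

/-- Each `S (-τ)` is isometric and, as `μ ≥ 1`, the decay from `t` to `t + τ` gains at least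
`e^{-τ}`, whose integral is 1. Hence no constant is lost; only values of `F` at times after `t`
enter. -/
theorem norm_duhamel_le {F : ℝ → E} {A μ t : ℝ} (hμ : 1 ≤ μ) (hA : 0 ≤ A)
    (hb : ∀ τ, 0 < τ → ‖F (t + τ)‖ ≤ A * Real.exp (-(μ * (t + τ)))) :
    ‖duhamel S F t‖ ≤ A * Real.exp (-(μ * t)) := by
  rw [duhamel, norm_smul, norm_neg, Complex.norm_I, one_mul]
  calc ‖∫ τ in Set.Ioi (0 : ℝ), S (-τ) (F (t + τ))‖
      ≤ ∫ τ in Set.Ioi (0 : ℝ), A * Real.exp (-(μ * t)) * Real.exp (-τ) := by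
        refine norm_integral_le_of_norm_le (integrableOn_exp_neg_const_mul _) ?_
        refine (ae_restrict_iff' measurableSet_Ioi).2 (Filter.Eventually.of_forall fun τ hτ => ?_)
        exact norm_duhamel_integrand_le hμ hA hτ (hb τ hτ)
    _ = A * Real.exp (-(μ * t)) := by
        rw [integral_const_mul, integral_exp_neg_Ioi_zero, mul_one]

theorem continuous_duhamel (hS : Continuous fun p : ℝ × E => S p.1 p.2) {F : ℝ → E}
    (hF : Continuous F) {A μ : ℝ} (hμ : 1 ≤ μ) (hA : 0 ≤ A)
    (hb : ∀ t, ‖F t‖ ≤ A * Real.exp (-(μ * t))) :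
    Continuous (duhamel S F) := by
  unfold duhamel
  refine Continuous.const_smul ?_ _
  rw [continuous_iff_continuousAt]
  intro t₀
  have hci := continuous_duhamel_integrand hS hF
  refine continuousAt_of_dominated
    (bound := fun τ => A * Real.exp (-(μ * (t₀ - 1))) * Real.exp (-τ)) ?_ ?_
    (integrableOn_exp_neg_const_mul _) ?_
  · exact Filter.Eventually.of_forall fun t =>
      (hci.comp (by fun_prop : Continuous fun τ : ℝ => (t, τ))).aestronglyMeasurable
  · filter_upwards [lt_mem_nhds (by linarith : t₀ - 1 < t₀)] with t ht
    refine (ae_restrict_iff' measurableSet_Ioi).2 (Filter.Eventually.of_forall fun τ hτ => ?_)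
    refine (norm_duhamel_integrand_le hμ hA hτ (hb _)).trans ?_
    gcongr
  · exact Filter.Eventually.of_forall fun τ =>
      (hci.comp (by fun_prop : Continuous fun t : ℝ => (t, τ))).continuousAt

theorem duhamel_sub (hS : Continuous fun p : ℝ × E => S p.1 p.2) {F G : ℝ → E}
    (hF : Continuous F) (hG : Continuous G) {A μ t : ℝ} (hμ : 1 ≤ μ) (hA : 0 ≤ A)
    (hb : ∀ t, ‖F t‖ ≤ A * Real.exp (-(μ * t))) (hb' : ∀ t, ‖G t‖ ≤ A * Real.exp (-(μ * t))) :
    duhamel S F t - duhamel S G t = duhamel S (fun t => F t - G t) t := by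
  simp only [duhamel, map_sub]
  rw [integral_sub (integrableOn_duhamel hS hF hμ hA fun τ _ => hb _)
    (integrableOn_duhamel hS hG hμ hA fun τ _ => hb' _), smul_sub]

variable [CompleteSpace E]

/-- Solvability of the Duhamel equation from infinity for a Lipschitz source decaying
exponentially, with propagation of closed constraints. -/
theorem exists_duhamel_fixedPoint (hS : Continuous fun p : ℝ × E => S p.1 p.2)
    {N : ℝ → E → E} (hN : Continuous fun p : ℝ × E => N p.1 p.2)
    (hL : ∀ t u w, ‖N t u - N t w‖ ≤ 1 / 2 * ‖u - w‖) {κ μ : ℝ} (hμ : 1 ≤ μ) (hκ : 0 ≤ κ)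
    (h0 : ∀ t, ‖N t 0‖ ≤ κ * Real.exp (-(μ * t)))
    {P : ℝ → E → Prop} (hPc : ∀ t, IsClosed {u | P t u}) (hP0 : ∀ t, 0 ≤ t → P t 0)
    (hstep : ∀ (u : ℝ → E) (A : ℝ), 0 ≤ A → Continuous u →
      (∀ t, ‖N t (u t)‖ ≤ A * Real.exp (-(μ * t))) → (∀ t, 0 ≤ t → P t (u t)) →
      ∀ t, 0 ≤ t → P t (duhamel S (fun s => N s (u s)) t)) :
    ∃ (u : ℝ → E) (A : ℝ), 0 ≤ A ∧ Continuous u ∧ (∀ t, u t = duhamel S (fun s => N s (u s)) t) ∧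
      (∀ t, ‖N t (u t)‖ ≤ A * Real.exp (-(μ * t))) ∧ ∀ t, 0 ≤ t → P t (u t) := by
  let w : ℝ → ℝ := fun t => Real.exp (μ * t)
  -- The unknown is `ζ = e^{μt} u`, so that the sup norm of bounded continuous functions is the
  -- exponentially weighted norm of `u`.
  let un : (ℝ →ᵇ E) → ℝ → E := fun ζ t => ((Real.exp (-(μ * t)) : ℝ) : ℂ) • ζ t
  have hunc : ∀ ζ, Continuous (un ζ) := fun ζ => by
    have := ζ.continuous
    simp only [un]
    fun_prop
  have hunn : ∀ ζ t, ‖un ζ t‖ ≤ ‖ζ‖ * Real.exp (-(μ * t)) := fun ζ t => by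
    simp only [un]
    rw [norm_smul, Complex.norm_real, Real.norm_of_nonneg (Real.exp_pos _).le, mul_comm]
    gcongr
    exact ζ.norm_coe_le_norm t
  have hNc : ∀ u : ℝ → E, Continuous u → Continuous fun s => N s (u s) := fun u hu =>
    hN.comp (by fun_prop : Continuous fun s => (s, u s))
  have hNb : ∀ ζ t, ‖N t (un ζ t)‖ ≤ (κ + ‖ζ‖) * Real.exp (-(μ * t)) := fun ζ t => by
    have h1 := hL t (un ζ t) 0
    rw [sub_zero] at h1
    have h2 := norm_sub_norm_le (N t (un ζ t)) (N t 0)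
    have h3 := hunn ζ t
    have h4 := h0 t
    have h5 := norm_nonneg (un ζ t)
    nlinarith
  have hexp : ∀ t, Real.exp (μ * t) * Real.exp (-(μ * t)) = 1 := fun t => by
    rw [← Real.exp_add]; simp
  let Φ : (ℝ →ᵇ E) → (ℝ →ᵇ E) := fun ζ =>
    BoundedContinuousFunction.ofNormedAddCommGroup
      (fun t => ((Real.exp (μ * t) : ℝ) : ℂ) • duhamel S (fun s => N s (un ζ s)) t)
      (by
        have := continuous_duhamel hS (hNc _ (hunc ζ)) hμ (by positivity) (hNb ζ)
        fun_prop)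
      (κ + ‖ζ‖)
      (fun t => by
        have := norm_duhamel_le (S := S) (F := fun s => N s (un ζ s)) (A := κ + ‖ζ‖) hμ
          (by positivity) (t := t) fun τ _ => hNb ζ (t + τ)
        rw [norm_smul, Complex.norm_real, Real.norm_of_nonneg (Real.exp_pos _).le]
        calc _ ≤ Real.exp (μ * t) * ((κ + ‖ζ‖) * Real.exp (-(μ * t))) := by gcongr
          _ = (κ + ‖ζ‖) * (Real.exp (μ * t) * Real.exp (-(μ * t))) := by ring
          _ = κ + ‖ζ‖ := by rw [hexp, mul_one])
  have hΦ : ∀ ζ t, un (Φ ζ) t = duhamel S (fun s => N s (un ζ s)) t := fun ζ t => by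
    simp only [un, Φ, BoundedContinuousFunction.coe_ofNormedAddCommGroup]
    rw [smul_smul, ← Complex.ofReal_mul, mul_comm, hexp, Complex.ofReal_one, one_smul]
  have hcontr : ContractingWith (1 / 2) Φ := by
    refine ⟨by rw [← NNReal.coe_lt_coe]; norm_num, LipschitzWith.of_dist_le_mul fun ζ ξ => ?_⟩
    rw [BoundedContinuousFunction.dist_le (by positivity)]
    intro t
    rw [dist_eq_norm, dist_eq_norm]
    simp only [Φ, BoundedContinuousFunction.coe_ofNormedAddCommGroup]
    rw [← smul_sub, norm_smul, Complex.norm_real, Real.norm_of_nonneg (Real.exp_pos _).le]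
    have hA : 0 ≤ κ + ‖ζ‖ + ‖ξ‖ := by positivity
    rw [duhamel_sub hS (hNc _ (hunc ζ)) (hNc _ (hunc ξ)) hμ hA
      (fun t => (hNb ζ t).trans
        (mul_le_mul_of_nonneg_right (by linarith [norm_nonneg ξ]) (Real.exp_pos _).le))
      (fun t => (hNb ξ t).trans
        (mul_le_mul_of_nonneg_right (by linarith [norm_nonneg ζ]) (Real.exp_pos _).le))]
    have hd : ∀ s, ‖N s (un ζ s) - N s (un ξ s)‖ ≤
        (1 / 2 * ‖ζ - ξ‖) * Real.exp (-(μ * s)) := fun s => by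
      refine (hL _ _ _).trans ?_
      have : un ζ s - un ξ s = un (ζ - ξ) s := by
        simp only [un, BoundedContinuousFunction.coe_sub, Pi.sub_apply, smul_sub]
      rw [this, mul_assoc]
      gcongr
      exact hunn _ _
    have := norm_duhamel_le (S := S) (F := fun s => N s (un ζ s) - N s (un ξ s)) hμ
      (by positivity) (t := t) fun τ _ => hd (t + τ)
    calc _ ≤ Real.exp (μ * t) * ((1 / 2 * ‖ζ - ξ‖) * Real.exp (-(μ * t))) := by gcongr
      _ = (1 / 2 * ‖ζ - ξ‖) * (Real.exp (μ * t) * Real.exp (-(μ * t))) := by ring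
      _ = _ := by rw [hexp, mul_one]; norm_num
  -- The constraint holds for 0, is inherited by each Picard iterate through `hstep`, and passes to
  -- the fixed point because it is closed at each time. It is imposed only for `t ≥ 0`, which is
  -- consistent because Duhamel integrals from infinity look only at later times.
  have hiter : ∀ n t, 0 ≤ t → P t (un (Φ^[n] 0) t) := by
    intro n
    induction n with
    | zero => intro t ht; simpa [un] using hP0 t ht
    | succ n ih =>
      intro t ht
      rw [Function.iterate_succ_apply', hΦ]
      exact hstep _ _ (by positivity) (hunc _) (hNb _) ih t ht
  set ζ := ContractingWith.fixedPoint Φ hcontr with hζ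
  have hfix : Φ ζ = ζ := hcontr.fixedPoint_isFixedPt
  refine ⟨un ζ, κ + ‖ζ‖, by positivity, hunc ζ, fun t => ?_, hNb ζ, fun t ht => ?_⟩
  · rw [← hΦ, hfix]
  · have hl := hcontr.tendsto_iterate_fixedPoint (0 : ℝ →ᵇ E)
    have hev : Continuous fun ξ : ℝ →ᵇ E => un ξ t := by
      have : Continuous fun ξ : ℝ →ᵇ E => ξ t := (BoundedContinuousFunction.evalCLM ℂ t).continuous
      simp only [un]
      fun_prop
    exact (hPc t).mem_of_tendsto ((hev.tendsto ζ).comp hl)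
      (Filter.Eventually.of_forall fun n => hiter n t ht)

end Duhamel

/-! ### Sup bounds for Duhamel integrals of the Schrödinger group -/

variable {d : ℕ}

/-- The constant in the `L^∞` bound for Duhamel integrals. -/
def linfConst (d : ℕ) (β s : ℝ) : ℝ :=
  1 + 2 * Real.Gamma (1 - d * β / 2) *
    (8 * 2 ^ ((d : ℝ) / 2) / (1 - (1 / 2) ^ (s / 2 - (d : ℝ) * (1 - β) / 4)))

/-- The heat-flow criterion for boundedness is applied with `q = d(1-β)/4`. The regularisation at
time 1 is controlled by the `L²` norm alone. The regularised increments are controlled by the split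
dispersive estimate, whose singularity `τ^{-dβ/2}` is integrable against `e^{-τ}`; this is the
source of the Gamma factor in `linfConst`. -/
theorem duhamel_ae_norm_le {F : ℝ → L2 d} (hF : Continuous F) {β s κ lam μ A t : ℝ} {ϖ : Space d → ℝ}
    (hβ0 : 0 ≤ β) (hβ1 : β ≤ 1) (hβd : (d : ℝ) * β / 2 < 1) (hs0 : 0 ≤ s) (hs2 : s ≤ 2)
    (hs : (d : ℝ) * (1 - β) / 4 < s / 2) (hκ : 0 < κ) (hlam : 1 ≤ lam) (hμ : lam ≤ μ) (hA : 0 ≤ A)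
    (ht : 0 ≤ t) (hϖ0 : ∀ h, h ≠ 0 → 0 < ϖ h) (hϖ : ∀ h, ϖ h ≤ ‖h‖ ^ s)
    (hb : ∀ t, ‖F t‖ ≤ A * Real.exp (-(μ * t)))
    (hb2 : ∀ t, 0 ≤ t → ‖F t‖ ≤ κ * Real.exp (-(μ * t)))
    (hb3 : ∀ t, 0 ≤ t → ∀ h, h ≠ 0 → ∫⁻ y, ‖(trans h (F t) - F t : L2 d) y‖ₑ ^ (2 / (1 + β)) ≤
      ENNReal.ofReal ((κ * Real.exp (-(lam * t)) * ϖ h) ^ (2 / (1 + β)))) :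
    ∀ᵐ y, ‖duhamel sch F t y‖ ≤ κ * linfConst d β s * Real.exp (-(lam * t)) := by
  have hμ1 : 1 ≤ μ := hlam.trans hμ
  have hint := integrableOn_duhamel continuous_sch_uncurry hF (t := t) hμ1 hA fun τ _ => hb _
  set p : ℝ := 1 - d * β / 2 with hp
  have hp0 : 0 < p := by rw [hp]; linarith
  set B := κ * Real.exp (-(lam * t)) with hB
  have hB0 : 0 < B := by positivity
  have base : ∀ x, ‖heatEval (1 : ℂ) x (duhamel sch F t)‖ ≤ B := by
    intro x
    have h1 := norm_heatEval_le (z := 1) (by simp) x (duhamel sch F t)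
    rw [Complex.one_re, Real.one_rpow, one_mul] at h1
    refine h1.trans ?_
    refine (norm_duhamel_le hμ1 hκ.le fun τ hτ => hb2 _ (by linarith)).trans ?_
    rw [hB]
    gcongr
  have inc : ∀ (σ : ℝ) (x h : Space d), 0 < σ → σ ≤ 1 →
      ‖heatEval (σ : ℂ) x (trans h (duhamel sch F t) - duhamel sch F t)‖ ≤
        (2 * B * Real.Gamma p) * σ ^ (-((d : ℝ) * (1 - β) / 4)) * ‖h‖ ^ s := by
    intro σ x h hσ hσ1
    have hσ' : 0 < (σ : ℂ).re := by simpa using hσ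
    by_cases h0 : h = 0
    · rw [heatEval_sub hσ', heatEval_trans, h0, add_zero, sub_self, norm_zero]
      have := (Real.Gamma_pos_of_pos hp0).le
      positivity
    -- Evaluation of an increment is a bounded functional on `L²`, hence passes under the integral;
    -- translations commute with the group, and the group shifts the complex time from `σ` to `σ -
    -- iτ`.
    have e1 : heatEval (σ : ℂ) x (trans h (duhamel sch F t) - duhamel sch F t) =
        -Complex.I * ∫ τ in Set.Ioi (0 : ℝ), heatEval ((σ : ℂ) + Complex.I * ((-τ : ℝ) : ℂ)) x
          (trans h (F (t + τ)) - F (t + τ)) := by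
      set T : L2 d →L[ℂ] ℂ := (innerSL ℂ (heatKernel (σ : ℂ) hσ' x)).comp
        ((trans h).toContinuousLinearMap - ContinuousLinearMap.id ℂ (L2 d)) with hT
      have hTa : ∀ f, T f = heatEval (σ : ℂ) x (trans h f - f) := fun f => by
        rw [heatEval_eq_inner hσ', hT]; rfl
      rw [← hTa, duhamel, map_smul, smul_eq_mul]
      refine congrArg _ ((T.integral_comp_comm hint).symm.trans ?_)
      congr 1
      funext τ
      rw [hTa, trans_sch, ← map_sub, heatEval_sch]
    rw [e1, norm_mul, norm_neg, Complex.norm_I, one_mul]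
    have hG := Real.GammaIntegral_convergent hp0
    calc _ ≤ ∫ τ in Set.Ioi (0 : ℝ), (2 * B * ϖ h * σ ^ (-((d : ℝ) * (1 - β) / 4))) *
          (Real.exp (-τ) * τ ^ (p - 1)) := by
          refine norm_integral_le_of_norm_le (hG.const_mul _) ?_
          refine (ae_restrict_iff' measurableSet_Ioi).2
            (Filter.Eventually.of_forall fun τ hτ => ?_)
          have hτ0 : (0 : ℝ) < τ := hτ
          set z : ℂ := (σ : ℂ) + Complex.I * ((-τ : ℝ) : ℂ) with hz
          have hzre : z.re = σ := by simp [hz]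
          have hzim : z.im = -τ := by simp [hz]
          have hτz : τ ≤ ‖z‖ := by
            have := Complex.abs_im_le_norm z
            rwa [hzim, abs_neg, abs_of_pos hτ0] at this
          have hBτ : 0 < κ * Real.exp (-(lam * (t + τ))) * ϖ h := by
            have := hϖ0 h h0
            positivity
          have := norm_heatEval_le_of_lintegral_rpow hβ0 hβ1 (z := z) (by rw [hzre]; exact hσ)
            hτ0 hτz x _ hBτ (hb3 (t + τ) (by linarith) h h0)
          rw [hzre] at this
          refine this.trans ?_
          have e2 : p - 1 = -((d : ℝ) * β / 2) := by rw [hp]; ring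
          rw [e2]
          have e3 : κ * Real.exp (-(lam * (t + τ))) ≤ B * Real.exp (-τ) := by
            rw [hB, mul_assoc, ← Real.exp_add]
            gcongr
            nlinarith
          have hw := hϖ0 h h0
          calc _ ≤ 2 * (B * Real.exp (-τ) * ϖ h) * σ ^ (-((d : ℝ) * (1 - β) / 4)) *
                τ ^ (-((d : ℝ) * β / 2)) := by gcongr
            _ = _ := by ring
      _ = (2 * B * ϖ h * σ ^ (-((d : ℝ) * (1 - β) / 4))) * Real.Gamma p := by
          rw [integral_const_mul, Real.Gamma_eq_integral hp0]
      _ ≤ (2 * B * ‖h‖ ^ s * σ ^ (-((d : ℝ) * (1 - β) / 4))) * Real.Gamma p := by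
          have := (Real.Gamma_pos_of_pos hp0).le
          gcongr
          exact hϖ h
      _ = _ := by ring
  have hΓ := (Real.Gamma_pos_of_pos hp0).le
  filter_upwards [ae_norm_le_of_heatEval_increments hs0 hs2 hs (by positivity) base inc] with y hy
  refine hy.trans (le_of_eq ?_)
  rw [linfConst, ← hp, hB]
  ring

end NLSTrain
end

open scoped ENNReal Topology
noncomputable section
namespace NLSTrain
open MeasureTheory
open scoped Convolution

variable {d : ℕ}

/-! ### Regular representatives of bound states -/

/-- The directional derivative of a mollification of `φ` is the mollification of `G · w`, by testing
the weak gradient with `y ↦ r (z - y)`. A bound on `G` is needed only within the bump radius of the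
segment, which preserves the spatial decay. -/
theorem abs_bump_convolution_sub_le {φ : Space d → ℝ} {G : Space d → Space d}
    (h : HasH1Gradient φ G) {M : ℝ} {x w : Space d} (ρ : ContDiffBump (0 : Space d))
    (hG : ∀ᵐ y, ∀ τ ∈ Set.Icc (0 : ℝ) 1, ‖x + τ • w - y‖ < ρ.rOut → ‖G y‖ ≤ M) :
    |(ρ.normed volume ⋆[ContinuousLinearMap.lsmul ℝ ℝ, volume] φ) (x + w) -
      (ρ.normed volume ⋆[ContinuousLinearMap.lsmul ℝ ℝ, volume] φ) x| ≤ M * ‖w‖ := by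
  set r := ρ.normed (volume : Measure (Space d)) with hr
  have hrs : ContDiff ℝ (⊤ : ℕ∞) r := ρ.contDiff_normed
  have hrc : HasCompactSupport r := ρ.hasCompactSupport_normed
  have hφl : LocallyIntegrable φ volume := h.memLp.locallyIntegrable (by norm_num)
  set L := ContinuousLinearMap.lsmul (E := ℝ) ℝ ℝ with hL
  have hflip : ∀ z, (r ⋆[L, volume] φ) z = (φ ⋆[L, volume] r) z := by
    intro z
    rw [convolution_eq_swap, convolution]
    congr 1
    funext t
    simp [hL, mul_comm]
  have hd : ∀ z, HasFDerivAt (φ ⋆[L, volume] r)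
      ((φ ⋆[L.precompR (Space d), volume] fderiv ℝ r) z) z := fun z =>
    hrc.hasFDerivAt_convolution_right L hφl (hrs.of_le (by exact_mod_cast le_top)) z
  have hdapp : ∀ z, (φ ⋆[L.precompR (Space d), volume] fderiv ℝ r) z w =
      ∫ y, inner ℝ (G y) w * r (z - y) := by
    intro z
    rw [convolution_precompR_apply L hφl (hrc.fderiv ℝ)
      (hrs.continuous_fderiv (by simp)), convolution]
    have hw := h.weak (fun y => r (z - y)) (hrs.comp (contDiff_const.sub contDiff_id))
      (hrc.comp_homeomorph (Homeomorph.subLeft z)) w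
    have e : ∀ y, fderiv ℝ (fun y => r (z - y)) y w = -(fderiv ℝ r (z - y) w) := by
      intro y
      have h1 : HasFDerivAt (fun y : Space d => z - y) (-ContinuousLinearMap.id ℝ (Space d)) y := by
        simpa using (hasFDerivAt_id y).const_sub z
      have h2 : HasFDerivAt r (fderiv ℝ r (z - y)) (z - y) :=
        ((hrs.differentiable (by simp)) _).hasFDerivAt
      have h3 : HasFDerivAt (fun y => r (z - y)) _ y := h2.comp y h1
      rw [h3.fderiv]
      simp
    simp only [e] at hw
    rw [← neg_eq_iff_eq_neg, ← integral_neg] at hw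
    rw [← hw]
    congr 1
    funext y
    simp [hL]
  have hbd : ∀ τ ∈ Set.Icc (0 : ℝ) 1,
      ‖(φ ⋆[L.precompR (Space d), volume] fderiv ℝ r) (x + τ • w) w‖ ≤ M * ‖w‖ := by
    intro τ hτ
    rw [hdapp]
    have hone : ∫ y, M * ‖w‖ * r (x + τ • w - y) = M * ‖w‖ := by
      rw [integral_const_mul, integral_sub_left_eq_self (fun y => r y), hr, ρ.integral_normed,
        mul_one]
    rw [← hone]
    refine norm_integral_le_of_norm_le ?_ ?_
    · have : Integrable r := ρ.integrable_normed
      exact (this.comp_sub_left (x + τ • w)).const_mul _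
    · filter_upwards [hG] with y hy
      have hn : 0 ≤ r (x + τ • w - y) := ρ.nonneg_normed _
      rw [norm_mul, Real.norm_of_nonneg hn]
      by_cases hin : ‖x + τ • w - y‖ < ρ.rOut
      · refine mul_le_mul_of_nonneg_right ?_ hn
        refine (norm_inner_le_norm _ _).trans ?_
        exact mul_le_mul_of_nonneg_right (hy τ hτ hin) (norm_nonneg _)
      · have : r (x + τ • w - y) = 0 := by
          have hs := ρ.support_normed_eq (μ := (volume : Measure (Space d)))
          by_contra hne
          have : x + τ • w - y ∈ Function.support (ρ.normed volume) := hne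
          rw [hs, Metric.mem_ball, dist_zero_right] at this
          exact hin this
        rw [this, mul_zero, mul_zero]
  have hline : ∀ τ ∈ Set.Icc (0 : ℝ) 1,
      HasDerivWithinAt (fun τ : ℝ => (φ ⋆[L, volume] r) (x + τ • w))
        ((φ ⋆[L.precompR (Space d), volume] fderiv ℝ r) (x + τ • w) w) (Set.Icc 0 1) τ := by
    intro τ _
    have h1 : HasDerivAt (fun τ : ℝ => x + τ • w) w τ := by
      simpa using ((hasDerivAt_id τ).smul_const w).const_add x
    exact ((hd _).comp_hasDerivAt τ h1).hasDerivWithinAt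
  have := norm_image_sub_le_of_norm_deriv_le_segment_01' hline
    (fun τ hτ => hbd τ ⟨hτ.1, hτ.2.le⟩)
  simp only [one_smul, zero_smul, add_zero, Real.norm_eq_abs] at this
  rw [hflip, hflip]
  exact this

/-- Mollifications obey the increment bounds everywhere and converge almost everywhere, so the
bounds hold on a dense set of full measure. There `φ` is Lipschitz, extends to the whole space, and
closedness transfers the estimates to the extension. Of the two increment bounds, the uniform one
serves for the extension and the localised one for the conclusion. -/
theorem exists_regular_representative {φ : Space d → ℝ} {G : Space d → Space d}
    (h : HasH1Gradient φ G) {A A' k : ℝ} (hA' : 0 ≤ A') (hk : 0 ≤ k)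
    (hφ : ∀ᵐ x, |φ x| ≤ A * Real.exp (-(k * ‖x‖)))
    (hG : ∀ᵐ x, ‖G x‖ ≤ A' * Real.exp (-(k * ‖x‖))) :
    ∃ φ' : Space d → ℝ, φ' =ᵐ[volume] φ ∧ Continuous φ' ∧
      (∀ x, |φ' x| ≤ A * Real.exp (-(k * ‖x‖))) ∧
      ∀ x y, |φ' y - φ' x| ≤ A' * Real.exp (-(k * (‖x‖ - ‖y - x‖))) * ‖y - x‖ := by
  let ρ : ℕ → ContDiffBump (0 : Space d) := fun n =>
    ⟨1 / (n + 1), 2 / (n + 1), by positivity, by gcongr; norm_num⟩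
  have hρ : Filter.Tendsto (fun n => (ρ n).rOut) Filter.atTop (𝓝 0) := by
    have := (tendsto_one_div_add_atTop_nhds_zero_nat (𝕜 := ℝ)).const_mul 2
    simpa [ρ, div_eq_mul_inv] using this
  have hconv := ContDiffBump.ae_convolution_tendsto_right_of_locallyIntegrable (K := 2) hρ
    (Filter.Eventually.of_forall fun n => by simp only [ρ]; rw [mul_one_div])
    (h.memLp.locallyIntegrable (by norm_num) : LocallyIntegrable φ volume)
  set c : ℕ → Space d → ℝ := fun n =>
    ((ρ n).normed volume ⋆[ContinuousLinearMap.lsmul ℝ ℝ, volume] φ) with hc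
  have hcb1 : ∀ n x y, |c n y - c n x| ≤ A' * ‖y - x‖ := by
    intro n x y
    have := abs_bump_convolution_sub_le h (x := x) (w := y - x) (ρ n) (by
      filter_upwards [hG] with z hz τ _ _
      refine hz.trans (mul_le_of_le_one_right hA' ?_)
      rw [Real.exp_le_one_iff]
      have := mul_nonneg hk (norm_nonneg z)
      linarith)
    rwa [add_sub_cancel] at this
  have hcb2 : ∀ n x y, |c n y - c n x| ≤
      A' * Real.exp (-(k * (‖x‖ - ‖y - x‖ - (ρ n).rOut))) * ‖y - x‖ := by
    intro n x y
    have := abs_bump_convolution_sub_le h (x := x) (w := y - x) (ρ n)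
      (M := A' * Real.exp (-(k * (‖x‖ - ‖y - x‖ - (ρ n).rOut)))) (by
      filter_upwards [hG] with z hz τ hτ hlt
      refine hz.trans ?_
      gcongr
      have h1 : x = z - τ • (y - x) + (x + τ • (y - x) - z) := by abel
      have h2 : ‖x‖ ≤ ‖z‖ + ‖τ • (y - x)‖ + ‖x + τ • (y - x) - z‖ := by
        conv_lhs => rw [h1]
        refine (norm_add_le _ _).trans ?_
        gcongr
        exact norm_sub_le _ _
      have h3 : ‖τ • (y - x)‖ ≤ ‖y - x‖ := by
        rw [norm_smul, Real.norm_of_nonneg hτ.1]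
        exact mul_le_of_le_one_left (norm_nonneg _) hτ.2
      linarith)
    rwa [add_sub_cancel] at this
  set Z : Set (Space d) := {x | Filter.Tendsto (fun n => c n x) Filter.atTop (𝓝 (φ x)) ∧
    |φ x| ≤ A * Real.exp (-(k * ‖x‖))} with hZ
  have hZae : ∀ᵐ x, x ∈ Z := by
    filter_upwards [hconv, hφ] with x h1 h2 using ⟨h1, h2⟩
  have hZd : Dense Z := Measure.dense_of_ae hZae
  have hl1 : ∀ x ∈ Z, ∀ y ∈ Z, |φ y - φ x| ≤ A' * ‖y - x‖ := fun x hx y hy =>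
    le_of_tendsto ((hy.1.sub hx.1).abs) (Filter.Eventually.of_forall fun n => hcb1 n x y)
  have hl2 : ∀ x ∈ Z, ∀ y ∈ Z,
      |φ y - φ x| ≤ A' * Real.exp (-(k * (‖x‖ - ‖y - x‖))) * ‖y - x‖ := by
    intro x hx y hy
    have hlim : Filter.Tendsto
        (fun n => A' * Real.exp (-(k * (‖x‖ - ‖y - x‖ - (ρ n).rOut))) * ‖y - x‖) Filter.atTop
        (𝓝 (A' * Real.exp (-(k * (‖x‖ - ‖y - x‖ - 0))) * ‖y - x‖)) := by
      have hcont : Continuous fun r : ℝ => A' * Real.exp (-(k * (‖x‖ - ‖y - x‖ - r))) * ‖y - x‖ := by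
        fun_prop
      exact (hcont.tendsto 0).comp hρ
    rw [sub_zero] at hlim
    exact le_of_tendsto_of_tendsto' ((hy.1.sub hx.1).abs) hlim fun n => hcb2 n x y
  have hlip : LipschitzOnWith (Real.toNNReal A') φ Z := by
    refine LipschitzOnWith.of_dist_le_mul fun x hx y hy => ?_
    rw [Real.coe_toNNReal _ hA', Real.dist_eq, dist_eq_norm]
    exact hl1 y hy x hx
  obtain ⟨φ', hφ'l, hφ'e⟩ := hlip.extend_real
  have hcont := hφ'l.continuous
  refine ⟨φ', ?_, hcont, ?_, ?_⟩
  · filter_upwards [hZae] with x hx using (hφ'e hx).symm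
  · have hcl : IsClosed {x | |φ' x| ≤ A * Real.exp (-(k * ‖x‖))} :=
      isClosed_le (by fun_prop) (by fun_prop)
    intro x
    refine hcl.closure_subset_iff.2 (fun y hy => ?_) (hZd x)
    change |φ' y| ≤ _
    rw [← hφ'e hy]
    exact hy.2
  · have hcl : IsClosed {p : Space d × Space d |
        |φ' p.2 - φ' p.1| ≤ A' * Real.exp (-(k * (‖p.1‖ - ‖p.2 - p.1‖))) * ‖p.2 - p.1‖} :=
      isClosed_le (by fun_prop) (by fun_prop)
    intro x y
    refine hcl.closure_subset_iff.2 (fun p hp => ?_) ((hZd.prod hZd) (x, y))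
    change |φ' p.2 - φ' p.1| ≤ _
    rw [← hφ'e hp.1, ← hφ'e hp.2]
    exact hl2 _ hp.1 _ hp.2

end NLSTrain
end

open scoped ENNReal Topology
noncomputable section
namespace NLSTrain
open MeasureTheory

variable {d : ℕ}

/-! ### Solitons solve the equation in the sense of distributions -/

theorem laplacian_eq_sum_fderiv {F : Type*} [NormedAddCommGroup F] [NormedSpace ℝ F]
    {f : Space d → F} (hf : ContDiff ℝ (⊤ : ℕ∞) f) (x : Space d) :
    Laplacian.laplacian f x = ∑ i, fderiv ℝ (fun y => fderiv ℝ f y (EuclideanSpace.basisFun (Fin d) ℝ i)) x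
      (EuclideanSpace.basisFun (Fin d) ℝ i) := by
  rw [InnerProductSpace.laplacian_eq_iteratedFDeriv_orthonormalBasis f
    (EuclideanSpace.basisFun (Fin d) ℝ)]
  refine Finset.sum_congr rfl fun i _ => ?_
  rw [iteratedFDeriv_two_apply]
  have h : DifferentiableAt ℝ (fderiv ℝ f) x :=
    ((hf.fderiv_right (m := (⊤ : ℕ∞)) (by simp)).differentiable (by simp)) x
  rw [fderiv_clm_apply h (differentiableAt_const _)]
  simp

theorem contDiff_fderiv_apply {E F : Type*} [NormedAddCommGroup E] [NormedSpace ℝ E]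
    [NormedAddCommGroup F] [NormedSpace ℝ F] {f : E → F} (hf : ContDiff ℝ (⊤ : ℕ∞) f) (w : E) :
    ContDiff ℝ (⊤ : ℕ∞) fun x => fderiv ℝ f x w :=
  (hf.fderiv_right (m := (⊤ : ℕ∞)) (by simp)).clm_apply contDiff_const

/-! ### Time and space slices of test functions on space-time -/

section Slices

variable {F : Type*} [NormedAddCommGroup F] [NormedSpace ℝ F] {ψ : ℝ × Space d → F}

theorem hasDerivAt_time_slice (hψ : ContDiff ℝ (⊤ : ℕ∞) ψ) (p : ℝ × Space d) :
    HasDerivAt (fun s : ℝ => ψ (s, p.2)) (fderiv ℝ ψ p (1, 0)) p.1 := by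
  have h1 : HasDerivAt (fun s : ℝ => (s, p.2)) ((1 : ℝ), (0 : Space d)) p.1 :=
    (hasDerivAt_id p.1).prodMk (hasDerivAt_const _ _)
  have h2 : HasFDerivAt ψ (fderiv ℝ ψ p) (p.1, p.2) :=
    ((hψ.differentiable (by simp)) p).hasFDerivAt
  exact h2.comp_hasDerivAt p.1 h1

theorem fderiv_space_slice (hψ : ContDiff ℝ (⊤ : ℕ∞) ψ) (t : ℝ) (x e : Space d) :
    fderiv ℝ (fun y => ψ (t, y)) x e = fderiv ℝ ψ (t, x) (0, e) := by
  have h1 : HasFDerivAt (fun y : Space d => (t, y)) (ContinuousLinearMap.inr ℝ ℝ (Space d)) x :=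
    hasFDerivAt_prodMk_right t x
  have h2 : HasFDerivAt ψ (fderiv ℝ ψ (t, x)) (t, x) :=
    ((hψ.differentiable (by simp)) _).hasFDerivAt
  have h3 : HasFDerivAt (fun y : Space d => ψ (t, y)) _ x := h2.comp x h1
  rw [h3.fderiv]
  simp

/-- The Laplacian in the space variable of a function on space-time. -/
def spaceLaplacian (ψ : ℝ × Space d → F) (p : ℝ × Space d) : F :=
  ∑ i, fderiv ℝ (fun q => fderiv ℝ ψ q (0, EuclideanSpace.basisFun (Fin d) ℝ i)) p
    (0, EuclideanSpace.basisFun (Fin d) ℝ i)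

theorem contDiff_slice (hψ : ContDiff ℝ (⊤ : ℕ∞) ψ) (t : ℝ) :
    ContDiff ℝ (⊤ : ℕ∞) fun y => ψ (t, y) :=
  hψ.comp (contDiff_const.prodMk contDiff_id)

theorem laplacian_slice (hψ : ContDiff ℝ (⊤ : ℕ∞) ψ) (t : ℝ) (x : Space d) :
    Laplacian.laplacian (fun y => ψ (t, y)) x = spaceLaplacian ψ (t, x) := by
  rw [laplacian_eq_sum_fderiv (contDiff_slice hψ t), spaceLaplacian]
  refine Finset.sum_congr rfl fun i _ => ?_
  simp only [fderiv_space_slice hψ]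
  exact fderiv_space_slice (contDiff_fderiv_apply hψ _) t x _

theorem contDiff_spaceLaplacian (hψ : ContDiff ℝ (⊤ : ℕ∞) ψ) :
    ContDiff ℝ (⊤ : ℕ∞) (spaceLaplacian ψ) :=
  ContDiff.sum fun _ _ => contDiff_fderiv_apply (contDiff_fderiv_apply hψ _) _

theorem spaceLaplacian_eq_zero_of_notMem {p : ℝ × Space d} (hp : p ∉ tsupport ψ) :
    spaceLaplacian ψ p = 0 := by
  refine Finset.sum_eq_zero fun i _ => ?_
  set e : ℝ × Space d := (0, EuclideanSpace.basisFun (Fin d) ℝ i)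
  have h1 : (fun q => fderiv ℝ ψ q e) =ᶠ[𝓝 p] fun _ => 0 := by
    have : ∀ᶠ q in 𝓝 p, q ∉ tsupport ψ := (isClosed_tsupport ψ).isOpen_compl.eventually_mem hp
    filter_upwards [this] with q hq
    have : fderiv ℝ ψ q = 0 := by
      by_contra hne
      exact hq (support_fderiv_subset ℝ hne)
    rw [this]; rfl
  rw [h1.fderiv_eq]
  simp

theorem hasCompactSupport_spaceLaplacian (hc : HasCompactSupport ψ) :
    HasCompactSupport (spaceLaplacian ψ) :=
  HasCompactSupport.intro hc fun _ hp => spaceLaplacian_eq_zero_of_notMem hp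

theorem hasCompactSupport_fderiv_apply (hc : HasCompactSupport ψ) (w : ℝ × Space d) :
    HasCompactSupport fun p => fderiv ℝ ψ p w :=
  hc.fderiv_apply ℝ w

end Slices

theorem HasH1Gradient.congr_ae {φ φ' : Space d → ℝ} {G : Space d → Space d}
    (h : HasH1Gradient φ G) (he : φ' =ᵐ[volume] φ) : HasH1Gradient φ' G where
  memLp := h.memLp.ae_eq he.symm
  memLp_grad := h.memLp_grad
  weak ψ h1 h2 e := by
    rw [← h.weak ψ h1 h2 e]
    refine integral_congr_ae ?_
    filter_upwards [he] with x hx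
    rw [hx]

theorem IsBoundState.congr_ae {g : ℝ → ℝ} {ω : ℝ} {φ φ' : Space d → ℝ} {G : Space d → Space d}
    (h : IsBoundState g ω φ G) (he : φ' =ᵐ[volume] φ) : IsBoundState g ω φ' G where
  h1 := h.h1.congr_ae he
  nontrivial h0 := h.nontrivial (he.symm.trans h0)
  equation ψ h1 h2 := by
    have e1 : ∫ x, φ' x * ψ x = ∫ x, φ x * ψ x := by
      refine integral_congr_ae ?_
      filter_upwards [he] with x hx
      rw [hx]
    have e2 : ∫ x, g (φ' x ^ 2) * φ' x * ψ x = ∫ x, g (φ x ^ 2) * φ x * ψ x := by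
      refine integral_congr_ae ?_
      filter_upwards [he] with x hx
      rw [hx]
    rw [e1, e2]
    exact h.equation ψ h1 h2

/-- The weak equation carries one derivative on `φ`. Using the weak gradient against each `∂ᵢψ`
moves it onto the test function, which gives the very weak form needed for distributions. -/
theorem IsBoundState.integral_eq_zero_real {g : ℝ → ℝ} {ω : ℝ} {φ : Space d → ℝ}
    {G : Space d → Space d} (h : IsBoundState g ω φ G) (hc : Continuous φ)
    (hg : Continuous fun x => g (φ x ^ 2) * φ x) {ψ : Space d → ℝ}
    (hψ : ContDiff ℝ (⊤ : ℕ∞) ψ) (hs : HasCompactSupport ψ) :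
    ∫ x, (φ x * (Laplacian.laplacian ψ x - ω * ψ x) + g (φ x ^ 2) * φ x * ψ x) = 0 := by
  set e := EuclideanSpace.basisFun (Fin d) ℝ with he
  have hGi : ∀ i, Integrable fun x => inner ℝ (G x) (e i) * fderiv ℝ ψ x (e i) := by
    intro i
    have hG : LocallyIntegrable (fun x => inner ℝ (G x) (e i)) volume :=
      (h.h1.memLp_grad.inner_const (e i)).locallyIntegrable (by norm_num)
    have := hG.integrable_smul_left_of_hasCompactSupport
      (g := fun x => fderiv ℝ ψ x (e i)) (contDiff_fderiv_apply hψ _).continuous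
      (hs.fderiv_apply ℝ (e i))
    refine this.congr (Filter.Eventually.of_forall fun x => ?_)
    simp [mul_comm]
  have hφi : ∀ i, Integrable fun x => φ x * fderiv ℝ (fun y => fderiv ℝ ψ y (e i)) x (e i) := by
    intro i
    have h2 := contDiff_fderiv_apply (contDiff_fderiv_apply hψ (e i)) (e i)
    exact (hc.mul h2.continuous).integrable_of_hasCompactSupport
      (((hs.fderiv_apply ℝ (e i)).fderiv_apply ℝ (e i)).mul_left)
  have h1 : ∫ x, φ x * Laplacian.laplacian ψ x = -∫ x, fderiv ℝ ψ x (G x) := by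
    have e1 : (fun x => φ x * Laplacian.laplacian ψ x) =
        fun x => ∑ i, φ x * fderiv ℝ (fun y => fderiv ℝ ψ y (e i)) x (e i) := by
      funext x
      rw [laplacian_eq_sum_fderiv hψ, Finset.mul_sum]
    have e2 : (fun x => fderiv ℝ ψ x (G x)) =
        fun x => ∑ i, inner ℝ (G x) (e i) * fderiv ℝ ψ x (e i) := by
      funext x
      conv_lhs => rw [← e.sum_repr (G x)]
      rw [map_sum]
      refine Finset.sum_congr rfl fun i _ => ?_
      rw [map_smul, smul_eq_mul, e.repr_apply_apply, real_inner_comm]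
    rw [e1, e2, integral_finsetSum _ fun i _ => hφi i, integral_finsetSum _ fun i _ => hGi i,
      ← Finset.sum_neg_distrib]
    exact Finset.sum_congr rfl fun i _ =>
      h.h1.weak _ (contDiff_fderiv_apply hψ (e i)) (hs.fderiv_apply ℝ (e i)) (e i)
  have i1 : Integrable fun x => φ x * Laplacian.laplacian ψ x := by
    refine (integrable_finsetSum Finset.univ fun i _ => hφi i).congr
      (Filter.Eventually.of_forall fun x => ?_)
    simp only
    rw [laplacian_eq_sum_fderiv hψ, Finset.mul_sum]
  have i2 : Integrable fun x => φ x * ψ x :=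
    (hc.mul hψ.continuous).integrable_of_hasCompactSupport hs.mul_left
  have i3 : Integrable fun x => g (φ x ^ 2) * φ x * ψ x :=
    (hg.mul hψ.continuous).integrable_of_hasCompactSupport hs.mul_left
  have e3 : (fun x => φ x * (Laplacian.laplacian ψ x - ω * ψ x) + g (φ x ^ 2) * φ x * ψ x) =
      fun x => (φ x * Laplacian.laplacian ψ x - ω * (φ x * ψ x)) + g (φ x ^ 2) * φ x * ψ x := by
    funext x; ring
  rw [e3, integral_add (f := fun x => φ x * Laplacian.laplacian ψ x - ω * (φ x * ψ x))
    (i1.sub (i2.const_mul ω)) i3, integral_sub i1 (i2.const_mul ω), integral_const_mul, h1, ← h.equation ψ hψ hs]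
  ring

theorem IsBoundState.integral_eq_zero {g : ℝ → ℝ} {ω : ℝ} {φ : Space d → ℝ}
    {G : Space d → Space d} (h : IsBoundState g ω φ G) (hc : Continuous φ)
    (hg : Continuous fun x => g (φ x ^ 2) * φ x) {ψ : Space d → ℂ}
    (hψ : ContDiff ℝ (⊤ : ℕ∞) ψ) (hs : HasCompactSupport ψ) :
    ∫ x, ((φ x : ℂ) * (Laplacian.laplacian ψ x - ω * ψ x) + (g (φ x ^ 2) * φ x : ℝ) * ψ x) = 0 := by
  set J := fun x => (φ x : ℂ) * (Laplacian.laplacian ψ x - ω * ψ x) +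
    (g (φ x ^ 2) * φ x : ℝ) * ψ x with hJ
  have part : ∀ l : ℂ →L[ℝ] ℝ, ∫ x, l (J x) = 0 := by
    intro l
    have hl : ContDiff ℝ (⊤ : ℕ∞) (l ∘ ψ) := l.contDiff.comp hψ
    rw [← h.integral_eq_zero_real hc hg hl (hs.comp_left (map_zero l))]
    congr 1
    funext x
    rw [ContDiffAt.laplacian_CLM_comp_left ((contDiff_infty.1 hψ 2).contDiffAt)]
    have hlm : ∀ (a : ℝ) (z : ℂ), l ((a : ℂ) * z) = a * l z := by
      intro a z
      rw [← Complex.real_smul, map_smul, smul_eq_mul]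
    simp only [hJ, map_add, hlm, map_sub, Function.comp_apply]
  have hint : Integrable J := by
    have c1 : Continuous (Laplacian.laplacian ψ) := by
      have : Laplacian.laplacian ψ = fun x => ∑ i, fderiv ℝ (fun y => fderiv ℝ ψ y
          (EuclideanSpace.basisFun (Fin d) ℝ i)) x (EuclideanSpace.basisFun (Fin d) ℝ i) :=
        funext fun x => laplacian_eq_sum_fderiv hψ x
      rw [this]
      exact continuous_finsetSum _ fun i _ =>
        (contDiff_fderiv_apply (contDiff_fderiv_apply hψ _) _).continuous
    have hψc := hψ.continuous
    have hcont : Continuous J := by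
      simp only [hJ]
      fun_prop
    refine hcont.integrable_of_hasCompactSupport (HasCompactSupport.intro hs fun x hx => ?_)
    have z1 : ψ x = 0 := image_eq_zero_of_notMem_tsupport hx
    have z2 : Laplacian.laplacian ψ x = 0 := by
      have h0 : ψ =ᶠ[𝓝 x] fun _ => 0 := by
        have : ∀ᶠ q in 𝓝 x, q ∉ tsupport ψ := (isClosed_tsupport ψ).isOpen_compl.eventually_mem hx
        filter_upwards [this] with q hq using image_eq_zero_of_notMem_tsupport hq
      rw [(InnerProductSpace.laplacian_congr_nhds h0).eq_of_nhds]
      simp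
    simp [hJ, z1, z2]
  refine Complex.ext ?_ ?_
  · rw [← Complex.reCLM_apply, ← Complex.reCLM.integral_comp_comm hint]
    exact part _
  · rw [← Complex.imCLM_apply, ← Complex.imCLM.integral_comp_comm hint]
    exact part _

end NLSTrain
end

open scoped ENNReal Topology
noncomputable section
namespace NLSTrain
open MeasureTheory

variable {d : ℕ}

/-! ### Galilean invariance of the equation -/

theorem fderiv_exp_mul {E : Type*} [NormedAddCommGroup E] [NormedSpace ℝ E] {L : E → ℝ}
    {L' : E →L[ℝ] ℝ} {x : E} (hL : HasFDerivAt L L' x) {χ : E → ℂ} (hχ : DifferentiableAt ℝ χ x)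
    (w : E) :
    fderiv ℝ (fun y => Complex.exp (Complex.I * (L y : ℂ)) * χ y) x w =
      Complex.exp (Complex.I * (L x : ℂ)) * (Complex.I * (L' w : ℂ) * χ x + fderiv ℝ χ x w) := by
  have h1 : HasFDerivAt (fun y => (L y : ℂ)) (Complex.ofRealCLM.comp L') x :=
    Complex.ofRealCLM.hasFDerivAt.comp x hL
  have h2 : HasFDerivAt (fun y => Complex.exp (Complex.I * (L y : ℂ)))
      (Complex.exp (Complex.I * (L x : ℂ)) • (Complex.I • Complex.ofRealCLM.comp L')) x :=
    (h1.const_mul Complex.I).cexp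
  have h3 := h2.mul hχ.hasFDerivAt
  have h4 : HasFDerivAt (fun y => Complex.exp (Complex.I * (L y : ℂ)) * χ y) _ x := h3
  rw [h4.fderiv]
  simp
  ring

/-- The product rule produces a first order term `i v·∇χ`, which will cancel the transport term
created by passing to the moving frame, and `-|v|²/4`, which the time dependence of the phase
compensates. -/
theorem laplacian_exp_mul (v : Space d) (c : ℝ) {χ : Space d → ℂ} (hχ : ContDiff ℝ (⊤ : ℕ∞) χ)
    (x : Space d) :
    Laplacian.laplacian
      (fun y => Complex.exp (Complex.I * ((1 / 2 * inner ℝ v y + c : ℝ) : ℂ)) * χ y) x =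
      Complex.exp (Complex.I * ((1 / 2 * inner ℝ v x + c : ℝ) : ℂ)) *
        (Laplacian.laplacian χ x + Complex.I * fderiv ℝ χ x v - (1 / 4 * ‖v‖ ^ 2 : ℝ) * χ x) := by
  set e := EuclideanSpace.basisFun (Fin d) ℝ with he
  have hL : ∀ y : Space d, HasFDerivAt (fun y => 1 / 2 * inner ℝ v y + c)
      ((1 / 2 : ℝ) • innerSL ℝ v) y := fun y =>
    ((innerSL ℝ v).hasFDerivAt.const_mul (1 / 2 : ℝ)).add_const c
  have hLs : ContDiff ℝ (⊤ : ℕ∞) fun y : Space d => 1 / 2 * inner ℝ v y + c :=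
    (contDiff_const.mul (contDiff_const.inner ℝ contDiff_id)).add contDiff_const
  have hE : ContDiff ℝ (⊤ : ℕ∞) fun y =>
      Complex.exp (Complex.I * ((1 / 2 * inner ℝ v y + c : ℝ) : ℂ)) * χ y :=
    ((contDiff_const.mul (Complex.ofRealCLM.contDiff.comp hLs)).cexp).mul hχ
  have hdiff : Differentiable ℝ χ := hχ.differentiable (by simp)
  rw [laplacian_eq_sum_fderiv hE, laplacian_eq_sum_fderiv hχ]
  have e1 : ∀ w : Space d, (fun y => fderiv ℝ (fun y =>
      Complex.exp (Complex.I * ((1 / 2 * inner ℝ v y + c : ℝ) : ℂ)) * χ y) y w) =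
      fun y => Complex.exp (Complex.I * ((1 / 2 * inner ℝ v y + c : ℝ) : ℂ)) *
        (Complex.I * (((1 / 2 : ℝ) • innerSL ℝ v) w : ℂ) * χ y + fderiv ℝ χ y w) := fun w =>
    funext fun y => fderiv_exp_mul (hL y) (hdiff y) w
  have e2 : ∀ w : Space d, fderiv ℝ (fun y => fderiv ℝ (fun y =>
      Complex.exp (Complex.I * ((1 / 2 * inner ℝ v y + c : ℝ) : ℂ)) * χ y) y w) x w =
      Complex.exp (Complex.I * ((1 / 2 * inner ℝ v x + c : ℝ) : ℂ)) *
        (fderiv ℝ (fun y => fderiv ℝ χ y w) x w + Complex.I * (inner ℝ v w * fderiv ℝ χ x w) -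
          1 / 4 * (inner ℝ v w : ℂ) ^ 2 * χ x) := by
    intro w
    have hw : DifferentiableAt ℝ (fun y => fderiv ℝ χ y w) x :=
      ((contDiff_fderiv_apply hχ w).differentiable (by simp)) x
    rw [e1, fderiv_exp_mul (hL x) (χ := fun y => Complex.I * (((1 / 2 : ℝ) • innerSL ℝ v) w : ℂ) *
        χ y + fderiv ℝ χ y w) (((hdiff x).const_mul _).add hw),
      fderiv_fun_add ((hdiff x).const_mul _) hw, fderiv_const_mul (hdiff x)]
    simp only [_root_.add_apply, _root_.smul_apply, innerSL_apply_apply,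
      smul_eq_mul]
    push_cast
    linear_combination (Complex.exp (Complex.I * (1 / 2 * (inner ℝ v x : ℝ) + c : ℂ)) *
      (1 / 4 * (inner ℝ v w : ℂ) ^ 2 * χ x)) * Complex.I_sq
  have s1 : ∑ i, (inner ℝ v (e i) : ℂ) ^ 2 = (‖v‖ ^ 2 : ℝ) := by
    have := e.sum_sq_norm_inner_left v
    rw [← this]
    push_cast
    refine Finset.sum_congr rfl fun i _ => ?_
    rw [Real.norm_eq_abs]
    exact_mod_cast congrArg Complex.ofReal (sq_abs (inner ℝ v (e i))).symm
  have s2 : ∑ i, (inner ℝ v (e i) : ℂ) * fderiv ℝ χ x (e i) = fderiv ℝ χ x v := by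
    conv_rhs => rw [← e.sum_repr v]
    rw [map_sum]
    refine Finset.sum_congr rfl fun i _ => ?_
    rw [map_smul, e.repr_apply_apply, real_inner_comm, Complex.real_smul]
  simp only [e2]
  rw [← Finset.mul_sum, Finset.sum_sub_distrib, Finset.sum_add_distrib, ← Finset.mul_sum, s2,
    ← Finset.sum_mul, ← Finset.mul_sum, s1]
  push_cast
  ring

/-- Galilean shear of space-time. -/
def shear (v : Space d) : (ℝ × Space d) ≃ₜ (ℝ × Space d) where
  toFun p := (p.1, p.2 + p.1 • v)
  invFun p := (p.1, p.2 - p.1 • v)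
  left_inv p := by simp
  right_inv p := by simp
  continuous_toFun := by fun_prop
  continuous_invFun := by fun_prop

theorem integral_shear {F : ℝ × Space d → ℂ} (hF : Integrable F) (v : Space d) :
    ∫ p, F p = ∫ t, ∫ y, F (t, y + t • v) := by
  rw [show (volume : Measure (ℝ × Space d)) = (volume : Measure ℝ).prod volume from rfl] at *
  rw [integral_prod _ hF]
  congr 1
  funext t
  exact (integral_add_right_eq_self (fun y => F (t, y)) (t • v)).symm

theorem nonlin_exp_mul (g : ℝ → ℝ) (θ r : ℝ) :
    nonlin g (Complex.exp (Complex.I * (θ : ℂ)) * (r : ℂ)) =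
      Complex.exp (Complex.I * (θ : ℂ)) * ((g (r ^ 2) * r : ℝ) : ℂ) := by
  have h : ‖Complex.exp (Complex.I * (θ : ℂ)) * (r : ℂ)‖ ^ 2 = r ^ 2 := by
    rw [norm_mul, mul_comm Complex.I, Complex.norm_exp_ofReal_mul_I, one_mul, Complex.norm_real,
      Real.norm_eq_abs, sq_abs]
  rw [nonlin, h]
  push_cast
  ring

theorem IsBoundState.soliton_equation {g : ℝ → ℝ} {ω : ℝ} {φ : Space d → ℝ}
    {G : Space d → Space d} (h : IsBoundState g ω φ G) (hc : Continuous φ)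
    (hg : Continuous fun x => g (φ x ^ 2) * φ x) (v : Space d) (γ : ℝ) {ψ : ℝ × Space d → ℂ}
    (hψ : ContDiff ℝ (⊤ : ℕ∞) ψ) (hs : HasCompactSupport ψ) :
    ∫ p : ℝ × Space d, (soliton φ ω v 0 γ p.1 p.2 *
      (-Complex.I * fderiv ℝ ψ p (1, 0) + spaceLaplacian ψ p) +
      nonlin g (soliton φ ω v 0 γ p.1 p.2) * ψ p) = 0 := by
  -- In the frame `y = x - tv` the soliton is `e^{iθ} φ(y)`. The phase is moved onto the sheared
  -- test function, and `Ψ` becomes a test function for the standing profile `φ`.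
  set θ : ℝ × Space d → ℝ := fun p =>
    ω * p.1 + 1 / 2 * inner ℝ v p.2 + 1 / 4 * ‖v‖ ^ 2 * p.1 + γ with hθ
  set χ : ℝ × Space d → ℂ := fun p => ψ (shear v p) with hχdef
  set Ψ : ℝ × Space d → ℂ := fun p => Complex.exp (Complex.I * (θ p : ℂ)) * χ p with hΨdef
  have hχ : ContDiff ℝ (⊤ : ℕ∞) χ := by
    refine hψ.comp (contDiff_fst.prodMk (contDiff_snd.add (contDiff_fst.smul contDiff_const)))
  have hχc : HasCompactSupport χ := hs.comp_homeomorph (shear v)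
  have hθs : ContDiff ℝ (⊤ : ℕ∞) θ :=
    (((contDiff_const.mul contDiff_fst).add (contDiff_const.mul
      (contDiff_const.inner ℝ contDiff_snd))).add (contDiff_const.mul contDiff_fst)).add
      contDiff_const
  have hΨ : ContDiff ℝ (⊤ : ℕ∞) Ψ :=
    ((contDiff_const.mul (Complex.ofRealCLM.contDiff.comp hθs)).cexp).mul hχ
  have hΨc : HasCompactSupport Ψ := hχc.mul_left
  have hsol : ∀ t y, soliton φ ω v 0 γ t (y + t • v) =
      Complex.exp (Complex.I * (θ (t, y) : ℂ)) * (φ y : ℂ) := by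
    intro t y
    rw [soliton]
    congr 3
    · congr 1
      simp only [hθ, inner_add_right, inner_smul_right, real_inner_self_eq_norm_sq]
      ring
    · simp
  have hχt : ∀ t y, fderiv ℝ χ (t, y) (1, 0) =
      fderiv ℝ ψ (t, y + t • v) (1, 0) + fderiv ℝ ψ (t, y + t • v) (0, v) := by
    intro t y
    have h1 : HasFDerivAt (fun p : ℝ × Space d => (p.1, p.2 + p.1 • v))
        ((ContinuousLinearMap.fst ℝ ℝ (Space d)).prod (ContinuousLinearMap.snd ℝ ℝ (Space d) +
          (ContinuousLinearMap.fst ℝ ℝ (Space d)).smulRight v)) (t, y) := by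
      refine hasFDerivAt_fst.prodMk (hasFDerivAt_snd.add ?_)
      exact ((ContinuousLinearMap.fst ℝ ℝ (Space d)).smulRight v).hasFDerivAt
    have h2 : HasFDerivAt ψ (fderiv ℝ ψ (t, y + t • v)) (t, y + t • v) :=
      ((hψ.differentiable (by simp)) _).hasFDerivAt
    have h3 : HasFDerivAt χ _ (t, y) := h2.comp (t, y) h1
    rw [h3.fderiv, ← map_add]
    simp
  have hslice : ∀ t y, fderiv ℝ (fun y => ψ (t, y + t • v)) y v =
      fderiv ℝ ψ (t, y + t • v) (0, v) := by
    intro t y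
    rw [show (fun y => ψ (t, y + t • v)) = fun y => χ (t, y) from rfl, fderiv_space_slice hχ]
    have h1 : HasFDerivAt (fun p : ℝ × Space d => (p.1, p.2 + p.1 • v))
        ((ContinuousLinearMap.fst ℝ ℝ (Space d)).prod (ContinuousLinearMap.snd ℝ ℝ (Space d) +
          (ContinuousLinearMap.fst ℝ ℝ (Space d)).smulRight v)) (t, y) := by
      refine hasFDerivAt_fst.prodMk (hasFDerivAt_snd.add ?_)
      exact ((ContinuousLinearMap.fst ℝ ℝ (Space d)).smulRight v).hasFDerivAt
    have h2 : HasFDerivAt ψ (fderiv ℝ ψ (t, y + t • v)) (t, y + t • v) :=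
      ((hψ.differentiable (by simp)) _).hasFDerivAt
    have h3 : HasFDerivAt χ _ (t, y) := h2.comp (t, y) h1
    rw [h3.fderiv]
    simp
  have hΨt : ∀ t y, fderiv ℝ Ψ (t, y) (1, 0) = Complex.exp (Complex.I * (θ (t, y) : ℂ)) *
      (Complex.I * (ω + 1 / 4 * ‖v‖ ^ 2 : ℝ) * ψ (t, y + t • v) +
        (fderiv ℝ ψ (t, y + t • v) (1, 0) + fderiv ℝ ψ (t, y + t • v) (0, v))) := by
    intro t y
    have hL : HasFDerivAt θ (ω • ContinuousLinearMap.fst ℝ ℝ (Space d) +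
        (1 / 2 : ℝ) • (innerSL ℝ v).comp (ContinuousLinearMap.snd ℝ ℝ (Space d)) +
        (1 / 4 * ‖v‖ ^ 2) • ContinuousLinearMap.fst ℝ ℝ (Space d)) (t, y) := by
      refine (((hasFDerivAt_fst.const_mul ω).add ?_).add (hasFDerivAt_fst.const_mul _)).add_const γ
      exact ((innerSL ℝ v).comp
        (ContinuousLinearMap.snd ℝ ℝ (Space d))).hasFDerivAt.const_mul (1 / 2 : ℝ)
    rw [fderiv_exp_mul hL ((hχ.differentiable (by simp)) _), hχt]
    simp [hχdef, shear]
  have hΨl : ∀ t y, spaceLaplacian Ψ (t, y) = Complex.exp (Complex.I * (θ (t, y) : ℂ)) *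
      (spaceLaplacian ψ (t, y + t • v) + Complex.I * fderiv ℝ ψ (t, y + t • v) (0, v) -
        (1 / 4 * ‖v‖ ^ 2 : ℝ) * ψ (t, y + t • v)) := by
    intro t y
    rw [← laplacian_slice hΨ]
    have e1 : (fun y => Ψ (t, y)) = fun y => Complex.exp (Complex.I *
        ((1 / 2 * inner ℝ v y + (ω * t + 1 / 4 * ‖v‖ ^ 2 * t + γ) : ℝ) : ℂ)) *
          ψ (t, y + t • v) := by
      funext y
      simp only [hΨdef, hθ, hχdef, shear]
      congr 4
      ring
    have hsm : ContDiff ℝ (⊤ : ℕ∞) fun y : Space d => ψ (t, y + t • v) :=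
      hψ.comp (contDiff_const.prodMk (contDiff_id.add contDiff_const))
    rw [e1, laplacian_exp_mul v _ hsm, hslice]
    have e2 : Laplacian.laplacian (fun y : Space d => ψ (t, y + t • v)) y =
        spaceLaplacian ψ (t, y + t • v) := by
      rw [laplacian_eq_sum_fderiv hsm, spaceLaplacian]
      refine Finset.sum_congr rfl fun i _ => ?_
      set e := EuclideanSpace.basisFun (Fin d) ℝ i
      simp only [fderiv_comp_add_right (f := fun y => ψ (t, y)), fderiv_space_slice hψ]
      rw [fderiv_comp_add_right (f := fun y => fderiv ℝ ψ (t, y) (0, e))]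
      exact fderiv_space_slice (contDiff_fderiv_apply hψ _) t _ e
    rw [e2]
    congr 3
    simp only [hθ]
    congr 1
    ring
  -- After the change of frame the integrand is `A1 + A2`. On each time slice `A2` integrates to
  -- zero by the bound state equation tested with `Ψ (t, ·)`; for each fixed `y`, `A1` is a total
  -- time derivative with compact support.
  set A1 : ℝ × Space d → ℂ := fun p => (φ p.2 : ℂ) * (-Complex.I * fderiv ℝ Ψ p (1, 0)) with hA1
  set A2 : ℝ × Space d → ℂ := fun p => (φ p.2 : ℂ) * (spaceLaplacian Ψ p - ω * Ψ p) +
    (g (φ p.2 ^ 2) * φ p.2 : ℝ) * Ψ p with hA2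
  have cΨ := hΨ.continuous
  have cΨt := (contDiff_fderiv_apply hΨ (1, 0)).continuous
  have cΨl := (contDiff_spaceLaplacian hΨ).continuous
  have cφ : Continuous fun p : ℝ × Space d => φ p.2 := hc.comp continuous_snd
  have cg : Continuous fun p : ℝ × Space d => g (φ p.2 ^ 2) * φ p.2 := hg.comp continuous_snd
  have i1 : Integrable A1 :=
    Continuous.integrable_of_hasCompactSupport (by simp only [hA1]; fun_prop)
      ((hasCompactSupport_fderiv_apply hΨc (1, 0)).mul_left.mul_left)
  have i2 : Integrable A2 := by
    refine Continuous.integrable_of_hasCompactSupport (by simp only [hA2]; fun_prop)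
      (HasCompactSupport.intro hΨc fun p hp => ?_)
    simp [hA2, image_eq_zero_of_notMem_tsupport hp, spaceLaplacian_eq_zero_of_notMem hp]
  have hkey : ∀ t y, soliton φ ω v 0 γ t (y + t • v) *
      (-Complex.I * fderiv ℝ ψ (t, y + t • v) (1, 0) + spaceLaplacian ψ (t, y + t • v)) +
      nonlin g (soliton φ ω v 0 γ t (y + t • v)) * ψ (t, y + t • v) = A1 (t, y) + A2 (t, y) := by
    intro t y
    rw [hsol, nonlin_exp_mul]
    simp only [hA1, hA2, hΨt, hΨl]
    simp only [hΨdef, hχdef, shear, Homeomorph.homeomorph_mk_coe, Equiv.coe_fn_mk]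
    push_cast
    linear_combination (φ y * Complex.exp (Complex.I * θ (t, y)) *
      ((ω + 1 / 4 * ‖v‖ ^ 2 : ℂ) * ψ (t, y + t • v))) * Complex.I_sq
  have csol : Continuous fun p : ℝ × Space d => soliton φ ω v 0 γ p.1 p.2 := by
    unfold soliton
    fun_prop
  have cnl : Continuous fun p : ℝ × Space d => nonlin g (soliton φ ω v 0 γ p.1 p.2) := by
    have : (fun p : ℝ × Space d => nonlin g (soliton φ ω v 0 γ p.1 p.2)) = fun p =>
        Complex.exp (Complex.I * ((ω * p.1 + (1 / 2) * inner ℝ v p.2 - (1 / 4) * ‖v‖ ^ 2 * p.1 + γ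
          : ℝ) : ℂ)) * ((g (φ (p.2 - 0 - p.1 • v) ^ 2) * φ (p.2 - 0 - p.1 • v) : ℝ) : ℂ) := by
      funext p
      rw [soliton, nonlin_exp_mul]
    rw [this]
    have cg' : Continuous fun p : ℝ × Space d =>
        g (φ (p.2 - 0 - p.1 • v) ^ 2) * φ (p.2 - 0 - p.1 • v) :=
      hg.comp (f := fun p : ℝ × Space d => p.2 - 0 - p.1 • v) (by fun_prop)
    fun_prop
  rw [integral_shear _ v]
  · simp only [hkey]
    have e0 : ∀ t, ∫ y, A2 (t, y) = 0 := fun t => by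
      rw [← h.integral_eq_zero hc hg (contDiff_slice hΨ t)
        (HasCompactSupport.intro (hΨc.image continuous_snd) fun y hy => ?_)]
      · simp only [laplacian_slice hΨ, hA2]
      · exact image_eq_zero_of_notMem_tsupport fun hm => hy ⟨_, hm, rfl⟩
    have hvol : (volume : Measure (ℝ × Space d)) = (volume : Measure ℝ).prod volume := rfl
    rw [hvol] at i1 i2
    have e1 : ∀ᵐ t : ℝ, ∫ y, (A1 (t, y) + A2 (t, y)) = ∫ y, A1 (t, y) := by
      filter_upwards [i1.prod_right_ae, i2.prod_right_ae] with t h1 h2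
      rw [integral_add h1 h2, e0, add_zero]
    rw [integral_congr_ae e1, integral_integral_swap (f := fun t y => A1 (t, y)) i1]
    refine integral_eq_zero_of_ae (Filter.Eventually.of_forall fun y => ?_)
    simp only [hA1, Pi.zero_apply]
    rw [integral_const_mul, integral_const_mul]
    have z : ∫ t, fderiv ℝ Ψ (t, y) (1, 0) = 0 := by
      have ct : Continuous fun t : ℝ => (t, y) := by fun_prop
      have hcs : ∀ {f : ℝ × Space d → ℂ}, HasCompactSupport f →
          HasCompactSupport fun t : ℝ => f (t, y) := fun {f} hf =>
        HasCompactSupport.intro (hf.image continuous_fst) fun t ht =>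
          image_eq_zero_of_notMem_tsupport fun hm => ht ⟨_, hm, rfl⟩
      exact integral_eq_zero_of_hasDerivAt_of_integrable
        (f := fun t => Ψ (t, y)) (fun t => hasDerivAt_time_slice hΨ (t, y))
        ((cΨt.comp ct).integrable_of_hasCompactSupport
          (hcs (hasCompactSupport_fderiv_apply hΨc (1, 0))))
        ((cΨ.comp ct).integrable_of_hasCompactSupport (hcs hΨc))
    rw [z, mul_zero, mul_zero]
  · have cψ := hψ.continuous
    have cψt := (contDiff_fderiv_apply hψ (1, 0)).continuous
    have cψl := (contDiff_spaceLaplacian hψ).continuous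
    refine Continuous.integrable_of_hasCompactSupport (by fun_prop)
      (HasCompactSupport.intro hs fun p hp => ?_)
    have z : fderiv ℝ ψ p = 0 := by
      by_contra hne
      exact hp (support_fderiv_subset ℝ hne)
    simp [image_eq_zero_of_notMem_tsupport hp, spaceLaplacian_eq_zero_of_notMem hp, z]

end NLSTrain
end

open scoped ENNReal Topology
noncomputable section
namespace NLSTrain
open MeasureTheory FourierTransform

variable {d : ℕ}

/-! ### The Duhamel formula and the equation in the sense of distributions -/

theorem fourier_laplacian_apply (f : SchwartzMap (Space d) ℂ) (ξ : Space d) :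
    𝓕 (Laplacian.laplacian f) ξ = -(4 * Real.pi ^ 2 * ‖ξ‖ ^ 2 : ℝ) * 𝓕 f ξ := by
  rw [SchwartzMap.laplacian_eq_fourierMultiplierCLM, SchwartzMap.fourierMultiplierCLM_apply,
    FourierTransform.fourier_smul, FourierTransform.fourier_fourierInv_eq]
  rw [_root_.smul_apply, SchwartzMap.smulLeftCLM_apply_apply (by fun_prop)]
  simp only [Complex.real_smul]
  push_cast
  ring

theorem tendsto_of_fourier {ι : Type*} {l : Filter ι} {f : ι → L2 d} {g : L2 d}
    (h : Filter.Tendsto (fun i => (𝓕 (f i) : L2 d)) l (𝓝 (𝓕 g))) : Filter.Tendsto f l (𝓝 g) :=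
  ((Lp.fourierTransformₗᵢ (Space d) ℂ).isometry.isEmbedding.tendsto_nhds_iff).2 h

theorem memLp_slope_schPhase (Φ : SchwartzMap (Space d) ℂ) (h : ℝ) : MemLp (fun ξ : Space d =>
    (h : ℂ)⁻¹ * (Complex.exp (Complex.I * (schPhase h ξ : ℝ)) * Φ ξ - Φ ξ)) 2 :=
  ((memLp_phase_mul (continuous_schPhase h) (Φ.memLp 2)).sub (Φ.memLp 2)).const_mul _

theorem memLp_I_mul (Λ : SchwartzMap (Space d) ℂ) :
    MemLp (fun ξ : Space d => Complex.I * Λ ξ) 2 := (Λ.memLp 2).const_mul _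

/-- The difference quotients of the symbol are dominated through `|e^{iθ} - 1| ≤ |θ|`, which bounds
them by `|Λ|`. This is the derivative of the group at time 0 on Schwartz functions, seen on the
Fourier side. -/
theorem tendsto_slope_schPhase {Φ Λ : SchwartzMap (Space d) ℂ}
    (hΛa : ∀ ξ, Λ ξ = -(4 * Real.pi ^ 2 * ‖ξ‖ ^ 2 : ℝ) * Φ ξ) :
    Filter.Tendsto (fun h => ((memLp_slope_schPhase Φ h).toLp _ : L2 d)) (𝓝[≠] (0 : ℝ))
      (𝓝 ((memLp_I_mul Λ).toLp _)) := by
  have hder : ∀ ξ : Space d, HasDerivAt (fun h : ℝ =>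
      Complex.exp (Complex.I * (schPhase h ξ : ℝ)) * Φ ξ) (Complex.I * Λ ξ) 0 := by
    intro ξ
    have h1 : HasDerivAt (fun h : ℝ => Complex.I * (schPhase h ξ : ℂ))
        (Complex.I * (-(4 * Real.pi ^ 2 * ‖ξ‖ ^ 2 : ℝ) : ℂ)) 0 := by
      have h2 : HasDerivAt (fun h : ℝ => schPhase h ξ) (-(4 * Real.pi ^ 2 * ‖ξ‖ ^ 2)) 0 := by
        have := (hasDerivAt_id (0 : ℝ)).const_mul (-(4 * Real.pi ^ 2 * ‖ξ‖ ^ 2))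
        rw [mul_one] at this
        refine this.congr_of_eventuallyEq (Filter.Eventually.of_forall fun h => ?_)
        simp only [schPhase, id]; ring
      have := h2.ofReal_comp.const_mul Complex.I
      rwa [Complex.ofReal_neg] at this
    have h3 := h1.cexp.mul_const (Φ ξ)
    have e : Complex.exp (Complex.I * (schPhase 0 ξ : ℂ)) = 1 := by simp [schPhase]
    rw [e, one_mul, mul_assoc] at h3
    rw [hΛa]
    exact h3
  refine tendsto_toLp_of_dominated (memLp_slope_schPhase Φ) (memLp_I_mul Λ)
    (b := fun ξ => 2 * ‖Λ ξ‖) (by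
      have : MemLp (fun ξ => 2 * Λ ξ) 2 := (Λ.memLp 2).const_mul 2
      have := ((memLp_two_iff_lintegral).1 this).2.ne
      refine ne_of_eq_of_ne ?_ this
      congr 1
      funext ξ
      rw [← ofReal_norm, norm_mul]
      simp) (by
      filter_upwards [self_mem_nhdsWithin] with h hh
      refine Filter.Eventually.of_forall fun ξ => ?_
      have hh0 : 0 < |h| := abs_pos.2 hh
      have h1 : ‖(h : ℂ)⁻¹ * (Complex.exp (Complex.I * (schPhase h ξ : ℝ)) * Φ ξ - Φ ξ)‖ ≤
          ‖Λ ξ‖ := by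
        rw [← sub_one_mul, norm_mul, norm_mul, norm_inv, Complex.norm_real, Real.norm_eq_abs,
          hΛa, norm_mul, norm_neg, Complex.norm_real, Real.norm_of_nonneg (by positivity)]
        have h2 : ‖Complex.exp (Complex.I * (schPhase h ξ : ℝ)) - 1‖ ≤ |schPhase h ξ| := by
          have := Real.norm_exp_I_mul_ofReal_sub_one_le (x := schPhase h ξ)
          simpa using this
        have h3 : |schPhase h ξ| = |h| * (4 * Real.pi ^ 2 * ‖ξ‖ ^ 2) := by
          have : schPhase h ξ = -(h * (4 * Real.pi ^ 2 * ‖ξ‖ ^ 2)) := by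
            simp only [schPhase]; ring
          rw [this, abs_neg, abs_mul, abs_of_nonneg (by positivity : 0 ≤ 4 * Real.pi ^ 2 * ‖ξ‖ ^ 2)]
        calc |h|⁻¹ * (‖Complex.exp (Complex.I * (schPhase h ξ : ℝ)) - 1‖ * ‖Φ ξ‖)
            ≤ |h|⁻¹ * (|h| * (4 * Real.pi ^ 2 * ‖ξ‖ ^ 2) * ‖Φ ξ‖) := by
              rw [← h3]; gcongr
          _ = 4 * Real.pi ^ 2 * ‖ξ‖ ^ 2 * ‖Φ ξ‖ := by
              field_simp
      refine (norm_sub_le _ _).trans ?_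
      have h5 : ‖Complex.I * Λ ξ‖ = ‖Λ ξ‖ := by rw [norm_mul, Complex.norm_I, one_mul]
      rw [h5]
      linarith) (by
      refine Filter.Eventually.of_forall fun ξ => ?_
      have := (hasDerivAt_iff_tendsto_slope_zero.1 (hder ξ))
      refine this.congr fun h => ?_
      rw [zero_add, Complex.real_smul, Complex.ofReal_inv]
      congr 2
      simp [schPhase])

theorem fourier_sch (t : ℝ) (F : L2 d) :
    𝓕 (sch t F) = mulPhase (schPhase t) (continuous_schPhase t) (𝓕 F) :=
  fourier_fourierPhase _ _ _

theorem fourier_L2_sub (F G : L2 d) : (𝓕 (F - G) : L2 d) = 𝓕 F - 𝓕 G :=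
  map_sub (Lp.fourierTransformₗᵢ (Space d) ℂ) F G

theorem fourier_slope_sch (h : ℝ) (F : L2 d) :
    (𝓕 (h⁻¹ • (sch (0 + h) F - sch 0 F)) : L2 d) =
      ((h⁻¹ : ℝ) : ℂ) • (mulPhase (schPhase h) (continuous_schPhase h) (𝓕 F) - 𝓕 F) := by
  rw [zero_add, sch_zero, ← fourier_sch, ← fourier_L2_sub]
  exact (Lp.fourierTransformₗᵢ (Space d) ℂ).map_smul ((h⁻¹ : ℝ) : ℂ) (sch h F - F)

theorem hasDerivAt_sch_zero (f : SchwartzMap (Space d) ℂ) :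
    HasDerivAt (fun h : ℝ => (sch h (f.toLp 2) : L2 d))
      (Complex.I • ((Laplacian.laplacian f : SchwartzMap (Space d) ℂ).toLp 2 : L2 d)) 0 := by
  obtain ⟨Φ, hΦ⟩ : ∃ Φ : SchwartzMap (Space d) ℂ, Φ = 𝓕 f := ⟨_, rfl⟩
  obtain ⟨Λ, hΛ⟩ : ∃ Λ : SchwartzMap (Space d) ℂ,
      Λ = 𝓕 (Laplacian.laplacian f : SchwartzMap (Space d) ℂ) := ⟨_, rfl⟩
  have hΛa : ∀ ξ, Λ ξ = -(4 * Real.pi ^ 2 * ‖ξ‖ ^ 2 : ℝ) * Φ ξ := by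
    rw [hΛ, hΦ]; exact fourier_laplacian_apply f
  rw [hasDerivAt_iff_tendsto_slope_zero]
  refine tendsto_of_fourier ?_
  have e0 : (𝓕 (Complex.I • ((Laplacian.laplacian f : SchwartzMap (Space d) ℂ).toLp 2 : L2 d)) :
      L2 d) = (memLp_I_mul Λ).toLp _ := by
    rw [FourierTransform.fourier_smul, SchwartzMap.toLp_fourier_eq, ← hΛ]
    ext1
    filter_upwards [(memLp_I_mul Λ).coeFn_toLp, Lp.coeFn_smul Complex.I (Λ.toLp 2 : L2 d),
      Λ.coeFn_toLp 2 volume] with ξ h1 h2 h3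
    rw [h1, h2, Pi.smul_apply, h3, smul_eq_mul]
  rw [e0]
  refine (tendsto_slope_schPhase hΛa).congr fun h => ?_
  have hX : (Φ.toLp 2 : L2 d) =ᵐ[volume] Φ := Φ.coeFn_toLp 2 volume
  rw [fourier_slope_sch, SchwartzMap.toLp_fourier_eq, ← hΦ]
  generalize (Φ.toLp 2 : L2 d) = X at hX ⊢
  ext1
  filter_upwards [(memLp_slope_schPhase Φ h).coeFn_toLp, Lp.coeFn_smul ((h⁻¹ : ℝ) : ℂ)
    (mulPhase (schPhase h) (continuous_schPhase h) X - X),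
    Lp.coeFn_sub (mulPhase (schPhase h) (continuous_schPhase h) X) X,
    mulPhase_coe (schPhase h) (continuous_schPhase h) X, hX]
    with ξ h1 h2 h3 h4 h5
  rw [h1, h2, Pi.smul_apply, h3, Pi.sub_apply, h4, h5, smul_eq_mul, Complex.ofReal_inv]

end NLSTrain
end

open scoped ENNReal Topology
noncomputable section
namespace NLSTrain
open MeasureTheory FourierTransform

variable {d : ℕ}

/-! ### Differentiating pairings with Duhamel integrals -/

section Group

variable {E : Type*} [NormedAddCommGroup E] [InnerProductSpace ℂ E] {S : ℝ → E →ₗᵢ[ℂ] E}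

theorem isometry_map_real_smul (T : E →ₗᵢ[ℂ] E) (r : ℝ) (z : E) : T (r • z) = r • T z := by
  rw [← Complex.coe_smul, map_smul, Complex.coe_smul]

/-- A product rule in which the orbit only through the single vector `k t` is assumed
differentiable. The increment of `k` is handled by joint strong continuity, the increment of the
group by the group law and the derivative of that orbit at 0. -/
theorem hasDerivAt_neg_group_apply (hS : Continuous fun p : ℝ × E => S p.1 p.2)
    (hadd : ∀ s t z, S (s + t) z = S s (S t z)) (h0 : ∀ z, S 0 z = z) {k : ℝ → E} {k1 Z : E} {t : ℝ}
    (hk : HasDerivAt k k1 t) (hB : HasDerivAt (fun h => S h (k t)) (Complex.I • Z) 0) :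
    HasDerivAt (fun τ => S (-τ) (k τ)) (S (-t) (k1 - Complex.I • Z)) t := by
  rw [hasDerivAt_iff_tendsto_slope_zero] at hB ⊢
  have hneg : Filter.Tendsto (fun h : ℝ => -h) (𝓝[≠] 0) (𝓝[≠] 0) := by
    refine tendsto_nhdsWithin_iff.2 ⟨?_, ?_⟩
    · have : Filter.Tendsto (fun h : ℝ => -h) (𝓝 0) (𝓝 (-0)) := continuous_neg.tendsto 0
      rw [neg_zero] at this
      exact this.mono_left nhdsWithin_le_nhds
    · filter_upwards [self_mem_nhdsWithin] with h hh
      simpa using hh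
  have hA := hasDerivAt_iff_tendsto_slope_zero.1 hk
  have hA' : Filter.Tendsto (fun h : ℝ => S (-(t + h)) (h⁻¹ • (k (t + h) - k t))) (𝓝[≠] 0)
      (𝓝 (S (-t) k1)) := by
    have h1 : Filter.Tendsto (fun h : ℝ => -(t + h)) (𝓝[≠] 0) (𝓝 (-t)) := by
      have : Filter.Tendsto (fun h : ℝ => -(t + h)) (𝓝 0) (𝓝 (-(t + 0))) :=
        (by fun_prop : Continuous fun h : ℝ => -(t + h)).tendsto 0
      rw [add_zero] at this
      exact this.mono_left nhdsWithin_le_nhds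
    exact (hS.tendsto (-t, k1)).comp (h1.prodMk_nhds hA)
  have hB' : Filter.Tendsto (fun h : ℝ => S (-t) (-((-h)⁻¹ • (S (0 + -h) (k t) - S 0 (k t)))))
      (𝓝[≠] 0) (𝓝 (S (-t) (-(Complex.I • Z)))) :=
    ((S (-t)).continuous.tendsto _).comp (hB.comp hneg).neg
  have hsum := hA'.add hB'
  rw [← map_add, ← sub_eq_add_neg] at hsum
  refine hsum.congr fun h => ?_
  rw [inv_neg, neg_smul, neg_neg, zero_add, h0, isometry_map_real_smul, isometry_map_real_smul,
    ← smul_add, map_sub, map_sub, ← hadd, neg_add]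
  congr 1
  abel

variable [CompleteSpace E]

/-- Pulled back by the group, the Duhamel integral becomes `-i ∫_t^∞ S(-s) F(s) ds`, to which the
fundamental theorem of calculus applies. -/
theorem hasDerivAt_neg_group_duhamel (hS : Continuous fun p : ℝ × E => S p.1 p.2)
    (hadd : ∀ s t z, S (s + t) z = S s (S t z)) {F : ℝ → E} (hF : Continuous F) {A μ : ℝ}
    (hμ : 1 ≤ μ) (hA : 0 ≤ A) (hb : ∀ t, ‖F t‖ ≤ A * Real.exp (-(μ * t))) (t : ℝ) :
    HasDerivAt (fun τ => S (-τ) (duhamel S F τ)) (Complex.I • S (-t) (F t)) t := by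
  set G : ℝ → E := fun s => S (-s) (F s) with hG
  have hEc : Continuous G := hS.comp (by fun_prop : Continuous fun s : ℝ => (-s, F s))
  have hEi : IntegrableOn G (Set.Ioi 0) := by
    have := integrableOn_duhamel hS hF (t := 0) hμ hA fun τ _ => hb _
    simpa [hG] using this
  have hYu : ∀ t, S (-t) (duhamel S F t) =
      (-Complex.I) • ((∫ s in Set.Ioi (0 : ℝ), G s) - ∫ s in (0 : ℝ)..t, G s) := by
    intro t
    have hint := integrableOn_duhamel hS hF (t := t) hμ hA fun τ _ => hb _
    have e1 : S (-t) (∫ τ in Set.Ioi (0 : ℝ), S (-τ) (F (t + τ))) =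
        ∫ τ in Set.Ioi (0 : ℝ), G (t + τ) := by
      refine ((S (-t)).toContinuousLinearMap.integral_comp_comm hint).symm.trans ?_
      congr 1
      funext τ
      change S (-t) (S (-τ) (F (t + τ))) = _
      rw [← hadd]
      simp only [hG]
      congr 2
      ring
    have e2 : ∫ τ in Set.Ioi (0 : ℝ), G (t + τ) = ∫ s in Set.Ioi t, G s := by
      rw [← integral_indicator measurableSet_Ioi, ← integral_indicator measurableSet_Ioi,
        ← integral_add_left_eq_self (fun s => (Set.Ioi t).indicator G s) t]
      congr 1
      funext τ
      by_cases h : 0 < τ <;> simp [Set.indicator, h]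
    have hEt : IntegrableOn G (Set.Ioi t) := by
      by_cases h : 0 ≤ t
      · exact hEi.mono_set (Set.Ioi_subset_Ioi h)
      · rw [← Set.Ioc_union_Ioi_eq_Ioi (not_le.1 h).le]
        exact (hEc.integrableOn_Ioc).union hEi
    rw [duhamel, map_smul, e1, e2, ← intervalIntegral.integral_interval_add_Ioi hEi hEt,
      add_sub_cancel_left]
  have h1 := intervalIntegral.integral_hasDerivAt_right (hEc.intervalIntegrable 0 t)
      (hEc.stronglyMeasurableAtFilter _ _) hEc.continuousAt
  have h2 := (h1.const_sub (∫ s in Set.Ioi (0 : ℝ), G s)).const_smul (-Complex.I)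
  have e : -Complex.I • -G t = Complex.I • G t := by rw [smul_neg, neg_smul, neg_neg]
  rw [e] at h2
  exact h2.congr_of_eventuallyEq (Filter.Eventually.of_forall hYu)

/-- The Duhamel integral itself need not be differentiable in the norm, but isometry allows both
entries to be replaced by their pullbacks under `S (-t)`, and those are differentiable. -/
theorem hasDerivAt_inner_duhamel (hS : Continuous fun p : ℝ × E => S p.1 p.2)
    (hadd : ∀ s t z, S (s + t) z = S s (S t z)) (h0 : ∀ z, S 0 z = z) {F : ℝ → E}
    (hF : Continuous F) {A μ : ℝ}
    (hμ : 1 ≤ μ) (hA : 0 ≤ A) (hb : ∀ t, ‖F t‖ ≤ A * Real.exp (-(μ * t))) {k : ℝ → E} {k1 Z : E}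
    {t : ℝ} (hk : HasDerivAt k k1 t) (hB : HasDerivAt (fun h => S h (k t)) (Complex.I • Z) 0) :
    HasDerivAt (fun t => inner ℂ (k t) (duhamel S F t))
      (Complex.I * (-Complex.I * inner ℂ k1 (duhamel S F t) + inner ℂ Z (duhamel S F t) +
        inner ℂ (k t) (F t))) t := by
  have h := (hasDerivAt_neg_group_apply hS hadd h0 hk hB).inner ℂ
    (hasDerivAt_neg_group_duhamel hS hadd hF hμ hA hb t)
  simp only [LinearIsometry.inner_map_map] at h
  refine h.congr_deriv ?_
  rw [inner_smul_right, LinearIsometry.inner_map_map, inner_sub_left, inner_smul_left,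
    Complex.conj_I]
  linear_combination (inner ℂ k1 (duhamel S F t)) * Complex.I_sq

end Group

/-- The complex conjugate of a time slice of a test function, as an element of `L²`. -/
def sliceLp {χ : ℝ × Space d → ℂ} (hχ : Continuous χ) (hc : HasCompactSupport χ) (t : ℝ) : L2 d :=
  MemLp.toLp (fun x => (starRingEnd ℂ) (χ (t, x)))
    ((Complex.continuous_conj.comp (hχ.comp (by fun_prop : Continuous fun x : Space d => (t, x))
      )).memLp_of_hasCompactSupport
      ((HasCompactSupport.intro (f := fun x => χ (t, x)) (hc.image continuous_snd) fun x hx =>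
        image_eq_zero_of_notMem_tsupport fun hm => hx ⟨_, hm, rfl⟩).comp_left (map_zero _)))

theorem sliceLp_coe {χ : ℝ × Space d → ℂ} (hχ : Continuous χ) (hc : HasCompactSupport χ) (t : ℝ) :
    sliceLp hχ hc t =ᵐ[volume] fun x => (starRingEnd ℂ) (χ (t, x)) :=
  MemLp.coeFn_toLp _

theorem inner_sliceLp {χ : ℝ × Space d → ℂ} (hχ : Continuous χ) (hc : HasCompactSupport χ) (t : ℝ)
    (f : L2 d) : inner ℂ (sliceLp hχ hc t) f = ∫ x, f x * χ (t, x) := by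
  rw [L2.inner_def]
  refine integral_congr_ae ?_
  filter_upwards [sliceLp_coe hχ hc t] with x hx
  rw [RCLike.inner_apply, hx, Complex.conj_conj]

theorem hasDerivAt_sliceLp {ψ : ℝ × Space d → ℂ} (hψ : ContDiff ℝ (⊤ : ℕ∞) ψ)
    (hs : HasCompactSupport ψ) (t : ℝ) :
    HasDerivAt (sliceLp hψ.continuous hs)
      (sliceLp (contDiff_fderiv_apply hψ (1, 0)).continuous
        (hasCompactSupport_fderiv_apply hs (1, 0)) t) t := by
  set c1 := (contDiff_fderiv_apply hψ ((1 : ℝ), (0 : Space d))).continuous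
  set s1 := hasCompactSupport_fderiv_apply hs ((1 : ℝ), (0 : Space d))
  obtain ⟨M, hM⟩ := s1.exists_bound_of_continuous c1
  have hM0 : 0 ≤ M := (norm_nonneg _).trans (hM 0)
  set K : Set (Space d) := Prod.snd '' tsupport ψ with hK
  have hKc : IsCompact K := hs.image continuous_snd
  have hz : ∀ (τ : ℝ) (x : Space d), x ∉ K → ψ (τ, x) = 0 := fun τ x hx =>
    image_eq_zero_of_notMem_tsupport fun hm => hx ⟨_, hm, rfl⟩
  have hz1 : ∀ (τ : ℝ) (x : Space d), x ∉ K → fderiv ℝ ψ (τ, x) (1, 0) = 0 := by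
    intro τ x hx
    have : fderiv ℝ ψ (τ, x) = 0 := by
      by_contra hne
      exact hx ⟨_, support_fderiv_subset ℝ hne, rfl⟩
    rw [this]; rfl
  rw [hasDerivAt_iff_tendsto_slope_zero]
  have hmem : ∀ h : ℝ, MemLp (fun x : Space d => (h : ℂ)⁻¹ *
      ((starRingEnd ℂ) (ψ (t + h, x)) - (starRingEnd ℂ) (ψ (t, x)))) 2 := by
    intro h
    have h1 := (Lp.memLp (sliceLp hψ.continuous hs (t + h))).ae_eq (sliceLp_coe hψ.continuous hs _)
    have h2 := (Lp.memLp (sliceLp hψ.continuous hs t)).ae_eq (sliceLp_coe hψ.continuous hs _)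
    exact (h1.sub h2).const_mul _
  have hmem0 : MemLp (fun x : Space d => (starRingEnd ℂ) (fderiv ℝ ψ (t, x) (1, 0))) 2 :=
    (Lp.memLp (sliceLp c1 s1 t)).ae_eq (sliceLp_coe c1 s1 t)
  have hlim := tendsto_toLp_of_dominated (l := 𝓝[≠] (0 : ℝ)) hmem hmem0
    (b := K.indicator fun _ => 2 * M) (by
      have : ∀ x, ENNReal.ofReal (K.indicator (fun _ => 2 * M) x) ^ (2 : ℝ) =
          K.indicator (fun _ => ENNReal.ofReal (2 * M) ^ (2 : ℝ)) x := by
        intro x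
        by_cases hx : x ∈ K <;> simp [hx]
      simp only [this]
      rw [lintegral_indicator hKc.measurableSet, setLIntegral_const]
      exact ENNReal.mul_ne_top (ENNReal.rpow_ne_top_of_nonneg (by norm_num) ENNReal.ofReal_ne_top)
        hKc.measure_lt_top.ne) (by
      refine Filter.Eventually.of_forall fun h => Filter.Eventually.of_forall fun x => ?_
      by_cases hx : x ∈ K
      · rw [Set.indicator_of_mem hx]
        have h1 : ‖ψ (t + h, x) - ψ (t, x)‖ ≤ M * ‖(t + h) - t‖ :=
          Convex.norm_image_sub_le_of_norm_hasDerivWithin_le (s := Set.univ)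
            (f := fun τ => ψ (τ, x)) (f' := fun τ => fderiv ℝ ψ (τ, x) (1, 0))
            (fun τ _ => (hasDerivAt_time_slice hψ (τ, x)).hasDerivWithinAt) (fun τ _ => hM _)
            convex_univ trivial trivial
        rw [add_sub_cancel_left] at h1
        have h2 : ‖(h : ℂ)⁻¹ *
            ((starRingEnd ℂ) (ψ (t + h, x)) - (starRingEnd ℂ) (ψ (t, x)))‖ ≤ M := by
          rw [← map_sub, norm_mul, RCLike.norm_conj, norm_inv, Complex.norm_real]
          by_cases hh : h = 0
          · simp [hh, hM0]
          · have : 0 < ‖h‖ := norm_pos_iff.2 hh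
            calc _ ≤ ‖h‖⁻¹ * (M * ‖h‖) := by gcongr
              _ = M := by field_simp
        refine (norm_sub_le _ _).trans ?_
        have h3 : ‖(starRingEnd ℂ) (fderiv ℝ ψ (t, x) (1, 0))‖ ≤ M := by
          rw [RCLike.norm_conj]; exact hM _
        linarith
      · rw [Set.indicator_of_notMem hx, hz _ _ hx, hz _ _ hx, hz1 _ _ hx]
        simp) (by
      refine Filter.Eventually.of_forall fun x => ?_
      have h1 := hasDerivAt_iff_tendsto_slope_zero.1 (hasDerivAt_time_slice hψ (t, x))
      have h2 := (Complex.continuous_conj.tendsto _).comp h1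
      refine h2.congr fun h => ?_
      simp only [Function.comp_apply, Complex.real_smul, map_mul, map_sub, Complex.conj_ofReal,
        Complex.ofReal_inv, map_inv₀])
  refine (hlim.congr fun h => ?_)
  ext1
  filter_upwards [(hmem h).coeFn_toLp, Lp.coeFn_smul (h⁻¹ : ℝ)
    (sliceLp hψ.continuous hs (t + h) - sliceLp hψ.continuous hs t),
    Lp.coeFn_sub (sliceLp hψ.continuous hs (t + h)) (sliceLp hψ.continuous hs t),
    sliceLp_coe hψ.continuous hs (t + h), sliceLp_coe hψ.continuous hs t] with x h1 h2 h3 h4 h5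
  rw [h1, h2, Pi.smul_apply, h3, Pi.sub_apply, h4, h5, Complex.real_smul, Complex.ofReal_inv]

theorem hasDerivAt_sch_sliceLp {ψ : ℝ × Space d → ℂ} (hψ : ContDiff ℝ (⊤ : ℕ∞) ψ)
    (hs : HasCompactSupport ψ) (t : ℝ) :
    HasDerivAt (fun h : ℝ => sch h (sliceLp hψ.continuous hs t))
      (Complex.I • sliceLp (contDiff_spaceLaplacian hψ).continuous
            (hasCompactSupport_spaceLaplacian hs) t) 0 := by
  have hsl : ContDiff ℝ (⊤ : ℕ∞) fun x => (starRingEnd ℂ) (ψ (t, x)) :=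
    (Complex.conjCLE.contDiff).comp (contDiff_slice hψ t)
  have hsc : HasCompactSupport fun x => (starRingEnd ℂ) (ψ (t, x)) :=
    (HasCompactSupport.intro (f := fun x => ψ (t, x)) (hs.image continuous_snd) fun x hx =>
        image_eq_zero_of_notMem_tsupport fun hm => hx ⟨_, hm, rfl⟩).comp_left (map_zero _)
  set f : SchwartzMap (Space d) ℂ := hsc.toSchwartzMap hsl with hf
  have hfk : f.toLp 2 = sliceLp hψ.continuous hs t := by
    ext1
    filter_upwards [f.coeFn_toLp 2 volume, sliceLp_coe hψ.continuous hs t] with x h1 h2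
    rw [h1, h2]
    rfl
  have hfk2 : (Laplacian.laplacian f : SchwartzMap (Space d) ℂ).toLp 2 = sliceLp (contDiff_spaceLaplacian hψ).continuous (hasCompactSupport_spaceLaplacian hs) t := by
    ext1
    filter_upwards [(Laplacian.laplacian f : SchwartzMap (Space d) ℂ).coeFn_toLp 2 volume,
      sliceLp_coe (contDiff_spaceLaplacian hψ).continuous
        (hasCompactSupport_spaceLaplacian hs) t] with x h1 h2
    rw [h1, h2, SchwartzMap.laplacian_apply, ← laplacian_slice hψ]
    have := ContDiffAt.laplacian_CLM_comp_left (l := (Complex.conjCLE : ℂ →L[ℝ] ℂ))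
      ((contDiff_infty.1 (contDiff_slice hψ t) 2).contDiffAt (x := x))
    exact this
  have hB := hasDerivAt_sch_zero f
  rwa [hfk, hfk2] at hB

/-- The pairing of the Duhamel integral with the slices of `ψ` has compact support in time, and its
derivative is `i` times the integrand, so the integral vanishes. No sign condition on the support of
`ψ` is needed, as the source is defined for all times. -/
theorem integral_test_duhamel {F : ℝ → L2 d} (hF : Continuous F) {A μ : ℝ} (hμ : 1 ≤ μ)
    (hA : 0 ≤ A) (hb : ∀ t, ‖F t‖ ≤ A * Real.exp (-(μ * t))) {ψ : ℝ × Space d → ℂ}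
    (hψ : ContDiff ℝ (⊤ : ℕ∞) ψ) (hs : HasCompactSupport ψ) :
    ∫ t, ((∫ x, duhamel sch F t x * (-Complex.I * fderiv ℝ ψ (t, x) (1, 0) +
      spaceLaplacian ψ (t, x))) + ∫ x, F t x * ψ (t, x)) = 0 := by
  set u := duhamel sch F with hu
  set k := sliceLp hψ.continuous hs with hk
  set k1 := sliceLp (contDiff_fderiv_apply hψ ((1 : ℝ), (0 : Space d))).continuous
        (hasCompactSupport_fderiv_apply hs (1, 0)) with hk1
  set k2 := sliceLp (contDiff_spaceLaplacian hψ).continuous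
            (hasCompactSupport_spaceLaplacian hs) with hk2
  have huc : Continuous u := continuous_duhamel continuous_sch_uncurry hF hμ hA hb
  set q : ℝ → ℂ := fun t => inner ℂ (k t) (u t) with hq
  set J : ℝ → ℂ := fun t => (∫ x, u t x * (-Complex.I * fderiv ℝ ψ (t, x) (1, 0) +
      spaceLaplacian ψ (t, x))) + ∫ x, F t x * ψ (t, x) with hJdef
  have hJ : ∀ t, J t = -Complex.I * inner ℂ (k1 t) (u t) + inner ℂ (k2 t) (u t) +
      inner ℂ (k t) (F t) := by
    intro t
    have i1 : Integrable fun x => u t x * fderiv ℝ ψ (t, x) (1, 0) := by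
      have := L2.integrable_inner (𝕜 := ℂ) (k1 t) (u t)
      refine this.congr ?_
      filter_upwards [sliceLp_coe (contDiff_fderiv_apply hψ ((1 : ℝ), (0 : Space d))).continuous
        (hasCompactSupport_fderiv_apply hs (1, 0)) t] with x hx
      rw [RCLike.inner_apply, hk1, hx, Complex.conj_conj]
    have i2 : Integrable fun x => u t x * spaceLaplacian ψ (t, x) := by
      have := L2.integrable_inner (𝕜 := ℂ) (k2 t) (u t)
      refine this.congr ?_
      filter_upwards [sliceLp_coe (contDiff_spaceLaplacian hψ).continuous
        (hasCompactSupport_spaceLaplacian hs) t] with x hx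
      rw [RCLike.inner_apply, hk2, hx, Complex.conj_conj]
    simp only [hJdef]
    rw [inner_sliceLp, inner_sliceLp, inner_sliceLp, ← integral_const_mul,
      ← integral_add (i1.const_mul _) i2]
    congr 2
    funext x
    ring
  have hqd : ∀ t, HasDerivAt q (Complex.I * J t) t := fun t => by
    rw [hJ]
    exact hasDerivAt_inner_duhamel continuous_sch_uncurry sch_add sch_zero hF hμ hA hb
      (hasDerivAt_sliceLp hψ hs t) (hasDerivAt_sch_sliceLp hψ hs t)
  have hqi : Integrable q := by
    have hqc : Continuous q :=
      continuous_iff_continuousAt.2 fun t => (hqd t).continuousAt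
    refine hqc.integrable_of_hasCompactSupport
      (HasCompactSupport.intro (hs.image continuous_fst) fun t ht => ?_)
    simp only [hq]
    rw [inner_sliceLp]
    refine integral_eq_zero_of_ae (Filter.Eventually.of_forall fun x => ?_)
    have : ψ (t, x) = 0 := image_eq_zero_of_notMem_tsupport fun hm => ht ⟨_, hm, rfl⟩
    simp [this]
  have hJi : Integrable J := by
    have ck : Continuous k :=
      continuous_iff_continuousAt.2 fun t => (hasDerivAt_sliceLp hψ hs t).continuousAt
    have ck1 : Continuous k1 := continuous_iff_continuousAt.2 fun t =>
      (hasDerivAt_sliceLp (contDiff_fderiv_apply hψ (1, 0))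
        (hasCompactSupport_fderiv_apply hs (1, 0)) t).continuousAt
    have ck2 : Continuous k2 := continuous_iff_continuousAt.2 fun t =>
      (hasDerivAt_sliceLp (contDiff_spaceLaplacian hψ)
        (hasCompactSupport_spaceLaplacian hs) t).continuousAt
    have hJc : Continuous J := by
      have : J = fun t => -Complex.I * inner ℂ (k1 t) (u t) + inner ℂ (k2 t) (u t) +
        inner ℂ (k t) (F t) := funext hJ
      rw [this]
      fun_prop
    refine hJc.integrable_of_hasCompactSupport
      (HasCompactSupport.intro (hs.image continuous_fst) fun t ht => ?_)
    have hz : ∀ x, (t, x) ∉ tsupport ψ := fun x hm => ht ⟨_, hm, rfl⟩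
    have z1 : ∀ x, fderiv ℝ ψ (t, x) = 0 := fun x => by
      by_contra hne
      exact hz x (support_fderiv_subset ℝ hne)
    simp [hJdef, z1, image_eq_zero_of_notMem_tsupport (hz _),
      spaceLaplacian_eq_zero_of_notMem (hz _)]
  have h0 := integral_eq_zero_of_hasDerivAt_of_integrable hqd (hJi.const_mul Complex.I) hqi
  rw [integral_const_mul] at h0
  exact (mul_eq_zero.1 h0).resolve_left Complex.I_ne_zero

end NLSTrain
end

open scoped ENNReal Topology
noncomputable section
namespace NLSTrain
open MeasureTheory
open scoped Convolution

variable {d : ℕ}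

/-- A continuous curve in `L²` has a jointly measurable representative. -/
theorem exists_stronglyMeasurable_representative {u : ℝ → L2 d} (hu : Continuous u) :
    ∃ η : ℝ → Space d → ℂ, StronglyMeasurable (Function.uncurry η) ∧ ∀ t, η t =ᵐ[volume] u t := by
  let ρ : ℕ → ContDiffBump (0 : Space d) := fun n =>
    ⟨1 / (n + 1), 2 / (n + 1), by positivity, by gcongr; norm_num⟩
  have hρ : Filter.Tendsto (fun n => (ρ n).rOut) Filter.atTop (𝓝 0) := by
    have := (tendsto_one_div_add_atTop_nhds_zero_nat (𝕜 := ℝ)).const_mul 2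
    simpa [ρ, div_eq_mul_inv] using this
  -- Mollifications at a fixed scale are continuous in `x`, and continuous in `t` because they are
  -- inner products of `u t` with a fixed kernel. They are therefore jointly measurable, and so is
  -- their limit.
  set c : ℕ → ℝ → Space d → ℂ := fun n t =>
    ((ρ n).normed volume ⋆[ContinuousLinearMap.lsmul ℝ ℝ, volume] (u t : Space d → ℂ)) with hc
  have hloc : ∀ t, LocallyIntegrable (u t : Space d → ℂ) volume := fun t =>
    (Lp.memLp (u t)).locallyIntegrable (by norm_num)
  have hconv : ∀ t, ∀ᵐ x, Filter.Tendsto (fun n => c n t x) Filter.atTop (𝓝 (u t x)) := fun t =>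
    ContDiffBump.ae_convolution_tendsto_right_of_locallyIntegrable (K := 2) hρ
      (Filter.Eventually.of_forall fun n => by simp only [ρ]; rw [mul_one_div]) (hloc t)
  have hcx : ∀ n t, Continuous (c n t) := fun n t =>
    (ρ n).hasCompactSupport_normed.continuous_convolution_left _ (ρ n).continuous_normed (hloc t)
  have hct : ∀ n x, Continuous fun t => c n t x := by
    intro n x
    have hk : MemLp (fun y : Space d => (((ρ n).normed volume (x - y) : ℝ) : ℂ)) 2 := by
      refine Continuous.memLp_of_hasCompactSupport ?_ ?_
      · have := (ρ n).continuous_normed (μ := (volume : Measure (Space d)))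
        fun_prop
      · exact (((ρ n).hasCompactSupport_normed (μ := (volume : Measure (Space d)))).comp_homeomorph
          (Homeomorph.subLeft x)).comp_left (g := fun r : ℝ => (r : ℂ)) Complex.ofReal_zero
    have e : (fun t => c n t x) = fun t => inner ℂ (hk.toLp _ : L2 d) (u t) := by
      funext t
      rw [L2.inner_def]
      simp only [hc]
      rw [convolution_eq_swap]
      refine integral_congr_ae ?_
      filter_upwards [hk.coeFn_toLp] with y hy
      rw [RCLike.inner_apply, hy, Complex.conj_ofReal, ContinuousLinearMap.lsmul_apply,
        Complex.real_smul, mul_comm]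
    rw [e]
    fun_prop
  have hmeas : ∀ n, StronglyMeasurable (Function.uncurry (c n)) := fun n =>
    stronglyMeasurable_uncurry_of_continuous_of_stronglyMeasurable (hct n)
      fun t => (hcx n t).stronglyMeasurable
  refine ⟨fun t x => Filter.limUnder Filter.atTop fun n => c n t x,
    StronglyMeasurable.limUnder (l := Filter.atTop) hmeas, fun t => ?_⟩
  filter_upwards [hconv t] with x hx
  exact hx.limUnder_eq

end NLSTrain
end

open scoped ENNReal Topology
noncomputable section
namespace NLSTrain
open MeasureTheory

variable {d : ℕ}

/-! ### Exponents -/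

/-- Exponents used in the fixed point argument: `β` is the integrability gain, `s < s'` are
Hölder exponents, `x0` and `x1` measure the size of the train and of its increments and `Y` is an
integrability threshold. -/
structure Exponents (d : ℕ) (α β s s' x0 x1 Y : ℝ) : Prop where
  β_pos : 0 < β
  β_le_one : β ≤ 1
  β_le : β ≤ α
  β_dim : (d : ℝ) * β / 2 < 1
  s_lower : (d : ℝ) * (1 - β) / 4 < s / 2
  s_pos : 0 < s
  s_lt : s < s'
  s'_le : s' ≤ 1
  x1_pos : 0 < x1
  x1_le : x1 ≤ x0
  x0_lt : x0 < 1 / α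
  x1_lt : x1 < 1 / α - s' / 2
  Y_gt : (d : ℝ) / 2 < Y
  source : Y * (1 + β) ≤ 2 * (α * x0 + x1)
  power : Y * (1 + β - min α (1 + β)) ≤ 2 * x1
  mixed : Y * (1 + β - min α 1) ≤ 2 * ((α - min α 1) * x0 + x1)
  potential : Y * β ≤ 2 * (α * x0)

/-- All required inequalities are strict at the limiting values `s = s' = d(1-β)/2`, `x0 = 1/α`, `x1
= 1/α - s'/2`, `Y = d/2`, or are recovered with strictness by the perturbation in `ε`. Hence only
`β` needs an explicit choice. -/
theorem exists_exponents {α : ℝ} (hα : 0 < α)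
    (hcond : d = 1 ∨ ((d = 2 ∨ d = 3) ∧ 2 * (1 / 2 - 1 / (d : ℝ)) < α ∧ α < 2)) :
    ∃ β s s' x0 x1 Y : ℝ, Exponents d α β s s' x0 x1 Y := by
  obtain ⟨β, b0, b1, bα, bd, bs, bx, hα2, hd4⟩ : ∃ β : ℝ, 0 < β ∧ β ≤ 1 ∧ β ≤ α ∧
      (d : ℝ) * β / 2 < 1 ∧ (d : ℝ) * (1 - β) / 2 < 1 ∧ (d : ℝ) * (1 - β) / 4 < 1 / α ∧
      (d : ℝ) / 2 < 1 + 1 / α ∧ (d : ℝ) < 4 := by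
    -- Here `β ≤ α`, `dβ < 2` and `d(1-β) < 2` compete. In dimension 3 they force `1/3 < β < 2/3`,
    -- possible exactly because `α > 1/3`; `α < 2` provides `1/α > 1/2` for the remaining
    -- conditions. In lower dimensions a multiple of `min 1 α` works.
    rcases hcond with rfl | ⟨rfl | rfl, h1, h2⟩
    · refine ⟨min 1 α, by positivity, min_le_left _ _, min_le_right _ _, ?_, ?_, ?_, ?_, ?_⟩
      · have := min_le_left 1 α
        push_cast; linarith
      · have : 0 < min 1 α := by positivity
        push_cast; linarith
      · have hp : 0 < 1 / α := by positivity
        rcases le_total 1 α with h | h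
        · rw [min_eq_left h]; push_cast; linarith
        · rw [min_eq_right h]
          have : 1 ≤ 1 / α := by rw [le_div_iff₀ hα]; linarith
          push_cast; linarith
      · have hp : 0 < 1 / α := by positivity
        push_cast; linarith
      · norm_num
    · have hp : 1 / 2 < 1 / α := one_div_lt_one_div_of_lt hα h2
      have hm : 0 < min 1 α := by positivity
      have hm1 := min_le_left 1 α
      have hm2 := min_le_right 1 α
      refine ⟨min 1 α / 2, by positivity, by linarith, by linarith, ?_, ?_, ?_, ?_, ?_⟩ <;>
        push_cast <;> linarith
    · have hp : 1 / 2 < 1 / α := one_div_lt_one_div_of_lt hα h2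
      have h3 : (1 : ℝ) / 3 < α := by push_cast at h1; linarith
      obtain ⟨β, hβ1, hβ2⟩ := exists_between (lt_min (by norm_num : (1 : ℝ) / 3 < 2 / 3) h3)
      have hβ3 := hβ2.trans_le (min_le_left _ _)
      have hβ4 := hβ2.trans_le (min_le_right _ _)
      refine ⟨β, by linarith, by linarith, by linarith, ?_, ?_, ?_, ?_, ?_⟩ <;>
        push_cast <;> linarith
  have hd0 : (0 : ℝ) ≤ d := Nat.cast_nonneg d
  have hαi : α * (1 / α) = 1 := by field_simp
  -- A strict inequality between continuous functions of `ε` at `ε = 0` persists for small positive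
  -- `ε`.
  have key : ∀ {F G : ℝ → ℝ}, Continuous F → Continuous G → F 0 < G 0 →
      ∀ᶠ ε in 𝓝[>] (0 : ℝ), F ε < G ε := fun hF hG h =>
    (hF.continuousAt.eventually_lt hG.continuousAt h).filter_mono nhdsWithin_le_nhds
  set S : ℝ := (d : ℝ) * (1 - β) / 2 with hS
  have hS0 : 0 ≤ S := by have : 0 ≤ 1 - β := by linarith
                         positivity
  set m := min α 1 with hm
  have hm1 : m ≤ 1 := min_le_right _ _
  have hmα : m ≤ α := min_le_left _ _
  have k1 := key (F := fun ε => S + 2 * ε) (G := fun _ => 1) (by fun_prop) (by fun_prop)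
    (by simpa using bs)
  have k2 := key (F := fun _ => 0) (G := fun ε => 1 / α - (S + 2 * ε) / 2 - ε) (by fun_prop)
    (by fun_prop) (by simp only [hS]; linarith)
  have k3 := key (F := fun ε => ((d : ℝ) / 2 + ε) * (1 + β))
    (G := fun ε => 2 * (α * (1 / α - ε) + (1 / α - (S + 2 * ε) / 2 - ε))) (by fun_prop)
    (by fun_prop) (by simp only [sub_zero, hαi, hS]; linarith)
  have k4 := key (F := fun ε => ((d : ℝ) / 2 + ε) * (1 + β - α))
    (G := fun ε => 2 * (1 / α - (S + 2 * ε) / 2 - ε)) (by fun_prop)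
    -- At `ε = 0` the condition is `d(2-α)/4 < 1/α`, which follows from `α(2-α) ≤ 1` and `d < 4`.
    (by fun_prop) (by
      have : (d : ℝ) * (2 - α) / 4 < 1 / α := by
        rw [lt_div_iff₀ hα]
        nlinarith [sq_nonneg (α - 1)]
      simp only [hS]; linarith)
  have k5 := key (F := fun ε => ((d : ℝ) / 2 + ε) * (1 + β - m))
    (G := fun ε => 2 * ((α - m) * (1 / α - ε) + (1 / α - (S + 2 * ε) / 2 - ε))) (by fun_prop)
    (by fun_prop) (by
      have : (d : ℝ) * (2 - m) / 4 < (α - m) * (1 / α) + 1 / α := by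
        rw [← add_one_mul, mul_one_div, lt_div_iff₀ hα]
        rcases le_total α 1 with h | h
        · rw [hm, min_eq_left h]
          nlinarith [sq_nonneg (α - 1)]
        · rw [hm, min_eq_right h]
          nlinarith
      simp only [hS]; linarith)
  have k6 := key (F := fun ε => ((d : ℝ) / 2 + ε) * β) (G := fun ε => 2 * (α * (1 / α - ε)))
    (by fun_prop) (by fun_prop) (by simp only [sub_zero, hαi]; linarith)
  obtain ⟨ε, ⟨⟨⟨⟨⟨h1, h2⟩, h3⟩, h4⟩, h5⟩, h6⟩, hε⟩ :=
    ((((((k1.and k2).and k3).and k4).and k5).and k6).and self_mem_nhdsWithin).exists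
  have hε0 : 0 < ε := hε
  refine ⟨β, S + ε, S + 2 * ε, 1 / α - ε, 1 / α - (S + 2 * ε) / 2 - ε, d / 2 + ε, ?_⟩
  refine ⟨b0, b1, bα, bd, by linarith, by linarith, by linarith, h1.le, h2, by linarith,
    by linarith, by linarith, by linarith, h3.le, ?_, h5.le, h6.le⟩
  rcases le_total α (1 + β) with h | h
  · rw [min_eq_left h]; exact h4.le
  · rw [min_eq_right h, sub_self, mul_zero]; linarith

/-! ### A Lebesgue norm for nonnegative functions -/

/-- The `L^r` norm of a nonnegative function. -/
def lnorm (r : ℝ) (F : Space d → ℝ≥0∞) : ℝ≥0∞ := (∫⁻ x, F x ^ r) ^ (1 / r)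

theorem lnorm_mono_ae {r : ℝ} (hr : 0 ≤ r) {F G : Space d → ℝ≥0∞} (h : ∀ᵐ x, F x ≤ G x) :
    lnorm r F ≤ lnorm r G := by
  unfold lnorm
  refine ENNReal.rpow_le_rpow (lintegral_mono_ae ?_) (by positivity)
  filter_upwards [h] with x hx
  gcongr

theorem lnorm_add_le {r : ℝ} (hr : 1 ≤ r) {F G : Space d → ℝ≥0∞} (hF : AEMeasurable F)
    (hG : AEMeasurable G) : lnorm r (fun x => F x + G x) ≤ lnorm r F + lnorm r G :=
  ENNReal.lintegral_Lp_add_le hF hG hr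

theorem lnorm_const_mul {r : ℝ} (hr : 0 < r) {c : ℝ≥0∞} (hc : c ≠ ∞) (F : Space d → ℝ≥0∞) :
    lnorm r (fun x => c * F x) = c * lnorm r F := by
  unfold lnorm
  simp only [ENNReal.mul_rpow_of_nonneg _ _ hr.le]
  rw [lintegral_const_mul' _ _ (ENNReal.rpow_ne_top_of_nonneg hr.le hc),
    ENNReal.mul_rpow_of_nonneg _ _ (by positivity), ← ENNReal.rpow_mul, mul_one_div,
    div_self hr.ne', ENNReal.rpow_one]

theorem lintegral_le_of_lnorm_le {r : ℝ} (hr : 0 < r) {F : Space d → ℝ≥0∞} {B : ℝ≥0∞}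
    (h : lnorm r F ≤ B) : ∫⁻ x, F x ^ r ≤ B ^ r := by
  have := ENNReal.rpow_le_rpow h hr.le
  rwa [lnorm, ← ENNReal.rpow_mul, one_div_mul_cancel hr.ne', ENNReal.rpow_one] at this

theorem lnorm_two_coe (u : L2 d) : lnorm 2 (fun x => ‖u x‖ₑ) = ENNReal.ofReal ‖u‖ := by
  rw [lnorm, ← eLpNorm_two_eq, Lp.norm_def, ENNReal.ofReal_toReal (Lp.eLpNorm_ne_top u)]

/-- Hölder with exponents `(1+b)/b` and `1+b`, after raising to the power `2/(1+b)`: a power `b` of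
one `L²` function times another lies in `L^{2/(1+b)}`. -/
theorem lnorm_holder_two {b : ℝ} (hb : 0 ≤ b) {E G : Space d → ℝ≥0∞} (hE : AEMeasurable E)
    (hG : AEMeasurable G) :
    lnorm (2 / (1 + b)) (fun x => E x ^ b * G x) ≤ lnorm 2 E ^ b * lnorm 2 G := by
  have h1b : 0 < 1 + b := by linarith
  have h := ENNReal.lintegral_mul_norm_pow_le (μ := (volume : Measure (Space d)))
    (hE.pow_const (2 : ℝ)) (hG.pow_const (2 : ℝ)) (p := b / (1 + b)) (q := 1 / (1 + b))
    (by positivity) (by positivity) (by field_simp; ring)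
  have e : ∀ x, (E x ^ b * G x) ^ (2 / (1 + b)) =
      (E x ^ (2 : ℝ)) ^ (b / (1 + b)) * (G x ^ (2 : ℝ)) ^ (1 / (1 + b)) := by
    intro x
    rw [ENNReal.mul_rpow_of_nonneg _ _ (by positivity), ← ENNReal.rpow_mul, ← ENNReal.rpow_mul,
      ← ENNReal.rpow_mul]
    congr 2 <;> field_simp
  unfold lnorm
  simp only [e]
  refine (ENNReal.rpow_le_rpow h (by positivity)).trans (le_of_eq ?_)
  rw [ENNReal.mul_rpow_of_nonneg _ _ (by positivity), ← ENNReal.rpow_mul, ← ENNReal.rpow_mul,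
    ← ENNReal.rpow_mul]
  congr 2 <;> field_simp

/-- An `L²` function to the power `κ ≤ 1+b` uses the fraction `κ/(1+b)` of Hölder's inequality and
the weight supplies the rest. As `Q ≤ 1`, a larger power of `Q` than the required multiple of `Y`
does no harm. -/
theorem lnorm_holder_weight {b κ y Y : ℝ} (hb : 0 ≤ b) (hκ0 : 0 ≤ κ) (hκ : κ ≤ 1 + b)
    (hy : Y * (1 + b - κ) ≤ 2 * y) {E Q : Space d → ℝ≥0∞} (hE : AEMeasurable E)
    (hQ : AEMeasurable Q) (hQ1 : ∀ x, Q x ≤ 1) (hQi : ∫⁻ x, Q x ^ Y ≤ 1) :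
    lnorm (2 / (1 + b)) (fun x => E x ^ κ * Q x ^ y) ≤ lnorm 2 E ^ κ := by
  have h1b : 0 < 1 + b := by linarith
  have hq : 0 ≤ (1 + b - κ) / (1 + b) := div_nonneg (by linarith) h1b.le
  have h := ENNReal.lintegral_mul_norm_pow_le (μ := (volume : Measure (Space d)))
    (hE.pow_const (2 : ℝ)) (hQ.pow_const Y) (p := κ / (1 + b)) (q := (1 + b - κ) / (1 + b))
    (by positivity) hq (by field_simp; ring)
  have e : ∀ x, (E x ^ κ * Q x ^ y) ^ (2 / (1 + b)) ≤
      (E x ^ (2 : ℝ)) ^ (κ / (1 + b)) * (Q x ^ Y) ^ ((1 + b - κ) / (1 + b)) := by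
    intro x
    rw [ENNReal.mul_rpow_of_nonneg _ _ (by positivity), ← ENNReal.rpow_mul, ← ENNReal.rpow_mul,
      ← ENNReal.rpow_mul, ← ENNReal.rpow_mul]
    have e1 : κ * (2 / (1 + b)) = 2 * (κ / (1 + b)) := by ring
    rw [e1]
    refine mul_le_mul_right (ENNReal.rpow_le_rpow_of_exponent_ge (hQ1 x) ?_) _
    rw [mul_div_assoc', mul_div_assoc']
    exact div_le_div_of_nonneg_right (by linarith) h1b.le
  unfold lnorm
  refine (ENNReal.rpow_le_rpow ((lintegral_mono e).trans h) (by positivity)).trans ?_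
  have h3 : (∫⁻ x, Q x ^ Y) ^ ((1 + b - κ) / (1 + b)) ≤ 1 := ENNReal.rpow_le_one hQi hq
  calc _ ≤ ((∫⁻ x, E x ^ (2 : ℝ)) ^ (κ / (1 + b)) * 1) ^ (1 / (2 / (1 + b))) := by gcongr
    _ = _ := by
      rw [mul_one, ← ENNReal.rpow_mul, ← ENNReal.rpow_mul]
      congr 1
      field_simp

end NLSTrain
end

open scoped ENNReal Topology
noncomputable section
namespace NLSTrain
open MeasureTheory

variable {d : ℕ}

/-! ### The source term of the perturbation equation -/

/-- The modulus of continuity `min(1,|h|)^s`. -/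
def holderWeight (s : ℝ) (h : Space d) : ℝ := min 1 ‖h‖ ^ s

theorem holderWeight_nonneg (s : ℝ) (h : Space d) : 0 ≤ holderWeight s h :=
  Real.rpow_nonneg (le_min zero_le_one (norm_nonneg h)) _

theorem holderWeight_pos (s : ℝ) {h : Space d} (hh : h ≠ 0) : 0 < holderWeight s h :=
  Real.rpow_pos_of_pos (lt_min one_pos (norm_pos_iff.2 hh)) _

theorem holderWeight_le {s : ℝ} (hs : 0 ≤ s) (h : Space d) : holderWeight s h ≤ ‖h‖ ^ s :=
  Real.rpow_le_rpow (le_min zero_le_one (norm_nonneg h)) (min_le_right _ _) hs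

/-- Quantitative bounds for a profile `T` and its interaction error `H` in terms of a
weight `Q`. -/
structure ProfileBounds (α x0 x1 Y s ν μ : ℝ) (T H : ℝ → Space d → ℂ) (Q : ℝ → Space d → ℝ) :
    Prop where
  continuous_T : Continuous fun p : ℝ × Space d => T p.1 p.2
  continuous_H : Continuous fun p : ℝ × Space d => H p.1 p.2
  measurable_Q : ∀ t, Measurable (Q t)
  Q_nonneg : ∀ t x, 0 ≤ Q t x
  Q_le_one : ∀ t x, Q t x ≤ 1
  Q_int : ∀ t, ∫⁻ x, ENNReal.ofReal (Q t x) ^ Y ≤ 1 / 2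
  Q_shift : ∃ c : ℝ, 0 ≤ c ∧ ∀ t t₀ x, |t - t₀| ≤ 1 → Q t x ≤ c * Q t₀ x
  T_le : ∀ t x, ‖T t x‖ ≤ μ * Q t x ^ x0
  T_incr : ∀ t x h, ‖T t (x + h) - T t x‖ ≤
    μ * holderWeight s h * max (Q t x) (Q t (x + h)) ^ x1
  H_le : ∀ t x, ‖H t x‖ ≤ μ * Real.exp (-(ν * |t|)) * Q t x ^ (α * x0 + x1)
  H_incr : ∀ t x h, ‖H t (x + h) - H t x‖ ≤
    μ * Real.exp (-(ν * |t|)) * holderWeight s h * max (Q t x) (Q t (x + h)) ^ (α * x0 + x1)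

/-- The second order difference bound of the nonlinearity. -/
def SecondDiffBound (f : ℂ → ℂ) (C α : ℝ) : Prop :=
  ∀ (M : ℝ) (w₁ e₁ w₂ e₂ : ℂ), M ≤ 1 → ‖w₁‖ ≤ M → ‖w₂‖ ≤ M → ‖w₁ + e₁‖ ≤ M → ‖w₂ + e₂‖ ≤ M →
    ‖(f (w₁ + e₁) - f w₁) - (f (w₂ + e₂) - f w₂)‖ ≤
      C * (M ^ α * ‖e₁ - e₂‖ + (max ‖e₁‖ ‖e₂‖) ^ (min α 1) * M ^ (α - min α 1) * ‖w₁ - w₂‖)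

theorem add_rpow_le_two_rpow_mul {a b p : ℝ} (ha : 0 ≤ a) (hb : 0 ≤ b) (hp : 0 ≤ p) :
    (a + b) ^ p ≤ 2 ^ p * (a ^ p + b ^ p) := by
  have h1 : a + b ≤ 2 * max a b := by
    have := le_max_left a b
    have := le_max_right a b
    linarith
  have h0 : 0 ≤ max a b := ha.trans (le_max_left _ _)
  calc (a + b) ^ p ≤ (2 * max a b) ^ p := Real.rpow_le_rpow (by positivity) h1 hp
    _ = 2 ^ p * max a b ^ p := Real.mul_rpow (by norm_num) h0
    _ ≤ 2 ^ p * (a ^ p + b ^ p) := by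
      gcongr
      have := Real.rpow_nonneg ha p
      have := Real.rpow_nonneg hb p
      rcases le_total a b with h | h
      · rw [max_eq_right h]; linarith
      · rw [max_eq_left h]; linarith

/-- The amplitude `a` of the perturbation and the amplitude `S` of the profile are separated,
because they will be measured differently: the former in `L²`, the latter by powers of the weight.
-/
theorem SecondDiffBound.split {f : ℂ → ℂ} {C α : ℝ} (hf : SecondDiffBound f C α) (hC : 0 ≤ C)
    (hα : 0 < α) {w₁ e₁ w₂ e₂ : ℂ} {a S : ℝ} (hw₁ : ‖w₁‖ ≤ S) (hw₂ : ‖w₂‖ ≤ S)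
    (he₁ : ‖e₁‖ ≤ a) (he₂ : ‖e₂‖ ≤ a) (hM : a + S ≤ 1) :
    ‖(f (w₁ + e₁) - f w₁) - (f (w₂ + e₂) - f w₂)‖ ≤
      C * 2 ^ α * (a ^ α * ‖e₁ - e₂‖ + S ^ α * ‖e₁ - e₂‖ + a ^ α * ‖w₁ - w₂‖ +
        a ^ (min α 1) * S ^ (α - min α 1) * ‖w₁ - w₂‖) := by
  have ha : 0 ≤ a := (norm_nonneg _).trans he₁
  have hS : 0 ≤ S := (norm_nonneg _).trans hw₁
  have hm : 0 < min α 1 := lt_min hα one_pos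
  have hn : 0 ≤ α - min α 1 := sub_nonneg.2 (min_le_left _ _)
  refine (hf (a + S) w₁ e₁ w₂ e₂ hM (by linarith) (by linarith)
    ((norm_add_le _ _).trans (by linarith)) ((norm_add_le _ _).trans (by linarith))).trans ?_
  have h1 : (max ‖e₁‖ ‖e₂‖) ^ (min α 1) ≤ a ^ (min α 1) :=
    Real.rpow_le_rpow (le_max_of_le_left (norm_nonneg _)) (max_le he₁ he₂) hm.le
  have h2 := add_rpow_le_two_rpow_mul ha hS hα.le
  have h3 : (a + S) ^ (α - min α 1) ≤ 2 ^ α * (a ^ (α - min α 1) + S ^ (α - min α 1)) := by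
    refine (add_rpow_le_two_rpow_mul ha hS hn).trans ?_
    have : (2 : ℝ) ^ (α - min α 1) ≤ 2 ^ α :=
      Real.rpow_le_rpow_of_exponent_le (by norm_num) (by linarith)
    have h4 := Real.rpow_nonneg ha (α - min α 1)
    have h5 := Real.rpow_nonneg hS (α - min α 1)
    gcongr
  have h4 : a ^ (min α 1) * a ^ (α - min α 1) = a ^ α := by
    rw [← Real.rpow_add_of_nonneg ha hm.le hn, add_sub_cancel]
  have h5 := Real.rpow_nonneg ha (min α 1)
  have h6 := Real.rpow_nonneg (add_nonneg ha hS) (α - min α 1)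
  calc _ ≤ C * (2 ^ α * (a ^ α + S ^ α) * ‖e₁ - e₂‖ +
        a ^ (min α 1) * (2 ^ α * (a ^ (α - min α 1) + S ^ (α - min α 1))) * ‖w₁ - w₂‖) := by
        gcongr
    _ = C * 2 ^ α * (a ^ α * ‖e₁ - e₂‖ + S ^ α * ‖e₁ - e₂‖ +
        a ^ (min α 1) * a ^ (α - min α 1) * ‖w₁ - w₂‖ +
        a ^ (min α 1) * S ^ (α - min α 1) * ‖w₁ - w₂‖) := by ring
    _ = _ := by rw [h4]

/-! ### Increments of the source in Lebesgue spaces -/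

section Increment

variable {α β s s' x0 x1 Y ν μ C R : ℝ} {f : ℂ → ℂ} {T H : ℝ → Space d → ℂ}
  {Q : ℝ → Space d → ℝ}

/-- The maximum is dominated by the sum of the two translates; the bound `1/2` on `Q_int` leaves
room for this. -/
theorem ProfileBounds.lintegral_max_le (tb : ProfileBounds α x0 x1 Y s ν μ T H Q)
    (t : ℝ) (h : Space d) :
    ∫⁻ x, ENNReal.ofReal (max (Q t x) (Q t (x + h))) ^ Y ≤ 1 := by
  have h1 : ∫⁻ x, ENNReal.ofReal (Q t (x + h)) ^ Y ≤ 1 / 2 := by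
    rw [lintegral_add_right_eq_self (fun x => ENNReal.ofReal (Q t x) ^ Y) h]
    exact tb.Q_int t
  calc _ ≤ ∫⁻ x, (ENNReal.ofReal (Q t x) ^ Y + ENNReal.ofReal (Q t (x + h)) ^ Y) := by
        refine lintegral_mono fun x => ?_
        rcases le_total (Q t x) (Q t (x + h)) with hh | hh
        · rw [max_eq_right hh]; exact le_add_self
        · rw [max_eq_left hh]; exact le_self_add
    _ = (∫⁻ x, ENNReal.ofReal (Q t x) ^ Y) + ∫⁻ x, ENNReal.ofReal (Q t (x + h)) ^ Y :=
        lintegral_add_left ((tb.measurable_Q t).ennreal_ofReal.pow_const _) _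
    _ ≤ 1 / 2 + 1 / 2 := add_le_add (tb.Q_int t) h1
    _ = 1 := by rw [ENNReal.add_halves]

/-- Pointwise bound of the increments of the source. -/
theorem ProfileBounds.norm_increment_le (tb : ProfileBounds α x0 x1 Y s ν μ T H Q)
    (hf : SecondDiffBound f C α) (hC : 0 ≤ C) (hE : Exponents d α β s s' x0 x1 Y) (hα : 0 < α)
    (hμ0 : 0 ≤ μ) (hμR : R + μ ≤ 1) {t : ℝ} {x h : Space d} {e₁ e₂ : ℂ}
    {a : ℝ} (he₁ : ‖e₁‖ ≤ a) (he₂ : ‖e₂‖ ≤ a) (haR : a ≤ R) :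
    ‖((f (T t (x + h) + e₁) - f (T t (x + h))) - (f (T t x + e₂) - f (T t x))) +
        (H t (x + h) - H t x)‖ ≤
      C * 2 ^ α * (a ^ α * ‖e₁ - e₂‖) +
      C * 2 ^ α * μ ^ α * (‖e₁ - e₂‖ * max (Q t x) (Q t (x + h)) ^ (α * x0)) +
      C * 2 ^ α * μ * holderWeight s h * (a ^ α * max (Q t x) (Q t (x + h)) ^ x1) +
      C * 2 ^ α * μ * holderWeight s h *
        (a ^ (min α 1) * max (Q t x) (Q t (x + h)) ^ ((α - min α 1) * x0 + x1)) +
      μ * Real.exp (-(ν * |t|)) * holderWeight s h *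
        max (Q t x) (Q t (x + h)) ^ (α * x0 + x1) := by
  set q := max (Q t x) (Q t (x + h)) with hq
  have hx1 := hE.x1_pos
  have hx0 : 0 < x0 := hx1.trans_le hE.x1_le
  have hn : 0 ≤ α - min α 1 := sub_nonneg.2 (min_le_left _ _)
  have hq0 : 0 ≤ q := (tb.Q_nonneg t x).trans (le_max_left _ _)
  have hq1 : q ≤ 1 := max_le (tb.Q_le_one t x) (tb.Q_le_one t _)
  have ha : 0 ≤ a := (norm_nonneg _).trans he₁
  have hqx : q ^ x0 ≤ 1 := Real.rpow_le_one hq0 hq1 hx0.le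
  have hμ1 : μ ≤ 1 := by linarith
  have hS1 : ‖T t (x + h)‖ ≤ μ * q ^ x0 := by
    refine (tb.T_le t _).trans ?_
    have := Real.rpow_le_rpow (tb.Q_nonneg t (x + h)) (le_max_right (Q t x) (Q t (x + h))) hx0.le
    gcongr
  have hS2 : ‖T t x‖ ≤ μ * q ^ x0 := by
    refine (tb.T_le t _).trans ?_
    have := Real.rpow_le_rpow (tb.Q_nonneg t x) (le_max_left (Q t x) (Q t (x + h))) hx0.le
    gcongr
  have hM : a + μ * q ^ x0 ≤ 1 := by nlinarith
  -- The base points are the profile at `x + h` and at `x`, the increments are the perturbation at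
  -- these points; both profile values are at most `μ q^{x0}`.
  have main := hf.split hC hα hS1 hS2 he₁ he₂ hM
  have hSα : (μ * q ^ x0) ^ α = μ ^ α * q ^ (α * x0) := by
    rw [Real.mul_rpow hμ0 (by positivity), ← Real.rpow_mul hq0, mul_comm x0]
  have hSn : (μ * q ^ x0) ^ (α - min α 1) ≤ q ^ ((α - min α 1) * x0) := by
    rw [Real.mul_rpow hμ0 (by positivity), ← Real.rpow_mul hq0, mul_comm x0]
    exact mul_le_of_le_one_left (by positivity) (Real.rpow_le_one hμ0 hμ1 hn)
  have hT := tb.T_incr t x h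
  rw [← hq] at hT
  have hw := holderWeight_nonneg s h
  refine (norm_add_le _ _).trans (add_le_add ?_ (tb.H_incr t x h))
  refine main.trans ?_
  rw [hSα]
  have e1 : q ^ ((α - min α 1) * x0 + x1) = q ^ ((α - min α 1) * x0) * q ^ x1 :=
    Real.rpow_add_of_nonneg hq0 (by positivity) hx1.le
  rw [e1]
  calc _ ≤ C * 2 ^ α * (a ^ α * ‖e₁ - e₂‖ + μ ^ α * q ^ (α * x0) * ‖e₁ - e₂‖ +
        a ^ α * (μ * holderWeight s h * q ^ x1) +
        a ^ (min α 1) * q ^ ((α - min α 1) * x0) * (μ * holderWeight s h * q ^ x1)) := by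
        gcongr
    _ = _ := by ring

set_option maxHeartbeats 1000000 in
/-- Bounds of the increments of the source in `L^{2/(1+b)}`. -/
theorem ProfileBounds.lnorm_increment_le (tb : ProfileBounds α x0 x1 Y s ν μ T H Q)
    (hf : SecondDiffBound f C α) (hC : 0 ≤ C) (hE : Exponents d α β s s' x0 x1 Y) (hα : 0 < α)
    (hμ0 : 0 ≤ μ) (hR0 : 0 < R) (hR : 2 * R ≤ 1) (hμR : R + μ ≤ 1) {b : ℝ} (hb0 : 0 ≤ b)
    (hbβ : b ≤ β) {lam κ : ℝ} (hlam : 0 ≤ lam) (hν : lam ≤ ν)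
    (hsmall : 2 * (C * 2 ^ α * R ^ α) * R + C * 2 ^ α * μ ^ α * R + 2 * (C * 2 ^ α * μ) + μ ≤ κ)
    {t : ℝ} (ht : 0 ≤ t) (h : Space d) {u w : L2 d}
    (hu : ‖u‖ ≤ R * Real.exp (-(lam / min α 1 * t)))
    (hw : ‖w‖ ≤ R * Real.exp (-(lam / min α 1 * t)))
    (hwu : ‖w - u‖ ≤ R * Real.exp (-(lam * t)) * holderWeight s h)
    (hub : ∀ᵐ x, ‖u x‖ ≤ R) (hwb : ∀ᵐ x, ‖w x‖ ≤ R) :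
    lnorm (2 / (1 + b)) (fun x => ‖((f (T t (x + h) + w x) - f (T t (x + h))) -
      (f (T t x + u x) - f (T t x))) + (H t (x + h) - H t x)‖ₑ) ≤
      ENNReal.ofReal (κ * Real.exp (-(lam * t)) * holderWeight s h) := by
  have hβ1 := hE.β_le_one
  have hβα := hE.β_le
  have h1b : 0 < 1 + b := by linarith
  have hr1 : 1 ≤ 2 / (1 + b) := by rw [le_div_iff₀ h1b]; linarith
  have hr0 : 0 < 2 / (1 + b) := by linarith
  have hm : 0 < min α 1 := lt_min hα one_pos
  have hmα : min α 1 ≤ α := min_le_left _ _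
  have hm1 : min α 1 ≤ 1 := min_le_right _ _
  have hY0 : 0 < Y := lt_of_le_of_lt (by positivity) hE.Y_gt
  have hx1 := hE.x1_pos
  have hx0 : 0 < x0 := hx1.trans_le hE.x1_le
  set Λ := lam / min α 1 with hΛ
  have hΛm : Λ * min α 1 = lam := div_mul_cancel₀ _ hm.ne'
  have hΛ0 : 0 ≤ Λ := by positivity
  set q : Space d → ℝ≥0∞ := fun x => ENNReal.ofReal (max (Q t x) (Q t (x + h))) with hq
  have hqm : AEMeasurable q :=
    ((tb.measurable_Q t).max ((tb.measurable_Q t).comp (measurable_add_const h))).ennreal_ofReal.aemeasurable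
  have hq1 : ∀ x, q x ≤ 1 := fun x => by
    rw [hq, ← ENNReal.ofReal_one]
    exact ENNReal.ofReal_le_ofReal (max_le (tb.Q_le_one t x) (tb.Q_le_one t _))
  have hqi := tb.lintegral_max_le t h
  have hq0 : ∀ x, 0 ≤ max (Q t x) (Q t (x + h)) := fun x =>
    (tb.Q_nonneg t x).trans (le_max_left _ _)
  have mu : AEMeasurable fun x => ‖u x‖ₑ := (Lp.aestronglyMeasurable u).enorm
  have mw : AEMeasurable fun x => ‖w x‖ₑ := (Lp.aestronglyMeasurable w).enorm
  set E : Space d → ℝ≥0∞ := fun x => max ‖w x‖ₑ ‖u x‖ₑ with hEdef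
  have mE : AEMeasurable E := mw.max mu
  set G : Space d → ℝ≥0∞ := fun x => ‖(w - u : L2 d) x‖ₑ with hG
  have mG : AEMeasurable G := (Lp.aestronglyMeasurable (w - u)).enorm
  set W := holderWeight s h with hW
  have hW0 : 0 ≤ W := holderWeight_nonneg s h
  set k := C * 2 ^ α with hk
  have hk0 : 0 ≤ k := by positivity
  -- Hölder's inequality in `L^{2/(1+b)}` admits at most the power `1+b` of an `L²` function. When
  -- `α` is larger, `a ≤ 1` allows `a^α` to be replaced by `a^{κ₁}`.
  set κ₁ := min α (1 + b) with hκ₁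
  have hκ₁0 : 0 < κ₁ := lt_min hα h1b
  have hκ₁m : min α 1 ≤ κ₁ := min_le_min le_rfl (by linarith)
  -- norms of the factors
  have nE : lnorm 2 E ≤ ENNReal.ofReal (2 * R * Real.exp (-(Λ * t))) := by
    have e1 : lnorm 2 E ≤ lnorm 2 fun x => ‖w x‖ₑ + ‖u x‖ₑ :=
      lnorm_mono_ae (by norm_num) (Filter.Eventually.of_forall fun x =>
        max_le le_self_add le_add_self)
    refine e1.trans ((lnorm_add_le (by norm_num) mw mu).trans ?_)
    rw [lnorm_two_coe, lnorm_two_coe, ← ENNReal.ofReal_add (norm_nonneg _) (norm_nonneg _)]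
    exact ENNReal.ofReal_le_ofReal (by linarith)
  have nG : lnorm 2 G ≤ ENNReal.ofReal (R * Real.exp (-(lam * t)) * W) := by
    rw [hG, lnorm_two_coe]
    exact ENNReal.ofReal_le_ofReal hwu
  have hexp1 : Real.exp (-(Λ * t)) ≤ 1 := by
    rw [Real.exp_le_one_iff]; have := mul_nonneg hΛ0 ht; linarith
  -- The `L²` rate `Λ` was taken as `lam / min α 1` so that even the lowest power of the
  -- perturbation that occurs still decays at rate `lam`.
  have nEp : ∀ p, min α 1 ≤ p → lnorm 2 E ^ p ≤ ENNReal.ofReal (Real.exp (-(lam * t))) := by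
    intro p hp
    have hp0 : 0 ≤ p := hm.le.trans hp
    refine (ENNReal.rpow_le_rpow nE hp0).trans ?_
    rw [ENNReal.ofReal_rpow_of_nonneg (by positivity) hp0]
    refine ENNReal.ofReal_le_ofReal ?_
    calc (2 * R * Real.exp (-(Λ * t))) ^ p ≤ (Real.exp (-(Λ * t))) ^ p := by
          refine Real.rpow_le_rpow (by positivity) ?_ hp0
          exact mul_le_of_le_one_left (Real.exp_pos _).le hR
      _ = Real.exp (-(Λ * t) * p) := by rw [← Real.exp_mul]
      _ ≤ Real.exp (-(lam * t)) := by
          refine Real.exp_le_exp.2 ?_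
          rw [← hΛm]
          nlinarith [mul_le_mul_of_nonneg_left hp (mul_nonneg hΛ0 ht)]
  -- the five contributions
  have t1 : lnorm (2 / (1 + b)) (fun x => ENNReal.ofReal (k * R ^ (α - b)) * (E x ^ b * G x)) ≤
      ENNReal.ofReal (2 * (k * R ^ α) * R * (Real.exp (-(lam * t)) * W)) := by
    rw [lnorm_const_mul hr0 ENNReal.ofReal_ne_top]
    have e1 : lnorm 2 E ^ b ≤ ENNReal.ofReal (2 * R ^ b) := by
      refine (ENNReal.rpow_le_rpow nE hb0).trans ?_
      rw [ENNReal.ofReal_rpow_of_nonneg (by positivity) hb0]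
      refine ENNReal.ofReal_le_ofReal ?_
      calc (2 * R * Real.exp (-(Λ * t))) ^ b ≤ (2 * R) ^ b :=
            Real.rpow_le_rpow (by positivity) (mul_le_of_le_one_right (by positivity) hexp1) hb0
        _ = 2 ^ b * R ^ b := Real.mul_rpow (by norm_num) hR0.le
        _ ≤ 2 ^ (1 : ℝ) * R ^ b := by
            gcongr
            · norm_num
            · linarith
        _ = 2 * R ^ b := by rw [Real.rpow_one]
    calc _ ≤ ENNReal.ofReal (k * R ^ (α - b)) *
          (ENNReal.ofReal (2 * R ^ b) * ENNReal.ofReal (R * Real.exp (-(lam * t)) * W)) := by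
          gcongr
          exact (lnorm_holder_two hb0 mE mG).trans (mul_le_mul' e1 nG)
      _ = ENNReal.ofReal (k * R ^ (α - b) * (2 * R ^ b * (R * Real.exp (-(lam * t)) * W))) := by
          rw [← ENNReal.ofReal_mul (by positivity), ← ENNReal.ofReal_mul (by positivity)]
      _ = _ := by
          congr 1
          have : R ^ α = R ^ (α - b) * R ^ b := by
            rw [← Real.rpow_add hR0, sub_add_cancel]
          rw [this]; ring
  have t2 : lnorm (2 / (1 + b)) (fun x => ENNReal.ofReal (k * μ ^ α) *
      (G x ^ (1 : ℝ) * q x ^ (α * x0))) ≤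
      ENNReal.ofReal (k * μ ^ α * R * (Real.exp (-(lam * t)) * W)) := by
    rw [lnorm_const_mul hr0 ENNReal.ofReal_ne_top]
    have e1 := lnorm_holder_weight (y := α * x0) (Y := Y) hb0 zero_le_one (by linarith)
      (by have := hE.potential
          have := mul_le_mul_of_nonneg_left hbβ hY0.le
          linarith) mG hqm hq1 hqi
    rw [ENNReal.rpow_one] at e1
    calc _ ≤ ENNReal.ofReal (k * μ ^ α) * ENNReal.ofReal (R * Real.exp (-(lam * t)) * W) := by
          gcongr
          exact e1.trans nG
      _ = _ := by
          rw [← ENNReal.ofReal_mul (by positivity)]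
          congr 1; ring
  have t3 : lnorm (2 / (1 + b)) (fun x => ENNReal.ofReal (k * μ * W) *
      (E x ^ κ₁ * q x ^ x1)) ≤
      ENNReal.ofReal (k * μ * (Real.exp (-(lam * t)) * W)) := by
    rw [lnorm_const_mul hr0 ENNReal.ofReal_ne_top]
    have e1 := lnorm_holder_weight (y := x1) (Y := Y) hb0 hκ₁0.le (min_le_right _ _)
      (by have h1 := hE.power
          have h2 : 1 + b - κ₁ ≤ 1 + β - min α (1 + β) := by
            rw [hκ₁]
            rcases le_total α (1 + b) with h | h
            · rw [min_eq_left h, min_eq_left (by linarith)]; linarith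
            · rw [min_eq_right h]
              have := min_le_right α (1 + β)
              linarith
          have := mul_le_mul_of_nonneg_left h2 hY0.le
          linarith) mE hqm hq1 hqi
    calc _ ≤ ENNReal.ofReal (k * μ * W) * ENNReal.ofReal (Real.exp (-(lam * t))) := by
          gcongr
          exact e1.trans (nEp _ hκ₁m)
      _ = _ := by
          rw [← ENNReal.ofReal_mul (by positivity)]
          congr 1; ring
  have t4 : lnorm (2 / (1 + b)) (fun x => ENNReal.ofReal (k * μ * W) *
      (E x ^ (min α 1) * q x ^ ((α - min α 1) * x0 + x1))) ≤
      ENNReal.ofReal (k * μ * (Real.exp (-(lam * t)) * W)) := by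
    rw [lnorm_const_mul hr0 ENNReal.ofReal_ne_top]
    have e1 := lnorm_holder_weight (y := (α - min α 1) * x0 + x1) (Y := Y) hb0 hm.le (by linarith)
      (by have h1 := hE.mixed
          have := mul_le_mul_of_nonneg_left (by linarith : 1 + b - min α 1 ≤ 1 + β - min α 1) hY0.le
          linarith) mE hqm hq1 hqi
    calc _ ≤ ENNReal.ofReal (k * μ * W) * ENNReal.ofReal (Real.exp (-(lam * t))) := by
          gcongr
          exact e1.trans (nEp _ le_rfl)
      _ = _ := by
          rw [← ENNReal.ofReal_mul (by positivity)]
          congr 1; ring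
  have t5 : lnorm (2 / (1 + b)) (fun x => ENNReal.ofReal (μ * Real.exp (-(ν * |t|)) * W) *
      (G x ^ (0 : ℝ) * q x ^ (α * x0 + x1))) ≤
      ENNReal.ofReal (μ * (Real.exp (-(lam * t)) * W)) := by
    rw [lnorm_const_mul hr0 ENNReal.ofReal_ne_top]
    have e1 := lnorm_holder_weight (y := α * x0 + x1) (Y := Y) hb0 le_rfl h1b.le
      (by have := hE.source
          have := mul_le_mul_of_nonneg_left (by linarith : 1 + b ≤ 1 + β) hY0.le
          linarith) mG hqm hq1 hqi
    rw [ENNReal.rpow_zero] at e1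
    calc _ ≤ ENNReal.ofReal (μ * Real.exp (-(ν * |t|)) * W) * 1 := by gcongr
      _ ≤ _ := by
          rw [mul_one]
          refine ENNReal.ofReal_le_ofReal ?_
          rw [abs_of_nonneg ht, mul_assoc]
          gcongr
  -- pointwise bound
  have hpt : ∀ᵐ x, ‖((f (T t (x + h) + w x) - f (T t (x + h))) -
      (f (T t x + u x) - f (T t x))) + (H t (x + h) - H t x)‖ₑ ≤
      ((((ENNReal.ofReal (k * R ^ (α - b)) * (E x ^ b * G x)) +
        (ENNReal.ofReal (k * μ ^ α) * (G x ^ (1 : ℝ) * q x ^ (α * x0)))) +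
        (ENNReal.ofReal (k * μ * W) * (E x ^ κ₁ * q x ^ x1))) +
        (ENNReal.ofReal (k * μ * W) * (E x ^ (min α 1) * q x ^ ((α - min α 1) * x0 + x1)))) +
        (ENNReal.ofReal (μ * Real.exp (-(ν * |t|)) * W) *
          (G x ^ (0 : ℝ) * q x ^ (α * x0 + x1))) := by
    filter_upwards [hub, hwb, Lp.coeFn_sub w u] with x h1 h2 h3
    set a := max ‖w x‖ ‖u x‖ with ha
    have ha0 : 0 ≤ a := (norm_nonneg _).trans (le_max_left _ _)
    have haR : a ≤ R := max_le h2 h1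
    have hEx : E x = ENNReal.ofReal a := by
      rw [hEdef, ha, ENNReal.ofReal_max, ofReal_norm, ofReal_norm]
    have hGx : G x = ENNReal.ofReal ‖w x - u x‖ := by
      simp only [hG]
      rw [h3, Pi.sub_apply, ofReal_norm]
    have hn : 0 ≤ α - min α 1 := sub_nonneg.2 hmα
    have b1 := tb.norm_increment_le hf hC hE hα hμ0 hμR (t := t) (x := x) (h := h)
      (le_max_left ‖w x‖ ‖u x‖) (le_max_right ‖w x‖ ‖u x‖) haR
    rw [← ofReal_norm]
    refine (ENNReal.ofReal_le_ofReal b1).trans ?_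
    have hqx := hq0 x
    rw [hEx, hGx]
    simp only [hq]
    rw [ENNReal.ofReal_rpow_of_nonneg ha0 hb0, ENNReal.ofReal_rpow_of_nonneg (norm_nonneg _) zero_le_one,
      ENNReal.ofReal_rpow_of_nonneg hqx (by positivity), ENNReal.ofReal_rpow_of_nonneg ha0 hκ₁0.le,
      ENNReal.ofReal_rpow_of_nonneg hqx hx1.le, ENNReal.ofReal_rpow_of_nonneg ha0 hm.le,
      ENNReal.ofReal_rpow_of_nonneg hqx (by positivity), ENNReal.ofReal_rpow_of_nonneg (norm_nonneg _) le_rfl,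
      ENNReal.ofReal_rpow_of_nonneg hqx (by positivity)]
    rw [← ENNReal.ofReal_mul (by positivity), ← ENNReal.ofReal_mul (by positivity),
      ← ENNReal.ofReal_mul (by positivity), ← ENNReal.ofReal_mul (by positivity),
      ← ENNReal.ofReal_mul (by positivity), ← ENNReal.ofReal_mul (by positivity),
      ← ENNReal.ofReal_mul (by positivity), ← ENNReal.ofReal_mul (by positivity),
      ← ENNReal.ofReal_mul (by positivity), ← ENNReal.ofReal_mul (by positivity),
      ← ENNReal.ofReal_add (by positivity) (by positivity),
      ← ENNReal.ofReal_add (by positivity) (by positivity),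
      ← ENNReal.ofReal_add (by positivity) (by positivity),
      ← ENNReal.ofReal_add (by positivity) (by positivity)]
    refine ENNReal.ofReal_le_ofReal ?_
    rw [Real.rpow_one, Real.rpow_zero, one_mul]
    have ha1 : a ≤ 1 := by linarith
    -- In the term quadratic in the perturbation, `α - b` powers are spent on the sup bound `R`,
    -- which gives smallness, and `b` powers are kept for Hölder; this uses `b ≤ β ≤ α`.
    have c1 : a ^ α ≤ R ^ (α - b) * a ^ b := by
      have : a ^ α = a ^ (α - b) * a ^ b := by
        rw [← Real.rpow_add_of_nonneg ha0 (by linarith) hb0, sub_add_cancel]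
      rw [this]
      have := Real.rpow_le_rpow ha0 haR (by linarith : 0 ≤ α - b)
      gcongr
    have c3 : a ^ α ≤ a ^ κ₁ :=
      Real.rpow_le_rpow_of_exponent_ge' ha0 ha1 hκ₁0.le (min_le_left _ _)
    refine add_le_add (add_le_add (add_le_add (add_le_add ?_ le_rfl) ?_) le_rfl) le_rfl
    · calc k * (a ^ α * ‖w x - u x‖) ≤ k * (R ^ (α - b) * a ^ b * ‖w x - u x‖) := by gcongr
        _ = _ := by ring
    · gcongr
  refine (lnorm_mono_ae hr0.le hpt).trans ?_
  have m1 : AEMeasurable fun x => ENNReal.ofReal (k * R ^ (α - b)) * (E x ^ b * G x) :=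
    ((mE.pow_const _).mul mG).const_mul _
  have m2 : AEMeasurable fun x => ENNReal.ofReal (k * μ ^ α) * (G x ^ (1 : ℝ) * q x ^ (α * x0)) :=
    ((mG.pow_const _).mul (hqm.pow_const _)).const_mul _
  have m3 : AEMeasurable fun x => ENNReal.ofReal (k * μ * W) * (E x ^ κ₁ * q x ^ x1) :=
    ((mE.pow_const _).mul (hqm.pow_const _)).const_mul _
  have m4 : AEMeasurable fun x => ENNReal.ofReal (k * μ * W) *
      (E x ^ (min α 1) * q x ^ ((α - min α 1) * x0 + x1)) :=
    ((mE.pow_const _).mul (hqm.pow_const _)).const_mul _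
  have m5 : AEMeasurable fun x => ENNReal.ofReal (μ * Real.exp (-(ν * |t|)) * W) *
      (G x ^ (0 : ℝ) * q x ^ (α * x0 + x1)) :=
    ((mG.pow_const _).mul (hqm.pow_const _)).const_mul _
  refine (lnorm_add_le hr1 (((m1.add m2).add m3).add m4) m5).trans ?_
  refine (add_le_add ((lnorm_add_le hr1 ((m1.add m2).add m3) m4).trans (add_le_add
    ((lnorm_add_le hr1 (m1.add m2) m3).trans (add_le_add
      ((lnorm_add_le hr1 m1 m2).trans (add_le_add t1 t2)) t3)) t4)) t5).trans ?_
  have hEW : 0 ≤ Real.exp (-(lam * t)) * W := by positivity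
  rw [← ENNReal.ofReal_add (by positivity) (by positivity),
    ← ENNReal.ofReal_add (by positivity) (by positivity),
    ← ENNReal.ofReal_add (by positivity) (by positivity),
    ← ENNReal.ofReal_add (by positivity) (by positivity)]
  refine ENNReal.ofReal_le_ofReal ?_
  have := mul_le_mul_of_nonneg_right hsmall hEW
  linarith

end Increment

end NLSTrain
end

open scoped ENNReal Topology
noncomputable section
namespace NLSTrain
open MeasureTheory

variable {d : ℕ}

/-! ### The source as a Lipschitz map on `L²` -/

section Source

variable {F : ℂ → ℂ} {L : ℝ} {T H : ℝ → Space d → ℂ}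

theorem continuous_of_lipschitz_bound (hF : ∀ z w, ‖F z - F w‖ ≤ L * ‖z - w‖) : Continuous F := by
  have : LipschitzWith (Real.toNNReal L) F := LipschitzWith.of_dist_le_mul fun z w => by
    rw [dist_eq_norm, dist_eq_norm]
    exact (hF z w).trans (mul_le_mul_of_nonneg_right (Real.le_coe_toNNReal L) (norm_nonneg _))
  exact this.continuous

theorem memLp_source (hF : ∀ z w, ‖F z - F w‖ ≤ L * ‖z - w‖)
    (hT : Continuous fun p : ℝ × Space d => T p.1 p.2) (hH : ∀ t, MemLp (H t) 2) (t : ℝ)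
    (u : L2 d) : MemLp (fun x => F (T t x + u x) - F (T t x) + H t x) 2 := by
  refine MemLp.add ?_ (hH t)
  have hFc := continuous_of_lipschitz_bound hF
  have hTt : Continuous (T t) := hT.comp (by fun_prop : Continuous fun x : Space d => (t, x))
  have hu := Lp.aestronglyMeasurable u
  refine (Lp.memLp u).of_le_mul (c := L) ?_ (Filter.Eventually.of_forall fun x => ?_)
  · exact (hFc.comp_aestronglyMeasurable (hTt.aestronglyMeasurable.add hu)).sub
      (hFc.comp hTt).aestronglyMeasurable
  · refine (hF _ _).trans (le_of_eq ?_)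
    rw [add_sub_cancel_left]

/-- The source `F(T+u) - F(T) + H` of the perturbation equation, as a map on `L²`. -/
def sourceMap (hF : ∀ z w, ‖F z - F w‖ ≤ L * ‖z - w‖)
    (hT : Continuous fun p : ℝ × Space d => T p.1 p.2) (hH : ∀ t, MemLp (H t) 2) (t : ℝ)
    (u : L2 d) : L2 d :=
  (memLp_source hF hT hH t u).toLp _

variable (hF : ∀ z w, ‖F z - F w‖ ≤ L * ‖z - w‖)
  (hT : Continuous fun p : ℝ × Space d => T p.1 p.2) (hH : ∀ t, MemLp (H t) 2)

theorem sourceMap_coe (t : ℝ) (u : L2 d) : sourceMap hF hT hH t u =ᵐ[volume]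
    fun x => F (T t x + u x) - F (T t x) + H t x :=
  (memLp_source hF hT hH t u).coeFn_toLp

theorem norm_sourceMap_sub_le (t : ℝ) (u w : L2 d) :
    ‖sourceMap hF hT hH t u - sourceMap hF hT hH t w‖ ≤ L * ‖u - w‖ := by
  refine Lp.norm_le_mul_norm_of_ae_le_mul ?_
  filter_upwards [sourceMap_coe hF hT hH t u, sourceMap_coe hF hT hH t w,
    Lp.coeFn_sub (sourceMap hF hT hH t u) (sourceMap hF hT hH t w), Lp.coeFn_sub u w]
    with x h1 h2 h3 h4
  rw [h3, h4, Pi.sub_apply, Pi.sub_apply, h1, h2]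
  have e : F (T t x + u x) - F (T t x) + H t x - (F (T t x + w x) - F (T t x) + H t x) =
      F (T t x + u x) - F (T t x + w x) := by ring
  rw [e]
  refine (hF _ _).trans (le_of_eq ?_)
  rw [add_sub_add_left_eq_sub]

/-- For fixed `u`, continuity in time is dominated convergence with the locally uniform majorant of
`H`. The Lipschitz bound in `u`, uniform in time, upgrades this to joint continuity. -/
theorem continuous_sourceMap (hL : 0 ≤ L)
    (hHc : Continuous fun p : ℝ × Space d => H p.1 p.2)
    (hdom : ∀ t₀, ∃ b : Space d → ℝ, MemLp b 2 ∧ ∀ᶠ t in 𝓝 t₀, ∀ x, ‖H t x‖ ≤ b x) :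
    Continuous fun p : ℝ × L2 d => sourceMap hF hT hH p.1 p.2 := by
  have hFc := continuous_of_lipschitz_bound hF
  have htime : ∀ u : L2 d, Continuous fun t => sourceMap hF hT hH t u := by
    intro u
    refine continuous_iff_continuousAt.2 fun t₀ => ?_
    obtain ⟨b, hb, hle⟩ := hdom t₀
    have hb' : MemLp (fun x => 2 * L * ‖u x‖ + 2 * ‖b x‖) 2 :=
      ((Lp.memLp u).norm.const_mul (2 * L)).add (hb.norm.const_mul 2)
    have hbc : MemLp (fun x => ((2 * L * ‖u x‖ + 2 * ‖b x‖ : ℝ) : ℂ)) 2 := hb'.ofReal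
    refine tendsto_toLp_of_dominated (fun t => memLp_source hF hT hH t u)
      (memLp_source hF hT hH t₀ u) (b := fun x => 2 * L * ‖u x‖ + 2 * ‖b x‖) ?_ ?_ ?_
    · refine ne_of_eq_of_ne ?_ ((memLp_two_iff_lintegral.1 hbc).2.ne)
      congr 1
      funext x
      have h0 : 0 ≤ 2 * L * ‖u x‖ + 2 * ‖b x‖ := by positivity
      rw [← ofReal_norm, Complex.norm_real, Real.norm_of_nonneg h0]
    · have h0 := hle.self_of_nhds
      filter_upwards [hle] with t ht
      refine Filter.Eventually.of_forall fun x => ?_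
      have h1 : ∀ τ, ‖F (T τ x + u x) - F (T τ x)‖ ≤ L * ‖u x‖ := fun τ => by
        refine (hF _ _).trans (le_of_eq ?_)
        rw [add_sub_cancel_left]
      have h2 : b x ≤ ‖b x‖ := Real.le_norm_self _
      calc _ ≤ ‖F (T t x + u x) - F (T t x) + H t x‖ +
            ‖F (T t₀ x + u x) - F (T t₀ x) + H t₀ x‖ := norm_sub_le _ _
        _ ≤ (L * ‖u x‖ + b x) + (L * ‖u x‖ + b x) :=
            add_le_add ((norm_add_le _ _).trans (add_le_add (h1 t) (ht x)))
              ((norm_add_le _ _).trans (add_le_add (h1 t₀) (h0 x)))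
        _ ≤ _ := by linarith
    · refine Filter.Eventually.of_forall fun x => ?_
      have hTx : Continuous fun t => T t x :=
        hT.comp (by fun_prop : Continuous fun t : ℝ => (t, x))
      have hHx : Continuous fun t => H t x :=
        hHc.comp (by fun_prop : Continuous fun t : ℝ => (t, x))
      have : Continuous fun t => F (T t x + u x) - F (T t x) + H t x := by fun_prop
      exact this.tendsto t₀
  refine continuous_iff_continuousAt.2 fun ⟨t₀, u₀⟩ => ?_
  rw [ContinuousAt, tendsto_iff_norm_sub_tendsto_zero]
  have hle : ∀ p : ℝ × L2 d, ‖sourceMap hF hT hH p.1 p.2 - sourceMap hF hT hH t₀ u₀‖ ≤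
      L * ‖p.2 - u₀‖ + ‖sourceMap hF hT hH p.1 u₀ - sourceMap hF hT hH t₀ u₀‖ := fun p =>
    (norm_sub_le_norm_sub_add_norm_sub _ (sourceMap hF hT hH p.1 u₀) _).trans
      (add_le_add (norm_sourceMap_sub_le hF hT hH _ _ _) le_rfl)
  have hlim : Filter.Tendsto (fun p : ℝ × L2 d =>
      L * ‖p.2 - u₀‖ + ‖sourceMap hF hT hH p.1 u₀ - sourceMap hF hT hH t₀ u₀‖) (𝓝 (t₀, u₀))
      (𝓝 (L * ‖u₀ - u₀‖ + ‖sourceMap hF hT hH t₀ u₀ - sourceMap hF hT hH t₀ u₀‖)) := by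
    have c1 : Continuous fun p : ℝ × L2 d => sourceMap hF hT hH p.1 u₀ :=
      (htime u₀).comp continuous_fst
    have : Continuous fun p : ℝ × L2 d =>
      L * ‖p.2 - u₀‖ + ‖sourceMap hF hT hH p.1 u₀ - sourceMap hF hT hH t₀ u₀‖ := by fun_prop
    exact this.tendsto (t₀, u₀)
  simp only [sub_self, norm_zero, mul_zero, add_zero] at hlim
  exact squeeze_zero (fun _ => norm_nonneg _) hle hlim

theorem norm_sourceMap_zero (t : ℝ) : ENNReal.ofReal ‖sourceMap hF hT hH t 0‖ =
    lnorm 2 (fun x => ‖H t x‖ₑ) := by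
  rw [← lnorm_two_coe]
  unfold lnorm
  congr 1
  refine lintegral_congr_ae ?_
  filter_upwards [sourceMap_coe hF hT hH t 0, Lp.coeFn_zero ℂ 2 (volume : Measure (Space d))]
    with x h1 h2
  rw [h1, h2]
  simp

theorem trans_sourceMap_sub_coe (t : ℝ) (h : Space d) (u : L2 d) :
    (trans h (sourceMap hF hT hH t u) - sourceMap hF hT hH t u : L2 d) =ᵐ[volume]
      fun x => ((F (T t (x + h) + trans h u x) - F (T t (x + h))) -
        (F (T t x + u x) - F (T t x))) + (H t (x + h) - H t x) := by
  have hqm := (measurePreserving_add_right (volume : Measure (Space d)) h).quasiMeasurePreserving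
  filter_upwards [Lp.coeFn_sub (trans h (sourceMap hF hT hH t u)) (sourceMap hF hT hH t u),
    trans_coe h (sourceMap hF hT hH t u), hqm.ae_eq_comp (sourceMap_coe hF hT hH t u),
    sourceMap_coe hF hT hH t u, trans_coe h u] with x h1 h2 h3 h4 h5
  rw [h1, Pi.sub_apply, h2, h4, h5]
  simp only [Function.comp_apply] at h3
  rw [h3]
  ring

end Source

/-! ### Propagation of the bounds and solution of the perturbation equation -/

section Solve

variable {α β s s' x0 x1 Y ν μ C R : ℝ} {f : ℂ → ℂ} {T H : ℝ → Space d → ℂ}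
  {Q : ℝ → Space d → ℝ}

/-- The weighted Hölder inequality with `κ = 0` and `b = 0`, so that only the weight is left; the
exponent condition `source` at `β` implies the one at 0. -/
theorem ProfileBounds.lnorm_weight_le (tb : ProfileBounds α x0 x1 Y s ν μ T H Q)
    (hE : Exponents d α β s s' x0 x1 Y) (t : ℝ) :
    lnorm 2 (fun x => ENNReal.ofReal (Q t x) ^ (α * x0 + x1)) ≤ 1 := by
  have hY0 : 0 < Y := lt_of_le_of_lt (by positivity) hE.Y_gt
  have := lnorm_holder_weight (b := 0) (κ := 0) (y := α * x0 + x1) (Y := Y)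
    (E := fun _ : Space d => 0) (Q := fun x => ENNReal.ofReal (Q t x)) le_rfl le_rfl (by norm_num)
    (by have := hE.source
        have := mul_le_mul_of_nonneg_left hE.β_pos.le hY0.le
        linarith) aemeasurable_const (tb.measurable_Q t).ennreal_ofReal.aemeasurable
    (fun x => by rw [← ENNReal.ofReal_one]; exact ENNReal.ofReal_le_ofReal (tb.Q_le_one t x))
    ((tb.Q_int t).trans (by simp))
  simpa using this

theorem ProfileBounds.lnorm_H_le (tb : ProfileBounds α x0 x1 Y s ν μ T H Q)
    (hE : Exponents d α β s s' x0 x1 Y) (hα : 0 < α) (t : ℝ) :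
    lnorm 2 (fun x => ‖H t x‖ₑ) ≤ ENNReal.ofReal (μ * Real.exp (-(ν * |t|))) := by
  have hx1 := hE.x1_pos
  have hx0 : 0 < x0 := hx1.trans_le hE.x1_le
  have h1 : lnorm 2 (fun x => ‖H t x‖ₑ) ≤ lnorm 2 (fun x =>
      ENNReal.ofReal (μ * Real.exp (-(ν * |t|))) * ENNReal.ofReal (Q t x) ^ (α * x0 + x1)) := by
    refine lnorm_mono_ae (by norm_num) (Filter.Eventually.of_forall fun x => ?_)
    rw [ENNReal.ofReal_rpow_of_nonneg (tb.Q_nonneg t x) (by positivity), ← ENNReal.ofReal_mul'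
      (Real.rpow_nonneg (tb.Q_nonneg t x) _), ← ofReal_norm]
    exact ENNReal.ofReal_le_ofReal (tb.H_le t x)
  refine h1.trans ?_
  rw [lnorm_const_mul (by norm_num) ENNReal.ofReal_ne_top]
  exact mul_le_of_le_one_right' (tb.lnorm_weight_le hE t)

theorem ProfileBounds.memLp_H (tb : ProfileBounds α x0 x1 Y s ν μ T H Q)
    (hE : Exponents d α β s s' x0 x1 Y) (hα : 0 < α) (t : ℝ) : MemLp (H t) 2 := by
  refine memLp_two_iff_lintegral.2 ⟨?_, ?_⟩
  · exact (tb.continuous_H.comp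
      (by fun_prop : Continuous fun x : Space d => (t, x))).aestronglyMeasurable
  · refine (lintegral_le_of_lnorm_le (by norm_num) (tb.lnorm_H_le hE hα t)).trans_lt ?_
    exact ENNReal.rpow_lt_top_of_nonneg (by norm_num) ENNReal.ofReal_ne_top

/-- A change of time by at most 1 changes the weight by at most a constant factor, so a multiple of
the weight at `t₀` dominates nearby times. -/
theorem ProfileBounds.exists_dominated (tb : ProfileBounds α x0 x1 Y s ν μ T H Q)
    (hE : Exponents d α β s s' x0 x1 Y) (hα : 0 < α) (hμ : 0 ≤ μ) (hν : 0 ≤ ν) (t₀ : ℝ) :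
    ∃ b : Space d → ℝ, MemLp b 2 ∧ ∀ᶠ t in 𝓝 t₀, ∀ x, ‖H t x‖ ≤ b x := by
  have hx1 := hE.x1_pos
  have hx0 : 0 < x0 := hx1.trans_le hE.x1_le
  obtain ⟨c, hc, hsh⟩ := tb.Q_shift
  set p := α * x0 + x1 with hp
  have hp0 : 0 < p := by positivity
  have hm : MemLp (fun x => Q t₀ x ^ p) 2 := by
    have h1 : MemLp (fun x => ((Q t₀ x ^ p : ℝ) : ℂ)) 2 := by
      refine memLp_two_iff_lintegral.2 ⟨?_, ?_⟩
      · exact (Complex.measurable_ofReal.comp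
          ((tb.measurable_Q t₀).pow_const p)).aestronglyMeasurable
      · refine (lintegral_le_of_lnorm_le (B := 1) (by norm_num) ?_).trans_lt (by simp)
        refine le_trans (le_of_eq ?_) (tb.lnorm_weight_le hE t₀)
        congr 1
        funext x
        rw [← ofReal_norm, Complex.norm_real,
          Real.norm_of_nonneg (Real.rpow_nonneg (tb.Q_nonneg t₀ x) _),
          ENNReal.ofReal_rpow_of_nonneg (tb.Q_nonneg t₀ x) hp0.le]
    simpa using h1.re
  refine ⟨fun x => μ * c ^ p * Q t₀ x ^ p, hm.const_mul _, ?_⟩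
  filter_upwards [Metric.closedBall_mem_nhds t₀ one_pos] with t ht x
  have h1 := hsh t t₀ x (by rwa [Metric.mem_closedBall, Real.dist_eq] at ht)
  have h2 : Real.exp (-(ν * |t|)) ≤ 1 := by
    rw [Real.exp_le_one_iff]; have := mul_nonneg hν (abs_nonneg t); linarith
  have h3 : Q t x ^ p ≤ c ^ p * Q t₀ x ^ p := by
    rw [← Real.mul_rpow hc (tb.Q_nonneg _ _)]
    exact Real.rpow_le_rpow (tb.Q_nonneg t x) h1 hp0.le
  have h4 := Real.rpow_nonneg (tb.Q_nonneg t x) p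
  calc ‖H t x‖ ≤ μ * Real.exp (-(ν * |t|)) * Q t x ^ p := tb.H_le t x
    _ ≤ μ * 1 * (c ^ p * Q t₀ x ^ p) := by gcongr
    _ = _ := by ring

theorem trans_duhamel (h : Space d) {G : ℝ → L2 d} {t : ℝ}
    (hG : IntegrableOn (fun τ => sch (-τ) (G (t + τ))) (Set.Ioi 0)) :
    trans h (duhamel sch G t) - duhamel sch G t =
      duhamel sch (fun τ => trans h (G τ) - G τ) t := by
  set Λ : L2 d →L[ℂ] L2 d :=
    (trans h).toContinuousLinearMap - ContinuousLinearMap.id ℂ (L2 d) with hΛ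
  have hΛa : ∀ f, Λ f = trans h f - f := fun f => rfl
  rw [← hΛa, duhamel, map_smul, duhamel]
  refine congrArg _ ((Λ.integral_comp_comm hG).symm.trans ?_)
  congr 1
  funext τ
  rw [hΛa, trans_sch, ← map_sub]

theorem isClosed_ae_norm_le (B : ℝ) : IsClosed {u : L2 d | ∀ᵐ x, ‖u x‖ ≤ B} :=
  isSeqClosed_iff_isClosed.1 fun _ _ hf hlim => ae_norm_le_of_tendsto hlim hf

/-- The bounds propagated by the fixed point iteration. -/
def PerturbationBound (R lam Λ s : ℝ) (t : ℝ) (u : L2 d) : Prop :=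
  ‖u‖ ≤ R * Real.exp (-(Λ * t)) ∧ (∀ᵐ x, ‖u x‖ ≤ R * Real.exp (-(lam * t))) ∧
    ∀ h, ‖trans h u - u‖ ≤ R * Real.exp (-(lam * t)) * holderWeight s h

theorem isClosed_perturbationBound (R lam Λ s t : ℝ) :
    IsClosed {u : L2 d | PerturbationBound R lam Λ s t u} := by
  refine (isClosed_le continuous_norm continuous_const).inter
    ((isClosed_ae_norm_le _).inter ?_)
  have e : {u : L2 d | ∀ h, ‖trans h u - u‖ ≤ R * Real.exp (-(lam * t)) * holderWeight s h} =
      ⋂ h, {u | ‖trans h u - u‖ ≤ R * Real.exp (-(lam * t)) * holderWeight s h} := by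
    ext u; simp
  change IsClosed {u : L2 d | ∀ h, ‖trans h u - u‖ ≤
    R * Real.exp (-(lam * t)) * holderWeight s h}
  rw [e]
  exact isClosed_iInter fun h => isClosed_le
    (((trans h).continuous.sub continuous_id).norm) continuous_const

theorem perturbationBound_zero {R lam Λ s t : ℝ} (hR : 0 ≤ R) :
    PerturbationBound R lam Λ s t (0 : L2 d) := by
  refine ⟨by rw [norm_zero]; positivity, ?_, fun h => ?_⟩
  · filter_upwards [Lp.coeFn_zero ℂ 2 (volume : Measure (Space d))] with x hx
    rw [hx, Pi.zero_apply, norm_zero]; positivity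
  · rw [map_zero, sub_zero, norm_zero]
    have := holderWeight_nonneg s h
    positivity

/-- The `L²` decay and the Hölder modulus follow from isometry of the group, the latter using the
increment bound at `b = 0`, where `L^{2/(1+b)}` is `L²`. The sup bound uses the increments at `b =
β`. The factor `linfConst` is absorbed by taking `κ` small compared with `R`. -/
theorem perturbationBound_duhamel (hE : Exponents d α β s s' x0 x1 Y) {lam Λ κ A : ℝ}
    (hlam : 1 ≤ lam) (hlΛ : lam ≤ Λ) (hκ : 0 < κ)
    (hκR : κ * linfConst d β s ≤ R) (hκ1 : κ ≤ R) {G : ℝ → L2 d} (hGc : Continuous G)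
    (hA : 0 ≤ A) (hub : ∀ t, ‖G t‖ ≤ A * Real.exp (-(Λ * t)))
    (hb2 : ∀ t, 0 ≤ t → ‖G t‖ ≤ κ * Real.exp (-(Λ * t)))
    (hincr : ∀ b, 0 ≤ b → b ≤ β → ∀ t, 0 ≤ t → ∀ h,
      lnorm (2 / (1 + b)) (fun x => ‖(trans h (G t) - G t : L2 d) x‖ₑ) ≤
        ENNReal.ofReal (κ * Real.exp (-(lam * t)) * holderWeight s h)) {t : ℝ} (ht : 0 ≤ t) :
    PerturbationBound R lam Λ s t (duhamel sch G t) := by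
  have hΛ1 : 1 ≤ Λ := hlam.trans hlΛ
  refine ⟨?_, ?_, fun h => ?_⟩
  · refine (norm_duhamel_le hΛ1 hκ.le fun τ hτ => hb2 _ (by linarith)).trans ?_
    gcongr
  · have := duhamel_ae_norm_le hGc hE.β_pos.le hE.β_le_one hE.β_dim hE.s_pos.le
      (by have := hE.s_lt; have := hE.s'_le; linarith) hE.s_lower hκ hlam hlΛ hA ht
      (fun h hh => holderWeight_pos s hh) (fun h => holderWeight_le hE.s_pos.le h) hub hb2
      (fun t ht h _ => by
        have h1b : 0 < 1 + β := by linarith [hE.β_pos]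
        have h1 := lintegral_le_of_lnorm_le (by positivity) (hincr β hE.β_pos.le le_rfl t ht h)
        have hw := holderWeight_nonneg s h
        rwa [ENNReal.ofReal_rpow_of_nonneg (by positivity) (by positivity)] at h1)
    filter_upwards [this] with x hx
    exact hx.trans (mul_le_mul_of_nonneg_right hκR (Real.exp_pos _).le)
  · rw [trans_duhamel h (integrableOn_duhamel continuous_sch_uncurry hGc hΛ1 hA
      fun τ _ => hub _)]
    have hw := holderWeight_nonneg s h
    refine (norm_duhamel_le (A := κ * holderWeight s h) hlam (by positivity)
      fun τ hτ => ?_).trans ?_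
    · have h1 := hincr 0 le_rfl hE.β_pos.le (t + τ) (by linarith) h
      rw [add_zero, div_one, lnorm_two_coe] at h1
      have h2 := (ENNReal.ofReal_le_ofReal_iff (by positivity)).1 h1
      linarith
    · have := mul_le_mul_of_nonneg_right hκ1
        (mul_nonneg hw (Real.exp_pos (-(lam * t))).le)
      linarith

set_option maxHeartbeats 1000000 in
/-- Existence of the perturbation of the profile. -/
theorem ProfileBounds.exists_perturbation (tb : ProfileBounds α x0 x1 Y s ν μ T H Q)
    (hf : SecondDiffBound f C α) (hC : 0 ≤ C) (hE : Exponents d α β s s' x0 x1 Y) (hα : 0 < α)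
    {F : ℂ → ℂ} {L lam κ : ℝ} (hF : ∀ z w, ‖F z - F w‖ ≤ L * ‖z - w‖)
    (hFf : ∀ z, ‖z‖ ≤ 2 * R → F z = f z) (hL0 : 0 ≤ L) (hL : L ≤ 1 / 2)
    (hμ0 : 0 ≤ μ) (hR0 : 0 < R) (hR : 2 * R ≤ 1) (hμR : μ ≤ R) (hlam : 1 ≤ lam)
    (hν : lam / min α 1 ≤ ν) (hκ : 0 < κ) (hκR : κ * linfConst d β s ≤ R)
    (hκ1 : κ ≤ R) (hLκ : L * R + μ ≤ κ)
    (hsmall : 2 * (C * 2 ^ α * R ^ α) * R + C * 2 ^ α * μ ^ α * R + 2 * (C * 2 ^ α * μ) + μ ≤ κ) :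
    ∃ (u : ℝ → L2 d) (A : ℝ), 0 ≤ A ∧ Continuous u ∧
      Continuous (fun t => sourceMap hF tb.continuous_T (tb.memLp_H hE hα) t (u t)) ∧
      (∀ t, u t = duhamel sch
        (fun τ => sourceMap hF tb.continuous_T (tb.memLp_H hE hα) τ (u τ)) t) ∧
      (∀ t, ‖sourceMap hF tb.continuous_T (tb.memLp_H hE hα) t (u t)‖ ≤
        A * Real.exp (-(lam / min α 1 * t))) ∧
      ∀ t, 0 ≤ t → ‖u t‖ ≤ R * Real.exp (-(lam * t)) ∧
        ∀ᵐ x, ‖u t x‖ ≤ R * Real.exp (-(lam * t)) := by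
  have hm : 0 < min α 1 := lt_min hα one_pos
  have hm1 : min α 1 ≤ 1 := min_le_right _ _
  set Λ := lam / min α 1 with hΛ
  have hlΛ : lam ≤ Λ := by rw [hΛ, le_div_iff₀ hm]; nlinarith
  have hΛ1 : 1 ≤ Λ := hlam.trans hlΛ
  have hν0 : 0 ≤ ν := by linarith
  have hHm := tb.memLp_H hE hα
  set N := sourceMap hF tb.continuous_T hHm with hN
  have hNc : Continuous fun p : ℝ × L2 d => N p.1 p.2 :=
    continuous_sourceMap hF tb.continuous_T hHm hL0 tb.continuous_H
      (tb.exists_dominated hE hα hμ0 hν0)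
  have hNlip : ∀ t u w, ‖N t u - N t w‖ ≤ L * ‖u - w‖ :=
    norm_sourceMap_sub_le hF tb.continuous_T hHm
  have hN0 : ∀ t, ‖N t 0‖ ≤ μ * Real.exp (-(Λ * t)) := by
    intro t
    have h1 : ‖N t 0‖ ≤ μ * Real.exp (-(ν * |t|)) := by
      have h2 := (norm_sourceMap_zero hF tb.continuous_T hHm t).le.trans (tb.lnorm_H_le hE hα t)
      exact (ENNReal.ofReal_le_ofReal_iff (by positivity)).1 h2
    -- The interaction error decays in both time directions, so its bound also dominates the
    -- one-sided weight required by the fixed point argument on the whole line.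
    refine h1.trans ?_
    have : Λ * t ≤ ν * |t| := by
      have := le_abs_self t
      have := abs_nonneg t
      nlinarith
    gcongr
  have hNu : ∀ t u, 0 ≤ t → ‖u‖ ≤ R * Real.exp (-(Λ * t)) →
      ‖N t u‖ ≤ κ * Real.exp (-(Λ * t)) := by
    intro t u _ hu
    have h1 := norm_sourceMap_sub_le hF tb.continuous_T hHm t u 0
    rw [sub_zero] at h1
    have h2 : ‖N t u‖ ≤ ‖N t u - N t 0‖ + ‖N t 0‖ := by
      simpa using norm_add_le (N t u - N t 0) (N t 0)
    calc ‖N t u‖ ≤ L * (R * Real.exp (-(Λ * t))) + μ * Real.exp (-(Λ * t)) := by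
          refine h2.trans (add_le_add (h1.trans ?_) (hN0 t))
          gcongr
      _ = (L * R + μ) * Real.exp (-(Λ * t)) := by ring
      _ ≤ _ := by gcongr
  have hincr : ∀ b, 0 ≤ b → b ≤ β → ∀ t u, 0 ≤ t → PerturbationBound R lam Λ s t u → ∀ h,
      lnorm (2 / (1 + b)) (fun x => ‖(trans h (N t u) - N t u : L2 d) x‖ₑ) ≤
        ENNReal.ofReal (κ * Real.exp (-(lam * t)) * holderWeight s h) := by
    intro b hb0 hbβ t u ht hu h
    have h1b : 0 < 1 + b := by linarith
    have hexp : Real.exp (-(lam * t)) ≤ 1 := by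
      rw [Real.exp_le_one_iff]
      have : 0 ≤ lam * t := by positivity
      linarith
    have hub : ∀ᵐ x, ‖u x‖ ≤ R := hu.2.1.mono fun x hx =>
      hx.trans (mul_le_of_le_one_right hR0.le hexp)
    have hqm := (measurePreserving_add_right (volume : Measure (Space d)) h).quasiMeasurePreserving
    have hwb : ∀ᵐ x, ‖trans h u x‖ ≤ R := by
      filter_upwards [trans_coe h u, hqm.ae hub] with x h1 h2
      rw [h1]; exact h2
    refine le_trans (lnorm_mono_ae (by positivity) ?_) (tb.lnorm_increment_le hf hC hE hα hμ0 hR0 hR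
      (by linarith) hb0 hbβ (by linarith) (hlΛ.trans hν) hsmall ht h
      (u := u) (w := trans h u) hu.1 (by rw [LinearIsometry.norm_map]; exact hu.1) (hu.2.2 h)
      hub hwb)
    filter_upwards [trans_sourceMap_sub_coe hF tb.continuous_T hHm t h u, hub, hwb] with x h1 h2 h3
    rw [h1]
    -- The profile and the perturbation are each at most `R`, so all arguments lie in the ball of
    -- radius `2R`, where the extension `F` agrees with `f`.
    have hTle : ∀ y, ‖T t y‖ ≤ R := fun y => by
      refine (tb.T_le t y).trans ?_
      have := Real.rpow_le_one (tb.Q_nonneg t y) (tb.Q_le_one t y)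
        (hE.x1_pos.le.trans hE.x1_le)
      nlinarith
    have k1 : ∀ y (z : ℂ), ‖z‖ ≤ R → ‖T t y + z‖ ≤ 2 * R := fun y z hz =>
      (norm_add_le _ _).trans (by linarith [hTle y])
    have k2 : ∀ y, ‖T t y‖ ≤ 2 * R := fun y => by linarith [hTle y]
    rw [hFf _ (k1 _ _ h2), hFf _ (k1 _ _ h3), hFf _ (k2 _), hFf _ (k2 _)]
  clear_value N
  -- The weight in the contraction is the fast rate `Λ` of the `L²` norm; the slower rate `lam`
  -- enters only through the constraint.
  obtain ⟨u, A, hA, hu1, hu2, hu3, hu4⟩ := exists_duhamel_fixedPoint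
    (P := PerturbationBound R lam Λ s) continuous_sch_uncurry hNc
    (fun t u w => (hNlip t u w).trans (by gcongr)) hΛ1 hμ0 hN0
    (isClosed_perturbationBound R lam Λ s) (fun t _ => perturbationBound_zero hR0.le)
    (fun u A hA hu hub hPu t ht => perturbationBound_duhamel hE hlam hlΛ hκ hκR hκ1
      (hNc.comp (by fun_prop : Continuous fun τ : ℝ => (τ, u τ))) hA hub
      (fun t ht => hNu t _ ht (hPu t ht).1)
      (fun b hb0 hbβ t ht h => hincr b hb0 hbβ t _ ht (hPu t ht) h) ht)
  refine ⟨u, A, hA, hu1, hNc.comp (by fun_prop : Continuous fun τ : ℝ => (τ, u τ)), hu2, hu3,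
    fun t ht => ⟨?_, (hu4 t ht).2.1⟩⟩
  refine (hu4 t ht).1.trans ?_
  gcongr

end Solve

end NLSTrain
end

open scoped ENNReal Topology
noncomputable section
namespace NLSTrain
open MeasureTheory

variable {d : ℕ}

/-! ### Superpositions of almost orthogonal waves -/

/-- The second difference with equal base points and `e₂ = 0` is a first difference. -/
theorem SecondDiffBound.norm_sub_le {f : ℂ → ℂ} {C α : ℝ} (hf : SecondDiffBound f C α)
    {M : ℝ} {z w : ℂ} (hM : M ≤ 1) (hz : ‖z‖ ≤ M) (hw : ‖w‖ ≤ M) :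
    ‖f z - f w‖ ≤ C * M ^ α * ‖z - w‖ := by
  have h := hf M w (z - w) w 0 hM hw hw (by rwa [add_sub_cancel]) (by rwa [add_zero])
  simpa [add_sub_cancel, mul_assoc] using h

theorem SecondDiffBound.norm_le {f : ℂ → ℂ} {C α : ℝ} (hf : SecondDiffBound f C α)
    (hf0 : f 0 = 0) {M : ℝ} {z : ℂ} (hM : M ≤ 1) (hz : ‖z‖ ≤ M) :
    ‖f z‖ ≤ C * M ^ α * ‖z‖ := by
  have h := hf.norm_sub_le (w := 0) hM hz (by rw [norm_zero]; exact (norm_nonneg z).trans hz)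
  simpa [hf0] using h

/-- Bounds for a family of waves `R j`, all but one of which are small at any given point. -/
structure WaveBounds (x0 x1 s k : ℝ) (b : ℕ → ℝ) (R : ℕ → ℝ → Space d → ℂ)
    (Q : ℝ → Space d → ℝ) : Prop where
  continuous : ∀ j, Continuous fun p : ℝ × Space d => R j p.1 p.2
  coeff_nonneg : ∀ j, 0 ≤ b j
  summable_coeff : Summable b
  Q_nonneg : ∀ t x, 0 ≤ Q t x
  Q_le_one : ∀ t x, Q t x ≤ 1
  norm_le : ∀ j t x, ‖R j t x‖ ≤ b j * Q t x ^ x0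
  norm_le_of_ne : ∀ t x, ∃ m, ∀ j, j ≠ m →
    ‖R j t x‖ ≤ b j * (Real.exp (-(k * |t|)) * Q t x ^ x0)
  incr : ∀ j t x h, ‖R j t (x + h) - R j t x‖ ≤
    b j * (holderWeight s h * max (Q t x) (Q t (x + h)) ^ x1)

theorem norm_tsum_le_mul {F : ℕ → ℂ} {b : ℕ → ℝ} (hb : Summable b) {μ c : ℝ}
    (hc : 0 ≤ c) (hμ : ∑' j, b j ≤ μ) (h : ∀ j, ‖F j‖ ≤ b j * c) : ‖∑' j, F j‖ ≤ μ * c := by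
  refine (tsum_of_norm_bounded (hb.mul_right c).hasSum h).trans ?_
  rw [tsum_mul_right]
  gcongr

theorem summable_of_norm_le_mul {F : ℕ → ℂ} {b : ℕ → ℝ} (hb : Summable b) {c : ℝ}
    (h : ∀ j, ‖F j‖ ≤ b j * c) : Summable F :=
  Summable.of_norm_bounded (hb.mul_right c) h

section

variable {α x0 x1 s s' k μ μ₁ C : ℝ} {b : ℕ → ℝ} {R : ℕ → ℝ → Space d → ℂ}
  {Q : ℝ → Space d → ℝ} {f : ℂ → ℂ}

theorem WaveBounds.norm_le_coeff (wb : WaveBounds x0 x1 s k b R Q) (hx0 : 0 ≤ x0) (j : ℕ) (t : ℝ)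
    (x : Space d) : ‖R j t x‖ ≤ b j :=
  (wb.norm_le j t x).trans (mul_le_of_le_one_right (wb.coeff_nonneg j)
    (Real.rpow_le_one (wb.Q_nonneg t x) (wb.Q_le_one t x) hx0))

theorem WaveBounds.summable (wb : WaveBounds x0 x1 s k b R Q) (t : ℝ) (x : Space d) :
    Summable fun j => R j t x :=
  summable_of_norm_le_mul wb.summable_coeff fun j => wb.norm_le j t x

theorem WaveBounds.coeff_le (wb : WaveBounds x0 x1 s k b R Q) (hμ : ∑' j, b j ≤ μ₁) (j : ℕ) :
    b j ≤ μ₁ :=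
  (wb.summable_coeff.le_tsum j fun i _ => wb.coeff_nonneg i).trans hμ

theorem WaveBounds.norm_tsum_le (wb : WaveBounds x0 x1 s k b R Q) (hμ : ∑' j, b j ≤ μ₁)
    (t : ℝ) (x : Space d) : ‖∑' j, R j t x‖ ≤ μ₁ * Q t x ^ x0 :=
  norm_tsum_le_mul wb.summable_coeff (Real.rpow_nonneg (wb.Q_nonneg t x) _) hμ
    fun j => wb.norm_le j t x

theorem WaveBounds.norm_tsum_sub_le (wb : WaveBounds x0 x1 s k b R Q) (hμ : ∑' j, b j ≤ μ₁)
    (t : ℝ) (x h : Space d) : ‖∑' j, R j t (x + h) - ∑' j, R j t x‖ ≤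
      μ₁ * (holderWeight s h * max (Q t x) (Q t (x + h)) ^ x1) := by
  rw [← (wb.summable t (x + h)).tsum_sub (wb.summable t x)]
  exact norm_tsum_le_mul wb.summable_coeff (mul_nonneg (holderWeight_nonneg s h)
    (Real.rpow_nonneg (le_max_of_le_left (wb.Q_nonneg t x)) _)) hμ fun j => wb.incr j t x h

theorem WaveBounds.continuous_tsum (wb : WaveBounds x0 x1 s k b R Q) (hx0 : 0 ≤ x0) :
    Continuous fun p : ℝ × Space d => ∑' j, R j p.1 p.2 :=
  _root_.continuous_tsum wb.continuous wb.summable_coeff fun j p => wb.norm_le_coeff hx0 j p.1 p.2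

theorem WaveBounds.norm_comp_le (wb : WaveBounds x0 x1 s k b R Q) (hx0 : 0 ≤ x0)
    (hμ : ∑' j, b j ≤ μ₁) (hμ1 : μ₁ ≤ 1) (hα : 0 ≤ α) (hC : 0 ≤ C)
    (hf : SecondDiffBound f C α) (hf0 : f 0 = 0) (j : ℕ) (t : ℝ) (x : Space d) :
    ‖f (R j t x)‖ ≤ b j * C := by
  have hb := wb.coeff_le hμ j
  have hb0 := wb.coeff_nonneg j
  have h1 := hf.norm_le hf0 (hb.trans hμ1) (wb.norm_le_coeff hx0 j t x)
  have h2 : b j ^ α ≤ 1 := Real.rpow_le_one hb0 (hb.trans hμ1) hα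
  have h3 := Real.rpow_nonneg hb0 α
  calc _ ≤ C * b j ^ α * ‖R j t x‖ := h1
    _ ≤ C * 1 * b j := by gcongr; exact wb.norm_le_coeff hx0 j t x
    _ = b j * C := by ring

theorem WaveBounds.continuous_error (wb : WaveBounds x0 x1 s k b R Q) (hx0 : 0 ≤ x0)
    (hμ : ∑' j, b j ≤ μ₁) (hμ1 : μ₁ ≤ 1) (hα : 0 ≤ α) (hC : 0 ≤ C)
    (hf : SecondDiffBound f C α) (hf0 : f 0 = 0) (hfc : Continuous f) :
    Continuous fun p : ℝ × Space d => f (∑' j, R j p.1 p.2) - ∑' j, f (R j p.1 p.2) :=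
  (hfc.comp (wb.continuous_tsum hx0)).sub
    (_root_.continuous_tsum (fun j => hfc.comp (wb.continuous j)) (wb.summable_coeff.mul_right C)
      fun j p => wb.norm_comp_le hx0 hμ hμ1 hα hC hf hf0 j p.1 p.2)

theorem WaveBounds.summable_comp (wb : WaveBounds x0 x1 s k b R Q) (hx0 : 0 ≤ x0)
    (hμ : ∑' j, b j ≤ μ₁) (hμ1 : μ₁ ≤ 1) (hα : 0 ≤ α) (hC : 0 ≤ C)
    (hf : SecondDiffBound f C α) (hf0 : f 0 = 0) (t : ℝ) (x : Space d) :
    Summable fun j => f (R j t x) :=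
  summable_of_norm_le_mul wb.summable_coeff fun j => wb.norm_comp_le hx0 hμ hμ1 hα hC hf hf0 j t x

/-- The interaction error decays in time. -/
theorem WaveBounds.norm_error_le (wb : WaveBounds x0 x1 s k b R Q) (hx0 : 0 ≤ x0)
    (hx1 : x1 ≤ x0) (hx1' : 0 < x1)
    (hμ : ∑' j, b j ≤ μ₁) (hμ1 : μ₁ ≤ 1) (hα : 0 < α) (hC : 0 ≤ C)
    (hf : SecondDiffBound f C α) (hf0 : f 0 = 0) (t : ℝ) (x : Space d) :
    ‖f (∑' j, R j t x) - ∑' j, f (R j t x)‖ ≤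
      2 * (C * μ₁ ^ α * μ₁) * Real.exp (-(k * |t|)) * Q t x ^ (α * x0 + x1) := by
  obtain ⟨m, hm⟩ := wb.norm_le_of_ne t x
  have hq0 := wb.Q_nonneg t x
  have hq1 := wb.Q_le_one t x
  have hμ0 : 0 ≤ μ₁ := (wb.coeff_nonneg 0).trans (wb.coeff_le hμ 0)
  generalize hE : Real.exp (-(k * |t|)) = E at hm ⊢
  have hE0 : 0 ≤ E := hE ▸ (Real.exp_pos _).le
  have hqx0 : 0 ≤ Q t x ^ x0 := Real.rpow_nonneg hq0 _
  have hqx1 : Q t x ^ x0 ≤ 1 := Real.rpow_le_one hq0 hq1 hx0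
  have hM1 : μ₁ * Q t x ^ x0 ≤ 1 := by nlinarith
  have hMα : 0 ≤ (μ₁ * Q t x ^ x0) ^ α := Real.rpow_nonneg (by positivity) _
  have hT := wb.norm_tsum_le hμ t x
  have hR : ∀ j, ‖R j t x‖ ≤ μ₁ * Q t x ^ x0 := fun j =>
    (wb.norm_le j t x).trans (by have := wb.coeff_le hμ j; gcongr)
  have hs := wb.summable t x
  have hsf := wb.summable_comp hx0 hμ hμ1 hα.le hC hf hf0 t x
  -- Both `f(T)` and `∑ f(R_j)` are compared with `f(R_m)`, where `m` is the only wave that may be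
  -- large at the given point; all the others carry the factor `e^{-k|t|}`.
  have h1 : ‖∑' j, R j t x - R m t x‖ ≤ μ₁ * (E * Q t x ^ x0) := by
    rw [hs.tsum_eq_add_tsum_ite m, add_sub_cancel_left]
    refine norm_tsum_le_mul wb.summable_coeff (by positivity) hμ fun j => ?_
    split_ifs with hj
    · rw [norm_zero]
      have := wb.coeff_nonneg j
      positivity
    · exact hm j hj
  have h2 : ‖∑' j, f (R j t x) - f (R m t x)‖ ≤
      μ₁ * (C * (μ₁ * Q t x ^ x0) ^ α * (E * Q t x ^ x0)) := by
    rw [hsf.tsum_eq_add_tsum_ite m, add_sub_cancel_left]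
    refine norm_tsum_le_mul wb.summable_coeff (by positivity) hμ fun j => ?_
    have := wb.coeff_nonneg j
    split_ifs with hj
    · rw [norm_zero]
      positivity
    · calc _ ≤ C * (μ₁ * Q t x ^ x0) ^ α * ‖R j t x‖ := hf.norm_le hf0 hM1 (hR j)
        _ ≤ C * (μ₁ * Q t x ^ x0) ^ α * (b j * (E * Q t x ^ x0)) := by gcongr; exact hm j hj
        _ = _ := by ring
  have h3 := hf.norm_sub_le hM1 hT (hR m)
  have e : f (∑' j, R j t x) - ∑' j, f (R j t x) =
      (f (∑' j, R j t x) - f (R m t x)) - (∑' j, f (R j t x) - f (R m t x)) := by ring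
  have hQ : (Q t x ^ x0) ^ α * Q t x ^ x0 ≤ Q t x ^ (α * x0 + x1) := by
    rw [← Real.rpow_mul hq0, Real.rpow_add_of_nonneg hq0 (by positivity) hx1'.le, mul_comm x0 α]
    have := Real.rpow_le_rpow_of_exponent_ge' hq0 hq1 hx1'.le hx1
    have := Real.rpow_nonneg hq0 (α * x0)
    gcongr
  have hμα := Real.rpow_nonneg hμ0 α
  rw [e]
  refine (norm_sub_le _ _).trans ((add_le_add (h3.trans (mul_le_mul_of_nonneg_left h1
    (by positivity))) h2).trans ?_)
  rw [Real.mul_rpow hμ0 hqx0]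
  calc _ = 2 * (C * μ₁ ^ α * μ₁) * E * ((Q t x ^ x0) ^ α * Q t x ^ x0) := by ring
    _ ≤ _ := by gcongr

/-- Increments of the interaction error. -/
theorem WaveBounds.norm_error_sub_le (wb : WaveBounds x0 x1 s k b R Q) (hx0 : 0 ≤ x0)
    (hx1' : 0 < x1)
    (hμ : ∑' j, b j ≤ μ₁) (hμ1 : μ₁ ≤ 1) (hα : 0 < α) (hC : 0 ≤ C)
    (hf : SecondDiffBound f C α) (hf0 : f 0 = 0) (t : ℝ) (x h : Space d) :
    ‖(f (∑' j, R j t (x + h)) - ∑' j, f (R j t (x + h))) -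
        (f (∑' j, R j t x) - ∑' j, f (R j t x))‖ ≤
      2 * (C * μ₁ ^ α * μ₁) * holderWeight s h *
        max (Q t x) (Q t (x + h)) ^ (α * x0 + x1) := by
  have hμ0 : 0 ≤ μ₁ := (wb.coeff_nonneg 0).trans (wb.coeff_le hμ 0)
  have hT := wb.norm_tsum_sub_le hμ t x h
  have hI := fun j => wb.incr j t x h
  obtain ⟨q, hq⟩ : ∃ q, q = max (Q t x) (Q t (x + h)) := ⟨_, rfl⟩
  rw [← hq] at hT hI ⊢
  have hxq : Q t x ≤ q := hq ▸ le_max_left _ _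
  have hhq : Q t (x + h) ≤ q := hq ▸ le_max_right _ _
  have hq0 : 0 ≤ q := (wb.Q_nonneg t x).trans hxq
  have hq1 : q ≤ 1 := hq ▸ max_le (wb.Q_le_one t x) (wb.Q_le_one t _)
  have hqx0 : 0 ≤ q ^ x0 := Real.rpow_nonneg hq0 _
  have hqx1 : q ^ x0 ≤ 1 := Real.rpow_le_one hq0 hq1 hx0
  have hqy0 : 0 ≤ q ^ x1 := Real.rpow_nonneg hq0 _
  have hM1 : μ₁ * q ^ x0 ≤ 1 := by nlinarith
  have hMα : 0 ≤ (μ₁ * q ^ x0) ^ α := Real.rpow_nonneg (by positivity) _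
  have hw := holderWeight_nonneg s h
  have hle : ∀ y, Q t y ≤ q → Q t y ^ x0 ≤ q ^ x0 := fun y hy =>
    Real.rpow_le_rpow (wb.Q_nonneg t y) hy hx0
  have hTy : ∀ y, Q t y ≤ q → ‖∑' j, R j t y‖ ≤ μ₁ * q ^ x0 := fun y hy =>
    (wb.norm_tsum_le hμ t y).trans (by have := hle y hy; gcongr)
  have hRy : ∀ y, Q t y ≤ q → ∀ j, ‖R j t y‖ ≤ μ₁ * q ^ x0 := fun y hy j =>
    (wb.norm_le j t y).trans (by
      have := wb.coeff_le hμ j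
      have := hle y hy
      have := Real.rpow_nonneg (wb.Q_nonneg t y) x0
      gcongr)
  have h1 := (hf.norm_sub_le hM1 (hTy _ hhq) (hTy _ hxq)).trans
    (mul_le_mul_of_nonneg_left hT (by positivity))
  have h2 : ‖∑' j, f (R j t (x + h)) - ∑' j, f (R j t x)‖ ≤
      μ₁ * (C * (μ₁ * q ^ x0) ^ α * (holderWeight s h * q ^ x1)) := by
    rw [← (wb.summable_comp hx0 hμ hμ1 hα.le hC hf hf0 t (x + h)).tsum_sub
      (wb.summable_comp hx0 hμ hμ1 hα.le hC hf hf0 t x)]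
    refine norm_tsum_le_mul wb.summable_coeff (by positivity) hμ fun j => ?_
    calc _ ≤ C * (μ₁ * q ^ x0) ^ α * ‖R j t (x + h) - R j t x‖ :=
          hf.norm_sub_le hM1 (hRy _ hhq j) (hRy _ hxq j)
      _ ≤ C * (μ₁ * q ^ x0) ^ α * (b j * (holderWeight s h * q ^ x1)) := by
        gcongr; exact hI j
      _ = _ := by ring
  rw [sub_sub_sub_comm]
  refine (norm_sub_le _ _).trans ((add_le_add h1 h2).trans (le_of_eq ?_))
  rw [Real.mul_rpow hμ0 hqx0, ← Real.rpow_mul hq0,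
    Real.rpow_add_of_nonneg hq0 (by positivity) hx1'.le, mul_comm x0 α]
  ring

theorem holderWeight_le_of_le {s s' : ℝ} (hs : 0 ≤ s) (hss : s ≤ s') (h : Space d) :
    holderWeight s' h ≤ holderWeight s h :=
  Real.rpow_le_rpow_of_exponent_ge' (le_min zero_le_one (norm_nonneg h)) (min_le_left _ _) hs hss

/-- Geometric interpolation of two bounds. -/
theorem le_of_le_rpow_interpolation {X A u v κ : ℝ} (hX : 0 ≤ X) (hA : 0 ≤ A) (hu : 0 ≤ u)
    (hv : 0 ≤ v) (hκ : 0 ≤ κ) (hκ1 : κ ≤ 1) (h1 : X ≤ A * u) (h2 : X ≤ A * v) :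
    X ≤ A * (u ^ κ * v ^ (1 - κ)) := by
  have hκ2 : 0 ≤ 1 - κ := sub_nonneg.2 hκ1
  have e : ∀ {z : ℝ}, 0 ≤ z → z = z ^ κ * z ^ (1 - κ) := fun hz => by
    rw [← Real.rpow_add_of_nonneg hz hκ hκ2, add_sub_cancel, Real.rpow_one]
  calc X = X ^ κ * X ^ (1 - κ) := e hX
    _ ≤ (A * u) ^ κ * (A * v) ^ (1 - κ) := by
      have := Real.rpow_le_rpow hX h1 hκ
      have := Real.rpow_le_rpow hX h2 hκ2
      gcongr
    _ = A ^ κ * A ^ (1 - κ) * (u ^ κ * v ^ (1 - κ)) := by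
      rw [Real.mul_rpow hA hu, Real.mul_rpow hA hv]; ring
    _ = _ := by rw [← e hA]

/-- A sum of almost orthogonal waves and its interaction error satisfy the profile bounds. -/
theorem WaveBounds.profileBounds {Y ν : ℝ} (wb : WaveBounds x0 x1 s' k b R Q)
    (hx1 : x1 ≤ x0) (hx1' : 0 < x1) (hs : 0 < s) (hss : s < s')
    (hμ : ∑' j, b j ≤ μ₁) (hμ1 : μ₁ ≤ 1) (hμμ : μ₁ ≤ μ) (hCμ : 4 * (C * μ₁ ^ α * μ₁) ≤ μ)
    (hα : 0 < α) (hC : 0 ≤ C)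
    (hf : SecondDiffBound f C α) (hf0 : f 0 = 0) (hfc : Continuous f)
    (hν : 0 ≤ ν) (hk : ν ≤ (1 - s / s') * k)
    (hQm : ∀ t, Measurable (Q t)) (hQint : ∀ t, ∫⁻ x, ENNReal.ofReal (Q t x) ^ Y ≤ 1 / 2)
    (hQshift : ∃ c : ℝ, 0 ≤ c ∧ ∀ t t₀ x, |t - t₀| ≤ 1 → Q t x ≤ c * Q t₀ x) :
    ProfileBounds α x0 x1 Y s ν μ (fun t x => ∑' j, R j t x)
      (fun t x => f (∑' j, R j t x) - ∑' j, f (R j t x)) Q := by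
  have hx0 : 0 ≤ x0 := hx1'.le.trans hx1
  have hs' : 0 < s' := hs.trans hss
  have hμ0 : 0 ≤ μ₁ := (wb.coeff_nonneg 0).trans (wb.coeff_le hμ 0)
  have hμα := Real.rpow_nonneg hμ0 α
  have hr0 : 0 < s / s' := div_pos hs hs'
  have hr1 : s / s' < 1 := (div_lt_one hs').2 hss
  have hk0 : 0 ≤ k := by
    by_contra hneg
    nlinarith [sub_pos.2 hr1]
  have hνk : ν ≤ k := hk.trans (by nlinarith)
  have hH : ∀ t x, ‖f (∑' j, R j t x) - ∑' j, f (R j t x)‖ ≤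
      2 * (C * μ₁ ^ α * μ₁) * Real.exp (-(k * |t|)) * Q t x ^ (α * x0 + x1) :=
    wb.norm_error_le hx0 hx1 hx1' hμ hμ1 hα hC hf hf0
  have hA0 : 0 ≤ C * μ₁ ^ α * μ₁ := by positivity
  have hp : 0 ≤ α * x0 + x1 := by positivity
  refine ⟨wb.continuous_tsum hx0, wb.continuous_error hx0 hμ hμ1 hα.le hC hf hf0 hfc, hQm,
    wb.Q_nonneg, wb.Q_le_one, hQint, hQshift, fun t x => ?_, fun t x h => ?_, fun t x => ?_,
    fun t x h => ?_⟩
  · refine (wb.norm_tsum_le hμ t x).trans ?_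
    have := Real.rpow_nonneg (wb.Q_nonneg t x) x0
    gcongr
  · refine (wb.norm_tsum_sub_le hμ t x h).trans ?_
    rw [mul_assoc]
    have h1 := Real.rpow_nonneg (le_max_of_le_left (wb.Q_nonneg t x) :
      0 ≤ max (Q t x) (Q t (x + h))) x1
    have h2 := holderWeight_le_of_le hs.le hss.le h
    have h3 := holderWeight_nonneg s h
    have h4 := holderWeight_nonneg s' h
    have h5 := hμ0.trans hμμ
    gcongr
  · refine (hH t x).trans ?_
    have := Real.rpow_nonneg (wb.Q_nonneg t x) (α * x0 + x1)
    have h2 : 2 * (C * μ₁ ^ α * μ₁) ≤ μ := by linarith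
    have h5 := hμ0.trans hμμ
    gcongr
  · have hq0 : 0 ≤ max (Q t x) (Q t (x + h)) := le_max_of_le_left (wb.Q_nonneg t x)
    have h1 := wb.norm_error_sub_le hx0 hx1' hμ hμ1 hα hC hf hf0 t x h
    have hle : ∀ y, Q t y ≤ max (Q t x) (Q t (x + h)) →
        ‖f (∑' j, R j t y) - ∑' j, f (R j t y)‖ ≤ 2 * (C * μ₁ ^ α * μ₁) *
          Real.exp (-(k * |t|)) * max (Q t x) (Q t (x + h)) ^ (α * x0 + x1) := by
      intro y hy
      refine (hH t y).trans ?_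
      have := Real.rpow_le_rpow (wb.Q_nonneg t y) hy hp
      gcongr
    have h2 := (norm_sub_le (f (∑' j, R j t (x + h)) - ∑' j, f (R j t (x + h)))
      (f (∑' j, R j t x) - ∑' j, f (R j t x))).trans
      (add_le_add (hle _ (le_max_right _ _)) (hle _ (le_max_left _ _)))
    generalize max (Q t x) (Q t (x + h)) = q at h1 h2 hq0
    have hqp := Real.rpow_nonneg hq0 (α * x0 + x1)
    have hw0 := holderWeight_nonneg s' h
    -- One bound has Hölder modulus `s'` without decay, the other has decay without a modulus. The
    -- geometric mean with weight `s/s'` keeps the modulus `s` and the rate `(1 - s/s') k`, which is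
    -- at least `ν`.
    have h3 := le_of_le_rpow_interpolation (A := 4 * (C * μ₁ ^ α * μ₁) * q ^ (α * x0 + x1))
      (u := holderWeight s' h) (v := Real.exp (-(k * |t|))) (κ := s / s') (norm_nonneg _)
      (by positivity) hw0 (Real.exp_pos _).le hr0.le hr1.le
      (h1.trans (by
        have : 0 ≤ C * μ₁ ^ α * μ₁ * q ^ (α * x0 + x1) * holderWeight s' h := by positivity
        nlinarith))
      (h2.trans (le_of_eq (by ring)))
    refine h3.trans ?_
    have e1 : holderWeight s' h ^ (s / s') = holderWeight s h := by
      rw [holderWeight, ← Real.rpow_mul (le_min zero_le_one (norm_nonneg h)),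
        mul_div_cancel₀ s hs'.ne']
      rfl
    have e2 : Real.exp (-(k * |t|)) ^ (1 - s / s') ≤ Real.exp (-(ν * |t|)) := by
      rw [← Real.exp_mul, Real.exp_le_exp]
      nlinarith [abs_nonneg t]
    rw [e1]
    have hw := holderWeight_nonneg s h
    calc _ ≤ 4 * (C * μ₁ ^ α * μ₁) * q ^ (α * x0 + x1) *
          (holderWeight s h * Real.exp (-(ν * |t|))) := by gcongr
      _ ≤ μ * q ^ (α * x0 + x1) * (holderWeight s h * Real.exp (-(ν * |t|))) := by gcongr
      _ = _ := by ring

end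

end NLSTrain
end

open scoped ENNReal Topology
noncomputable section
namespace NLSTrain
open MeasureTheory

variable {d : ℕ}

/-! ### Weights of soliton trains -/

theorem summable_pow_succ_rpow {θ ε : ℝ} (hθ : 0 ≤ θ) (hε : θ ^ ε ≤ 1 / 2) :
    Summable (fun j : ℕ => (θ ^ (j + 1)) ^ ε) ∧ ∑' j : ℕ, (θ ^ (j + 1)) ^ ε ≤ 2 * θ ^ ε := by
  have h0 : 0 ≤ θ ^ ε := Real.rpow_nonneg hθ ε
  have e : (fun j : ℕ => (θ ^ (j + 1)) ^ ε) = fun j : ℕ => θ ^ ε * (θ ^ ε) ^ j := by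
    ext j
    rw [← Real.rpow_natCast θ, ← Real.rpow_mul hθ, mul_comm _ ε, Real.rpow_mul hθ,
      Real.rpow_natCast, pow_succ, mul_comm]
  have hs := summable_geometric_of_lt_one h0 (by linarith)
  rw [e]
  refine ⟨hs.mul_left _, ?_⟩
  rw [tsum_mul_left, tsum_geometric_of_lt_one h0 (by linarith), mul_comm]
  refine mul_le_mul_of_nonneg_right ?_ h0
  rw [inv_le_comm₀ (by linarith) (by norm_num)]
  linarith

theorem integrable_exp_neg_mul_norm {k : ℝ} (hk : 0 < k) :
    Integrable fun x : Space d => Real.exp (-(k * ‖x‖)) := by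
  obtain ⟨n, hn⟩ : ∃ n : ℕ, n = d + 1 := ⟨_, rfl⟩
  have h := integrable_one_add_norm (E := Space d) (μ := volume) (r := (n : ℝ))
    (by rw [finrank_euclideanSpace_fin, hn]; push_cast; linarith)
  refine (h.const_mul (Real.exp k * n.factorial / k ^ n)).mono' (by fun_prop)
    (Filter.Eventually.of_forall fun x => ?_)
  have hx := norm_nonneg x
  rw [Real.norm_of_nonneg (Real.exp_pos _).le, Real.rpow_neg (by positivity),
    Real.rpow_natCast, ← div_eq_mul_inv, le_div_iff₀ (by positivity), le_div_iff₀ (by positivity)]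
  have h1 := Real.pow_div_factorial_le_exp (k * (1 + ‖x‖)) (by positivity) n
  rw [div_le_iff₀ (by positivity), mul_pow] at h1
  calc _ = Real.exp (-(k * ‖x‖)) * (k ^ n * (1 + ‖x‖) ^ n) := by ring
    _ ≤ Real.exp (-(k * ‖x‖)) * (Real.exp (k * (1 + ‖x‖)) * n.factorial) := by gcongr
    _ = Real.exp k * n.factorial := by
      rw [← mul_assoc, ← Real.exp_add]
      ring_nf

/-- The weight `sup_j ω_j e^{-c ω_j^{1/2}|x - t v_j|}`. -/
def trainWeight (c : ℝ) (ω : ℕ → ℝ) (v : ℕ → Space d) (t : ℝ) (x : Space d) : ℝ :=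
  ⨆ j, ω j * Real.exp (-(c * (ω j ^ (1 / 2 : ℝ) * ‖x - t • v j‖)))

section Weight

variable {c : ℝ} {ω : ℕ → ℝ} {v : ℕ → Space d}

theorem trainWeight_term_le (hc : 0 ≤ c) (h0 : ∀ j, 0 ≤ ω j) (h1 : ∀ j, ω j ≤ 1) (t : ℝ)
    (x : Space d) (j : ℕ) :
    ω j * Real.exp (-(c * (ω j ^ (1 / 2 : ℝ) * ‖x - t • v j‖))) ≤ 1 := by
  have h2 : Real.exp (-(c * (ω j ^ (1 / 2 : ℝ) * ‖x - t • v j‖))) ≤ 1 := by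
    rw [Real.exp_le_one_iff, neg_nonpos]
    have := Real.rpow_nonneg (h0 j) (1 / 2)
    positivity
  exact mul_le_one₀ (h1 j) (Real.exp_pos _).le h2

theorem bddAbove_trainWeight (hc : 0 ≤ c) (h0 : ∀ j, 0 ≤ ω j) (h1 : ∀ j, ω j ≤ 1) (t : ℝ)
    (x : Space d) :
    BddAbove (Set.range fun j => ω j * Real.exp (-(c * (ω j ^ (1 / 2 : ℝ) * ‖x - t • v j‖)))) :=
  ⟨1, by rintro _ ⟨j, rfl⟩; exact trainWeight_term_le hc h0 h1 t x j⟩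

theorem le_trainWeight (hc : 0 ≤ c) (h0 : ∀ j, 0 ≤ ω j) (h1 : ∀ j, ω j ≤ 1) (t : ℝ)
    (x : Space d) (j : ℕ) :
    ω j * Real.exp (-(c * (ω j ^ (1 / 2 : ℝ) * ‖x - t • v j‖))) ≤ trainWeight c ω v t x :=
  le_ciSup (bddAbove_trainWeight hc h0 h1 t x) j

theorem trainWeight_nonneg (h0 : ∀ j, 0 ≤ ω j) (t : ℝ) (x : Space d) :
    0 ≤ trainWeight c ω v t x :=
  Real.iSup_nonneg fun j => mul_nonneg (h0 j) (Real.exp_pos _).le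

theorem trainWeight_le_one (hc : 0 ≤ c) (h0 : ∀ j, 0 ≤ ω j) (h1 : ∀ j, ω j ≤ 1) (t : ℝ)
    (x : Space d) : trainWeight c ω v t x ≤ 1 :=
  ciSup_le (trainWeight_term_le hc h0 h1 t x)

theorem measurable_trainWeight (t : ℝ) : Measurable (trainWeight c ω v t) :=
  Measurable.iSup fun j => by fun_prop

/-- In unit time the scaled distance to soliton `j` changes by at most `ω_j^{1/2}|v_j| ≤ K`,
uniformly in `j` although the velocities are unbounded. -/
theorem trainWeight_shift {K : ℝ} (hc : 0 ≤ c) (h0 : ∀ j, 0 ≤ ω j) (h1 : ∀ j, ω j ≤ 1)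
    (hv : ∀ j, ω j ^ (1 / 2 : ℝ) * ‖v j‖ ≤ K) (t t₀ : ℝ) (x : Space d) (ht : |t - t₀| ≤ 1) :
    trainWeight c ω v t x ≤ Real.exp (c * K) * trainWeight c ω v t₀ x := by
  refine ciSup_le fun j => ?_
  refine le_trans ?_ (mul_le_mul_of_nonneg_left (le_trainWeight hc h0 h1 t₀ x j)
    (Real.exp_pos _).le)
  have hσ := Real.rpow_nonneg (h0 j) (1 / 2)
  have h2 : ‖x - t₀ • v j‖ ≤ ‖x - t • v j‖ + ‖v j‖ := by
    have e : x - t₀ • v j = (x - t • v j) + (t - t₀) • v j := by rw [sub_smul]; abel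
    rw [e]
    refine (norm_add_le _ _).trans ?_
    rw [norm_smul, Real.norm_eq_abs]
    nlinarith [norm_nonneg (v j)]
  rw [mul_left_comm (Real.exp (c * K)), ← Real.exp_add]
  refine mul_le_mul_of_nonneg_left (Real.exp_le_exp.2 ?_) (h0 j)
  have h3 := mul_le_mul_of_nonneg_left h2 hσ
  have h4 := hv j
  nlinarith

/-- Scaling by `w^{1/2}` produces the factor `w^{Y - d/2}`. For `Y > d/2` the contributions of
geometrically decreasing frequencies are summable and small. -/
theorem lintegral_weight_term {w Y : ℝ} (hc : 0 < c) (hY : 0 < Y) (hw : 0 < w) (y : Space d) :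
    ∫⁻ x : Space d, ENNReal.ofReal (w * Real.exp (-(c * (w ^ (1 / 2 : ℝ) * ‖x - y‖)))) ^ Y =
      ENNReal.ofReal (w ^ (Y - d / 2) * ∫ x : Space d, Real.exp (-(c * Y * ‖x‖))) := by
  rw [lintegral_sub_right_eq_self (fun x : Space d =>
    ENNReal.ofReal (w * Real.exp (-(c * (w ^ (1 / 2 : ℝ) * ‖x‖)))) ^ Y) y]
  have hσ : 0 < w ^ (1 / 2 : ℝ) := Real.rpow_pos_of_pos hw _
  have hi := integrable_exp_neg_mul_norm (d := d) (mul_pos hc hY)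
  have e : ∀ x : Space d, ENNReal.ofReal (w * Real.exp (-(c * (w ^ (1 / 2 : ℝ) * ‖x‖)))) ^ Y =
      ENNReal.ofReal (w ^ Y * Real.exp (-(c * Y * ‖(w ^ (1 / 2 : ℝ)) • x‖))) := by
    intro x
    rw [ENNReal.ofReal_rpow_of_nonneg (by positivity) hY.le,
      Real.mul_rpow hw.le (Real.exp_pos _).le, ← Real.exp_mul, norm_smul,
      Real.norm_of_nonneg hσ.le]
    ring_nf
  simp_rw [e]
  rw [← ofReal_integral_eq_lintegral_ofReal, integral_const_mul,
    Measure.integral_comp_smul volume (fun x : Space d => Real.exp (-(c * Y * ‖x‖)))]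
  · rw [finrank_euclideanSpace_fin, smul_eq_mul, abs_of_pos (by positivity), ← mul_assoc]
    congr 2
    rw [← Real.rpow_natCast, ← Real.rpow_mul hw.le, ← Real.rpow_neg hw.le, ← Real.rpow_add hw]
    ring_nf
  · exact (hi.comp_smul hσ.ne').const_mul _
  · exact Filter.Eventually.of_forall fun x => by positivity

theorem ofReal_trainWeight_rpow_le {Y : ℝ} (hY : 0 < Y) (t : ℝ) (x : Space d) :
    ENNReal.ofReal (trainWeight c ω v t x) ^ Y ≤
      ∑' j, ENNReal.ofReal (ω j * Real.exp (-(c * (ω j ^ (1 / 2 : ℝ) * ‖x - t • v j‖)))) ^ Y := by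
  generalize hS : (∑' j, ENNReal.ofReal
    (ω j * Real.exp (-(c * (ω j ^ (1 / 2 : ℝ) * ‖x - t • v j‖)))) ^ Y) = S
  have hj : ∀ j, ENNReal.ofReal
      (ω j * Real.exp (-(c * (ω j ^ (1 / 2 : ℝ) * ‖x - t • v j‖)))) ≤ S ^ Y⁻¹ := by
    intro j
    rw [ENNReal.le_rpow_inv_iff hY, ← hS]
    exact ENNReal.le_tsum j
  rw [← ENNReal.le_rpow_inv_iff hY]
  by_cases hST : S ^ Y⁻¹ = ∞
  · rw [hST]; exact le_top
  refine ENNReal.ofReal_le_of_le_toReal (ciSup_le fun j => ?_)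
  exact (ENNReal.ofReal_le_iff_le_toReal hST).1 (hj j)

theorem lintegral_trainWeight_le {θ Y : ℝ} (hc : 0 < c) (hY : 0 < Y) (hθ : 0 < θ)
    (hω : ∀ j, ω j = θ ^ (j + 1)) (hθY : θ ^ (Y - d / 2) ≤ 1 / 2)
    (hI : 2 * θ ^ (Y - d / 2) * ∫ x : Space d, Real.exp (-(c * Y * ‖x‖)) ≤ 1 / 2) (t : ℝ) :
    ∫⁻ x, ENNReal.ofReal (trainWeight c ω v t x) ^ Y ≤ 1 / 2 := by
  have hω0 : ∀ j, 0 < ω j := fun j => by rw [hω]; positivity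
  have hint : 0 ≤ ∫ x : Space d, Real.exp (-(c * Y * ‖x‖)) :=
    integral_nonneg fun x => (Real.exp_pos _).le
  obtain ⟨hs1, hs2⟩ := summable_pow_succ_rpow hθ.le hθY
  calc _ ≤ ∫⁻ x : Space d, ∑' j, ENNReal.ofReal
        (ω j * Real.exp (-(c * (ω j ^ (1 / 2 : ℝ) * ‖x - t • v j‖)))) ^ Y :=
        lintegral_mono fun x => ofReal_trainWeight_rpow_le hY t x
    _ = ∑' j, ∫⁻ x : Space d, ENNReal.ofReal
        (ω j * Real.exp (-(c * (ω j ^ (1 / 2 : ℝ) * ‖x - t • v j‖)))) ^ Y :=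
        lintegral_tsum fun j => by fun_prop
    _ = ∑' j, ENNReal.ofReal
        ((θ ^ (j + 1)) ^ (Y - d / 2) * ∫ x : Space d, Real.exp (-(c * Y * ‖x‖))) := by
        congr 1
        ext j
        rw [lintegral_weight_term hc hY (hω0 j), hω]
    _ = ENNReal.ofReal (∑' j : ℕ,
        (θ ^ (j + 1)) ^ (Y - d / 2) * ∫ x : Space d, Real.exp (-(c * Y * ‖x‖))) :=
        (ENNReal.ofReal_tsum_of_nonneg (fun j => by positivity) (hs1.mul_right _)).symm
    _ ≤ ENNReal.ofReal (1 / 2) := by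
        refine ENNReal.ofReal_le_ofReal ?_
        rw [tsum_mul_right]
        exact (mul_le_mul_of_nonneg_right hs2 hint).trans hI
    _ = 1 / 2 := by
        rw [ENNReal.ofReal_div_of_pos (by norm_num)]
        simp

end Weight

/-! ### Soliton trains -/

theorem norm_soliton (φ : Space d → ℝ) (w : ℝ) (v : Space d) (γ t : ℝ) (x : Space d) :
    ‖soliton φ w v 0 γ t x‖ = |φ (x - t • v)| := by
  rw [soliton, norm_mul, mul_comm Complex.I, Complex.norm_exp_ofReal_mul_I, one_mul,
    Complex.norm_real, Real.norm_eq_abs, sub_zero]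

theorem continuous_soliton {φ : Space d → ℝ} (hφ : Continuous φ) (w : ℝ) (v : Space d) (γ : ℝ) :
    Continuous fun p : ℝ × Space d => soliton φ w v 0 γ p.1 p.2 := by
  unfold soliton
  have : Continuous fun p : ℝ × Space d => inner ℝ v p.2 := by fun_prop
  fun_prop

theorem norm_exp_I_mul_sub_le {p q : ℝ} :
    ‖Complex.exp (Complex.I * p) - Complex.exp (Complex.I * q)‖ ≤ |p - q| := by
  have e : Complex.exp (Complex.I * p) - Complex.exp (Complex.I * q) =
      Complex.exp (Complex.I * q) * (Complex.exp (Complex.I * ((p - q : ℝ) : ℂ)) - 1) := by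
    rw [mul_sub, ← Complex.exp_add, mul_one]
    congr 2
    push_cast
    ring
  rw [e, norm_mul, mul_comm Complex.I (q : ℂ), Complex.norm_exp_ofReal_mul_I, one_mul]
  exact Real.norm_exp_I_mul_ofReal_sub_one_le

theorem norm_exp_I_mul_sub_le_rpow {p q y s : ℝ} (hs : 0 ≤ s) (hs1 : s ≤ 1) (hy : 0 ≤ y)
    (h : |p - q| ≤ y) :
    ‖Complex.exp (Complex.I * p) - Complex.exp (Complex.I * q)‖ ≤ 2 * y ^ s := by
  rcases le_total y 1 with h1 | h1
  · have h2 : y ≤ y ^ s := by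
      have := Real.rpow_le_rpow_of_exponent_ge' hy h1 hs hs1
      rwa [Real.rpow_one] at this
    have := norm_exp_I_mul_sub_le (p := p) (q := q)
    linarith
  · have h2 : 1 ≤ y ^ s := Real.one_le_rpow h1 hs
    refine (norm_sub_le _ _).trans ?_
    rw [mul_comm Complex.I, mul_comm Complex.I, Complex.norm_exp_ofReal_mul_I,
      Complex.norm_exp_ofReal_mul_I]
    linarith

/-- The increments of a soliton consist of a phase part and an amplitude part. -/
theorem norm_soliton_sub_le {s : ℝ} (hs : 0 ≤ s) (hs1 : s ≤ 1) (φ : Space d → ℝ) (w : ℝ)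
    (v : Space d) (γ t : ℝ) (x h : Space d) :
    ‖soliton φ w v 0 γ t (x + h) - soliton φ w v 0 γ t x‖ ≤
      |φ (x + h - t • v) - φ (x - t • v)| + 2 * (‖v‖ * ‖h‖) ^ s * |φ (x - t • v)| := by
  unfold soliton
  rw [sub_zero, sub_zero]
  obtain ⟨p, hp⟩ : ∃ p : ℝ,
    p = w * t + 1 / 2 * inner ℝ v (x + h) - 1 / 4 * ‖v‖ ^ 2 * t + γ := ⟨_, rfl⟩
  obtain ⟨q, hq⟩ : ∃ q : ℝ,
    q = w * t + 1 / 2 * inner ℝ v x - 1 / 4 * ‖v‖ ^ 2 * t + γ := ⟨_, rfl⟩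
  rw [← hp, ← hq]
  have hpq : |p - q| ≤ ‖v‖ * ‖h‖ := by
    have e : p - q = 1 / 2 * inner ℝ v h := by rw [hp, hq, inner_add_right]; ring
    rw [e, abs_mul, abs_of_pos (by norm_num : (0 : ℝ) < 1 / 2)]
    have := abs_real_inner_le_norm v h
    have := norm_nonneg v
    have := norm_nonneg h
    nlinarith [mul_nonneg (norm_nonneg v) (norm_nonneg h)]
  have h1 := norm_exp_I_mul_sub_le_rpow hs hs1 (by positivity) hpq
  generalize φ (x + h - t • v) = A
  generalize φ (x - t • v) = B
  have e : Complex.exp (Complex.I * p) * (A : ℂ) - Complex.exp (Complex.I * q) * (B : ℂ) =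
      Complex.exp (Complex.I * p) * ((A - B : ℝ) : ℂ) +
        (Complex.exp (Complex.I * p) - Complex.exp (Complex.I * q)) * (B : ℂ) := by
    push_cast; ring
  rw [e]
  refine (norm_add_le _ _).trans ?_
  rw [norm_mul, norm_mul, mul_comm Complex.I (p : ℂ), Complex.norm_exp_ofReal_mul_I, one_mul,
    Complex.norm_real, Complex.norm_real, Real.norm_eq_abs, Real.norm_eq_abs,
    mul_comm (p : ℂ) Complex.I]
  gcongr

/-- A family of exponentially localized profiles with geometrically decreasing frequencies and
well separated velocities. -/
structure SolitonTrain (α a D K θ : ℝ) (ω : ℕ → ℝ) (φ : ℕ → Space d → ℝ) (v : ℕ → Space d) :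
    Prop where
  θ_pos : 0 < θ
  θ_le : θ ≤ 1
  freq : ∀ j, ω j = θ ^ (j + 1)
  continuous : ∀ j, Continuous (φ j)
  decay : ∀ j y, |φ j y| ≤
    D * ω j ^ (1 / α) * Real.exp (-(a * (ω j ^ (1 / 2 : ℝ) * ‖y‖)))
  incr : ∀ j y y', |φ j y' - φ j y| ≤ D * ω j ^ (1 / α) * ω j ^ (1 / 2 : ℝ) *
    Real.exp (-(a * (ω j ^ (1 / 2 : ℝ) * (‖y‖ - ‖y' - y‖)))) * ‖y' - y‖
  speed : ∀ j, ω j ^ (1 / 2 : ℝ) * ‖v j‖ = K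
  separation : ∀ j m, j ≠ m → K / 2 ≤ ω j ^ (1 / 2 : ℝ) * ‖v j - v m‖

section Train

variable {α a D K θ : ℝ} {ω : ℕ → ℝ} {φ : ℕ → Space d → ℝ} {v : ℕ → Space d}

theorem SolitonTrain.freq_pos (st : SolitonTrain α a D K θ ω φ v) (j : ℕ) : 0 < ω j := by
  rw [st.freq]; exact pow_pos st.θ_pos _

theorem SolitonTrain.freq_le_one (st : SolitonTrain α a D K θ ω φ v) (j : ℕ) : ω j ≤ 1 := by
  rw [st.freq]; exact pow_le_one₀ st.θ_pos.le st.θ_le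

/-- At any given point, all solitons but one are far away. -/
theorem SolitonTrain.exists_far (st : SolitonTrain α a D K θ ω φ v) (t : ℝ) (x : Space d) :
    ∃ m, ∀ j, j ≠ m → K * |t| / 4 ≤ ω j ^ (1 / 2 : ℝ) * ‖x - t • v j‖ := by
  by_cases hall : ∀ j, K * |t| / 4 ≤ ω j ^ (1 / 2 : ℝ) * ‖x - t • v j‖
  · exact ⟨0, fun j _ => hall j⟩
  push Not at hall
  obtain ⟨m, hm⟩ := hall
  refine ⟨m, fun j hj => ?_⟩
  by_contra! hlt
  have hσj : 0 < ω j ^ (1 / 2 : ℝ) := Real.rpow_pos_of_pos (st.freq_pos j) _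
  have hσm : 0 < ω m ^ (1 / 2 : ℝ) := Real.rpow_pos_of_pos (st.freq_pos m) _
  have h1 := st.separation j m hj
  have h2 := st.separation m j hj.symm
  rw [norm_sub_rev] at h2
  have h3 : |t| * ‖v j - v m‖ ≤ ‖x - t • v j‖ + ‖x - t • v m‖ := by
    rw [← Real.norm_eq_abs, ← norm_smul, smul_sub, norm_sub_rev (x) (t • v j)]
    refine (le_of_eq ?_).trans (norm_add_le _ _)
    congr 1
    abel
  have hA := norm_nonneg (x - t • v j)
  have hB := norm_nonneg (x - t • v m)
  generalize ω j ^ (1 / 2 : ℝ) = σj at *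
  generalize ω m ^ (1 / 2 : ℝ) = σm at *
  generalize ‖v j - v m‖ = V at *
  generalize ‖x - t • v j‖ = A at *
  generalize ‖x - t • v m‖ = B at *
  have ht := abs_nonneg t
  generalize |t| = τ at *
  -- If two solitons were both closer than `K|t|/4` in their scaled distances, multiplying the
  -- triangle inequality by the smaller of the two scales would contradict the separation `K/2` of
  -- the velocities.
  rcases le_total σj σm with hle | hle
  · nlinarith [mul_le_mul_of_nonneg_left h3 hσj.le, mul_le_mul_of_nonneg_right hle hB,
      mul_le_mul_of_nonneg_right h1 ht]
  · nlinarith [mul_le_mul_of_nonneg_left h3 hσm.le, mul_le_mul_of_nonneg_right hle hA,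
      mul_le_mul_of_nonneg_right h2 ht]

/-- The soliton's exponential is traded for the power `y` of the weight, possible because `αy ≤ 1`
and the weight has exponent `aα/2`. Only half of the decay is spent; the other half remains for the
decay in time. -/
theorem SolitonTrain.rpow_mul_exp_le (st : SolitonTrain α a D K θ ω φ v) (hα : 0 < α)
    (ha : 0 < a) {X y : ℝ} (hy0 : 0 ≤ y) (hy : y ≤ 1 / α) (j : ℕ) (t : ℝ) (x : Space d) :
    ω j ^ X * Real.exp (-(a / 2 * (ω j ^ (1 / 2 : ℝ) * ‖x - t • v j‖))) ≤
      ω j ^ (X - y) * trainWeight (a * α / 2) ω v t x ^ y := by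
  have hω := st.freq_pos j
  have hr : 0 ≤ ω j ^ (1 / 2 : ℝ) * ‖x - t • v j‖ := by positivity
  have h1 := le_trainWeight (c := a * α / 2) (v := v) (by positivity)
    (fun j => (st.freq_pos j).le) st.freq_le_one t x j
  generalize ω j ^ (1 / 2 : ℝ) * ‖x - t • v j‖ = r at *
  have h2 := Real.rpow_le_rpow (by positivity) h1 hy0
  rw [Real.mul_rpow hω.le (Real.exp_pos _).le, ← Real.exp_mul] at h2
  have h3 : Real.exp (-(a / 2 * r)) ≤ Real.exp (-(a * α / 2 * r) * y) := by
    rw [Real.exp_le_exp]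
    have hyα : α * y ≤ 1 := by rwa [le_div_iff₀ hα, mul_comm] at hy
    nlinarith [mul_nonneg ha.le hr]
  calc _ = ω j ^ (X - y) * (ω j ^ y * Real.exp (-(a / 2 * r))) := by
        rw [← mul_assoc, ← Real.rpow_add hω, sub_add_cancel]
    _ ≤ ω j ^ (X - y) * (ω j ^ y * Real.exp (-(a * α / 2 * r) * y)) := by gcongr
    _ ≤ _ := by gcongr

theorem SolitonTrain.norm_soliton_le (st : SolitonTrain α a D K θ ω φ v) (hα : 0 < α)
    (ha : 0 < a) (hD : 0 ≤ D) {y : ℝ} (hy0 : 0 ≤ y) (hy : y ≤ 1 / α) (j : ℕ) (γ t : ℝ)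
    (x : Space d) :
    ‖soliton (φ j) (ω j) (v j) 0 γ t x‖ ≤ D * ω j ^ (1 / α - y) *
      (Real.exp (-(a / 2 * (ω j ^ (1 / 2 : ℝ) * ‖x - t • v j‖))) *
        trainWeight (a * α / 2) ω v t x ^ y) := by
  rw [norm_soliton]
  refine (st.decay j _).trans ?_
  have h := st.rpow_mul_exp_le hα ha (X := 1 / α) hy0 hy j t x
  generalize ω j ^ (1 / 2 : ℝ) * ‖x - t • v j‖ = r at *
  have e : Real.exp (-(a * r)) = Real.exp (-(a / 2 * r)) * Real.exp (-(a / 2 * r)) := by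
    rw [← Real.exp_add]; ring_nf
  rw [e]
  calc _ = D * Real.exp (-(a / 2 * r)) * (ω j ^ (1 / α) * Real.exp (-(a / 2 * r))) := by ring
    _ ≤ D * Real.exp (-(a / 2 * r)) * (ω j ^ (1 / α - y) * trainWeight (a * α / 2) ω v t x ^ y) := by
      gcongr
    _ = _ := by ring

/-- The phase oscillates at frequency of order `|v_j| = K ω_j^{-1/2}`, so a Hölder modulus of order
`s` costs `ω_j^{-s/2}`; this is the loss reflected in the condition on `x1`. The amplitude part is
better, gaining `ω_j^{1/2}`, and the factor `e^a` accounts for shifting the centre by at most 1. -/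
theorem SolitonTrain.norm_soliton_sub_le_of_norm_le_one (st : SolitonTrain α a D K θ ω φ v)
    (hα : 0 < α) (ha : 0 < a) (hD : 0 ≤ D) (hK : 1 ≤ K) {s y : ℝ} (hs : 0 ≤ s) (hs1 : s ≤ 1)
    (hy0 : 0 ≤ y) (hy : y ≤ 1 / α) (j : ℕ) (γ t : ℝ) {x h : Space d} (hh : ‖h‖ ≤ 1) :
    ‖soliton (φ j) (ω j) (v j) 0 γ t (x + h) - soliton (φ j) (ω j) (v j) 0 γ t x‖ ≤
      D * (2 * K + Real.exp a) * ω j ^ (1 / α - s / 2 - y) *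
        (holderWeight s h * trainWeight (a * α / 2) ω v t x ^ y) := by
  have hω := st.freq_pos j
  have hω1 := st.freq_le_one j
  have hw : holderWeight s h = ‖h‖ ^ s := by rw [holderWeight, min_eq_right hh]
  have hσ0 : 0 < ω j ^ (1 / 2 : ℝ) := Real.rpow_pos_of_pos hω _
  have hσ1 : ω j ^ (1 / 2 : ℝ) ≤ 1 := Real.rpow_le_one hω.le hω1 (by norm_num)
  have hm := st.rpow_mul_exp_le hα ha (X := 1 / α - s / 2) hy0 hy j t x
  have hr0 : 0 ≤ ω j ^ (1 / 2 : ℝ) * ‖x - t • v j‖ := by positivity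
  have hh0 := norm_nonneg h
  have hhs : ‖h‖ ≤ ‖h‖ ^ s := by
    have := Real.rpow_le_rpow_of_exponent_ge' hh0 hh hs hs1
    rwa [Real.rpow_one] at this
  have hexp : Real.exp (-(a * (ω j ^ (1 / 2 : ℝ) * ‖x - t • v j‖))) ≤
      Real.exp (-(a / 2 * (ω j ^ (1 / 2 : ℝ) * ‖x - t • v j‖))) := by
    rw [Real.exp_le_exp]; nlinarith [mul_nonneg ha.le hr0]
  have hamp : |φ j (x + h - t • v j) - φ j (x - t • v j)| ≤ D * Real.exp a * ‖h‖ ^ s *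
      (ω j ^ (1 / α - s / 2) *
        Real.exp (-(a / 2 * (ω j ^ (1 / 2 : ℝ) * ‖x - t • v j‖)))) := by
    have h1 := st.incr j (x - t • v j) (x + h - t • v j)
    have e : x + h - t • v j - (x - t • v j) = h := by abel
    rw [e] at h1
    refine h1.trans ?_
    have h2 : Real.exp (-(a * (ω j ^ (1 / 2 : ℝ) * (‖x - t • v j‖ - ‖h‖)))) ≤
        Real.exp a * Real.exp (-(a * (ω j ^ (1 / 2 : ℝ) * ‖x - t • v j‖))) := by
      rw [← Real.exp_add, Real.exp_le_exp]
      nlinarith [mul_le_one₀ hσ1 hh0 hh, mul_nonneg ha.le (sub_nonneg.2 (mul_le_one₀ hσ1 hh0 hh))]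
    have h3 : ω j ^ (1 / α) * ω j ^ (1 / 2 : ℝ) ≤ ω j ^ (1 / α - s / 2) := by
      rw [← Real.rpow_add hω]
      exact Real.rpow_le_rpow_of_exponent_ge hω hω1 (by linarith)
    calc _ = D * (ω j ^ (1 / α) * ω j ^ (1 / 2 : ℝ)) *
          Real.exp (-(a * (ω j ^ (1 / 2 : ℝ) * (‖x - t • v j‖ - ‖h‖)))) * ‖h‖ := by ring
      _ ≤ D * ω j ^ (1 / α - s / 2) * (Real.exp a *
          Real.exp (-(a / 2 * (ω j ^ (1 / 2 : ℝ) * ‖x - t • v j‖)))) * ‖h‖ ^ s := by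
        have := h2.trans (mul_le_mul_of_nonneg_left hexp (Real.exp_pos a).le)
        gcongr
      _ = _ := by ring
  have hph : 2 * (‖v j‖ * ‖h‖) ^ s * |φ j (x - t • v j)| ≤ D * (2 * K) * ‖h‖ ^ s *
      (ω j ^ (1 / α - s / 2) *
        Real.exp (-(a / 2 * (ω j ^ (1 / 2 : ℝ) * ‖x - t • v j‖)))) := by
    have hv : ‖v j‖ ^ s ≤ K * ω j ^ (-(s / 2)) := by
      have e : ‖v j‖ = K * ω j ^ (-(1 / 2) : ℝ) := by
        rw [← st.speed j, Real.rpow_neg hω.le, mul_right_comm, mul_inv_cancel₀ hσ0.ne', one_mul]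
      rw [e, Real.mul_rpow (by linarith) (by positivity), ← Real.rpow_mul hω.le]
      have h1 : K ^ s ≤ K := by
        have := Real.rpow_le_rpow_of_exponent_le hK hs1
        rwa [Real.rpow_one] at this
      have e2 : -(1 / 2) * s = -(s / 2) := by ring
      rw [e2]
      gcongr
    have hd := (st.decay j (x - t • v j)).trans
      (mul_le_mul_of_nonneg_left hexp (by positivity))
    have e : ω j ^ (1 / α - s / 2) = ω j ^ (-(s / 2)) * ω j ^ (1 / α) := by
      rw [← Real.rpow_add hω]; ring_nf
    rw [Real.mul_rpow (norm_nonneg _) hh0, e]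
    calc _ ≤ 2 * (K * ω j ^ (-(s / 2)) * ‖h‖ ^ s) * (D * ω j ^ (1 / α) *
          Real.exp (-(a / 2 * (ω j ^ (1 / 2 : ℝ) * ‖x - t • v j‖)))) := by gcongr
      _ = _ := by ring
  refine (norm_soliton_sub_le hs hs1 _ _ _ _ _ _ _).trans ((add_le_add hamp hph).trans ?_)
  rw [hw]
  have hK0 : 0 ≤ K := by linarith
  calc _ = D * (2 * K + Real.exp a) * ‖h‖ ^ s * (ω j ^ (1 / α - s / 2) *
        Real.exp (-(a / 2 * (ω j ^ (1 / 2 : ℝ) * ‖x - t • v j‖)))) := by ring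
    _ ≤ D * (2 * K + Real.exp a) * ‖h‖ ^ s *
        (ω j ^ (1 / α - s / 2 - y) * trainWeight (a * α / 2) ω v t x ^ y) := by gcongr
    _ = _ := by ring

/-- Wave bounds of a soliton train. -/
theorem SolitonTrain.waveBounds (st : SolitonTrain α a D K θ ω φ v) (hα : 0 < α) (ha : 0 < a)
    (hD : 0 ≤ D) (hK : 1 ≤ K) {s x0 x1 ε : ℝ} (hs : 0 ≤ s) (hs1 : s ≤ 1) (hx1 : 0 ≤ x1)
    (hx10 : x1 ≤ x0) (hx0 : x0 ≤ 1 / α - ε) (hε : x1 ≤ 1 / α - s / 2 - ε)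
    (hε0 : 0 ≤ ε) (hθε : θ ^ ε ≤ 1 / 2) :
    WaveBounds x0 x1 s (a * K / 8) (fun j => D * (2 * K + Real.exp a + 2) * ω j ^ ε)
      (fun j t x => soliton (φ j) (ω j) (v j) 0 0 t x) (trainWeight (a * α / 2) ω v) := by
  have hω := st.freq_pos
  have hω1 := st.freq_le_one
  have hc : 0 ≤ a * α / 2 := by positivity
  have hea := Real.exp_pos a
  have hQ0 : ∀ t x, 0 ≤ trainWeight (a * α / 2) ω v t x :=
    fun t x => trainWeight_nonneg (fun j => (hω j).le) t x
  have hC0 : D ≤ D * (2 * K + Real.exp a + 2) := le_mul_of_one_le_right hD (by linarith)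
  have hpow : ∀ j z, ε ≤ z → ω j ^ z ≤ ω j ^ ε := fun j z hz =>
    Real.rpow_le_rpow_of_exponent_ge (hω j) (hω1 j) hz
  have hone : ∀ (j : ℕ) (t : ℝ) (x : Space d),
      Real.exp (-(a / 2 * (ω j ^ (1 / 2 : ℝ) * ‖x - t • v j‖))) ≤ 1 := fun j t x => by
    rw [Real.exp_le_one_iff, neg_nonpos]
    have := (hω j).le
    positivity
  have hle : ∀ j t x, ‖soliton (φ j) (ω j) (v j) 0 0 t x‖ ≤
      D * (2 * K + Real.exp a + 2) * ω j ^ ε *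
      (Real.exp (-(a / 2 * (ω j ^ (1 / 2 : ℝ) * ‖x - t • v j‖))) *
        trainWeight (a * α / 2) ω v t x ^ x0) := fun j t x => by
    refine (st.norm_soliton_le hα ha hD (hx1.trans hx10) (by linarith) j 0 t x).trans ?_
    have h1 := hpow j (1 / α - x0) (by linarith)
    have h2 := Real.rpow_nonneg (hQ0 t x) x0
    have h3 := Real.rpow_nonneg (hω j).le ε
    have h4 := Real.rpow_nonneg (hω j).le (1 / α - x0)
    have := hD.trans hC0
    gcongr
  refine ⟨fun j => continuous_soliton (st.continuous j) _ _ _, fun j => ?_, ?_, hQ0,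
    trainWeight_le_one hc (fun j => (hω j).le) hω1, fun j t x => ?_, fun t x => ?_,
    fun j t x h => ?_⟩
  · have := (hω j).le
    positivity
  · refine Summable.mul_left _ ?_
    simp_rw [st.freq]
    exact (summable_pow_succ_rpow st.θ_pos.le hθε).1
  · refine (hle j t x).trans (mul_le_mul_of_nonneg_left (mul_le_of_le_one_left
      (Real.rpow_nonneg (hQ0 t x) x0) (hone j t x)) ?_)
    have := (hω j).le
    positivity
  · obtain ⟨m, hm⟩ := st.exists_far t x
    refine ⟨m, fun j hj => (hle j t x).trans (mul_le_mul_of_nonneg_left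
      (mul_le_mul_of_nonneg_right (Real.exp_le_exp.2 ?_) (Real.rpow_nonneg (hQ0 t x) x0)) ?_)⟩
    · have := mul_le_mul_of_nonneg_left (hm j hj) ha.le
      linarith
    · have := (hω j).le
      positivity
  · have hq := Real.rpow_le_rpow (hQ0 t x) (le_max_left _ (trainWeight (a * α / 2) ω v t (x + h)))
      hx1
    have hq' := Real.rpow_le_rpow (hQ0 t (x + h)) (le_max_right (trainWeight (a * α / 2) ω v t x) _)
      hx1
    have hq0 := Real.rpow_nonneg (hQ0 t x) x1
    have hq0' := Real.rpow_nonneg (hQ0 t (x + h)) x1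
    have hw := holderWeight_nonneg s h
    have hωj := (hω j).le
    -- For long increments the modulus is 1 and the sum of the two sizes suffices, which is what the
    -- summand `2` in the coefficient covers.
    rcases le_or_gt ‖h‖ 1 with hh | hh
    · refine (st.norm_soliton_sub_le_of_norm_le_one hα ha hD hK hs hs1 hx1 (by linarith)
        j 0 t hh).trans ?_
      have h1 := hpow j (1 / α - s / 2 - x1) (by linarith)
      have h4 := Real.rpow_nonneg hωj (1 / α - s / 2 - x1)
      have h5 : 2 * K + Real.exp a ≤ 2 * K + Real.exp a + 2 := by linarith
      gcongr
    · have hw1 : holderWeight s h = 1 := by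
        rw [holderWeight, min_eq_left hh.le, Real.one_rpow]
      rw [hw1, one_mul]
      have key : ∀ y, ‖soliton (φ j) (ω j) (v j) 0 0 t y‖ ≤
          D * ω j ^ ε * trainWeight (a * α / 2) ω v t y ^ x1 := fun y => by
        refine (st.norm_soliton_le hα ha hD hx1 (by linarith) j 0 t y).trans ?_
        have h1 := hpow j (1 / α - x1) (by linarith)
        have h2 := Real.rpow_nonneg (hQ0 t y) x1
        exact mul_le_mul (by gcongr) (mul_le_of_le_one_left h2 (hone j t y)) (by positivity)
          (by positivity)
      generalize max (trainWeight (a * α / 2) ω v t x) (trainWeight (a * α / 2) ω v t (x + h)) = q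
        at *
      have hp := Real.rpow_nonneg hωj ε
      calc _ ≤ ‖soliton (φ j) (ω j) (v j) 0 0 t (x + h)‖ +
            ‖soliton (φ j) (ω j) (v j) 0 0 t x‖ := norm_sub_le _ _
        _ ≤ D * ω j ^ ε * q ^ x1 + D * ω j ^ ε * q ^ x1 := by
          refine add_le_add ((key _).trans ?_) ((key _).trans ?_) <;> gcongr
        _ = D * 2 * ω j ^ ε * q ^ x1 := by ring
        _ ≤ _ := by
          have h5 : 2 ≤ 2 * K + Real.exp a + 2 := by linarith
          have h6 : 0 ≤ q ^ x1 := hq0.trans hq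
          gcongr

end Train

end NLSTrain
end

open scoped ENNReal Topology
noncomputable section
namespace NLSTrain
open MeasureTheory

variable {d : ℕ}

/-! ### Existence of soliton trains -/

theorem IsSmallSolitonFamily.exists_regular {g : ℝ → ℝ} {α ωs a D : ℝ} {φ : ℝ → Space d → ℝ}
    (hφ : IsSmallSolitonFamily g α ωs a D φ) (ha : 0 ≤ a) (hD : 0 ≤ D) {w : ℝ} (hw : 0 < w)
    (hws : w < ωs) :
    ∃ φ' : Space d → ℝ, φ' =ᵐ[volume] φ w ∧ Continuous φ' ∧ (∃ G, IsBoundState g w φ' G) ∧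
      (∀ y, |φ' y| ≤ D * w ^ (1 / α) * Real.exp (-(a * (w ^ (1 / 2 : ℝ) * ‖y‖)))) ∧
      ∀ y y', |φ' y' - φ' y| ≤ D * w ^ (1 / α) * w ^ (1 / 2 : ℝ) *
        Real.exp (-(a * (w ^ (1 / 2 : ℝ) * (‖y‖ - ‖y' - y‖)))) * ‖y' - y‖ := by
  obtain ⟨G, hG, hb⟩ := hφ w hw hws
  have hσ : 0 < w ^ (1 / 2 : ℝ) := Real.rpow_pos_of_pos hw _
  have e : w ^ (-(1 / 2) : ℝ) = (w ^ (1 / 2 : ℝ))⁻¹ := Real.rpow_neg hw.le _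
  obtain ⟨φ', h1, h2, h3, h4⟩ := exists_regular_representative hG.h1
    (A := D * w ^ (1 / α)) (A' := D * w ^ (1 / α) * w ^ (1 / 2 : ℝ)) (k := a * w ^ (1 / 2 : ℝ))
    (by positivity) (by positivity)
    (by
      filter_upwards [hb] with x hx
      have : 0 ≤ w ^ (-(1 / 2) : ℝ) * ‖G x‖ := by positivity
      linarith)
    (by
      filter_upwards [hb] with x hx
      have h5 : w ^ (-(1 / 2) : ℝ) * ‖G x‖ ≤
          D * w ^ (1 / α) * Real.exp (-(a * w ^ (1 / 2 : ℝ) * ‖x‖)) := by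
        linarith [abs_nonneg (φ w x)]
      rw [e, inv_mul_le_iff₀ hσ] at h5
      linarith)
  refine ⟨φ', h1, h2, ⟨G, hG.congr_ae h1⟩, fun y => ?_, fun y y' => ?_⟩
  · rw [← mul_assoc a]; exact h3 y
  · rw [← mul_assoc a]; exact h4 y y'

/-- As `θ ≤ 1/4`, the square roots of distinct frequencies differ by a factor of at least 2, so
their ratio stays at distance `1/2` from 1. -/
theorem rpow_half_sub_bound {θ : ℝ} (hθ : 0 < θ) (hθ1 : θ ≤ 1 / 4) {j m : ℕ} (hjm : j ≠ m) :
    1 / 2 ≤ |1 - (θ ^ (j + 1)) ^ (1 / 2 : ℝ) / (θ ^ (m + 1)) ^ (1 / 2 : ℝ)| := by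
  have key : ∀ i n : ℕ, i < n →
      (θ ^ (n + 1)) ^ (1 / 2 : ℝ) ≤ 1 / 2 * (θ ^ (i + 1)) ^ (1 / 2 : ℝ) := by
    intro i n hin
    have h1 : θ ^ (n + 1) ≤ 1 / 4 * θ ^ (i + 1) := by
      calc θ ^ (n + 1) ≤ θ ^ (i + 1 + 1) := pow_le_pow_of_le_one hθ.le (by linarith) (by omega)
        _ = θ * θ ^ (i + 1) := by ring
        _ ≤ 1 / 4 * θ ^ (i + 1) := by gcongr
    refine (Real.rpow_le_rpow (by positivity) h1 (by norm_num)).trans (le_of_eq ?_)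
    rw [Real.mul_rpow (by norm_num) (by positivity), ← Real.sqrt_eq_rpow (1 / 4)]
    congr 1
    rw [Real.sqrt_eq_iff_mul_self_eq (by norm_num) (by norm_num)]
    norm_num
  have hj : 0 < (θ ^ (j + 1)) ^ (1 / 2 : ℝ) := Real.rpow_pos_of_pos (by positivity) _
  have hm : 0 < (θ ^ (m + 1)) ^ (1 / 2 : ℝ) := Real.rpow_pos_of_pos (by positivity) _
  rcases lt_or_gt_of_ne hjm with h | h
  · have h1 : 2 ≤ (θ ^ (j + 1)) ^ (1 / 2 : ℝ) / (θ ^ (m + 1)) ^ (1 / 2 : ℝ) := by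
      rw [le_div_iff₀ hm]
      linarith [key j m h]
    rw [abs_of_nonpos (by linarith)]
    linarith
  · have h1 : (θ ^ (j + 1)) ^ (1 / 2 : ℝ) / (θ ^ (m + 1)) ^ (1 / 2 : ℝ) ≤ 1 / 2 := by
      rw [div_le_iff₀ hm]
      exact key m j h
    rw [abs_of_nonneg (by linarith)]
    linarith

theorem IsSmallSolitonFamily.exists_solitonTrain (hd : 0 < d) {g : ℝ → ℝ} {α ωs a D : ℝ}
    {φ : ℝ → Space d → ℝ} (hφ : IsSmallSolitonFamily g α ωs a D φ) (ha : 0 ≤ a) (hD : 0 ≤ D)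
    {K θ : ℝ} (hK : 0 ≤ K) (hθ : 0 < θ) (hθ1 : θ ≤ 1 / 4) (hθs : θ < ωs) :
    ∃ (φ' : ℕ → Space d → ℝ) (v : ℕ → Space d),
      (∀ j, φ' j =ᵐ[volume] φ (θ ^ (j + 1))) ∧
      (∀ j, ∃ G, IsBoundState g (θ ^ (j + 1)) (φ' j) G) ∧
      SolitonTrain α a D K θ (fun j => θ ^ (j + 1)) φ' v := by
  have hω : ∀ j : ℕ, 0 < θ ^ (j + 1) := fun j => by positivity
  have hωs : ∀ j : ℕ, θ ^ (j + 1) < ωs := fun j =>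
    (pow_le_of_le_one hθ.le (by linarith) (Nat.succ_ne_zero j)).trans_lt hθs
  choose φ' h1 h2 h3 h4 h5 using fun j => hφ.exists_regular ha hD (hω j) (hωs j)
  have hσ : ∀ j : ℕ, 0 < (θ ^ (j + 1)) ^ (1 / 2 : ℝ) := fun j => Real.rpow_pos_of_pos (hω j) _
  -- All velocities lie on one axis, with speed `K ω_j^{-1/2}`. Their differences, scaled by either
  -- frequency, are then at least `K/2`.
  refine ⟨φ', fun j => (K / (θ ^ (j + 1)) ^ (1 / 2 : ℝ)) • EuclideanSpace.single ⟨0, hd⟩ 1,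
    h1, h3, ⟨hθ, by linarith, fun j => rfl, h2, h4, h5, fun j => ?_, fun j m hjm => ?_⟩⟩
  · have := hσ j
    rw [norm_smul, Real.norm_of_nonneg (by positivity), PiLp.norm_single]
    simp only [norm_one, mul_one]
    field_simp
  · have hj := hσ j
    have hm := hσ m
    rw [← sub_smul, norm_smul, PiLp.norm_single, norm_one, mul_one, Real.norm_eq_abs,
      ← abs_of_pos hj, ← abs_mul, abs_of_pos hj]
    have e : (θ ^ (j + 1)) ^ (1 / 2 : ℝ) * (K / (θ ^ (j + 1)) ^ (1 / 2 : ℝ) -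
        K / (θ ^ (m + 1)) ^ (1 / 2 : ℝ)) =
        K * (1 - (θ ^ (j + 1)) ^ (1 / 2 : ℝ) / (θ ^ (m + 1)) ^ (1 / 2 : ℝ)) := by
      field_simp
    rw [e, abs_mul, abs_of_nonneg hK]
    have := rpow_half_sub_bound hθ hθ1 hjm
    nlinarith

/-! ### Passage to space-time -/

theorem ae_prod_of_ae_translate {p : Space d → Prop} (h : ∀ᵐ x, p x) (v : Space d) :
    ∀ᵐ q : ℝ × Space d, p (q.2 - q.1 • v) := by
  have hq : Measure.QuasiMeasurePreserving (fun q : ℝ × Space d => q.2 - q.1 • v)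
      volume volume := by
    refine ⟨by fun_prop, Measure.AbsolutelyContinuous.mk fun s hs h0 => ?_⟩
    have hm : Measurable fun q : ℝ × Space d => q.2 - q.1 • v := by fun_prop
    rw [Measure.map_apply hm hs, Measure.volume_eq_prod, Measure.measure_prod_null (hm hs)]
    refine Filter.Eventually.of_forall fun t => ?_
    exact ((measurePreserving_sub_right volume (t • v)).measure_preimage
      hs.nullMeasurableSet).trans h0
  exact hq.ae h

theorem ae_prod_of_forall_ae {p : ℝ × Space d → Prop} (hm : MeasurableSet {q | p q})
    (h : ∀ t, ∀ᵐ x, p (t, x)) : ∀ᵐ q : ℝ × Space d, p q := by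
  rw [Measure.volume_eq_prod]
  exact (Measure.ae_prod_iff_ae_ae hm).2 (Filter.Eventually.of_forall h)

theorem locallyIntegrableOn_of_ae_bounded {f : ℝ × Space d → ℂ} {s : Set (ℝ × Space d)} {M : ℝ}
    (hs : MeasurableSet s) (hf : AEStronglyMeasurable f)
    (hM : ∀ᵐ p, p ∈ s → ‖f p‖ ≤ M) : LocallyIntegrableOn f s := by
  intro x hx
  refine ⟨s ∩ Metric.closedBall x 1, inter_mem_nhdsWithin s (Metric.closedBall_mem_nhds x one_pos),
    ?_⟩
  refine Measure.integrableOn_of_bounded (M := M) ?_ hf ?_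
  · exact ((measure_mono Set.inter_subset_right).trans_lt
      (isCompact_closedBall x 1).measure_lt_top).ne
  · refine (ae_restrict_iff' (hs.inter Metric.isClosed_closedBall.measurableSet)).2 ?_
    filter_upwards [hM] with p hp hps using hp hps.1

/-- Countable superposition of weak solutions. -/
theorem integral_tsum_test {R N : ℕ → ℝ × Space d → ℂ} {P ψ : ℝ × Space d → ℂ} {b : ℕ → ℝ} {C : ℝ}
    (hb : Summable b) (hR : ∀ j, Continuous (R j)) (hN : ∀ j, Continuous (N j))
    (hRb : ∀ j p, ‖R j p‖ ≤ b j) (hNb : ∀ j p, ‖N j p‖ ≤ b j * C)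
    (hP : Continuous P) (hPs : HasCompactSupport P) (hψ : Continuous ψ) (hψs : HasCompactSupport ψ)
    (h : ∀ j, ∫ p, (R j p * P p + N j p * ψ p) = 0) :
    Integrable (fun p => (∑' j, R j p) * P p + (∑' j, N j p) * ψ p) ∧
      ∫ p, ((∑' j, R j p) * P p + (∑' j, N j p) * ψ p) = 0 := by
  have hPi : Integrable P := hP.integrable_of_hasCompactSupport hPs
  have hψi : Integrable ψ := hψ.integrable_of_hasCompactSupport hψs
  have hbnd : Integrable fun p => ‖P p‖ + C * ‖ψ p‖ := hPi.norm.add (hψi.norm.const_mul C)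
  have hle : ∀ j p, ‖R j p * P p + N j p * ψ p‖ ≤ b j * (‖P p‖ + C * ‖ψ p‖) := fun j p => by
    refine (norm_add_le _ _).trans ?_
    rw [norm_mul, norm_mul]
    have h1 := mul_le_mul_of_nonneg_right (hRb j p) (norm_nonneg (P p))
    have h2 := mul_le_mul_of_nonneg_right (hNb j p) (norm_nonneg (ψ p))
    linarith
  have hint : ∀ j, Integrable fun p => R j p * P p + N j p * ψ p := fun j =>
    (hbnd.const_mul (b j)).mono' (((hR j).mul hP).add ((hN j).mul hψ)).aestronglyMeasurable
      (Filter.Eventually.of_forall (hle j))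
  have hsR : ∀ p, Summable fun j => R j p := fun p => Summable.of_norm_bounded hb fun j => hRb j p
  have hsN : ∀ p, Summable fun j => N j p := fun p =>
    Summable.of_norm_bounded (hb.mul_right C) fun j => hNb j p
  have e : (fun p => (∑' j, R j p) * P p + (∑' j, N j p) * ψ p) =
      fun p => ∑' j, (R j p * P p + N j p * ψ p) := by
    ext p
    rw [((hsR p).mul_right _).tsum_add ((hsN p).mul_right _), tsum_mul_right, tsum_mul_right]
  have hc : Continuous fun p => (∑' j, R j p) * P p + (∑' j, N j p) * ψ p :=
    ((continuous_tsum hR hb hRb).mul hP).add ((continuous_tsum hN (hb.mul_right C) hNb).mul hψ)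
  refine ⟨hc.integrable_of_hasCompactSupport (hPs.mul_left.add hψs.mul_left), ?_⟩
  rw [e, ← integral_tsum_of_summable_integral_norm hint]
  · simp_rw [h, tsum_zero]
  · refine Summable.of_nonneg_of_le (fun j => integral_nonneg fun p => norm_nonneg _) (fun j => ?_)
      (hb.mul_right (∫ p, (‖P p‖ + C * ‖ψ p‖)))
    rw [← integral_const_mul]
    exact integral_mono (hint j).norm (hbnd.const_mul _) (hle j)

/-- Duhamel's formula in space-time, for test functions supported in positive times. -/
theorem integral_test_perturbation {u N : ℝ → L2 d} {A μ M : ℝ} (hN : Continuous N) (hμ : 1 ≤ μ)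
    (hA : 0 ≤ A) (hNb : ∀ t, ‖N t‖ ≤ A * Real.exp (-(μ * t))) (hu : ∀ t, u t = duhamel sch N t)
    {η n : ℝ → Space d → ℂ} (hηm : AEStronglyMeasurable (fun p : ℝ × Space d => η p.1 p.2))
    (hnm : AEStronglyMeasurable (fun p : ℝ × Space d => n p.1 p.2))
    (hη : ∀ t, η t =ᵐ[volume] u t) (hn : ∀ t, n t =ᵐ[volume] N t)
    (hηM : ∀ᵐ p : ℝ × Space d, 0 ≤ p.1 → ‖η p.1 p.2‖ ≤ M)
    (hnM : ∀ᵐ p : ℝ × Space d, 0 ≤ p.1 → ‖n p.1 p.2‖ ≤ M) {ψ : ℝ × Space d → ℂ}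
    (hψ : ContDiff ℝ (⊤ : ℕ∞) ψ) (hs : HasCompactSupport ψ)
    (hpos : tsupport ψ ⊆ Set.Ioi 0 ×ˢ Set.univ) :
    Integrable (fun p : ℝ × Space d =>
      η p.1 p.2 * (-Complex.I * fderiv ℝ ψ p (1, 0) + spaceLaplacian ψ p) +
        n p.1 p.2 * ψ p) ∧
    ∫ p : ℝ × Space d,
      (η p.1 p.2 * (-Complex.I * fderiv ℝ ψ p (1, 0) + spaceLaplacian ψ p) +
        n p.1 p.2 * ψ p) = 0 := by
  have hmain := integral_test_duhamel hN hμ hA hNb hψ hs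
  have hc1 := (contDiff_fderiv_apply hψ ((1 : ℝ), (0 : Space d))).continuous
  have hc2 := (contDiff_spaceLaplacian hψ).continuous
  obtain ⟨P, hP⟩ : ∃ P : ℝ × Space d → ℂ,
    P = fun p => -Complex.I * fderiv ℝ ψ p (1, 0) + spaceLaplacian ψ p := ⟨_, rfl⟩
  have hPc : Continuous P := by rw [hP]; exact (continuous_const.mul hc1).add hc2
  have hP0 : ∀ p, p ∉ tsupport ψ → P p = 0 := fun p hp => by
    have h1 : fderiv ℝ ψ p = 0 := by
      have := support_fderiv_subset (𝕜 := ℝ) (f := ψ)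
      by_contra h
      exact hp (this h)
    rw [hP]
    simp only [h1, spaceLaplacian_eq_zero_of_notMem hp]
    simp
  have hPs : HasCompactSupport P := HasCompactSupport.intro hs hP0
  have hPi : Integrable P := hPc.integrable_of_hasCompactSupport hPs
  have hψi : Integrable ψ := hψ.continuous.integrable_of_hasCompactSupport hs
  -- The sup bounds are known only for `t ≥ 0`; elsewhere the test function and its derivatives
  -- vanish.
  have hneg : ∀ p : ℝ × Space d, ¬ 0 ≤ p.1 → p ∉ tsupport ψ := fun p hp h =>
    hp (le_of_lt (hpos h).1)
  have hi : ∀ {w : ℝ × Space d → ℂ} {χ : ℝ × Space d → ℂ}, AEStronglyMeasurable w →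
      (∀ᵐ p : ℝ × Space d, 0 ≤ p.1 → ‖w p‖ ≤ M) → Integrable χ →
      (∀ p, p ∉ tsupport ψ → χ p = 0) → Integrable fun p => w p * χ p := by
    intro w χ hw hwM hχ hχ0
    refine (hχ.norm.const_mul M).mono' (hw.mul hχ.1) ?_
    filter_upwards [hwM] with p hp
    rw [norm_mul]
    by_cases h0 : 0 ≤ p.1
    · exact mul_le_mul_of_nonneg_right (hp h0) (norm_nonneg _)
    · rw [hχ0 p (hneg p h0)]; simp
  have h1 : Integrable fun p : ℝ × Space d => η p.1 p.2 * P p := hi hηm hηM hPi hP0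
  have h2 : Integrable fun p : ℝ × Space d => n p.1 p.2 * ψ p :=
    hi hnm hnM hψi fun p hp => image_eq_zero_of_notMem_tsupport hp
  have e : ∀ p : ℝ × Space d,
      -Complex.I * fderiv ℝ ψ p (1, 0) + spaceLaplacian ψ p = P p := fun p => by rw [hP]
  simp_rw [e] at hmain ⊢
  refine ⟨h1.add h2, ?_⟩
  rw [integral_add h1 h2, Measure.volume_eq_prod, integral_prod _ h1, integral_prod _ h2,
    ← integral_add h1.integral_prod_left h2.integral_prod_left, ← hmain]
  congr 1
  ext t
  congr 1
  · refine integral_congr_ae ?_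
    filter_upwards [hη t] with x hx
    simp only [hx, hu t]
  · refine integral_congr_ae ?_
    filter_upwards [hn t] with x hx
    simp only [hx]

end NLSTrain
end

open scoped ENNReal Topology
noncomputable section
namespace NLSTrain
open MeasureTheory

variable {d : ℕ}

/-! ### Choice of parameters -/

theorem exists_pos_le_rpow_le {r δ α : ℝ} (hr : 0 < r) (hδ : 0 < δ) (hα : 0 < α) :
    ∃ R : ℝ, 0 < R ∧ R ≤ r ∧ R ^ α ≤ δ := by
  refine ⟨min r (δ ^ (1 / α)), lt_min hr (Real.rpow_pos_of_pos hδ _), min_le_left _ _, ?_⟩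
  calc _ ≤ (δ ^ (1 / α)) ^ α := Real.rpow_le_rpow (le_min hr.le (Real.rpow_nonneg hδ.le _))
        (min_le_right _ _) hα.le
    _ = δ := by rw [← Real.rpow_mul hδ.le, one_div_mul_cancel hα.ne', Real.rpow_one]

theorem exists_contraction_parameters {C α B Λ ρ : ℝ} (hC : 0 < C) (hα : 0 < α) (hB : 1 ≤ B)
    (hΛ : 0 ≤ Λ) (hρ : 0 < ρ) :
    ∃ R μ κ : ℝ, 0 < R ∧ 2 * R ≤ 1 ∧ 2 * R ≤ ρ ∧ 0 < μ ∧ μ ≤ R ∧ 0 < κ ∧ κ * B ≤ R ∧ κ ≤ R ∧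
      Λ * (C * (2 * R) ^ α) ≤ 1 / 2 ∧ Λ * (C * (2 * R) ^ α) * R + μ ≤ κ ∧
      2 * (C * 2 ^ α * R ^ α) * R + C * 2 ^ α * μ ^ α * R + 2 * (C * 2 ^ α * μ) + μ ≤ κ := by
  have hB0 : 0 < B := by linarith
  have h2 : (0 : ℝ) < 2 ^ α := Real.rpow_pos_of_pos two_pos _
  obtain ⟨E, hE⟩ : ∃ E : ℝ, E = C * 2 ^ α := ⟨_, rfl⟩
  have hE0 : 0 < E := hE ▸ mul_pos hC h2
  -- `R^α` is small enough that both the quadratic coefficient `E R^α` and the Lipschitz constant of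
  -- the extension, even after multiplication by `B`, are at most `1/8`; here `B` stands for the
  -- loss in the sup bound.
  obtain ⟨R, hR0, hR1, hRα⟩ := exists_pos_le_rpow_le (r := min (1 / 2) (ρ / 2))
    (δ := 1 / (8 * B * E * (Λ + 1))) (by positivity) (by positivity) hα
  have hRa : R ≤ 1 / 2 := hR1.trans (min_le_left _ _)
  have hRb : R ≤ ρ / 2 := hR1.trans (min_le_right _ _)
  have hRα0 := Real.rpow_nonneg hR0.le α
  rw [le_div_iff₀ (by positivity)] at hRα
  have e1 : C * (2 * R) ^ α = E * R ^ α := by rw [hE, Real.mul_rpow two_pos.le hR0.le]; ring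
  have h3 : 0 ≤ E * R ^ α := by positivity
  have h4 : E * R ^ α * B ≤ 1 / 8 := by nlinarith [mul_nonneg (mul_nonneg h3 hB0.le) hΛ]
  have h5 : Λ * (E * R ^ α) * B ≤ 1 / 8 := by nlinarith [mul_nonneg h3 hB0.le]
  have h6 : E * R ^ α * R ≤ R / B / 8 := by
    rw [div_div, le_div_iff₀ (by positivity)]
    nlinarith
  have h7 : Λ * (E * R ^ α) * R ≤ R / B / 8 := by
    rw [div_div, le_div_iff₀ (by positivity)]
    nlinarith
  have hκR : R / B ≤ R := div_le_self hR0.le hB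
  have hκ : 0 < R / B := by positivity
  -- The size of the profile is fixed after `R`, so that the terms linear in `μ` take a quarter of
  -- `κ = R / B`.
  obtain ⟨μ, hμ⟩ : ∃ μ : ℝ, μ = R / B / (4 * (2 * E + 1)) := ⟨_, rfl⟩
  have hμ0 : 0 < μ := by rw [hμ]; positivity
  have hμ1 : μ * (2 * E + 1) = R / B / 4 := by
    rw [hμ]; field_simp
  have hμ2 : μ ≤ R / B / 4 := by nlinarith
  have hμR : μ ≤ R := by linarith
  have h8 : E * μ ^ α * R ≤ R / B / 8 := by
    refine le_trans ?_ h6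
    have := Real.rpow_le_rpow hμ0.le hμR hα.le
    gcongr
  refine ⟨R, μ, R / B, hR0, by linarith, by linarith, hμ0, hμR, hκ,
    (div_mul_cancel₀ R hB0.ne').le, hκR, ?_, ?_, ?_⟩
  · rw [e1]
    have : 0 ≤ Λ * (E * R ^ α) := by positivity
    nlinarith
  · rw [e1]; linarith
  · rw [← hE]; linarith

/-- Existence of soliton trains satisfying the profile bounds with prescribed constants. -/
theorem IsSmallSolitonFamily.exists_profileBounds (hd : 0 < d) {g : ℝ → ℝ}
    {α ωs a D C β s s' x0 x1 Y : ℝ} {φ : ℝ → Space d → ℝ}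
    (hφ : IsSmallSolitonFamily g α ωs a D φ) (hωs : 0 < ωs) (ha : 0 < a) (hD : 0 < D) (hα : 0 < α)
    (hC : 0 < C) (hf : SecondDiffBound (nonlin g) C α) (hfc : Continuous (nonlin g))
    (hE : Exponents d α β s s' x0 x1 Y) {μ ν : ℝ} (hμ0 : 0 < μ) (hμ1 : μ ≤ 1) (hν : 0 ≤ ν) :
    ∃ (ω : ℕ → ℝ) (φ' : ℕ → Space d → ℝ) (v : ℕ → Space d) (b : ℕ → ℝ) (Q : ℝ → Space d → ℝ),
      (∀ j, 0 < ω j ∧ ω j < ωs) ∧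
      (∃ c : ℝ, 0 < c ∧ ∀ j k, j < k →
        c ≤ (1 / 2) * (min 1 (min (ω j ^ (1 / 2 : ℝ)) (ω k ^ (1 / 2 : ℝ))) * ‖v j - v k‖)) ∧
      (∀ j, φ' j =ᵐ[volume] φ (ω j)) ∧ (∀ j, ∃ G, IsBoundState g (ω j) (φ' j) G) ∧
      (∀ j, Continuous (φ' j)) ∧ Summable b ∧
      (∀ j t x, ‖soliton (φ' j) (ω j) (v j) 0 0 t x‖ ≤ b j) ∧
      (∀ j t x, ‖nonlin g (soliton (φ' j) (ω j) (v j) 0 0 t x)‖ ≤ b j * C) ∧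
      ProfileBounds α x0 x1 Y s ν μ (fun t x => ∑' j, soliton (φ' j) (ω j) (v j) 0 0 t x)
        (fun t x => nonlin g (∑' j, soliton (φ' j) (ω j) (v j) 0 0 t x) -
          ∑' j, nonlin g (soliton (φ' j) (ω j) (v j) 0 0 t x)) Q := by
  have hs' : 0 < s' := hE.s_pos.trans hE.s_lt
  have hr : 0 < 1 - s / s' := sub_pos.2 ((div_lt_one hs').2 hE.s_lt)
  have hx0 : 0 < x0 := hE.x1_pos.trans_le hE.x1_le
  -- `μ₁` bounds the sum of the wave coefficients; the condition on `μ₁^α` makes the interaction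
  -- error, with its factor `4C`, no larger than `μ`.
  obtain ⟨μ₁, hμ₁0, hμ₁, hμ₁α⟩ := exists_pos_le_rpow_le (r := μ) (δ := 1 / (4 * C)) hμ0
    (by positivity) hα
  rw [le_div_iff₀ (by positivity)] at hμ₁α
  -- The decay rate of distant solitons is `aK/8`, of which the fraction `1 - s/s'` survives
  -- interpolation; `K` is chosen so that this exceeds the prescribed `ν`.
  obtain ⟨K, hK⟩ : ∃ K : ℝ, K = max 1 (8 * ν / (a * (1 - s / s'))) := ⟨_, rfl⟩
  have hK1 : 1 ≤ K := hK ▸ le_max_left _ _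
  have hKν : ν ≤ (1 - s / s') * (a * K / 8) := by
    have h := hK ▸ le_max_right 1 (8 * ν / (a * (1 - s / s')))
    rw [div_le_iff₀ (by positivity)] at h
    linarith
  obtain ⟨ε, hεdef⟩ : ∃ ε : ℝ, ε = min (1 / α - x0) (1 / α - s' / 2 - x1) := ⟨_, rfl⟩
  have hε0 : 0 < ε := by
    rw [hεdef]
    exact lt_min (by linarith [hE.x0_lt]) (by linarith [hE.x1_lt])
  have hε1 : ε ≤ 1 / α - x0 := hεdef ▸ min_le_left _ _
  have hε2 : ε ≤ 1 / α - s' / 2 - x1 := hεdef ▸ min_le_right _ _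
  obtain ⟨C₁, hC₁⟩ : ∃ C₁ : ℝ, C₁ = D * (2 * K + Real.exp a + 2) := ⟨_, rfl⟩
  have hC₁0 : 0 < C₁ := by rw [hC₁]; positivity
  obtain ⟨J, hJ⟩ : ∃ J : ℝ, J = ∫ x : Space d, Real.exp (-(a * α / 2 * Y * ‖x‖)) := ⟨_, rfl⟩
  have hJ0 : 0 ≤ J := hJ ▸ integral_nonneg fun x => (Real.exp_pos _).le
  have hY : 0 < Y - d / 2 := sub_pos.2 hE.Y_gt
  have hY0 : 0 < Y := by
    have : (0 : ℝ) ≤ d := Nat.cast_nonneg d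
    linarith
  -- `θ` comes last, since `C₁` depends on `K`. It must make the coefficients sum to at most `μ₁`,
  -- normalise the integral of the weight, keep the frequencies below `ωs`, and separate them by a
  -- factor of at least 4.
  obtain ⟨θ₁, hθ₁0, hθ₁, hθ₁ε⟩ := exists_pos_le_rpow_le (r := min (1 / 4) (ωs / 2))
    (δ := min (1 / 2) (μ₁ / (2 * C₁))) (by positivity) (by positivity) hε0
  obtain ⟨θ, hθ0, hθle, hθY⟩ := exists_pos_le_rpow_le (r := θ₁)
    (δ := min (1 / 2) (1 / (4 * (J + 1)))) hθ₁0 (by positivity) hY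
  have hθε := (Real.rpow_le_rpow hθ0.le hθle hε0.le).trans hθ₁ε
  have hθ4 : θ ≤ 1 / 4 := hθle.trans (hθ₁.trans (min_le_left _ _))
  have hθs : θ < ωs := by
    have := hθle.trans (hθ₁.trans (min_le_right _ _))
    linarith
  have hθε1 : θ ^ ε ≤ 1 / 2 := hθε.trans (min_le_left _ _)
  have hθε2 : θ ^ ε * (2 * C₁) ≤ μ₁ := by
    rw [← le_div_iff₀ (by positivity)]; exact hθε.trans (min_le_right _ _)
  have hθY1 : θ ^ (Y - d / 2) ≤ 1 / 2 := hθY.trans (min_le_left _ _)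
  have hθY2 : 2 * θ ^ (Y - d / 2) * J ≤ 1 / 2 := by
    have h := hθY.trans (min_le_right _ _)
    rw [le_div_iff₀ (by positivity)] at h
    nlinarith [Real.rpow_nonneg hθ0.le (Y - d / 2)]
  obtain ⟨φ', v, h1, h2, st⟩ := hφ.exists_solitonTrain hd ha.le hD.le (K := K) (by linarith) hθ0
    hθ4 hθs
  have wb := st.waveBounds hα ha hD.le hK1 hs'.le hE.s'_le hE.x1_pos.le hE.x1_le
    (by linarith : x0 ≤ 1 / α - ε) (by linarith) hε0.le hθε1
  rw [← hC₁] at wb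
  have hsum : ∑' j : ℕ, C₁ * (θ ^ (j + 1)) ^ ε ≤ μ₁ := by
    rw [tsum_mul_left]
    have := mul_le_mul_of_nonneg_left (summable_pow_succ_rpow hθ0.le hθε1).2 hC₁0.le
    linarith
  have hμ₁1 : μ₁ ≤ 1 := hμ₁.trans hμ1
  have hω0 : ∀ j : ℕ, 0 ≤ θ ^ (j + 1) := fun j => (st.freq_pos j).le
  refine ⟨fun j => θ ^ (j + 1), φ', v, fun j => C₁ * (θ ^ (j + 1)) ^ ε,
    trainWeight (a * α / 2) (fun j => θ ^ (j + 1)) v,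
    fun j => ⟨st.freq_pos j, (pow_le_of_le_one hθ0.le (by linarith)
      (Nat.succ_ne_zero j)).trans_lt hθs⟩, ⟨K / 4, by linarith, fun j k hjk => ?_⟩, h1, h2,
    st.continuous, wb.summable_coeff, fun j t x => wb.norm_le_coeff hx0.le j t x,
    fun j t x => wb.norm_comp_le hx0.le hsum hμ₁1 hα.le hC.le hf (nonlin_zero g) j t x, ?_⟩
  · have hj := st.separation j k hjk.ne
    have hk := st.separation k j hjk.ne'
    rw [norm_sub_rev] at hk
    have hσj : (θ ^ (j + 1)) ^ (1 / 2 : ℝ) ≤ 1 :=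
      Real.rpow_le_one (hω0 j) (st.freq_le_one j) (by norm_num)
    have hm : K / 2 ≤
        min ((θ ^ (j + 1)) ^ (1 / 2 : ℝ)) ((θ ^ (k + 1)) ^ (1 / 2 : ℝ)) * ‖v j - v k‖ := by
      rcases min_choice ((θ ^ (j + 1)) ^ (1 / 2 : ℝ)) ((θ ^ (k + 1)) ^ (1 / 2 : ℝ)) with h | h <;>
        rw [h] <;> assumption
    rw [min_eq_right ((min_le_left _ _).trans hσj)]
    linarith
  · refine wb.profileBounds hE.x1_le hE.x1_pos hE.s_pos hE.s_lt hsum hμ₁1 hμ₁ ?_ hα hC.le hf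
      (nonlin_zero g) hfc hν hKν measurable_trainWeight ?_ ?_
    · nlinarith
    · intro t
      refine lintegral_trainWeight_le (by positivity) hY0 hθ0 (fun j => rfl) hθY1 ?_ t
      rw [← hJ]; exact hθY2
    · exact ⟨Real.exp (a * α / 2 * K), (Real.exp_pos _).le, fun t t₀ x ht =>
        trainWeight_shift (by positivity) hω0 st.freq_le_one (fun j => (st.speed j).le) t t₀ x ht⟩

/-! ### The solution -/

theorem soliton_congr {φ φ' : Space d → ℝ} {w γ t : ℝ} {v x : Space d}
    (h : φ' (x - t • v) = φ (x - t • v)) : soliton φ w v 0 γ t x = soliton φ' w v 0 γ t x := by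
  rw [soliton, soliton, sub_zero, h]

theorem continuous_nonlin {g : ℝ → ℝ} (hg : ContinuousOn g (Set.Ici 0)) :
    Continuous (nonlin g) := by
  have : Continuous fun z : ℂ => g (‖z‖ ^ 2) :=
    hg.comp_continuous (by fun_prop) fun z => Set.mem_Ici.2 (sq_nonneg _)
  exact (Complex.continuous_ofReal.comp this).mul continuous_id

/-- A solution of the integral equation for the perturbation of a superposition of solitons
yields a distributional solution of the nonlinear equation. -/
theorem isNLSSolution_of_perturbation {g : ℝ → ℝ} {ω b : ℕ → ℝ} {φ' : ℕ → Space d → ℝ}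
    {v : ℕ → Space d} {C L R μ Λ A : ℝ} {T H η : ℝ → Space d → ℂ} {W : ℝ → Space d → ℂ}
    {F : ℂ → ℂ} {u N : ℝ → L2 d}
    (hg : ContinuousOn g (Set.Ici 0)) (hbs : ∀ j, ∃ G, IsBoundState g (ω j) (φ' j) G)
    (hφc : ∀ j, Continuous (φ' j)) (hb : Summable b)
    (hRb : ∀ j t x, ‖soliton (φ' j) (ω j) (v j) 0 0 t x‖ ≤ b j)
    (hNb : ∀ j t x, ‖nonlin g (soliton (φ' j) (ω j) (v j) 0 0 t x)‖ ≤ b j * C)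
    (hT : ∀ t x, T t x = ∑' j, soliton (φ' j) (ω j) (v j) 0 0 t x)
    (hH : ∀ t x, H t x = nonlin g (T t x) - ∑' j, nonlin g (soliton (φ' j) (ω j) (v j) 0 0 t x))
    (hTc : Continuous fun p : ℝ × Space d => T p.1 p.2)
    (hHc : Continuous fun p : ℝ × Space d => H p.1 p.2)
    (hTR : ∀ t x, ‖T t x‖ ≤ R) (hHμ : ∀ t x, ‖H t x‖ ≤ μ) (hL : 0 ≤ L) (hLR : L * R + μ ≤ R)
    (hFl : ∀ z w, ‖F z - F w‖ ≤ L * ‖z - w‖) (hFf : ∀ z, ‖z‖ ≤ 2 * R → F z = nonlin g z)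
    (hN : Continuous N) (hΛ : 1 ≤ Λ) (hA : 0 ≤ A) (hNA : ∀ t, ‖N t‖ ≤ A * Real.exp (-(Λ * t)))
    (hu : ∀ t, u t = duhamel sch N t)
    (hNu : ∀ t, N t =ᵐ[volume] fun x => F (T t x + u t x) - F (T t x) + H t x)
    (hηm : StronglyMeasurable (Function.uncurry η)) (hη : ∀ t, η t =ᵐ[volume] u t)
    (hηR : ∀ t, 0 ≤ t → ∀ᵐ x, ‖η t x‖ ≤ R)
    (hW : ∀ᵐ p : ℝ × Space d, W p.1 p.2 = T p.1 p.2) :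
    IsNLSSolution g fun t x => W t x + η t x := by
  have hfc := continuous_nonlin hg
  have hFc := continuous_of_lipschitz_bound hFl
  have hηm' : StronglyMeasurable fun p : ℝ × Space d => η p.1 p.2 := hηm
  have hηae : ∀ᵐ p : ℝ × Space d, 0 ≤ p.1 → ‖η p.1 p.2‖ ≤ R := by
    refine ae_prod_of_forall_ae (p := fun p : ℝ × Space d => 0 ≤ p.1 → ‖η p.1 p.2‖ ≤ R) ?_
      fun t => ?_
    · have h1 : MeasurableSet {p : ℝ × Space d | 0 ≤ p.1} :=
        measurableSet_le measurable_const measurable_fst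
      have h2 : MeasurableSet {p : ℝ × Space d | ‖η p.1 p.2‖ ≤ R} :=
        measurableSet_le hηm'.measurable.norm measurable_const
      have e : {p : ℝ × Space d | 0 ≤ p.1 → ‖η p.1 p.2‖ ≤ R} =
          {p : ℝ × Space d | 0 ≤ p.1}ᶜ ∪ {p : ℝ × Space d | ‖η p.1 p.2‖ ≤ R} := by
        ext p
        exact imp_iff_not_or
      rw [e]
      exact h1.compl.union h2
    · by_cases ht : 0 ≤ t
      · filter_upwards [hηR t ht] with x hx _ using hx
      · exact Filter.Eventually.of_forall fun x h => absurd h ht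
  obtain ⟨n, hn⟩ : ∃ n : ℝ → Space d → ℂ,
    n = fun t x => F (T t x + η t x) - F (T t x) + H t x := ⟨_, rfl⟩
  have hnm : StronglyMeasurable fun p : ℝ × Space d => n p.1 p.2 := by
    rw [hn]
    exact ((hFc.comp_stronglyMeasurable (hTc.stronglyMeasurable.add hηm')).sub
      (hFc.comp hTc).stronglyMeasurable).add hHc.stronglyMeasurable
  have hnN : ∀ t, n t =ᵐ[volume] N t := fun t => by
    filter_upwards [hNu t, hη t] with x h1 h2
    rw [h1, hn, ← h2]
  have hnR : ∀ᵐ p : ℝ × Space d, 0 ≤ p.1 → ‖n p.1 p.2‖ ≤ R := by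
    filter_upwards [hηae] with p hp h0
    have h1 := hFl (T p.1 p.2 + η p.1 p.2) (T p.1 p.2)
    rw [add_sub_cancel_left] at h1
    have h2 := mul_le_mul_of_nonneg_left (hp h0) hL
    rw [hn]
    refine (norm_add_le _ _).trans ?_
    linarith [hHμ p.1 p.2]
  have hWm : AEStronglyMeasurable fun p : ℝ × Space d => W p.1 p.2 + η p.1 p.2 :=
    ((hTc.aestronglyMeasurable.congr (by filter_upwards [hW] with p hp using hp.symm)).add
      hηm'.aestronglyMeasurable)
  have hTη : ∀ᵐ p : ℝ × Space d, 0 ≤ p.1 →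
      W p.1 p.2 = T p.1 p.2 ∧ ‖T p.1 p.2 + η p.1 p.2‖ ≤ 2 * R := by
    filter_upwards [hηae, hW] with p h1 h2 h0
    refine ⟨h2, (norm_add_le _ _).trans ?_⟩
    linarith [hTR p.1 p.2, h1 h0]
  have hS : MeasurableSet (Set.Ioi (0 : ℝ) ×ˢ (Set.univ : Set (Space d))) :=
    measurableSet_Ioi.prod MeasurableSet.univ
  obtain ⟨M, hM⟩ := (isCompact_closedBall (0 : ℂ) (2 * R)).exists_bound_of_continuousOn
    hfc.continuousOn
  refine ⟨locallyIntegrableOn_of_ae_bounded (M := 2 * R) hS hWm ?_,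
    locallyIntegrableOn_of_ae_bounded (M := M) hS (hfc.comp_aestronglyMeasurable hWm) ?_,
    fun ψ hψ hψs hpos => ?_⟩
  · filter_upwards [hTη] with p hp hps
    obtain ⟨h1, h2⟩ := hp (le_of_lt hps.1)
    rw [h1]; exact h2
  · filter_upwards [hTη] with p hp hps
    obtain ⟨h1, h2⟩ := hp (le_of_lt hps.1)
    exact hM _ (by rw [h1]; exact mem_closedBall_zero_iff.2 h2)
  · have hc1 := (contDiff_fderiv_apply hψ ((1 : ℝ), (0 : Space d))).continuous
    have hc2 := (contDiff_spaceLaplacian hψ).continuous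
    obtain ⟨hi1, he1⟩ := integral_tsum_test
      (R := fun j p => soliton (φ' j) (ω j) (v j) 0 0 p.1 p.2)
      (N := fun j p => nonlin g (soliton (φ' j) (ω j) (v j) 0 0 p.1 p.2))
      (P := fun p => -Complex.I * fderiv ℝ ψ p (1, 0) + spaceLaplacian ψ p) (ψ := ψ) hb
      (fun j => continuous_soliton (hφc j) _ _ _)
      (fun j => hfc.comp (continuous_soliton (hφc j) _ _ _))
      (fun j p => hRb j p.1 p.2) (fun j p => hNb j p.1 p.2)
      ((continuous_const.mul hc1).add hc2)
      ((hasCompactSupport_fderiv_apply hψs ((1 : ℝ), (0 : Space d))).mul_left.add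
        (hasCompactSupport_spaceLaplacian hψs)) hψ.continuous hψs
      (fun j => by
        obtain ⟨G, hG⟩ := hbs j
        refine hG.soliton_equation (hφc j) ?_ (v j) 0 hψ hψs
        exact (hg.comp_continuous ((hφc j).pow 2) fun x => Set.mem_Ici.2 (sq_nonneg (φ' j x))).mul (hφc j))
    obtain ⟨hi2, he2⟩ := integral_test_perturbation hN hΛ hA hNA hu hηm'.aestronglyMeasurable
      hnm.aestronglyMeasurable hη hnN hηae hnR hψ hψs hpos
    have hsum := integral_add hi1 hi2
    rw [he1, he2, add_zero] at hsum
    rw [← hsum]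
    refine integral_congr_ae ?_
    filter_upwards [hTη] with p hp
    have ed : deriv (fun s : ℝ => ψ (s, p.2)) p.1 = fderiv ℝ ψ p (1, 0) :=
      (hasDerivAt_time_slice hψ p).deriv
    have el : Laplacian.laplacian (fun y : Space d => ψ (p.1, y)) p.2 = spaceLaplacian ψ p :=
      laplacian_slice hψ p.1 p.2
    rw [ed, el, ← hT]
    by_cases h0 : 0 ≤ p.1
    · obtain ⟨h1, h2⟩ := hp h0
      have hR : ‖T p.1 p.2‖ ≤ 2 * R := by
        have := hTR p.1 p.2
        have := (norm_nonneg _).trans this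
        linarith
      -- In the ball of radius `2R` the extension is the true nonlinearity, so `f(T + η)` is `∑
      -- f(R_j)` plus the source. The equation for `u` is then the sum of the equations of the train
      -- and of the perturbation.
      have e3 : nonlin g (W p.1 p.2 + η p.1 p.2) =
          (∑' j, nonlin g (soliton (φ' j) (ω j) (v j) 0 0 p.1 p.2)) + n p.1 p.2 := by
        rw [hn, h1]
        simp only [hFf _ h2, hFf _ hR, hH]
        ring
      rw [e3, h1]
      ring
    · have hps : p ∉ tsupport ψ := fun h => h0 (le_of_lt (hpos h).1)
      have hf0 : fderiv ℝ ψ p = 0 := by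
        by_contra h
        exact hps (support_fderiv_subset ℝ h)
      rw [hf0, spaceLaplacian_eq_zero_of_notMem hps, image_eq_zero_of_notMem_tsupport hps]
      simp

end NLSTrain
end

open scoped ENNReal Topology
noncomputable section
namespace NLSTrain
open MeasureTheory

variable {d : ℕ}

/-! ### Assembly of the solution -/

theorem isL2Continuous_of_ae_eq {u : ℝ → L2 d} (hu : Continuous u) {η : ℝ → Space d → ℂ}
    (hη : ∀ t, η t =ᵐ[volume] u t) : IsL2Continuous η := by
  refine ⟨fun t _ => (Lp.memLp (u t)).ae_eq (hη t).symm, fun t₀ _ => ?_⟩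
  have e : ∀ t, eLpNorm (η t - η t₀) 2 volume = ENNReal.ofReal ‖u t - u t₀‖ := fun t => by
    rw [Lp.norm_def, ENNReal.ofReal_toReal (Lp.eLpNorm_ne_top _)]
    refine eLpNorm_congr_ae ?_
    filter_upwards [hη t, hη t₀, Lp.coeFn_sub (u t) (u t₀)] with x h1 h2 h3
    rw [h3, Pi.sub_apply, Pi.sub_apply, h1, h2]
  simp_rw [e]
  have h : Filter.Tendsto (fun t => ENNReal.ofReal ‖u t - u t₀‖) (𝓝 t₀)
      (𝓝 (ENNReal.ofReal ‖u t₀ - u t₀‖)) :=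
    (ENNReal.continuous_ofReal.comp (hu.sub continuous_const).norm).tendsto t₀
  rw [sub_self, norm_zero, ENNReal.ofReal_zero] at h
  exact h.mono_left nhdsWithin_le_nhds

theorem normL2Linf_le {u : L2 d} {η : Space d → ℂ} (hη : η =ᵐ[volume] u) {r : ℝ}
    (h2 : ‖u‖ ≤ r) (hinf : ∀ᵐ x, ‖u x‖ ≤ r) : normL2Linf η ≤ ENNReal.ofReal (2 * r) := by
  have hr : 0 ≤ r := (norm_nonneg u).trans h2
  rw [normL2Linf, eLpNorm_congr_ae hη, eLpNorm_congr_ae hη, two_mul, ENNReal.ofReal_add hr hr]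
  refine add_le_add ?_ ?_
  · rw [← ENNReal.ofReal_toReal (Lp.eLpNorm_ne_top u), ← Lp.norm_def]
    exact ENNReal.ofReal_le_ofReal h2
  · rw [eLpNorm_exponent_top]
    exact eLpNormEssSup_le_of_ae_bound hinf

theorem Exponents.one_le_linfConst {α β s s' x0 x1 Y : ℝ} (hE : Exponents d α β s s' x0 x1 Y) :
    1 ≤ linfConst d β s := by
  have h1 := (Real.Gamma_pos_of_pos (by linarith [hE.β_dim] : (0 : ℝ) < 1 - d * β / 2)).le
  have h2 : (1 / 2 : ℝ) ^ (s / 2 - (d : ℝ) * (1 - β) / 4) ≤ 1 :=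
    Real.rpow_le_one (by norm_num) (by norm_num) (sub_nonneg.2 hE.s_lower.le)
  have h3 : 0 ≤ 8 * 2 ^ ((d : ℝ) / 2) / (1 - (1 / 2 : ℝ) ^ (s / 2 - (d : ℝ) * (1 - β) / 4)) :=
    div_nonneg (by positivity) (sub_nonneg.2 h2)
  rw [linfConst]
  have := mul_nonneg (mul_nonneg two_pos.le h1) h3
  linarith

theorem exists_train_solution {g : ℝ → ℝ} {C₀ α α₂ : ℝ} (hF : AssumptionF d g C₀ α α₂)
    (hcond : d = 1 ∨ ((d = 2 ∨ d = 3) ∧ 2 * (1 / 2 - 1 / (d : ℝ)) < α ∧ α < 2))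
    {ωs a D ρ lam : ℝ} (hωs : 0 < ωs) (ha : 0 < a) (hD : 0 < D) (hρ : 0 < ρ) (hlam : 1 ≤ lam)
    {φ : ℝ → Space d → ℝ} (hφ : IsSmallSolitonFamily g α ωs a D φ) :
    ∃ (ω : ℕ → ℝ) (v : ℕ → Space d) (γ : ℕ → ℝ) (η : ℝ → Space d → ℂ),
      IsTrainProfile ωs φ ω v γ ∧ IsL2Continuous η ∧
      IsNLSSolution g (fun t x => profile φ ω v γ t x + η t x) ∧
      (⨆ t ∈ Set.Ici (0 : ℝ), ENNReal.ofReal (Real.exp (lam * t)) * normL2Linf (η t)) ≤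
        ENNReal.ofReal ρ := by
  have hα := hF.α₁_pos
  have hd : 0 < d := by rcases hcond with h | ⟨h | h, -⟩ <;> omega
  obtain ⟨C, hC, hf⟩ := hF.nonlin_second_diff
  replace hf : SecondDiffBound (nonlin g) C α := hf
  have hfc := continuous_nonlin hF.continuousOn
  obtain ⟨β, s, s', x0, x1, Y, hE⟩ := exists_exponents hα hcond
  have hx0 : 0 < x0 := hE.x1_pos.trans_le hE.x1_le
  obtain ⟨R, μ, κ, hR0, hR1, hRρ, hμ0, hμR, hκ, hκB, hκR, hL, hLκ, hsmall⟩ :=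
    exists_contraction_parameters hC hα hE.one_le_linfConst
      (lipschitzExtensionConstant ℂ).coe_nonneg hρ
  obtain ⟨F, hFl, hFf⟩ :=
    exists_lipschitz_extension_nonlin (g := g) (α₁ := α) (C := C) (R := 2 * R) hC.le
    (by linarith) fun z w hz hw => hf.norm_sub_le hR1 hz hw
  have hL0 : 0 ≤ (lipschitzExtensionConstant ℂ : ℝ) * (C * (2 * R) ^ α) := by
    have := (lipschitzExtensionConstant ℂ).coe_nonneg
    positivity
  generalize (lipschitzExtensionConstant ℂ : ℝ) * (C * (2 * R) ^ α) = L at *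
  have hm : 0 < min α 1 := lt_min hα one_pos
  have hν1 : 1 ≤ lam / min α 1 := by
    rw [le_div_iff₀ hm]
    linarith [min_le_right α 1]
  obtain ⟨ω, φ', v, b, Q, hω, hspeed, hae, hbs, hφc, hb, hRb, hNb, tb⟩ :=
    hφ.exists_profileBounds hd hωs ha hD hα hC hf hfc hE hμ0 (by linarith)
      (by linarith : 0 ≤ lam / min α 1)
  obtain ⟨u, A, hA, huc, hNc, hduh, hNA, hbound⟩ := tb.exists_perturbation hf hC.le hE hα hFl hFf
    hL0 hL hμ0.le hR0 hR1 hμR hlam le_rfl hκ hκB hκR hLκ hsmall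
  obtain ⟨η, hηm, hη⟩ := exists_stronglyMeasurable_representative huc
  -- The construction uses continuous representatives of the bound states. Countably many null sets,
  -- moved along the trajectories, separate them from the given family, at each time and in
  -- space-time.
  have hshift : ∀ t : ℝ, ∀ᵐ x : Space d, ∀ j, φ' j (x - t • v j) = φ (ω j) (x - t • v j) := fun t =>
    ae_all_iff.2 fun j =>
      (measurePreserving_sub_right volume (t • v j)).quasiMeasurePreserving.ae (hae j)
  have hprod : ∀ᵐ p : ℝ × Space d, ∀ j,
      φ' j (p.2 - p.1 • v j) = φ (ω j) (p.2 - p.1 • v j) :=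
    ae_all_iff.2 fun j => ae_prod_of_ae_translate (hae j) (v j)
  have hexp : ∀ {t : ℝ}, 0 ≤ t → R * Real.exp (-(lam * t)) ≤ R := fun ht =>
    mul_le_of_le_one_right hR0.le (Real.exp_le_one_iff.2 (by nlinarith))
  -- The phases play no role in the estimates and are set to 0.
  refine ⟨ω, v, fun _ => 0, η, ⟨hω, hspeed, fun t _ => ?_⟩, isL2Continuous_of_ae_eq huc hη, ?_, ?_⟩
  · filter_upwards [hshift t] with x hx
    refine Summable.of_nonneg_of_le (fun j => norm_nonneg _) (fun j => ?_) hb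
    rw [trainSoliton, soliton_congr (hx j)]
    exact hRb j t x
  · refine isNLSSolution_of_perturbation (R := R) (μ := μ) hF.continuousOn hbs hφc hb hRb hNb
      (fun t x => rfl) (fun t x => rfl) tb.continuous_T tb.continuous_H (fun t x => ?_)
      (fun t x => ?_) hL0 (hLκ.trans hκR) hFl hFf hNc hν1 hA hNA hduh
      (fun t => sourceMap_coe hFl tb.continuous_T (tb.memLp_H hE hα) t (u t)) hηm hη
      (fun t ht => ?_) ?_
    · exact (tb.T_le t x).trans ((mul_le_of_le_one_right hμ0.le
        (Real.rpow_le_one (tb.Q_nonneg t x) (tb.Q_le_one t x) hx0.le)).trans hμR)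
    · have h1 : Real.exp (-(lam / min α 1 * |t|)) ≤ 1 :=
        Real.exp_le_one_iff.2 (by nlinarith [abs_nonneg t])
      have h2 : 0 ≤ α * x0 + x1 := by
        have := hE.x1_pos
        positivity
      refine (tb.H_le t x).trans ?_
      rw [mul_assoc]
      exact mul_le_of_le_one_right hμ0.le (mul_le_one₀ h1
        (Real.rpow_nonneg (tb.Q_nonneg t x) _)
        (Real.rpow_le_one (tb.Q_nonneg t x) (tb.Q_le_one t x) h2))
    · filter_upwards [hη t, (hbound t ht).2] with x h1 h2
      rw [h1]
      exact h2.trans (hexp ht)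
    · filter_upwards [hprod] with p hp
      exact tsum_congr fun j => soliton_congr (hp j)
  · refine iSup₂_le fun t ht => ?_
    have h := normL2Linf_le (hη t) (hbound t ht).1 (hbound t ht).2
    refine (mul_le_mul_right h _).trans ?_
    rw [← ENNReal.ofReal_mul (Real.exp_pos _).le]
    refine ENNReal.ofReal_le_ofReal (le_trans (le_of_eq ?_) hRρ)
    rw [Real.exp_neg]
    field_simp

end NLSTrain
end

theorem corollary3p4 (d : ℕ) (g : ℝ → ℝ) (C₀ α₁ α₂ : ℝ)
    (hF : NLSTrain.AssumptionF d g C₀ α₁ α₂)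
    (hcond : d = 1 ∨ ((d = 2 ∨ d = 3) ∧ 2 * (1 / 2 - 1 / (d : ℝ)) < α₁ ∧ α₁ < 2))
    (ωs a D : ℝ) (hωs : 0 < ωs) (ha : 0 < a) (ha1 : a < 1) (hD : 0 < D)
    (ρ : ℝ) (hρ : 0 < ρ) :
    ∃ lam₀ : ℝ, 0 < lam₀ ∧ ∀ lam : ℝ, lam₀ ≤ lam →
      ∀ φ : ℝ → NLSTrain.Space d → ℝ, NLSTrain.IsSmallSolitonFamily g α₁ ωs a D φ →
      ∃ (ω : ℕ → ℝ) (v : ℕ → NLSTrain.Space d) (γ : ℕ → ℝ) (η : ℝ → NLSTrain.Space d → ℂ),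
        NLSTrain.IsTrainProfile ωs φ ω v γ ∧
        NLSTrain.IsL2Continuous η ∧
        NLSTrain.IsNLSSolution g (fun t x => NLSTrain.profile φ ω v γ t x + η t x) ∧
        (⨆ t ∈ Set.Ici (0 : ℝ),
          ENNReal.ofReal (Real.exp (lam * t)) * NLSTrain.normL2Linf (η t)) ≤
          ENNReal.ofReal ρ :=
  -- `λ₀ = 1` suffices: the train is chosen after `λ`, and larger `λ` only requires larger
  -- velocities. The lower bound 1 normalises the Duhamel integrals.
  ⟨1, one_pos, fun _ hlam _ hφ =>
    NLSTrain.exists_train_solution hF hcond hωs ha hD hρ hlam hφ⟩
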